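/- **Setting.** A finite family $P=(p_1,\dots,p_n)$ of triangles in the plane carries the mass distribution $\mu_P=\sum_i \mathrm{vol}|_{p_i}$ (density one on every triangle; triangles of a family may overlap, and then their densities add). A transport plan between $P$ and $S$ is a measure on $\mathbb R^2\times\mathbb R^2$ with marginals $\mu_P$ and $\mu_S$; its cost is the integral of the Euclidean distance $\|x-y\|$; $\mathrm{EMD}(P,S)$ is the infimum of the costs of all transport plans. Computations are done on a real RAM: a fixed program with memory cells for natural and for real numbers (initially zero outside the input), indirect addressing, comparisons, branching and loops, the operations $+,-,\cdot$ on natural numbers (with truncated subtraction), the exact operations $+,-,\cdot,/,\sqrt{\ }$ on real numbers and the conversion of natural to real numbers, each at unit cost; there is no rounding of reals to integers. **Given algorithm.** For $\delta>0$ and a nondecreasing function $f_\delta$, let $\mathcal A$ be an algorithm that, for any two nonempty finite families of points in the plane with positive weights and equal total weight, $k$ points altogether, returns in time at most $f_\delta(k)$ a transport plan between them, as a list of moves "(source point, target point, amount)" whose length is at most the time used, with cost at most $1+\delta$ times the cost of any transport plan between them. The program may call $\mathcal A$ as a subroutine, and a call is charged the time that $\mathcal A$ takes. **Theorem.** There are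 a single program (which receives $n$, $m$, $\delta$ and the coordinates of the triangles, and may call $\mathcal A$) and absolute constants $c',A>0$, and for every $\delta_0>0$ a constant $C\in\mathbb N$, such that the following holds for all $0<\delta\le\delta_0$, all $f_\delta$ and $\mathcal A$ as above, and all families $P$ of $n$ and $S$ of $m$ triangles, each family of total area $1$, with all edges of length at most $\Delta$. The program halts after $T$ steps (the time used by $\mathcal A$ included) and has then written down a transport plan between $P$ and $S$ of cost at most $$(1+c'\delta)\,\mathrm{EMD}(P,S)+A\,\frac{\delta}{\sqrt{nm}} .$$ With $$K=\left\lceil \frac{\sqrt{nm}\,\Delta\,(n+m)}{\delta^{4}}\right\rceil$$ the running time satisfies $T\le C\,f_\delta(CK)$. Consequently it is $O(f_\delta(K))$ whenever $f_\delta(2k)=O(f_\delta(k))$: if $f_\delta(2k)\le D f_\delta(k)$ for all $k$, then $T\le C D^{C} f_\delta(K)$. The transport plan is written as a finite list of instructions of two kinds, with axis-parallel boxes $B,B'$ and numbers $w$: "move the amount $w$ from the part of $\mu_P$ in $B$ to the part of $\mu_S$ in $B'$, spread evenly on both sides" and "leave mass of density $w$ in the box $B$ where it is". -/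

import Mathlib

open MeasureTheory ProbabilityTheory

/-! ### Triangles, transport plans and the earth mover's distance -/

/-- The Euclidean plane. -/
abbrev Plane : Type := EuclideanSpace ℝ (Fin 2)

/-- The (solid) triangle with the given vertices. -/
def solidTriangle (T : Fin 3 → Plane) : Set Plane := convexHull ℝ (Set.range T)

/-- The mass distribution of a finite family of triangles: every triangle carries mass of
density one, so that its mass is its area. -/
noncomputable def triangleMass {n : ℕ} (P : Fin n → Fin 3 → Plane) : Measure Plane :=
  ∑ i, volume.restrict (solidTriangle (P i))

/-- A transport plan from `μ` to `ν`: a measure on pairs (source, target) whose marginals are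
`μ` and `ν`. -/
def IsTransportPlan (μ ν : Measure Plane) (π : Measure (Plane × Plane)) : Prop :=
  π.map Prod.fst = μ ∧ π.map Prod.snd = ν

/-- The cost of a plan: mass times Euclidean distance. -/
noncomputable def transportCost (π : Measure (Plane × Plane)) : ENNReal :=
  ∫⁻ z, edist z.1 z.2 ∂π

/-- The earth mover's distance, the optimal cost of a transport plan. -/
noncomputable def emd (μ ν : Measure Plane) : ENNReal :=
  ⨅ (π : Measure (Plane × Plane)) (_ : IsTransportPlan μ ν π), transportCost π

/-! ### Transport between weighted point sets, and algorithms for it -/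

/-- A finite family of weighted points. -/
abbrev WeightedPoints : Type := List (Plane × ℝ)

/-- A matrix `τ` (only the entries with `i < U.length`, `j < V.length` matter) that moves the
weights of `U` to the weights of `V`. -/
def IsPointPlan (U V : WeightedPoints) (τ : ℕ → ℕ → ℝ) : Prop :=
  (∀ i < U.length, ∀ j < V.length, 0 ≤ τ i j) ∧
  (∀ i : Fin U.length, ∑ j : Fin V.length, τ i j = (U.get i).2) ∧
  (∀ j : Fin V.length, ∑ i : Fin U.length, τ i j = (V.get j).2)

/-- The cost of moving mass between weighted points. -/
noncomputable def pointPlanCost (U V : WeightedPoints) (τ : ℕ → ℕ → ℝ) : ℝ :=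
  ∑ i : Fin U.length, ∑ j : Fin V.length, τ i j * dist (U.get i).1 (V.get j).1

/-- A plan written as a list of triples `(i, j, w)`: move mass `w` from point `i` to point `j`. -/
abbrev SparsePlan : Type := List (ℕ × ℕ × ℝ)

/-- The matrix of a list of moves. -/
noncomputable def SparsePlan.matrix (L : SparsePlan) (i j : ℕ) : ℝ :=
  (L.map fun e => if e.1 = i ∧ e.2.1 = j then e.2.2 else 0).sum

/-- An algorithm for transport between weighted points, seen from outside: the list of moves that
it returns and the time that it takes. -/
structure PointSolver where
  plan : WeightedPoints → WeightedPoints → SparsePlan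
  time : WeightedPoints → WeightedPoints → ℕ

/-- `A` constructs `(1 + δ)`-approximate transport plans between weighted point sets with `k`
points altogether in time at most `f k`. Writing one move takes at least one unit of time. -/
def PointSolver.Approximates (A : PointSolver) (δ : ℝ) (f : ℕ → ℝ) : Prop :=
  ∀ U V : WeightedPoints, U ≠ [] → V ≠ [] →
    (∀ p ∈ U, 0 < p.2) → (∀ q ∈ V, 0 < q.2) →
    (U.map Prod.snd).sum = (V.map Prod.snd).sum →
      (∀ e ∈ A.plan U V, e.1 < U.length ∧ e.2.1 < V.length ∧ 0 ≤ e.2.2) ∧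
      IsPointPlan U V (A.plan U V).matrix ∧
      (∀ σ, IsPointPlan U V σ →
        pointPlanCost U V (A.plan U V).matrix ≤ (1 + δ) * pointPlanCost U V σ) ∧
      (A.plan U V).length ≤ A.time U V ∧
      (A.time U V : ℝ) ≤ f (U.length + V.length)

/-! ### The real random access machine -/

/-- Memory: cells for natural numbers (counters, addresses) and cells for real numbers. -/
structure MemState where
  nat : ℕ → ℕ
  real : ℕ → ℝ

/-- Arithmetic on natural numbers with (indirect) addressing; `sub` is truncated. -/
inductive NatExpr : Type where
  | lit (k : ℕ)
  | load (a : NatExpr)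
  | add (a b : NatExpr)
  | sub (a b : NatExpr)
  | mul (a b : NatExpr)

def NatExpr.eval (s : MemState) : NatExpr → ℕ
  | .lit k => k
  | .load a => s.nat (a.eval s)
  | .add a b => a.eval s + b.eval s
  | .sub a b => a.eval s - b.eval s
  | .mul a b => a.eval s * b.eval s

/-- The number of operations in an expression. -/
def NatExpr.cost : NatExpr → ℕ
  | .lit _ => 1
  | .load a => a.cost + 1
  | .add a b => a.cost + b.cost + 1
  | .sub a b => a.cost + b.cost + 1
  | .mul a b => a.cost + b.cost + 1

/-- Exact real arithmetic (no rounding to integers). -/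
inductive RealExpr : Type where
  | ofNat (a : NatExpr)
  | load (a : NatExpr)
  | add (x y : RealExpr)
  | sub (x y : RealExpr)
  | mul (x y : RealExpr)
  | div (x y : RealExpr)
  | sqrt (x : RealExpr)

noncomputable def RealExpr.eval (s : MemState) : RealExpr → ℝ
  | .ofNat a => (a.eval s : ℝ)
  | .load a => s.real (a.eval s)
  | .add x y => x.eval s + y.eval s
  | .sub x y => x.eval s - y.eval s
  | .mul x y => x.eval s * y.eval s
  | .div x y => x.eval s / y.eval s
  | .sqrt x => Real.sqrt (x.eval s)

/-- The number of operations in an expression. -/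
def RealExpr.cost : RealExpr → ℕ
  | .ofNat a => a.cost + 1
  | .load a => a.cost + 1
  | .add x y => x.cost + y.cost + 1
  | .sub x y => x.cost + y.cost + 1
  | .mul x y => x.cost + y.cost + 1
  | .div x y => x.cost + y.cost + 1
  | .sqrt x => x.cost + 1

/-- Tests. -/
inductive TestExpr : Type where
  | natLe (a b : NatExpr)
  | realLe (x y : RealExpr)
  | neg (p : TestExpr)
  | both (p q : TestExpr)

def TestExpr.Holds (s : MemState) : TestExpr → Prop
  | .natLe a b => a.eval s ≤ b.eval s
  | .realLe x y => x.eval s ≤ y.eval s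
  | .neg p => ¬ p.Holds s
  | .both p q => p.Holds s ∧ q.Holds s

/-- The number of operations in a test. -/
def TestExpr.cost : TestExpr → ℕ
  | .natLe a b => a.cost + b.cost + 1
  | .realLe x y => x.cost + y.cost + 1
  | .neg p => p.cost + 1
  | .both p q => p.cost + q.cost + 1

/-- Programs. `solve u k v l a r` runs the given algorithm for weighted points on the `k` points
stored in the real cells from `u` on and the `l` points stored from `v` on; it writes the number of
moves to the natural-number cell `a`, the pairs of indices to the cells after it, and the amounts
to the real cells from `r` on. -/
inductive Program : Type where
  | skip
  | setNat (addr val : NatExpr)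
  | setReal (addr : NatExpr) (val : RealExpr)
  | seq (c d : Program)
  | branch (p : TestExpr) (c d : Program)
  | loop (p : TestExpr) (c : Program)
  | solve (u k v l a r : NatExpr)

/-- The `k` weighted points stored (as triples: coordinates, weight) from address `u` on. -/
noncomputable def readPoints (mem : ℕ → ℝ) (u k : ℕ) : WeightedPoints :=
  (List.range k).map fun i => (!₂[mem (u + 3 * i), mem (u + 3 * i + 1)], mem (u + 3 * i + 2))

/-- Overwrite the cells from address `base` on by the list `l`. -/
def writeBlock {α : Type} (mem : ℕ → α) (base : ℕ) (l : List α) : ℕ → α :=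
  fun a => if base ≤ a then l.getD (a - base) (mem a) else mem a

/-- Write a list of moves to memory. -/
def writePlan (s : MemState) (a r : ℕ) (L : SparsePlan) : MemState where
  nat := writeBlock s.nat a (L.length :: L.flatMap fun e => [e.1, e.2.1])
  real := writeBlock s.real r (L.map fun e => e.2.2)

/-- `Exec A c s s' t`: with `A` as the algorithm for weighted points, the program `c` started in
the state `s` halts in the state `s'` after `t` steps (the time used by `A` included). -/
inductive Exec (A : PointSolver) : Program → MemState → MemState → ℕ → Prop
  | skip (s : MemState) : Exec A .skip s s 1
  | setNat (addr val : NatExpr) (s : MemState) :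
      Exec A (.setNat addr val) s
        { s with nat := Function.update s.nat (addr.eval s) (val.eval s) }
        (addr.cost + val.cost + 1)
  | setReal (addr : NatExpr) (val : RealExpr) (s : MemState) :
      Exec A (.setReal addr val) s
        { s with real := Function.update s.real (addr.eval s) (val.eval s) }
        (addr.cost + val.cost + 1)
  | seq {c d : Program} {s₁ s₂ s₃ : MemState} {t₁ t₂ : ℕ} :
      Exec A c s₁ s₂ t₁ → Exec A d s₂ s₃ t₂ → Exec A (.seq c d) s₁ s₃ (t₁ + t₂)
  | branchTrue {p : TestExpr} {c d : Program} {s s' : MemState} {t : ℕ} :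
      p.Holds s → Exec A c s s' t → Exec A (.branch p c d) s s' (p.cost + t)
  | branchFalse {p : TestExpr} {c d : Program} {s s' : MemState} {t : ℕ} :
      ¬ p.Holds s → Exec A d s s' t → Exec A (.branch p c d) s s' (p.cost + t)
  | loopDone {p : TestExpr} {c : Program} {s : MemState} :
      ¬ p.Holds s → Exec A (.loop p c) s s p.cost
  | loopStep {p : TestExpr} {c : Program} {s₁ s₂ s₃ : MemState} {t₁ t₂ : ℕ} :
      p.Holds s₁ → Exec A c s₁ s₂ t₁ → Exec A (.loop p c) s₂ s₃ t₂ →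
      Exec A (.loop p c) s₁ s₃ (p.cost + t₁ + t₂)
  | solve (u k v l a r : NatExpr) (s : MemState) (U V : WeightedPoints) :
      U = readPoints s.real (u.eval s) (k.eval s) →
      V = readPoints s.real (v.eval s) (l.eval s) →
      Exec A (.solve u k v l a r) s (writePlan s (a.eval s) (r.eval s) (A.plan U V))
        (u.cost + k.cost + v.cost + l.cost + a.cost + r.cost + A.time U V + 1)

/-! ### Input and output -/

/-- The coordinates of the vertices of a family of triangles, six numbers for each triangle. -/
noncomputable def coordList {n : ℕ} (P : Fin n → Fin 3 → Plane) : List ℝ :=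
  (List.ofFn P).flatMap fun T => [T 0 0, T 0 1, T 1 0, T 1 1, T 2 0, T 2 1]

/-- The initial memory: `n`, `m` in the first natural-number cells, then zeros; `δ` and the
coordinates of `P` and `S` in the first real cells, then zeros. -/
noncomputable def inputState (δ : ℝ) {n m : ℕ} (P : Fin n → Fin 3 → Plane)
    (S : Fin m → Fin 3 → Plane) : MemState where
  nat := writeBlock (fun _ => 0) 0 [n, m]
  real := writeBlock (fun _ => 0) 0 (δ :: (coordList P ++ coordList S))

/-- The half-open box `[x₀, x₁) × [y₀, y₁)` whose data `x₀, x₁, y₀, y₁` are stored at `a`. -/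
def storedBox (mem : ℕ → ℝ) (a : ℕ) : Set Plane :=
  {z | mem a ≤ z 0 ∧ z 0 < mem (a + 1) ∧ mem (a + 2) ≤ z 1 ∧ z 1 < mem (a + 3)}

/-- The transport plan that is written in the memory, as a sum of two kinds of instructions.
* `s.nat 0` instructions of nine real numbers each, stored from address `s.nat 1` on: a box, a
  second box and an amount `w`. They move the amount `w` from the part of `μ` in the first box to
  the part of `ν` in the second box, spread evenly on both sides.
* `s.nat 2` instructions of five real numbers each, stored from address `s.nat 3` on: a box and a
  number `w`. They leave mass of density `w` in the box where it is. -/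
noncomputable def writtenPlan (μ ν : Measure Plane) (s : MemState) : Measure (Plane × Plane) :=
  (∑ k ∈ Finset.range (s.nat 0),
    ENNReal.ofReal (s.real (s.nat 1 + 9 * k + 8)) •
      (cond μ (storedBox s.real (s.nat 1 + 9 * k))).prod
        (cond ν (storedBox s.real (s.nat 1 + 9 * k + 4)))) +
  ∑ k ∈ Finset.range (s.nat 2),
    ENNReal.ofReal (s.real (s.nat 3 + 5 * k + 4)) •
      (volume.restrict (storedBox s.real (s.nat 3 + 5 * k))).map fun z => (z, z)

/-! Only the excess of one density over the other has to be moved. By the triangle inequality, mass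
that is both sent from and received at a place can be cancelled from a plan without raising its cost
(`exists_cancel`). Suppose that both families have constant densities `p ≠ q` on a cell, and the
same densities on the ball of radius `r` around each of its points. After cancellation (on a fine
grid), the mass sent from or received in this cell has its other end where the excess has the
opposite sign, hence at a distance of about `r` or more. Gathering the excess in one center, within
a radius `rad ≤ η * r`, therefore changes the cost only by a factor `1 + O(η)`. Cells in which the
densities vary are admitted only with radius at most `r₀`; since the total mass is one, together
they cost an additive `O(r₀)`.

This is the notion of a `CellSystem`. `CellSystem.exists_plan` leads from transport plans to plans
between weighted centers; `CellSystem.isTransportPlan_movesPlan` and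
`CellSystem.transportCost_movesPlan_le` lead back from moves between centers to a transport plan in
which the common mass stays. With `η = δ / (1 + δ)` and `r₀ = η / √(nm)`, a nearly optimal solution
of the point problem gives the claimed cost (`CellSystem.transportCost_movesPlan_le_emd`).

The cells are the leaves of a forest of quadtrees. A box of size `l` is represented by the disk of
radius `κ * l` around its center, where `κ = 2 + 1 / δ`. A triangle that is seen to contain the disk
is counted, one that is seen to miss it is dropped, and any other remains undecided; a box is split
as long as it has undecided triangles and is larger than `r₀`. If a triangle is undecided for a box,
then the box lies in a strip of width `O(κ l)` along an edge, so comparison of areas leaves `O(κ² W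
/ l)` boxes of size `l` for each triangle (`QParams.count_act_le`), where `W` is the length of the
longest edge. The sum over all sizes is geometric and dominated by the smallest size. With `N = n +
m` this makes `O(N κ² W / r₀)` undecided pairs, which is `O(K)` for bounded `δ` (`size_estimates`).

The triangles may be far apart and reals cannot be rounded, so the roots are not taken from a fixed
grid. The coordinates are covered greedily by strips, in increasing order (`tot_strips`), and each
triangle is recorded for the nine products of strips around it. The order is found by selection from
about `√N` blocks, in time `O(N √N)`. This is affordable: total area one forces `n Δ² ≥ 1 / 4` and
`m Δ² ≥ 1 / 4`, hence `√N = O(√(nm) Δ)`. The weights of small undecided boxes come from an exact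
formula for the area of a triangle in a box (`boxArea_eq`).

Correctness and time of the program are handled together by the predicate `Tot`. All work outside of
the solver is `O(K)`, and `f (C * K)` dominates this because a solver must write down `k` moves for
some input with `k + 1` points (`PointSolver.Approximates.le_apply`). -/

/-! ### Total correctness with a step budget -/

/-- The number of operations written in a program. -/
def Program.size : Program → ℕ
  | .skip => 1
  | .setNat a v => a.cost + v.cost + 1
  | .setReal a v => a.cost + v.cost + 1
  | .seq c d => c.size + d.size
  | .branch p c d => p.cost + c.size + d.size
  | .loop p c => p.cost + c.size
  | .solve u k v l a r => u.cost + k.cost + v.cost + l.cost + a.cost + r.cost + 1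

/-- `Tot A c s k Q`: the program `c` started in `s` halts in a state with `Q`, and its running time
is at most `k + 1` times the size of the program. The budget `k` counts the passes through loops
and the time of the solver. -/
def Tot (A : PointSolver) (c : Program) (s : MemState) (k : ℕ) (Q : MemState → Prop) : Prop :=
  ∃ s' t, Exec A c s s' t ∧ t ≤ c.size * (k + 1) ∧ Q s'

namespace Tot

variable {A : PointSolver} {c d : Program} {s : MemState} {k k₁ k₂ : ℕ} {Q Q' : MemState → Prop}

theorem mono (h : Tot A c s k₁ Q') (hk : k₁ ≤ k₂) (hQ : ∀ s', Q' s' → Q s') : Tot A c s k₂ Q := by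
  obtain ⟨s', t, h1, h2, h3⟩ := h
  exact ⟨s', t, h1, h2.trans (by gcongr), hQ _ h3⟩

/-- Both `k₁ + 1` and `k₂ + 1` are at most `k₁ + k₂ + 1`, so budgets simply add up: the constant
overhead of each part is paid by its own size. -/
theorem seq (h : Tot A c s k₁ fun s₁ => Tot A d s₁ k₂ Q) : Tot A (.seq c d) s (k₁ + k₂) Q := by
  obtain ⟨s₁, t₁, h1, h2, s₂, t₂, h3, h4, h5⟩ := h
  refine ⟨s₂, t₁ + t₂, .seq h1 h3, ?_, h5⟩
  simp only [Program.size]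
  calc t₁ + t₂ ≤ c.size * (k₁ + 1) + d.size * (k₂ + 1) := add_le_add h2 h4
    _ ≤ c.size * (k₁ + k₂ + 1) + d.size * (k₁ + k₂ + 1) := by gcongr <;> omega
    _ = _ := by ring

theorem seq' (h : Tot A c s k₁ Q') (h' : ∀ s₁, Q' s₁ → Tot A d s₁ k₂ Q) :
    Tot A (.seq c d) s (k₁ + k₂) Q :=
  seq (h.mono le_rfl h')

theorem branchTrue {p : TestExpr} (hp : p.Holds s) (h : Tot A c s k Q) :
    Tot A (.branch p c d) s k Q := by
  obtain ⟨s', t, h1, h2, h3⟩ := h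
  refine ⟨s', _, .branchTrue hp h1, ?_, h3⟩
  simp only [Program.size]
  nlinarith [Nat.zero_le (p.cost * k), Nat.zero_le (d.size * (k + 1))]

theorem branchFalse {p : TestExpr} (hp : ¬ p.Holds s) (h : Tot A d s k Q) :
    Tot A (.branch p c d) s k Q := by
  obtain ⟨s', t, h1, h2, h3⟩ := h
  refine ⟨s', _, .branchFalse hp h1, ?_, h3⟩
  simp only [Program.size]
  nlinarith [Nat.zero_le (p.cost * k), Nat.zero_le (c.size * (k + 1))]

theorem loopDone {p : TestExpr} (hp : ¬ p.Holds s) (hQ : Q s) : Tot A (.loop p c) s k Q := by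
  refine ⟨s, _, .loopDone hp, ?_, hQ⟩
  simp only [Program.size]
  nlinarith [Nat.zero_le (p.cost * k), Nat.zero_le (c.size * (k + 1))]

/-- Each pass is charged one extra unit of budget; multiplied by the size of the loop, it pays for
the test and for the overhead of the body. -/
theorem loopStep {p : TestExpr} (hp : p.Holds s)
    (h : Tot A c s k₁ fun s₁ => Tot A (.loop p c) s₁ k₂ Q) :
    Tot A (.loop p c) s (k₁ + 1 + k₂) Q := by
  obtain ⟨s₁, t₁, h1, h2, s₂, t₂, h3, h4, h5⟩ := h
  refine ⟨s₂, _, .loopStep hp h1 h3, ?_, h5⟩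
  simp only [Program.size] at *
  calc p.cost + t₁ + t₂ ≤ p.cost + c.size * (k₁ + 1) + (p.cost + c.size) * (k₂ + 1) := by omega
    _ ≤ (p.cost + c.size) * (k₁ + 1) + (p.cost + c.size) * (k₂ + 1) := by
        gcongr; nlinarith [Nat.zero_le (p.cost * k₁)]
    _ = _ := by ring

/-- A loop with `n` passes, with an invariant that is indexed by the number of passes. -/
theorem loopFor {p : TestExpr} (n : ℕ) (I : ℕ → MemState → Prop) (b : ℕ → ℕ)
    (h : ∀ i < n, ∀ s, I i s → p.Holds s ∧ Tot A c s (b i) (I (i + 1)))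
    (hn : ∀ s, I n s → ¬ p.Holds s) (h0 : I 0 s) :
    Tot A (.loop p c) s (∑ i ∈ Finset.range n, (b i + 1)) (I n) := by
  -- Induction on the number `j` of passes that remain, because a loop is unfolded at its first
  -- pass.
  suffices H : ∀ j ≤ n, ∀ s, I (n - j) s →
      Tot A (.loop p c) s (∑ i ∈ Finset.Ico (n - j) n, (b i + 1)) (I n) by
    have := H n le_rfl s (by simpa using h0)
    simpa using this
  intro j
  induction j with
  | zero => intro _ s hs; exact loopDone (hn s (by simpa using hs)) (by simpa using hs)
  | succ j ih =>
    intro hj s hs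
    obtain ⟨hp, hc⟩ := h (n - (j + 1)) (by omega) s hs
    rw [Finset.sum_eq_sum_Ico_succ_bot (by omega)]
    refine loopStep hp (hc.mono le_rfl fun s₁ h₁ => ?_)
    have e : n - (j + 1) + 1 = n - j := by omega
    rw [e] at h₁ ⊢
    exact ih (by omega) s₁ h₁

theorem loopConst {p : TestExpr} (n : ℕ) (I : ℕ → MemState → Prop) (b : ℕ)
    (h : ∀ i < n, ∀ s, I i s → p.Holds s ∧ Tot A c s b (I (i + 1)))
    (hn : ∀ s, I n s → ¬ p.Holds s) (h0 : I 0 s) :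
    Tot A (.loop p c) s (n * (b + 1)) (I n) := by
  simpa using loopFor n I (fun _ => b) h hn h0

end Tot

/-- The sequential composition of a list of programs. -/
def Program.seqs (l : List Program) : Program := l.foldr .seq .skip

/-- Programs without loops and without calls of the solver. -/
def Program.Flat : Program → Prop
  | .skip => True
  | .setNat _ _ => True
  | .setReal _ _ => True
  | .seq c d => c.Flat ∧ d.Flat
  | .branch _ c d => c.Flat ∧ d.Flat
  | .loop _ _ => False
  | .solve .. => False

open Classical in
/-- The effect of a loop-free program. -/
noncomputable def Program.run : Program → MemState → MemState
  | .setNat a v, s => { s with nat := Function.update s.nat (a.eval s) (v.eval s) }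
  | .setReal a v, s => { s with real := Function.update s.real (a.eval s) (v.eval s) }
  | .seq c d, s => d.run (c.run s)
  | .branch p c d, s => if p.Holds s then c.run s else d.run s
  | _, s => s

/-- Without loops no operation is executed more than once, so the size alone bounds the time and the
budget is zero; the final state is an explicit function that can be simplified. -/
theorem Tot.flat {A : PointSolver} {c : Program} {s : MemState} {Q : MemState → Prop}
    (hc : c.Flat) (hQ : Q (c.run s)) : Tot A c s 0 Q := by
  induction c generalizing s Q with
  | skip => exact ⟨s, 1, .skip s, by simp [Program.size], hQ⟩
  | setNat a v => exact ⟨_, _, .setNat a v s, by simp [Program.size], hQ⟩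
  | setReal a v => exact ⟨_, _, .setReal a v s, by simp [Program.size], hQ⟩
  | seq c d ihc ihd => exact Tot.seq (k₁ := 0) (k₂ := 0) (ihc hc.1 (ihd hc.2 hQ))
  | branch p c d ihc ihd =>
    by_cases hp : p.Holds s
    · exact .branchTrue hp (ihc hc.1 (by simpa [Program.run, hp] using hQ))
    · exact .branchFalse hp (ihd hc.2 (by simpa [Program.run, hp] using hQ))
  | loop => exact hc.elim
  | solve => exact hc.elim

theorem Tot.seqs_nil {A : PointSolver} {s : MemState} {Q : MemState → Prop} (h : Q s) :
    Tot A (Program.seqs []) s 0 Q := Tot.flat trivial h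

theorem Tot.seqs_cons {A : PointSolver} {c : Program} {l : List Program} {s : MemState} {k₁ k₂ : ℕ}
    {Q : MemState → Prop} (h : Tot A c s k₁ fun s₁ => Tot A (Program.seqs l) s₁ k₂ Q) :
    Tot A (Program.seqs (c :: l)) s (k₁ + k₂) Q := Tot.seq h

/-- Programs run one after the other on the elements of a list, with an invariant that is indexed
by the list of elements that are done. -/
theorem Tot.seqs_map {α : Type*} {A : PointSolver} (f : α → Program) (b : ℕ) (l : List α)
    (I : List α → MemState → Prop)
    (h : ∀ pre x, ∀ s, x ∈ l → I pre s → Tot A (f x) s b (I (pre ++ [x]))) :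
    ∀ pre s, I pre s → Tot A (Program.seqs (l.map f)) s (l.length * b) (I (pre ++ l)) := by
  induction l with
  | nil => intro pre s hs; simpa using Tot.seqs_nil hs
  | cons x l ih =>
    intro pre s hs
    have := (h pre x s (by simp) hs)
    have H := Tot.seqs_cons (l := l.map f) (k₂ := l.length * b) (Q := I (pre ++ (x :: l)))
      (this.mono le_rfl fun s₁ h₁ => by
        simpa using ih (fun pre y s hy hs => h pre y s (by simp [hy]) hs) _ s₁ h₁)
    exact H.mono (by simp [add_mul]; omega) fun _ h => h

/-! ### Addresses -/

/-- The address of the cell `i` of the array number `j`. -/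
def addr (j : Fin 64) (i : ℕ) : ℕ := 64 * i + j.val

/-- Interleaving by residues modulo 64 yields 64 arrays that never collide and whose lengths need
not be known in advance. -/
theorem addr_inj {j j' : Fin 64} {i i' : ℕ} : addr j i = addr j' i' ↔ j = j' ∧ i = i' := by
  unfold addr
  rw [Fin.ext_iff]
  omega

theorem exists_eq_addr (a : ℕ) : ∃ j i, a = addr j i :=
  ⟨⟨a % 64, Nat.mod_lt _ (by norm_num)⟩, a / 64, by simp [addr]; omega⟩

theorem addr_lt {j : Fin 64} {i k : ℕ} : addr j i < 64 * k ↔ i < k := by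
  unfold addr; omega

/-- The cell `i` of an array. -/
def NatExpr.addr (j : Fin 64) (i : NatExpr) : NatExpr := .add (.mul (.lit 64) i) (.lit j.val)

/-- The value in the cell `i` of an array of natural numbers. -/
def NatExpr.at (j : Fin 64) (i : NatExpr) : NatExpr := .load (.addr j i)

/-- A natural-number variable. -/
def NatExpr.var (j : Fin 64) : NatExpr := .at j (.lit 0)

/-- The value in the cell `i` of an array of real numbers. -/
def RealExpr.at (j : Fin 64) (i : NatExpr) : RealExpr := .load (.addr j i)

@[simp] theorem NatExpr.eval_addr (s : MemState) (j : Fin 64) (i : NatExpr) :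
    (NatExpr.addr j i).eval s = _root_.addr j (i.eval s) := rfl

@[simp] theorem NatExpr.eval_at (s : MemState) (j : Fin 64) (i : NatExpr) :
    (NatExpr.at j i).eval s = s.nat (_root_.addr j (i.eval s)) := rfl

@[simp] theorem NatExpr.eval_var (s : MemState) (j : Fin 64) :
    (NatExpr.var j).eval s = s.nat (_root_.addr j 0) := rfl

@[simp] theorem RealExpr.eval_at (s : MemState) (j : Fin 64) (i : NatExpr) :
    (RealExpr.at j i).eval s = s.real (_root_.addr j (i.eval s)) := rfl

/-- Assignment to a natural-number variable. -/
def Program.setVar (j : Fin 64) (v : NatExpr) : Program := .setNat (.addr j (.lit 0)) v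

/-- Adding one to a natural-number variable. -/
def Program.incr (j : Fin 64) : Program := .setVar j (.add (.var j) (.lit 1))

/-- `f` and `g` agree outside of the arrays in `J`. -/
def SameOff {α : Type*} (J : List (Fin 64)) (f g : ℕ → α) : Prop :=
  ∀ j i, j ∉ J → g (addr j i) = f (addr j i)

theorem SameOff.refl {α : Type*} (J : List (Fin 64)) (f : ℕ → α) : SameOff J f f :=
  fun _ _ _ => rfl

theorem SameOff.trans {α : Type*} {J : List (Fin 64)} {f g h : ℕ → α} (h₁ : SameOff J f g)
    (h₂ : SameOff J g h) : SameOff J f h :=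
  fun j i hj => (h₂ j i hj).trans (h₁ j i hj)

theorem SameOff.mono {α : Type*} {J J' : List (Fin 64)} {f g : ℕ → α} (h₁ : SameOff J f g)
    (h : ∀ j ∈ J, j ∈ J') : SameOff J' f g :=
  fun j i hj => h₁ j i fun h' => hj (h _ h')

theorem SameOff.update {α : Type*} {J : List (Fin 64)} {f g : ℕ → α} (h₁ : SameOff J f g)
    {j : Fin 64} (hj : j ∈ J) (i : ℕ) (v : α) : SameOff J f (Function.update g (addr j i) v) := by
  intro j' i' hj'
  rw [Function.update_of_ne, h₁ j' i' hj']
  rw [Ne, addr_inj]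
  rintro ⟨rfl, -⟩
  exact hj' hj

/-! ### Derived expressions -/

namespace RealExpr

/-- A numeral. -/
def num (k : ℕ) : RealExpr := .ofNat (.lit k)

/-- The absolute value. -/
def abs (x : RealExpr) : RealExpr := .sqrt (.mul x x)

/-- The maximum of two numbers. -/
def max (x y : RealExpr) : RealExpr := .div (.add (.add x y) (abs (.sub x y))) (num 2)

/-- The minimum of two numbers. -/
def min (x y : RealExpr) : RealExpr := .div (.sub (.add x y) (abs (.sub x y))) (num 2)

@[simp] theorem eval_num (s : MemState) (k : ℕ) : (num k).eval s = (k : ℝ) := rfl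

@[simp] theorem eval_abs (s : MemState) (x : RealExpr) : (abs x).eval s = |x.eval s| := by
  simp [abs, RealExpr.eval, Real.sqrt_mul_self_eq_abs]

@[simp] theorem eval_max (s : MemState) (x y : RealExpr) :
    (max x y).eval s = Max.max (x.eval s) (y.eval s) := by
  simp only [max, RealExpr.eval, eval_abs, eval_num]
  push_cast
  rcases le_total (x.eval s) (y.eval s) with h | h
  · rw [max_eq_right h, abs_of_nonpos (by linarith)]; ring
  · rw [max_eq_left h, abs_of_nonneg (by linarith)]; ring

@[simp] theorem eval_min (s : MemState) (x y : RealExpr) :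
    (min x y).eval s = Min.min (x.eval s) (y.eval s) := by
  simp only [min, RealExpr.eval, eval_abs, eval_num]
  push_cast
  rcases le_total (x.eval s) (y.eval s) with h | h
  · rw [min_eq_left h, abs_of_nonpos (by linarith)]; ring
  · rw [min_eq_right h, abs_of_nonneg (by linarith)]; ring

end RealExpr


/-! ### Cancelling common mass in a finite transport plan -/

section Cancel

variable {ι : Type*} [Fintype ι] [DecidableEq ι]

/-- The mass that passes through the point `c` can be sent directly to its targets. -/
theorem exists_cancel_at (d : ι → ι → ℝ) (hd : ∀ i, d i i = 0)
    (htri : ∀ i j k, d i k ≤ d i j + d j k) (σ : ι → ι → ℝ) (hσ : ∀ i j, 0 ≤ σ i j) (c : ι) :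
    ∃ σ' : ι → ι → ℝ, (∀ i j, 0 ≤ σ' i j) ∧
      (∀ i, ∑ j, σ' i j =
        if i = c then ∑ j, σ i j - min (∑ j, σ i j) (∑ j, σ j i) else ∑ j, σ i j) ∧
      (∀ i, ∑ j, σ' j i =
        if i = c then ∑ j, σ j i - min (∑ j, σ i j) (∑ j, σ j i) else ∑ j, σ j i) ∧
      ∑ i, ∑ j, σ' i j * d i j ≤ ∑ i, ∑ j, σ i j * d i j := by
  set E := Finset.univ.erase c with hE
  set a := ∑ i ∈ E, σ i c with ha
  set b := ∑ j ∈ E, σ c j with hb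
  set m := min a b with hm
  have ha0 : 0 ≤ a := Finset.sum_nonneg fun i _ => hσ _ _
  have hb0 : 0 ≤ b := Finset.sum_nonneg fun i _ => hσ _ _
  have hm0 : 0 ≤ m := le_min ha0 hb0
  -- `α = m / a` and `β = m / b` are the shares of the incoming and the outgoing mass that are
  -- rerouted past `c`, and `w = m / (a * b)` distributes this mass over the pairs (source, target)
  -- in proportion to both flows. If `a` or `b` vanishes, nothing is rerouted.
  obtain ⟨α, β, w, hα0, hα1, hβ0, hβ1, hw0, hαa, hβb, hwa, hwb⟩ :
      ∃ α β w : ℝ, 0 ≤ α ∧ α ≤ 1 ∧ 0 ≤ β ∧ β ≤ 1 ∧ 0 ≤ w ∧ α * a = m ∧ β * b = m ∧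
        w * a = β ∧ w * b = α := by
    rcases ha0.eq_or_lt with h | h
    · have : m = 0 := by rw [hm, ← h]; exact min_eq_left hb0
      exact ⟨0, 0, 0, by simp [this]⟩
    rcases hb0.eq_or_lt with h' | h'
    · have : m = 0 := by rw [hm, ← h']; exact min_eq_right ha0
      exact ⟨0, 0, 0, by simp [this]⟩
    refine ⟨m / a, m / b, m / (a * b), by positivity, ?_, by positivity, ?_, by positivity, ?_, ?_,
      ?_, ?_⟩
    · rw [div_le_one h]; exact min_le_left _ _
    · rw [div_le_one h']; exact min_le_right _ _
    all_goals field_simp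
  have split : ∀ f : ι → ℝ, ∑ j, f j = f c + ∑ j ∈ E, f j := fun f =>
    (Finset.add_sum_erase _ f (Finset.mem_univ c)).symm
  have hne : ∀ j ∈ E, j ≠ c := fun j hj => Finset.ne_of_mem_erase hj
  have hmin : min (∑ j, σ c j) (∑ j, σ j c) = σ c c + m := by
    rw [split, split (fun j => σ j c), ← hb, ← ha, min_add_add_left, min_comm b a]
  -- The diagonal entry at `c` is counted in both marginals and is simply deleted; together with the
  -- rerouted amount `m` this is exactly the minimum in `hmin`.
  let σ' : ι → ι → ℝ := fun i j =>
    if i = c then (if j = c then 0 else σ c j * (1 - β))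
    else if j = c then σ i c * (1 - α) else σ i j + w * (σ i c * σ c j)
  have scc : σ' c c = 0 := by simp [σ']
  have scj : ∀ j ∈ E, σ' c j = σ c j * (1 - β) := fun j hj => by simp [σ', hne j hj]
  have sic : ∀ i ∈ E, σ' i c = σ i c * (1 - α) := fun j hj => by simp [σ', hne j hj]
  have sij : ∀ i ∈ E, ∀ j ∈ E, σ' i j = σ i j + w * (σ i c * σ c j) := fun i hi j hj => by
    simp [σ', hne j hj, hne i hi]
  refine ⟨σ', ?_, ?_, ?_, ?_⟩
  · intro i j
    have h1 : 0 ≤ 1 - α := by linarith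
    have h2 : 0 ≤ 1 - β := by linarith
    have := hσ i j; have := hσ i c; have := hσ c j
    simp only [σ']
    split_ifs <;> positivity
  · intro i
    split_ifs with hi
    · subst hi
      rw [hmin, split, scc, Finset.sum_congr rfl scj, ← Finset.sum_mul, ← hb, split (fun j => σ i j),
        ← hb]
      linear_combination -hβb
    · have hiE : i ∈ E := by simp [hE, hi]
      rw [split, sic i hiE, Finset.sum_congr rfl (sij i hiE), Finset.sum_add_distrib,
        ← Finset.mul_sum, ← Finset.mul_sum, ← hb, split (fun j => σ i j)]
      linear_combination σ i c * hwb
  · intro i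
    split_ifs with hi
    · subst hi
      rw [hmin, split, scc, Finset.sum_congr rfl sic, ← Finset.sum_mul, ← ha, split (fun j => σ j i),
        ← ha]
      linear_combination -hαa
    · have hiE : i ∈ E := by simp [hE, hi]
      rw [split, scj i hiE, Finset.sum_congr rfl (fun j hj => sij j hj i hiE),
        Finset.sum_add_distrib, ← Finset.mul_sum, ← Finset.sum_mul, ← ha, split (fun j => σ j i)]
      linear_combination σ c i * hwa
  · have e1 : ∑ i, ∑ j, σ' i j * d i j = ∑ j ∈ E, σ c j * (1 - β) * d c j +
        (∑ i ∈ E, σ i c * (1 - α) * d i c + ∑ i ∈ E, ∑ j ∈ E,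
          (σ i j * d i j + w * (σ i c * σ c j) * d i j)) := by
      rw [split, split, scc, ← Finset.sum_add_distrib]
      simp only [zero_mul, zero_add]
      congr 1
      · exact Finset.sum_congr rfl fun j hj => by rw [scj j hj]
      · refine Finset.sum_congr rfl fun i hi => ?_
        rw [split, sic i hi]
        congr 1
        exact Finset.sum_congr rfl fun j hj => by rw [sij i hi j hj]; ring
    have e2 : ∑ i, ∑ j, σ i j * d i j = ∑ j ∈ E, σ c j * d c j +
        (∑ i ∈ E, σ i c * d i c + ∑ i ∈ E, ∑ j ∈ E, σ i j * d i j) := by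
      rw [split, split, hd, ← Finset.sum_add_distrib]
      simp only [mul_zero, zero_add]
      congr 1
      exact Finset.sum_congr rfl fun i hi => by rw [split]
    -- The rerouted mass pays at most for the two legs through `c`, and these are the parts `α` and
    -- `β` of the flows that are saved.
    have e3 : ∑ i ∈ E, ∑ j ∈ E, w * (σ i c * σ c j) * d i j ≤
        α * (∑ i ∈ E, σ i c * d i c) + β * ∑ j ∈ E, σ c j * d c j := by
      calc ∑ i ∈ E, ∑ j ∈ E, w * (σ i c * σ c j) * d i j
          ≤ ∑ i ∈ E, ∑ j ∈ E, w * (σ i c * σ c j) * (d i c + d c j) := by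
            refine Finset.sum_le_sum fun i _ => Finset.sum_le_sum fun j _ => ?_
            have := hσ i c; have := hσ c j
            exact mul_le_mul_of_nonneg_left (htri _ _ _) (by positivity)
        _ = ∑ i ∈ E, (w * b * (σ i c * d i c) + w * σ i c * ∑ j ∈ E, σ c j * d c j) := by
            refine Finset.sum_congr rfl fun i _ => ?_
            rw [hb, Finset.mul_sum, Finset.mul_sum, Finset.sum_mul, ← Finset.sum_add_distrib]
            exact Finset.sum_congr rfl fun j _ => by ring
        _ = w * b * (∑ i ∈ E, σ i c * d i c) + w * a * ∑ j ∈ E, σ c j * d c j := by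
            rw [Finset.sum_add_distrib, ← Finset.mul_sum, ← Finset.sum_mul, ← Finset.mul_sum]
        _ = _ := by rw [hwa, hwb]
    rw [e1, e2]
    simp only [Finset.sum_add_distrib]
    have e4 : ∑ j ∈ E, σ c j * (1 - β) * d c j = (1 - β) * ∑ j ∈ E, σ c j * d c j := by
      rw [Finset.mul_sum]; exact Finset.sum_congr rfl fun j _ => by ring
    have e5 : ∑ j ∈ E, σ j c * (1 - α) * d j c = (1 - α) * ∑ j ∈ E, σ j c * d j c := by
      rw [Finset.mul_sum]; exact Finset.sum_congr rfl fun j _ => by ring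
    rw [e4, e5]
    linarith

/-- Mass that is both sent from and received at a point can be cancelled, without increasing the
cost. -/
theorem exists_cancel (d : ι → ι → ℝ) (hd : ∀ i, d i i = 0)
    (htri : ∀ i j k, d i k ≤ d i j + d j k) (σ : ι → ι → ℝ) (hσ : ∀ i j, 0 ≤ σ i j) :
    ∃ σ' : ι → ι → ℝ, (∀ i j, 0 ≤ σ' i j) ∧
      (∀ i, ∑ j, σ' i j = ∑ j, σ i j - min (∑ j, σ i j) (∑ j, σ j i)) ∧
      (∀ i, ∑ j, σ' j i = ∑ j, σ j i - min (∑ j, σ i j) (∑ j, σ j i)) ∧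
      ∑ i, ∑ j, σ' i j * d i j ≤ ∑ i, ∑ j, σ i j * d i j := by
  -- The points are treated one after the other: cancelling at `c` leaves the marginals at all other
  -- points unchanged.
  suffices H : ∀ F : Finset ι, ∃ σ' : ι → ι → ℝ, (∀ i j, 0 ≤ σ' i j) ∧
      (∀ i, ∑ j, σ' i j =
        if i ∈ F then ∑ j, σ i j - min (∑ j, σ i j) (∑ j, σ j i) else ∑ j, σ i j) ∧
      (∀ i, ∑ j, σ' j i =
        if i ∈ F then ∑ j, σ j i - min (∑ j, σ i j) (∑ j, σ j i) else ∑ j, σ j i) ∧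
      ∑ i, ∑ j, σ' i j * d i j ≤ ∑ i, ∑ j, σ i j * d i j by
    simpa using H Finset.univ
  intro F
  induction F using Finset.induction_on with
  | empty => exact ⟨σ, hσ, by simp, by simp, le_rfl⟩
  | insert c F hc ih =>
    obtain ⟨τ, h0, h1, h2, h3⟩ := ih
    obtain ⟨τ', k0, k1, k2, k3⟩ := exists_cancel_at d hd htri τ h0 c
    refine ⟨τ', k0, fun i => ?_, fun i => ?_, k3.trans h3⟩
    · rw [k1, h1, h2]
      by_cases hi : i = c
      · subst hi; simp [hc]
      · simp [hi]
    · rw [k2, h1, h2]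
      by_cases hi : i = c
      · subst hi; simp [hc]
      · simp [hi]

end Cancel


/-! ### Cell systems -/

/-- A finite partition of the mass of `μ` and `ν` into cells with centers and radii, with the
amounts that are sent (`src`), received (`tgt`) and left in place with density `stay` in each cell.
A cell is either small, or `μ` and `ν` are multiples of the area in it and in large balls around its
points. -/
structure CellSystem (ι : Type*) (μ ν : Measure Plane) (η r₀ : ℝ) where
  box : ι → Set Plane
  ctr : ι → Plane
  rad : ι → ℝ
  src : ι → ℝ
  tgt : ι → ℝ
  stay : ι → ℝ
  measurable : ∀ i, MeasurableSet (box i)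
  disjoint : Pairwise (Function.onFun Disjoint box)
  cover_left : μ (⋃ i, box i)ᶜ = 0
  cover_right : ν (⋃ i, box i)ᶜ = 0
  bounded : ∃ R : ℝ, ∀ i, ∀ z ∈ box i, ‖z‖ ≤ R
  rad_nonneg : ∀ i, 0 ≤ rad i
  dist_ctr : ∀ i, ∀ z ∈ box i, dist z (ctr i) ≤ rad i
  kind : ∀ i, (rad i ≤ r₀ ∧ src i = μ.real (box i) ∧ tgt i = ν.real (box i) ∧ stay i = 0) ∨
    ∃ p q : ℕ, (∀ X, MeasurableSet X → X ⊆ box i → μ X = p * volume X ∧ ν X = q * volume X) ∧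
      src i = max ((p : ℝ) - q) 0 * volume.real (box i) ∧
      tgt i = max ((q : ℝ) - p) 0 * volume.real (box i) ∧ stay i = min (p : ℝ) q ∧
      (p ≠ q → ∃ r, rad i ≤ η * r ∧ ∀ z ∈ box i, ∀ X, MeasurableSet X → X ⊆ Metric.ball z r →
        μ X = p * volume X ∧ ν X = q * volume X)

/-- A grid of mesh `ε / 2` cuts the boxes into finitely many pieces, because they are bounded. The
refinement serves the proof only: cancelling common mass must be done on a scale that is finer than
that of the boxes. -/
theorem exists_fine_cells {ι : Type*} [Fintype ι] (box : ι → Set Plane)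
    (hm : ∀ i, MeasurableSet (box i)) (hdis : Pairwise (Function.onFun Disjoint box))
    {R : ℝ} (hR : ∀ i, ∀ z ∈ box i, ‖z‖ ≤ R) {ε : ℝ} (hε : 0 < ε) :
    ∃ (κ : Type) (_ : Fintype κ) (cell : ι × κ → Set Plane),
      (∀ f, MeasurableSet (cell f)) ∧ Pairwise (Function.onFun Disjoint cell) ∧
      (∀ i, ⋃ k, cell (i, k) = box i) ∧ ∀ f, ∀ x ∈ cell f, ∀ y ∈ cell f, dist x y ≤ ε := by
  classical
  set G : ℤ := ⌈R / (ε / 2)⌉ + 1 with hG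
  refine ⟨Fin 2 → Finset.Icc (-G) G, inferInstance,
    fun f => box f.1 ∩ {z | ∀ k, ⌊z k / (ε / 2)⌋ = (f.2 k : ℤ)}, fun f => ?_, ?_, ?_, ?_⟩
  · refine (hm _).inter ?_
    rw [Set.ofPred_forall]
    refine MeasurableSet.iInter fun k => ?_
    have h1 : Measurable fun z : Plane => ⌊z k / (ε / 2)⌋ :=
      Int.measurable_floor.comp (by fun_prop)
    exact h1 (measurableSet_singleton _)
  · rintro ⟨i, k⟩ ⟨i', k'⟩ hne
    rw [Function.onFun, Set.disjoint_left]
    rintro z ⟨h1, h2⟩ ⟨h3, h4⟩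
    by_cases hi : i = i'
    · subst hi
      apply hne
      congr 1
      funext j
      exact Subtype.ext ((h2 j).symm.trans (h4 j))
    · exact Set.disjoint_left.1 (hdis hi) h1 h3
  · intro i
    ext z
    simp only [Set.mem_iUnion, Set.mem_inter_iff, Set.mem_ofPred_eq]
    refine ⟨fun ⟨_, h, _⟩ => h, fun h => ?_⟩
    have hb : ∀ k, ⌊z k / (ε / 2)⌋ ∈ Finset.Icc (-G) G := by
      intro k
      have h1 : |z k| ≤ R := by
        have := (PiLp.norm_apply_le z k).trans (hR i z h)
        simpa using this
      have h2 := abs_le.1 h1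
      have h3 : z k / (ε / 2) ≤ R / (ε / 2) := by gcongr; exact h2.2
      have h4 : -(R / (ε / 2)) ≤ z k / (ε / 2) := by rw [← neg_div]; gcongr; exact h2.1
      have h5 := Int.le_ceil (R / (ε / 2))
      rw [Finset.mem_Icc]
      constructor
      · rw [Int.le_floor]; push_cast [hG]; linarith
      · have : ⌊z k / (ε / 2)⌋ ≤ ⌈R / (ε / 2)⌉ := by
          have := Int.floor_le (z k / (ε / 2))
          exact Int.cast_le.1 (this.trans (h3.trans h5))
        omega
    exact ⟨fun k => ⟨_, hb k⟩, h, fun k => rfl⟩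
  · rintro ⟨i, k⟩ x ⟨_, hx⟩ y ⟨_, hy⟩
    have hk : ∀ j, |x j - y j| ≤ ε / 2 := by
      intro j
      have h := Int.abs_sub_lt_one_of_floor_eq_floor ((hx j).trans (hy j).symm)
      rw [← sub_div, abs_div, abs_of_pos (by positivity : 0 < ε / 2), div_lt_one (by positivity)] at h
      exact h.le
    rw [EuclideanSpace.dist_eq, Fin.sum_univ_two]
    apply Real.sqrt_le_iff.2 ⟨hε.le, ?_⟩
    have h0 := sq_le_sq' (by linarith [abs_nonneg (x 0 - y 0), hk 0]) (hk 0)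
    have h1 := sq_le_sq' (by linarith [abs_nonneg (x 1 - y 1), hk 1]) (hk 1)
    simp only [Real.dist_eq]
    nlinarith

theorem measure_union_of_null {α : Type*} [MeasurableSpace α] {μ : Measure α} {X Y : Set α}
    (h : μ Y = 0) : μ (X ∪ Y) = μ X :=
  le_antisymm ((measure_union_le X Y).trans (by simp [h])) (measure_mono Set.subset_union_left)

/-! ### Discretization of a transport plan on fine cells -/

section Discretize

variable {κ : Type*} [Fintype κ] {μ ν : Measure Plane} {π : Measure (Plane × Plane)}
  {cell : κ → Set Plane}

theorem plan_rect_univ_right (h : IsTransportPlan μ ν π) {X : Set Plane} (hX : MeasurableSet X) :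
    π (X ×ˢ Set.univ) = μ X := by
  rw [← h.1, Measure.map_apply measurable_fst hX, Set.prod_univ]

theorem plan_rect_univ_left (h : IsTransportPlan μ ν π) {X : Set Plane} (hX : MeasurableSet X) :
    π (Set.univ ×ˢ X) = ν X := by
  rw [← h.2, Measure.map_apply measurable_snd hX, Set.univ_prod]

theorem IsTransportPlan.isFiniteMeasure [IsFiniteMeasure μ] (h : IsTransportPlan μ ν π) :
    IsFiniteMeasure π := by
  refine ⟨?_⟩
  rw [← Set.univ_prod_univ, plan_rect_univ_right h MeasurableSet.univ]
  exact measure_lt_top _ _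

/-- The plan has no mass over the complement of the cells, since its second marginal has none there.
-/
theorem plan_sum_right (h : IsTransportPlan μ ν π) [IsFiniteMeasure μ]
    (hm : ∀ f, MeasurableSet (cell f)) (hd : Pairwise (Function.onFun Disjoint cell))
    (hν : ν (⋃ f, cell f)ᶜ = 0) {X : Set Plane} (hX : MeasurableSet X) :
    ∑ g, π.real (X ×ˢ cell g) = μ.real X := by
  have := h.isFiniteMeasure
  have e : π (X ×ˢ ⋃ f, cell f) = μ X := by
    rw [← plan_rect_univ_right h hX, ← Set.union_compl_self (⋃ f, cell f), Set.prod_union]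
    refine (measure_union_of_null (measure_mono_null (t := Set.univ ×ˢ (⋃ f, cell f)ᶜ)
      (Set.prod_mono (Set.subset_univ _) le_rfl) ?_)).symm
    rw [plan_rect_univ_left h (MeasurableSet.iUnion hm).compl, hν]
  rw [Measure.real, ← e, Set.prod_iUnion, measure_iUnion, tsum_fintype, ENNReal.toReal_sum]
  · rfl
  · exact fun _ _ => measure_ne_top _ _
  · intro i j hij
    exact Set.disjoint_prod.2 (Or.inr (hd hij))
  · exact fun i => hX.prod (hm i)

theorem plan_sum_left (h : IsTransportPlan μ ν π) [IsFiniteMeasure μ]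
    (hm : ∀ f, MeasurableSet (cell f)) (hd : Pairwise (Function.onFun Disjoint cell))
    (hμ : μ (⋃ f, cell f)ᶜ = 0) {X : Set Plane} (hX : MeasurableSet X) :
    ∑ g, π.real (cell g ×ˢ X) = ν.real X := by
  have := h.isFiniteMeasure
  have e : π ((⋃ f, cell f) ×ˢ X) = ν X := by
    rw [← plan_rect_univ_left h hX, ← Set.union_compl_self (⋃ f, cell f), Set.union_prod]
    refine (measure_union_of_null (measure_mono_null (t := (⋃ f, cell f)ᶜ ×ˢ Set.univ)
      (Set.prod_mono le_rfl (Set.subset_univ _)) ?_)).symm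
    rw [plan_rect_univ_right h (MeasurableSet.iUnion hm).compl, hμ]
  rw [Measure.real, ← e, Set.iUnion_prod_const, measure_iUnion, tsum_fintype, ENNReal.toReal_sum]
  · rfl
  · exact fun _ _ => measure_ne_top _ _
  · intro i j hij
    exact Set.disjoint_prod.2 (Or.inl (hd hij))
  · exact fun i => (hm i).prod hX

/-- Replacing both ends of a transport by the points of their cells changes its length by at most `2
* ε`, and the total mass is one. -/
theorem plan_discrete_cost (h : IsTransportPlan μ ν π) [IsProbabilityMeasure μ]
    (hm : ∀ f, MeasurableSet (cell f)) (hd : Pairwise (Function.onFun Disjoint cell))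
    (pt : κ → Plane) {ε : ℝ} (hε : 0 ≤ ε) (hpt : ∀ f, ∀ x ∈ cell f, dist x (pt f) ≤ ε)
    (hc : transportCost π ≠ ⊤) :
    ∑ f, ∑ g, π.real (cell f ×ˢ cell g) * dist (pt f) (pt g) ≤
      (transportCost π).toReal + 2 * ε := by
  have := h.isFiniteMeasure
  have hπ : π Set.univ = 1 := by
    rw [← Set.univ_prod_univ, plan_rect_univ_right h MeasurableSet.univ, measure_univ]
  have key : ∑ k : κ × κ, π (cell k.1 ×ˢ cell k.2) * ENNReal.ofReal (dist (pt k.1) (pt k.2)) ≤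
      transportCost π + ENNReal.ofReal (2 * ε) := by
    have e1 : ∀ k : κ × κ, π (cell k.1 ×ˢ cell k.2) * ENNReal.ofReal (dist (pt k.1) (pt k.2)) ≤
        ∫⁻ z in cell k.1 ×ˢ cell k.2, (edist z.1 z.2 + ENNReal.ofReal (2 * ε)) ∂π := by
      intro k
      rw [mul_comm, ← setLIntegral_const]
      refine setLIntegral_mono' ((hm _).prod (hm _)) fun z hz => ?_
      rw [edist_dist, ← ENNReal.ofReal_add dist_nonneg (by positivity)]
      apply ENNReal.ofReal_le_ofReal
      have h1 := hpt _ _ hz.1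
      have h2 := hpt _ _ hz.2
      have h3 := dist_triangle4 (pt k.1) z.1 z.2 (pt k.2)
      rw [dist_comm] at h1
      linarith
    refine (Finset.sum_le_sum fun k _ => e1 k).trans ?_
    rw [← tsum_fintype (L := .unconditional _), ← lintegral_iUnion (fun k => (hm _).prod (hm _))]
    · refine (setLIntegral_le_lintegral _ _).trans ?_
      rw [lintegral_add_right _ measurable_const, lintegral_const, hπ, mul_one]
      rfl
    · intro k l hkl
      refine Set.disjoint_prod.2 ?_
      by_cases h1 : k.1 = l.1
      · exact Or.inr (hd fun h2 => hkl (Prod.ext h1 h2))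
      · exact Or.inl (hd h1)
  have := ENNReal.toReal_mono (by finiteness) key
  rw [ENNReal.toReal_add hc (by finiteness), ENNReal.toReal_ofReal (by positivity),
    ENNReal.toReal_sum (fun k _ => by finiteness), Fintype.sum_prod_type] at this
  simpa [ENNReal.toReal_mul, Measure.real, ENNReal.toReal_ofReal] using this

end Discretize


theorem measureReal_eq_natCast_mul {μ : Measure Plane} {p : ℕ} {X : Set Plane}
    (h : μ X = p * volume X) : μ.real X = p * volume.real X := by
  rw [Measure.real, h, ENNReal.toReal_mul]; simp [Measure.real]

/-! ### From a transport plan to a plan between the centers of cells -/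

namespace CellSystem

variable {ι : Type*} {μ ν : Measure Plane} {η r₀ : ℝ}

theorem sum_real_fine {κ : Type*} [Fintype κ] (S : CellSystem ι μ ν η r₀) {cell : ι × κ → Set Plane}
    (hm : ∀ f, MeasurableSet (cell f)) (hd : Pairwise (Function.onFun Disjoint cell))
    (hU : ∀ i, ⋃ k, cell (i, k) = S.box i) (ρ : Measure Plane) (i : ι)
    (hρ : ρ (S.box i) ≠ ⊤) : ∑ k, ρ.real (cell (i, k)) = ρ.real (S.box i) := by
  have hle : ∀ k, cell (i, k) ⊆ S.box i := fun k => (hU i) ▸ Set.subset_iUnion (fun k => cell (i, k)) k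
  conv_rhs => rw [Measure.real, ← hU i]
  rw [measure_iUnion, tsum_fintype, ENNReal.toReal_sum]
  · rfl
  · exact fun k _ => ((measure_mono (hle k)).trans_lt hρ.lt_top).ne
  · exact fun k l hkl => hd (by simpa using hkl)
  · exact fun k => hm _

theorem volume_ne_top (S : CellSystem ι μ ν η r₀) (i : ι) : volume (S.box i) ≠ ⊤ := by
  obtain ⟨R, hR⟩ := S.bounded
  refine ((measure_mono fun z hz => ?_).trans_lt
    (measure_closedBall_lt_top (x := (0 : Plane)) (r := R))).ne
  simpa using hR i z hz

/-- The roles of source and target exchanged. -/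
def swap (S : CellSystem ι μ ν η r₀) : CellSystem ι ν μ η r₀ where
  box := S.box
  ctr := S.ctr
  rad := S.rad
  src := S.tgt
  tgt := S.src
  stay := S.stay
  measurable := S.measurable
  disjoint := S.disjoint
  cover_left := S.cover_right
  cover_right := S.cover_left
  bounded := S.bounded
  rad_nonneg := S.rad_nonneg
  dist_ctr := S.dist_ctr
  kind i := by
    obtain ⟨h1, h2, h3, h4⟩ | ⟨p, q, h1, h2, h3, h4, h5⟩ := S.kind i
    · exact Or.inl ⟨h1, h3, h2, h4⟩
    · refine Or.inr ⟨q, p, fun X hX hX' => (h1 X hX hX').symm, h3, h2, by rw [h4, min_comm],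
        fun hqp => ?_⟩
      obtain ⟨r, hr, hb⟩ := h5 hqp.symm
      exact ⟨r, hr, fun z hz X hX hX' => (hb z hz X hX hX').symm⟩

/-- A cell that is not small and has less mass to receive than to send is far from all places where
it is the other way round. -/
theorem rad_le_of_lt (S : CellSystem ι μ ν η r₀) (hη : 0 ≤ η) {i : ι}
    (hi : ¬ (S.rad i ≤ r₀ ∧ S.src i = μ.real (S.box i) ∧ S.tgt i = ν.real (S.box i) ∧ S.stay i = 0))
    {X Y : Set Plane} (hX : MeasurableSet X) (hXi : X ⊆ S.box i) (hY : MeasurableSet Y) {x : Plane}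
    (hx : x ∈ X) {ρ : ℝ} (hρ : Y ⊆ Metric.closedBall x ρ) (h1 : ν.real X < μ.real X)
    (h2 : μ.real Y < ν.real Y) : S.rad i ≤ η * ρ := by
  obtain hk | ⟨p, q, hpq, -, -, -, hball⟩ := S.kind i
  · exact (hi hk).elim
  have h3 := hpq _ hX hXi
  have h5 : q < p := by
    rw [measureReal_eq_natCast_mul h3.1, measureReal_eq_natCast_mul h3.2] at h1
    exact_mod_cast lt_of_mul_lt_mul_right h1 measureReal_nonneg
  obtain ⟨r, hr, hball⟩ := hball (by omega)
  refine hr.trans (mul_le_mul_of_nonneg_left ?_ hη)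
  -- Otherwise `Y` lies in a ball around `x` on which the densities are still `p` and `q` with `q <
  -- p`, so `ν` could not exceed `μ` on `Y`.
  by_contra! h6
  have h7 := hball x (hXi hx) Y hY (hρ.trans (Metric.closedBall_subset_ball h6))
  rw [measureReal_eq_natCast_mul h7.1, measureReal_eq_natCast_mul h7.2] at h2
  have : (q : ℝ) ≤ p := by exact_mod_cast h5.le
  have := mul_le_mul_of_nonneg_right this (measureReal_nonneg (μ := volume) (s := Y))
  linarith

open Classical in
-- In a cell with densities `p` and `q`, cancelling in each fine cell leaves `max (p - q) 0` times
-- its area, which adds up to `src`. In a small cell `src` is the full mass, so what the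
-- cancellation removed has to be added again.
theorem src_eq_sum {κ : Type*} [Fintype κ] [IsFiniteMeasure μ] (S : CellSystem ι μ ν η r₀)
    {cell : ι × κ → Set Plane} (cm : ∀ f, MeasurableSet (cell f))
    (cd : Pairwise (Function.onFun Disjoint cell)) (cU : ∀ i, ⋃ k, cell (i, k) = S.box i) (i : ι) :
    S.src i = (∑ k, (μ.real (cell (i, k)) - min (μ.real (cell (i, k))) (ν.real (cell (i, k))))) +
      if S.rad i ≤ r₀ ∧ S.src i = μ.real (S.box i) ∧ S.tgt i = ν.real (S.box i) ∧ S.stay i = 0 then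
        ∑ k, min (μ.real (cell (i, k))) (ν.real (cell (i, k))) else 0 := by
  split_ifs with hi
  · rw [hi.2.1, ← S.sum_real_fine cm cd cU μ i (measure_ne_top _ _), ← Finset.sum_add_distrib]
    exact Finset.sum_congr rfl fun k _ => by ring
  · obtain hk | ⟨p, q, hpq, h1, -, -, -⟩ := S.kind i
    · exact (hi hk).elim
    rw [h1, ← S.sum_real_fine cm cd cU volume i (S.volume_ne_top i), Finset.mul_sum, add_zero]
    refine Finset.sum_congr rfl fun k _ => ?_
    have h3 := hpq _ (cm (i, k)) ((cU i) ▸ Set.subset_iUnion (fun k => cell (i, k)) k)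
    rw [measureReal_eq_natCast_mul h3.1, measureReal_eq_natCast_mul h3.2,
      ← min_mul_of_nonneg _ _ measureReal_nonneg, ← sub_mul]
    congr 1
    rcases le_total (p : ℝ) q with h | h
    · rw [min_eq_left h, max_eq_right (by linarith)]; ring
    · rw [min_eq_right h, max_eq_left (by linarith)]

/-- A transport plan between `μ` and `ν` yields a plan between the reduced amounts in the cells;
the loss and the total of the amounts times the radii are small. -/
theorem exists_plan [Fintype ι] [IsProbabilityMeasure μ] [IsProbabilityMeasure ν]
    (S : CellSystem ι μ ν η r₀) (hη : 0 ≤ η) (hr₀ : 0 ≤ r₀) {π : Measure (Plane × Plane)}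
    (hπ : IsTransportPlan μ ν π) (hc : transportCost π ≠ ⊤) {ε : ℝ} (hε : 0 < ε) :
    ∃ σ : ι → ι → ℝ, (∀ i j, 0 ≤ σ i j) ∧ (∀ i, ∑ j, σ i j = S.src i) ∧
      (∀ j, ∑ i, σ i j = S.tgt j) ∧
      ∑ i, ∑ j, σ i j * dist (S.ctr i) (S.ctr j) ≤
        (1 + 2 * η) * ((transportCost π).toReal + ε) + 2 * r₀ ∧
      ∑ i, (S.src i + S.tgt i) * S.rad i ≤ 2 * η * ((transportCost π).toReal + ε) + 2 * r₀ := by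
  classical
  obtain ⟨R, hR⟩ := S.bounded
  obtain ⟨κ, _, cell, cm, cd, cU, cdiam⟩ := exists_fine_cells S.box S.measurable S.disjoint hR
    (by positivity : 0 < ε / 3)
  -- The discretization costs `2 * e`, and the distance bounds below contain another `e`.
  set e := ε / 3 with he
  have he0 : 0 < e := by positivity
  have hsub : ∀ f, cell f ⊆ S.box f.1 := fun f => (cU f.1) ▸ Set.subset_iUnion (fun k => cell (f.1, k)) f.2
  have hUU : ⋃ f, cell f = ⋃ i, S.box i := by
    rw [Set.iUnion_prod']; simp_rw [cU]
  have hμ0 : μ (⋃ f, cell f)ᶜ = 0 := hUU ▸ S.cover_left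
  have hν0 : ν (⋃ f, cell f)ᶜ = 0 := hUU ▸ S.cover_right
  -- The value for empty cells is irrelevant: they carry no mass.
  let pt : ι × κ → Plane := fun f => if h : (cell f).Nonempty then h.some else 0
  have hpt : ∀ f, ∀ x ∈ cell f, dist x (pt f) ≤ e := by
    intro f x hx
    have hne : (cell f).Nonempty := ⟨x, hx⟩
    simp only [pt, hne, dif_pos]
    exact cdiam f x hx _ hne.some_mem
  have hpt' : ∀ f, (cell f).Nonempty → pt f ∈ cell f := by
    intro f hne; simp only [pt, hne, dif_pos]; exact hne.some_mem
  set C := (transportCost π).toReal with hC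
  have hcost := plan_discrete_cost hπ cm cd pt he0.le hpt hc
  -- Common mass is cancelled between the fine cells, also within the small cells, where it is put
  -- back at the end.
  obtain ⟨σ, s0, srow, scol, scost⟩ := exists_cancel (fun f g => dist (pt f) (pt g)) (by simp)
    (fun _ _ _ => dist_triangle _ _ _) (fun f g => π.real (cell f ×ˢ cell g))
    (fun _ _ => measureReal_nonneg)
  simp only [plan_sum_right hπ cm cd hν0 (cm _), plan_sum_left hπ cm cd hμ0 (cm _)] at srow scol
  have hcost1 := scost.trans hcost
  set a : ι × κ → ℝ := fun f => μ.real (cell f) with ha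
  set b : ι × κ → ℝ := fun f => ν.real (cell f) with hb
  have a0 : ∀ f, 0 ≤ a f := fun _ => measureReal_nonneg
  have b0 : ∀ f, 0 ≤ b f := fun _ => measureReal_nonneg
  have sum_a : ∑ f, a f ≤ 1 := by
    rw [← probReal_univ (μ := μ), ha]
    have := measureReal_biUnion_finset (μ := μ) (s := Finset.univ) (f := cell)
      (fun f _ g _ h => cd h) (fun f _ => cm f)
    rw [← this]
    exact measureReal_mono (Set.subset_univ _)
  have sum_b : ∑ f, b f ≤ 1 := by
    rw [← probReal_univ (μ := ν), hb]
    have := measureReal_biUnion_finset (μ := ν) (s := Finset.univ) (f := cell)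
      (fun f _ g _ h => cd h) (fun f _ => cm f)
    rw [← this]
    exact measureReal_mono (Set.subset_univ _)
  -- small cells
  let B : ι → Prop := fun i => S.rad i ≤ r₀ ∧ S.src i = μ.real (S.box i) ∧
    S.tgt i = ν.real (S.box i) ∧ S.stay i = 0
  -- After cancellation, mass flows only from fine cells with a surplus of `μ` to fine cells with a
  -- surplus of `ν`.
  have row_pos : ∀ f g, 0 < σ f g → b f < a f ∧ a g < b g := by
    intro f g h
    have h1 : 0 < ∑ g, σ f g := Finset.sum_pos' (fun _ _ => s0 _ _) ⟨g, Finset.mem_univ _, h⟩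
    have h2 : 0 < ∑ f, σ f g := Finset.sum_pos' (fun _ _ => s0 _ _) ⟨f, Finset.mem_univ _, h⟩
    rw [srow] at h1
    rw [scol] at h2
    constructor
    · by_contra! h3
      rw [min_eq_left h3, sub_self] at h1; exact h1.false
    · by_contra! h3
      rw [min_eq_right h3, sub_self] at h2; exact h2.false
  have nonempty_of : ∀ f, a f ≠ b f → (cell f).Nonempty := by
    intro f h
    by_contra h'
    rw [Set.not_nonempty_iff_eq_empty] at h'
    simp [ha, hb, h'] at h
  -- This is the main estimate: unless the cell of `f` is small, its radius is at most `η` times the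
  -- way that the mass has to travel, up to `e`.
  have charge_src : ∀ f g, 0 < σ f g → ¬ B f.1 → S.rad f.1 ≤ η * (dist (pt f) (pt g) + e) := by
    intro f g h hB
    obtain ⟨h1, h2⟩ := row_pos f g h
    refine S.rad_le_of_lt hη hB (cm f) (hsub f) (cm g) (hpt' f (nonempty_of f h1.ne')) (fun z hz => ?_) h1 h2
    have := hpt g z hz
    have := dist_triangle z (pt g) (pt f)
    rw [dist_comm (pt g)] at this
    rw [Metric.mem_closedBall]; linarith
  have charge_tgt : ∀ f g, 0 < σ f g → ¬ B g.1 → S.rad g.1 ≤ η * (dist (pt f) (pt g) + e) := by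
    intro f g h hB
    obtain ⟨h1, h2⟩ := row_pos f g h
    refine S.swap.rad_le_of_lt hη (fun h => hB ⟨h.1, h.2.2.1, h.2.1, h.2.2.2⟩) (cm g) (hsub g) (cm f)
      (hpt' g (nonempty_of g h2.ne)) (fun z hz => ?_) h2 h1
    have := hpt f z hz
    have := dist_triangle z (pt f) (pt g)
    rw [Metric.mem_closedBall]; linarith
  set D := ∑ f, ∑ g, σ f g * dist (pt f) (pt g) with hD
  have tot : ∑ f, ∑ g, σ f g ≤ 1 := by
    refine le_trans (Finset.sum_le_sum fun f _ => ?_) sum_a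
    rw [srow]
    have := le_min (a0 f) (b0 f)
    linarith
  have sum_charge : ∑ f, ∑ g, σ f g * (η * (dist (pt f) (pt g) + e)) ≤ η * (C + ε) := by
    have : ∑ f, ∑ g, σ f g * (η * (dist (pt f) (pt g) + e)) =
        η * (D + e * ∑ f, ∑ g, σ f g) := by
      rw [hD, mul_add, Finset.mul_sum, Finset.mul_sum, Finset.mul_sum, ← Finset.sum_add_distrib]
      refine Finset.sum_congr rfl fun f _ => ?_
      rw [Finset.mul_sum, Finset.mul_sum, Finset.mul_sum, ← Finset.sum_add_distrib]
      exact Finset.sum_congr rfl fun g _ => by ring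
    rw [this]
    refine mul_le_mul_of_nonneg_left ?_ hη
    have : e * ∑ f, ∑ g, σ f g ≤ e * 1 := by gcongr
    linarith
  -- amounts in the cells
  have src_eq : ∀ i, S.src i = (∑ k, ∑ g, σ (i, k) g) +
      if B i then ∑ k, min (a (i, k)) (b (i, k)) else 0 := by
    intro i
    simp only [srow]
    exact (S.src_eq_sum cm cd cU i).trans (by congr!)
  have tgt_eq : ∀ i, S.tgt i = (∑ k, ∑ f, σ f (i, k)) +
      if B i then ∑ k, min (a (i, k)) (b (i, k)) else 0 := by
    intro i
    simp only [scol]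
    exact (S.swap.src_eq_sum cm cd cU i).trans (by
      congr! 3 <;> first
        | exact min_comm _ _
        | exact ⟨fun h => ⟨h.2.1, h.1, h.2.2⟩, fun h => ⟨h.2.1, h.1, h.2.2⟩⟩)
  -- The flow between fine cells is collected to a flow between cells, and the mass cancelled in
  -- small cells returns on the diagonal, where it costs nothing.
  refine ⟨fun i j => (∑ k, ∑ l, σ (i, k) (j, l)) +
    if i = j ∧ B i then ∑ k, min (a (i, k)) (b (i, k)) else 0, ?_, ?_, ?_, ?_, ?_⟩
  · intro i j
    refine add_nonneg (Finset.sum_nonneg fun _ _ => Finset.sum_nonneg fun _ _ => s0 _ _) ?_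
    split_ifs
    · exact Finset.sum_nonneg fun _ _ => le_min (a0 _) (b0 _)
    · rfl
  · intro i
    refine Eq.trans ?_ (src_eq i).symm
    rw [Finset.sum_add_distrib]
    congr 1
    · rw [Finset.sum_comm]
      exact Finset.sum_congr rfl fun k _ => (Fintype.sum_prod_type _).symm
    · rw [Finset.sum_eq_single i]
      · simp
      · intro j _ hj; simp [hj.symm]
      · simp
  · intro i
    refine Eq.trans ?_ (tgt_eq i).symm
    rw [Finset.sum_add_distrib]
    congr 1
    · calc ∑ j, ∑ k, ∑ l, σ (j, k) (i, l) = ∑ f : ι × κ, ∑ l, σ f (i, l) :=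
            (Fintype.sum_prod_type (fun f : ι × κ => ∑ l, σ f (i, l))).symm
        _ = _ := Finset.sum_comm
    · rw [Finset.sum_eq_single i]
      · simp
      · intro j _ hj; simp [hj]
      · simp
  · have e1 : ∀ i j, ((∑ k, ∑ l, σ (i, k) (j, l)) +
        if i = j ∧ B i then ∑ k, min (a (i, k)) (b (i, k)) else 0) * dist (S.ctr i) (S.ctr j) =
        ∑ k, ∑ l, σ (i, k) (j, l) * dist (S.ctr i) (S.ctr j) := by
      intro i j
      rw [add_mul, Finset.sum_mul]
      have : (if i = j ∧ B i then ∑ k, min (a (i, k)) (b (i, k)) else 0) *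
          dist (S.ctr i) (S.ctr j) = 0 := by
        split_ifs with h
        · rw [h.1]; simp
        · simp
      rw [this, add_zero]
      exact Finset.sum_congr rfl fun k _ => Finset.sum_mul _ _ _
    simp only [e1]
    have e2 : ∑ i, ∑ j, ∑ k, ∑ l, σ (i, k) (j, l) * dist (S.ctr i) (S.ctr j) =
        ∑ f : ι × κ, ∑ g : ι × κ, σ f g * dist (S.ctr f.1) (S.ctr g.1) := by
      rw [Fintype.sum_prod_type]
      refine Finset.sum_congr rfl fun i _ => ?_
      rw [Finset.sum_comm]
      exact Finset.sum_congr rfl fun k _ =>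
        (Fintype.sum_prod_type (fun g : ι × κ => σ (i, k) g * dist (S.ctr i) (S.ctr g.1))).symm
    rw [e2]
    -- Going from points to centers adds the two radii. Each of them is at most `r₀` or at most `η`
    -- times the distance travelled, up to `e`.
    have e3 : ∀ f g, σ f g * dist (S.ctr f.1) (S.ctr g.1) ≤ σ f g * dist (pt f) (pt g) +
        2 * (σ f g * (η * (dist (pt f) (pt g) + e))) + 2 * r₀ * σ f g := by
      intro f g
      rcases (s0 f g).eq_or_lt with h | h
      · rw [← h]; simp
      obtain ⟨h1, h2⟩ := row_pos f g h
      have h3 := S.dist_ctr f.1 _ (hsub f (hpt' f (nonempty_of f h1.ne')))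
      have h4 := S.dist_ctr g.1 _ (hsub g (hpt' g (nonempty_of g h2.ne)))
      have hch0 : 0 ≤ η * (dist (pt f) (pt g) + e) :=
        mul_nonneg hη (add_nonneg dist_nonneg he0.le)
      have h5 : S.rad f.1 ≤ η * (dist (pt f) (pt g) + e) + r₀ := by
        by_cases hB : B f.1
        · linarith [hB.1]
        · linarith [charge_src f g h hB]
      have h6 : S.rad g.1 ≤ η * (dist (pt f) (pt g) + e) + r₀ := by
        by_cases hB : B g.1
        · linarith [hB.1]
        · linarith [charge_tgt f g h hB]
      have h7 := dist_triangle4 (S.ctr f.1) (pt f) (pt g) (S.ctr g.1)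
      rw [dist_comm] at h3
      have h8 : dist (S.ctr f.1) (S.ctr g.1) ≤ dist (pt f) (pt g) +
        2 * (η * (dist (pt f) (pt g) + e)) + 2 * r₀ := by linarith
      have := mul_le_mul_of_nonneg_left h8 h.le
      linarith
    refine (Finset.sum_le_sum fun f _ => Finset.sum_le_sum fun g _ => e3 f g).trans ?_
    simp only [Finset.sum_add_distrib, ← Finset.mul_sum]
    have : 2 * r₀ * ∑ f, ∑ g, σ f g ≤ 2 * r₀ * 1 := by gcongr
    linarith
  · have src0 : ∀ i, 0 ≤ S.src i := by
      intro i
      rw [src_eq]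
      refine add_nonneg (Finset.sum_nonneg fun _ _ => Finset.sum_nonneg fun _ _ => s0 _ _) ?_
      split_ifs
      · exact Finset.sum_nonneg fun _ _ => le_min (a0 _) (b0 _)
      · rfl
    have tgt0 : ∀ i, 0 ≤ S.tgt i := by
      intro i
      rw [tgt_eq]
      refine add_nonneg (Finset.sum_nonneg fun _ _ => Finset.sum_nonneg fun _ _ => s0 _ _) ?_
      split_ifs
      · exact Finset.sum_nonneg fun _ _ => le_min (a0 _) (b0 _)
      · rfl
    have hch0 : ∀ f g, 0 ≤ σ f g * (η * (dist (pt f) (pt g) + e)) := fun f g =>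
        mul_nonneg (s0 f g) (mul_nonneg hη (add_nonneg dist_nonneg he0.le))
    have e1 : ∀ i, S.src i * S.rad i ≤
        (∑ k, ∑ g, σ (i, k) g * (η * (dist (pt (i, k)) (pt g) + e))) + r₀ * ∑ k, a (i, k) := by
      intro i
      have ha' : 0 ≤ r₀ * ∑ k, a (i, k) := mul_nonneg hr₀ (Finset.sum_nonneg fun _ _ => a0 _)
      by_cases hB : B i
      · rw [hB.2.1, ← S.sum_real_fine cm cd cU μ i (measure_ne_top _ _), mul_comm]
        have h1 : S.rad i * ∑ k, μ.real (cell (i, k)) ≤ r₀ * ∑ k, a (i, k) :=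
          mul_le_mul_of_nonneg_right hB.1 (Finset.sum_nonneg fun _ _ => a0 _)
        have h2 := Finset.sum_nonneg (s := Finset.univ)
          fun k _ => Finset.sum_nonneg (s := Finset.univ) fun g _ => hch0 (i, k) g
        linarith
      · rw [src_eq, if_neg hB, add_zero, Finset.sum_mul]
        have : ∑ k, (∑ g, σ (i, k) g) * S.rad i ≤
            ∑ k, ∑ g, σ (i, k) g * (η * (dist (pt (i, k)) (pt g) + e)) := by
          refine Finset.sum_le_sum fun k _ => ?_
          rw [Finset.sum_mul]
          refine Finset.sum_le_sum fun g _ => ?_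
          rcases (s0 (i, k) g).eq_or_lt with h | h
          · rw [← h]; simp
          · exact mul_le_mul_of_nonneg_left (charge_src (i, k) g h hB) h.le
        linarith
    have e2 : ∀ i, S.tgt i * S.rad i ≤
        (∑ k, ∑ f, σ f (i, k) * (η * (dist (pt f) (pt (i, k)) + e))) + r₀ * ∑ k, b (i, k) := by
      intro i
      have ha' : 0 ≤ r₀ * ∑ k, b (i, k) := mul_nonneg hr₀ (Finset.sum_nonneg fun _ _ => b0 _)
      by_cases hB : B i
      · rw [hB.2.2.1, ← S.sum_real_fine cm cd cU ν i (measure_ne_top _ _), mul_comm]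
        have h1 : S.rad i * ∑ k, ν.real (cell (i, k)) ≤ r₀ * ∑ k, b (i, k) :=
          mul_le_mul_of_nonneg_right hB.1 (Finset.sum_nonneg fun _ _ => b0 _)
        have h2 := Finset.sum_nonneg (s := Finset.univ)
          fun k _ => Finset.sum_nonneg (s := Finset.univ) fun f _ => hch0 f (i, k)
        linarith
      · rw [tgt_eq, if_neg hB, add_zero, Finset.sum_mul]
        have : ∑ k, (∑ f, σ f (i, k)) * S.rad i ≤
            ∑ k, ∑ f, σ f (i, k) * (η * (dist (pt f) (pt (i, k)) + e)) := by
          refine Finset.sum_le_sum fun k _ => ?_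
          rw [Finset.sum_mul]
          refine Finset.sum_le_sum fun f _ => ?_
          rcases (s0 f (i, k)).eq_or_lt with h | h
          · rw [← h]; simp
          · exact mul_le_mul_of_nonneg_left (charge_tgt f (i, k) h hB) h.le
        linarith
    have e3 : ∑ i, (S.src i + S.tgt i) * S.rad i ≤
        ∑ f : ι × κ, ∑ g : ι × κ, σ f g * (η * (dist (pt f) (pt g) + e)) + r₀ * ∑ f, a f +
        (∑ g : ι × κ, ∑ f : ι × κ, σ f g * (η * (dist (pt f) (pt g) + e)) + r₀ * ∑ f, b f) := by
      rw [Fintype.sum_prod_type, Fintype.sum_prod_type (f := a), Fintype.sum_prod_type (f := b),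
        Fintype.sum_prod_type (f := fun g => ∑ f : ι × κ, σ f g * (η * (dist (pt f) (pt g) + e))),
        Finset.mul_sum, Finset.mul_sum, ← Finset.sum_add_distrib, ← Finset.sum_add_distrib,
        ← Finset.sum_add_distrib]
      refine Finset.sum_le_sum fun i _ => ?_
      have := e1 i; have := e2 i
      rw [add_mul]
      exact add_le_add (e1 i) (e2 i)
    rw [Finset.sum_comm (f := fun g f => σ f g * (η * (dist (pt f) (pt g) + e)))] at e3
    have h1 : r₀ * ∑ f, a f ≤ r₀ * 1 := by gcongr
    have h2 : r₀ * ∑ f, b f ≤ r₀ * 1 := by gcongr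
    linarith

end CellSystem


/-! ### From moves between cells to a transport plan -/

namespace CellSystem

variable {ι : Type*} {μ ν : Measure Plane} {η r₀ : ℝ}

theorem measure_ne_zero_of_src_pos (S : CellSystem ι μ ν η r₀) {i : ι} (h : 0 < S.src i) :
    μ (S.box i) ≠ 0 := by
  obtain ⟨-, h2, -, -⟩ | ⟨p, q, h1, h2, -⟩ := S.kind i
  · intro h0; simp [h2, Measure.real, h0] at h
  · rw [(h1 _ (S.measurable i) le_rfl).1]
    rw [h2] at h
    have hv : volume (S.box i) ≠ 0 := by
      intro h0; simp [Measure.real, h0] at h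
    have hp : p ≠ 0 := by
      rintro rfl
      have : max (((0 : ℕ) : ℝ) - q) 0 = 0 := max_eq_right (by simp)
      rw [this, zero_mul] at h
      exact h.false
    exact mul_ne_zero (by exact_mod_cast hp) hv

theorem src_nonneg (S : CellSystem ι μ ν η r₀) (i : ι) : 0 ≤ S.src i := by
  obtain ⟨-, h2, -, -⟩ | ⟨p, q, h1, h2, -⟩ := S.kind i
  · rw [h2]; exact measureReal_nonneg
  · rw [h2]; exact mul_nonneg (le_max_right _ _) measureReal_nonneg

/-- For densities `p` and `q` this is the identity `max (p - q) 0 + min p q = p`; in a small cell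
everything is sent and nothing stays. The degenerate cases are cells of mass zero, for which the
conditional measure is zero. -/
theorem src_smul_cond_add [IsFiniteMeasure μ] (S : CellSystem ι μ ν η r₀) (i : ι) :
    ENNReal.ofReal (S.src i) • cond μ (S.box i) +
      ENNReal.ofReal (S.stay i) • volume.restrict (S.box i) = μ.restrict (S.box i) := by
  obtain ⟨-, h2, -, h4⟩ | ⟨p, q, h1, h2, -, h4, -⟩ := S.kind i
  · rw [h2, h4, ENNReal.ofReal_zero, zero_smul, add_zero, Measure.real,
      ENNReal.ofReal_toReal (measure_ne_top _ _), ProbabilityTheory.cond, smul_smul]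
    by_cases h0 : μ (S.box i) = 0
    · rw [Measure.restrict_zero_set h0, smul_zero]
    · rw [ENNReal.mul_inv_cancel h0 (measure_ne_top _ _), one_smul]
  · have hr : μ.restrict (S.box i) = (p : ENNReal) • volume.restrict (S.box i) := by
      ext X hX
      rw [Measure.smul_apply, Measure.restrict_apply hX, Measure.restrict_apply hX,
        (h1 _ (hX.inter (S.measurable i)) Set.inter_subset_right).1, smul_eq_mul]
    have hv := S.volume_ne_top i
    by_cases hv0 : volume (S.box i) = 0
    · rw [hr, Measure.restrict_zero_set hv0, smul_zero, smul_zero, add_zero, ProbabilityTheory.cond,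
        hr, Measure.restrict_zero_set hv0, smul_zero, smul_zero, smul_zero]
    rcases le_total p q with h | h
    · have h' : (p : ℝ) ≤ q := by exact_mod_cast h
      rw [h2, h4, max_eq_right (by linarith), zero_mul, ENNReal.ofReal_zero, zero_smul, zero_add,
        min_eq_left h', hr, ENNReal.ofReal_natCast]
    · have h' : (q : ℝ) ≤ p := by exact_mod_cast h
      rcases Nat.eq_zero_or_pos p with rfl | hp
      · have hq : q = 0 := by omega
        subst hq
        simp [h2, h4, hr]
      rw [h2, h4, max_eq_left (by linarith), min_eq_right h', ProbabilityTheory.cond, hr, smul_smul,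
        smul_smul, ← add_smul, (h1 _ (S.measurable i) le_rfl).1,
        ENNReal.ofReal_mul (by linarith), Measure.real, ENNReal.ofReal_toReal hv]
      congr 1
      have hp' : (p : ENNReal) ≠ 0 := by exact_mod_cast hp.ne'
      have e : ENNReal.ofReal ((p : ℝ) - q) * volume (S.box i) *
          (((p : ENNReal) * volume (S.box i))⁻¹ * p) = ENNReal.ofReal ((p : ℝ) - q) := by
        rw [mul_assoc, mul_comm ((p : ENNReal) * _)⁻¹, ← mul_assoc (volume _), mul_comm (volume _),
          ENNReal.mul_inv_cancel (mul_ne_zero hp' hv0) (by finiteness), mul_one]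
      rw [← mul_assoc] at e
      rw [e, ← ENNReal.ofReal_add (by linarith) (by positivity), sub_add_cancel,
        ENNReal.ofReal_natCast]

theorem sum_restrict_box [Fintype ι] (S : CellSystem ι μ ν η r₀) :
    ∑ i, μ.restrict (S.box i) = μ := by
  ext X hX
  rw [Measure.finsetSum_apply]
  simp only [Measure.restrict_apply hX]
  rw [← tsum_fintype (L := .unconditional _), ← measure_iUnion, ← Set.inter_iUnion]
  · refine le_antisymm (measure_mono Set.inter_subset_left) ?_
    rw [← Set.inter_union_compl X (⋃ i, S.box i)]
    refine (measure_union_le _ _).trans ?_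
    rw [measure_mono_null Set.inter_subset_right S.cover_left, add_zero]
    exact measure_mono (by simp)
  · exact fun i j hij => (S.disjoint hij).mono Set.inter_subset_right Set.inter_subset_right
  · exact fun i => hX.inter (S.measurable i)

/-- The transport plan that consists of moves between cells and of the mass that stays. -/
noncomputable def movesPlan [Fintype ι] (S : CellSystem ι μ ν η r₀) {M : Type*} [Fintype M]
    (fr tg : M → ι) (w : M → ℝ) : Measure (Plane × Plane) :=
  (∑ k, ENNReal.ofReal (w k) • (cond μ (S.box (fr k))).prod (cond ν (S.box (tg k)))) +
    ∑ i, ENNReal.ofReal (S.stay i) • (volume.restrict (S.box i)).map fun z => (z, z)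

variable [DecidableEq ι] {M : Type*} [Fintype M] {fr tg : M → ι} {w : M → ℝ}

theorem src_pos_of_move (S : CellSystem ι μ ν η r₀) (hw : ∀ k, 0 ≤ w k)
    (hfr : ∀ i, ∑ k with fr k = i, w k = S.src i) {k : M} (hk : w k ≠ 0) : 0 < S.src (fr k) := by
  rw [← hfr]
  exact Finset.sum_pos' (fun _ _ => hw _) ⟨k, by simp, lt_of_le_of_ne (hw k) hk.symm⟩

variable [Fintype ι]

theorem sum_moves [IsFiniteMeasure μ] (S : CellSystem ι μ ν η r₀) (hw : ∀ k, 0 ≤ w k)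
    (hfr : ∀ i, ∑ k with fr k = i, w k = S.src i) :
    (∑ k, ENNReal.ofReal (w k) • cond μ (S.box (fr k))) +
      ∑ i, ENNReal.ofReal (S.stay i) • volume.restrict (S.box i) = μ := by
  conv_rhs => rw [← S.sum_restrict_box]
  rw [← Finset.sum_fiberwise Finset.univ fr, ← Finset.sum_add_distrib]
  refine Finset.sum_congr rfl fun i _ => ?_
  rw [← S.src_smul_cond_add i, ← hfr i, ENNReal.ofReal_sum_of_nonneg fun k _ => hw k,
    Finset.sum_smul]
  congr 1
  refine Finset.sum_congr rfl fun k hk => ?_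
  rw [(Finset.mem_filter.1 hk).2]

/-- A marginal of a product is the other factor only if the factor that is integrated out is a
probability measure. This holds for each move with a nonzero amount, since then its cells have
positive mass; moves with amount zero do not contribute. -/
theorem isTransportPlan_movesPlan [IsProbabilityMeasure μ] [IsProbabilityMeasure ν]
    (S : CellSystem ι μ ν η r₀) (hw : ∀ k, 0 ≤ w k)
    (hfr : ∀ i, ∑ k with fr k = i, w k = S.src i)
    (hto : ∀ i, ∑ k with tg k = i, w k = S.tgt i) :
    IsTransportPlan μ ν (S.movesPlan fr tg w) := by
  have hmap : ∀ (f : Plane × Plane → Plane), Measurable f → (S.movesPlan fr tg w).map f =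
      (∑ k, ENNReal.ofReal (w k) •
        ((cond μ (S.box (fr k))).prod (cond ν (S.box (tg k)))).map f) +
      ∑ i, ENNReal.ofReal (S.stay i) •
        ((volume.restrict (S.box i)).map fun z => (z, z)).map f := by
    intro f hf
    have := Measure.mapₗ_apply_of_measurable hf (S.movesPlan fr tg w)
    rw [← this, movesPlan, map_add, map_sum, map_sum]
    simp_rw [map_smul, Measure.mapₗ_apply_of_measurable hf]
  have hd : Measurable fun z : Plane => (z, z) := by fun_prop
  have hpμ : ∀ k, w k ≠ 0 → IsProbabilityMeasure (cond μ (S.box (fr k))) := fun k hk =>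
    cond_isProbabilityMeasure (S.measure_ne_zero_of_src_pos (S.src_pos_of_move hw hfr hk))
  have hpν : ∀ k, w k ≠ 0 → IsProbabilityMeasure (cond ν (S.box (tg k))) := fun k hk =>
    cond_isProbabilityMeasure
      (S.swap.measure_ne_zero_of_src_pos (S.swap.src_pos_of_move hw hto hk))
  constructor
  · rw [hmap _ measurable_fst]
    conv_rhs => rw [← S.sum_moves hw hfr]
    congr 1
    · refine Finset.sum_congr rfl fun k _ => ?_
      by_cases hk : w k = 0
      · simp [hk]
      have := hpν k hk
      rw [Measure.map_fst_prod, measure_univ, one_smul]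
    · refine Finset.sum_congr rfl fun i _ => ?_
      rw [Measure.map_map measurable_fst hd]
      simp [Function.comp_def]
  · rw [hmap _ measurable_snd]
    conv_rhs => rw [← S.swap.sum_moves hw hto]
    congr 1
    · refine Finset.sum_congr rfl fun k _ => ?_
      by_cases hk : w k = 0
      · simp [hk]
      have := hpμ k hk
      have := hpν k hk
      rw [Measure.map_snd_prod, measure_univ, one_smul]
      rfl
    · refine Finset.sum_congr rfl fun i _ => ?_
      rw [Measure.map_map measurable_snd hd]
      simp only [Function.comp_def, Measure.map_id']
      rfl

/-- A move costs at most the distance of the centers plus both radii, per unit of mass. Grouping the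
radii by cells turns their contribution into `∑ i, (src i + tgt i) * rad i`, and the mass that stays
is free. -/
theorem transportCost_movesPlan_le [IsProbabilityMeasure μ] [IsProbabilityMeasure ν]
    (S : CellSystem ι μ ν η r₀) (hw : ∀ k, 0 ≤ w k)
    (hfr : ∀ i, ∑ k with fr k = i, w k = S.src i)
    (hto : ∀ i, ∑ k with tg k = i, w k = S.tgt i) :
    transportCost (S.movesPlan fr tg w) ≤ ENNReal.ofReal
      (∑ k, w k * dist (S.ctr (fr k)) (S.ctr (tg k)) +
        ∑ i, (S.src i + S.tgt i) * S.rad i) := by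
  have hd : Measurable fun z : Plane => (z, z) := by fun_prop
  have hed : Measurable fun z : Plane × Plane => edist z.1 z.2 := by fun_prop
  have e1 : ∀ k, ∫⁻ z, edist z.1 z.2 ∂(cond μ (S.box (fr k))).prod (cond ν (S.box (tg k))) ≤
      ENNReal.ofReal (dist (S.ctr (fr k)) (S.ctr (tg k)) + S.rad (fr k) + S.rad (tg k)) := by
    intro k
    have hae : ∀ᵐ z ∂(cond μ (S.box (fr k))).prod (cond ν (S.box (tg k))), edist z.1 z.2 ≤
        ENNReal.ofReal (dist (S.ctr (fr k)) (S.ctr (tg k)) + S.rad (fr k) + S.rad (tg k)) := by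
      have h1 : ∀ᵐ x ∂cond μ (S.box (fr k)), x ∈ S.box (fr k) := by
        refine Measure.ae_smul_measure ?_ _
        exact ae_restrict_mem (S.measurable _)
      have h2 : ∀ᵐ x ∂cond ν (S.box (tg k)), x ∈ S.box (tg k) := by
        refine Measure.ae_smul_measure ?_ _
        exact ae_restrict_mem (S.measurable _)
      filter_upwards [Measure.quasiMeasurePreserving_fst.ae h1,
        Measure.quasiMeasurePreserving_snd.ae h2] with z hz1 hz2
      rw [edist_dist]
      apply ENNReal.ofReal_le_ofReal
      have h3 := S.dist_ctr _ _ hz1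
      have h4 := S.dist_ctr _ _ hz2
      have h5 := dist_triangle4 z.1 (S.ctr (fr k)) (S.ctr (tg k)) z.2
      rw [dist_comm] at h4
      linarith
    refine (lintegral_mono_ae hae).trans ?_
    rw [lintegral_const, ← Set.univ_prod_univ, Measure.prod_prod]
    calc _ ≤ ENNReal.ofReal
            (dist (S.ctr (fr k)) (S.ctr (tg k)) + S.rad (fr k) + S.rad (tg k)) * (1 * 1) := by
          gcongr
          · exact prob_le_one
          · exact prob_le_one
      _ = _ := by simp
  have e2 : ∀ i, ∫⁻ z, edist z.1 z.2 ∂((volume.restrict (S.box i)).map fun z => (z, z)) = 0 := by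
    intro i
    rw [lintegral_map hed hd]
    simp
  have hk0 : ∀ k, 0 ≤ w k *
      (dist (S.ctr (fr k)) (S.ctr (tg k)) + S.rad (fr k) + S.rad (tg k)) := fun k => by
    have := hw k; have := S.rad_nonneg (fr k); have := S.rad_nonneg (tg k); positivity
  rw [transportCost, movesPlan, lintegral_add_measure, lintegral_finsetSum_measure,
    lintegral_finsetSum_measure]
  have e0 : ∑ i, ∫⁻ z, edist z.1 z.2 ∂(ENNReal.ofReal (S.stay i) •
      (volume.restrict (S.box i)).map fun z => (z, z)) = 0 :=
    Finset.sum_eq_zero fun i _ => by rw [lintegral_smul_measure, e2 i, smul_zero]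
  rw [e0, add_zero]
  simp only [lintegral_smul_measure, smul_eq_mul]
  have e3 : ∑ k, w k * (dist (S.ctr (fr k)) (S.ctr (tg k)) + S.rad (fr k) + S.rad (tg k)) =
      ∑ k, w k * dist (S.ctr (fr k)) (S.ctr (tg k)) + ∑ i, (S.src i + S.tgt i) * S.rad i := by
    have h1 : ∑ i, S.src i * S.rad i = ∑ k, w k * S.rad (fr k) := by
      rw [← Finset.sum_fiberwise Finset.univ fr]
      refine Finset.sum_congr rfl fun i _ => ?_
      rw [← hfr, Finset.sum_mul]
      exact Finset.sum_congr rfl fun k hk => by rw [(Finset.mem_filter.1 hk).2]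
    have h2 : ∑ i, S.tgt i * S.rad i = ∑ k, w k * S.rad (tg k) := by
      rw [← Finset.sum_fiberwise Finset.univ tg]
      refine Finset.sum_congr rfl fun i _ => ?_
      rw [← hto, Finset.sum_mul]
      exact Finset.sum_congr rfl fun k hk => by rw [(Finset.mem_filter.1 hk).2]
    simp only [add_mul, Finset.sum_add_distrib, h1, h2, mul_add]
    ring
  rw [← e3, ENNReal.ofReal_sum_of_nonneg fun k _ => hk0 k]
  refine Finset.sum_le_sum fun k _ => ?_
  rw [ENNReal.ofReal_mul (hw k)]
  gcongr
  exact e1 k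

end CellSystem


/-! ### The solver applied to the weights of a cell system -/

theorem List.sum_fin_get {α β : Type*} [AddCommMonoid β] (l : List α) (g : α → β) :
    ∑ k : Fin l.length, g (l.get k) = (l.map g).sum := by
  rw [← List.sum_ofFn]
  congr 1
  exact List.ext_getElem (by simp) (by simp)

theorem List.Nodup.sum_map_eq {α β : Type*} [Fintype α] [DecidableEq α] [AddCommMonoid β]
    {l : List α} (hl : l.Nodup) (g : α → β) (hg : ∀ a, a ∉ l → g a = 0) :
    (l.map g).sum = ∑ a, g a := by
  rw [← List.sum_toFinset g hl]
  exact Finset.sum_subset (Finset.subset_univ _) fun a _ ha => hg a (by simpa using ha)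

theorem SparsePlan.matrix_eq (L : SparsePlan) (i j : ℕ) :
    L.matrix i j = ∑ k : Fin L.length,
      if (L.get k).1 = i ∧ (L.get k).2.1 = j then (L.get k).2.2 else 0 :=
  (List.sum_fin_get L _).symm

theorem SparsePlan.sum_matrix_right (L : SparsePlan) {n : ℕ} (hn : ∀ e ∈ L, e.2.1 < n) (i : ℕ)
    (g : ℕ → ℝ) : ∑ j : Fin n, L.matrix i j * g j =
      ∑ k : Fin L.length, if (L.get k).1 = i then (L.get k).2.2 * g (L.get k).2.1 else 0 := by
  simp only [L.matrix_eq, Finset.sum_mul]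
  rw [Finset.sum_comm]
  refine Finset.sum_congr rfl fun k _ => ?_
  rw [Finset.sum_eq_single (⟨(L.get k).2.1, hn _ (L.get_mem k)⟩ : Fin n)]
  · simp [ite_mul]
  · intro j _ hj
    rw [if_neg, zero_mul]
    rintro ⟨-, h⟩
    exact hj (Fin.ext h.symm)
  · simp

theorem SparsePlan.sum_matrix_left (L : SparsePlan) {n : ℕ} (hn : ∀ e ∈ L, e.1 < n) (j : ℕ) :
    ∑ i : Fin n, L.matrix i j =
      ∑ k : Fin L.length, if (L.get k).2.1 = j then (L.get k).2.2 else 0 := by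
  simp only [L.matrix_eq]
  rw [Finset.sum_comm]
  refine Finset.sum_congr rfl fun k _ => ?_
  rw [Finset.sum_eq_single (⟨(L.get k).1, hn _ (L.get_mem k)⟩ : Fin n)]
  · simp
  · intro j _ hj
    rw [if_neg]
    rintro ⟨h, -⟩
    exact hj (Fin.ext h.symm)
  · simp

namespace CellSystem

variable {ι : Type*} [Fintype ι] [DecidableEq ι] {μ ν : Measure Plane} {η r₀ : ℝ}

omit [DecidableEq ι] in
theorem sum_measureReal_box [IsProbabilityMeasure μ] (S : CellSystem ι μ ν η r₀) :
    ∑ i, μ.real (S.box i) = 1 := by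
  have h := S.sum_restrict_box
  have h2 := congrArg (fun ρ : Measure Plane => (ρ Set.univ).toReal) h
  simp only [Measure.finsetSum_apply, Measure.restrict_apply_univ, measure_univ] at h2
  rw [ENNReal.toReal_sum fun _ _ => measure_ne_top _ _] at h2
  simpa [Measure.real] using h2

omit [Fintype ι] [DecidableEq ι] in
theorem src_add_stay (S : CellSystem ι μ ν η r₀) (i : ι) :
    S.src i + S.stay i * volume.real (S.box i) = μ.real (S.box i) := by
  obtain ⟨-, h2, -, h4⟩ | ⟨p, q, h1, h2, -, h4, -⟩ := S.kind i
  · rw [h2, h4]; ring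
  · rw [h2, h4, measureReal_eq_natCast_mul (h1 _ (S.measurable i) le_rfl).1, ← add_mul]
    congr 1
    rcases le_total (p : ℝ) q with h | h
    · rw [min_eq_left h, max_eq_right (by linarith)]; ring
    · rw [min_eq_right h, max_eq_left (by linarith)]; ring

omit [DecidableEq ι] in
-- Both masses are one and the same amount stays on both sides, so what is sent equals what is
-- received. The solver requires this balance.
theorem sum_src_eq_sum_tgt [IsProbabilityMeasure μ] [IsProbabilityMeasure ν]
    (S : CellSystem ι μ ν η r₀) : ∑ i, S.src i = ∑ i, S.tgt i := by
  have h1 := S.sum_measureReal_box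
  have h2 := S.swap.sum_measureReal_box
  simp only [← src_add_stay, Finset.sum_add_distrib] at h1 h2
  have e : ∑ i, S.swap.stay i * volume.real (S.swap.box i) =
    ∑ i, S.stay i * volume.real (S.box i) := rfl
  have e' : ∑ i, S.swap.src i = ∑ i, S.tgt i := rfl
  rw [e, e'] at h2
  linarith

/-- The moves that the solver returns for the positive amounts of a cell system. -/
theorem exists_moves [IsProbabilityMeasure μ] [IsProbabilityMeasure ν]
    (S : CellSystem ι μ ν η r₀) {solver : PointSolver} {δ : ℝ} {f : ℕ → ℝ}
    (hA : solver.Approximates δ f) {iu iv : List ι} (hu : iu.Nodup) (hv : iv.Nodup)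
    (mu : ∀ i, i ∈ iu ↔ 0 < S.src i) (mv : ∀ i, i ∈ iv ↔ 0 < S.tgt i) (hne : iu ≠ [])
    {U V : WeightedPoints} (hU : U = iu.map fun i => (S.ctr i, S.src i))
    (hV : V = iv.map fun i => (S.ctr i, S.tgt i)) {L : SparsePlan} (hL : L = solver.plan U V) :
    L.length ≤ solver.time U V ∧ (solver.time U V : ℝ) ≤ f (iu.length + iv.length) ∧
    ∃ fr tg : Fin L.length → ι, (∀ k, iu[(L.get k).1]? = some (fr k)) ∧
      (∀ k, iv[(L.get k).2.1]? = some (tg k)) ∧ (∀ k, 0 ≤ (L.get k).2.2) ∧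
      (∀ i, ∑ k with fr k = i, (L.get k).2.2 = S.src i) ∧
      (∀ i, ∑ k with tg k = i, (L.get k).2.2 = S.tgt i) ∧
      ∀ σ : ι → ι → ℝ, (∀ i j, 0 ≤ σ i j) → (∀ i, ∑ j, σ i j = S.src i) →
        (∀ j, ∑ i, σ i j = S.tgt j) →
        ∑ k, (L.get k).2.2 * dist (S.ctr (fr k)) (S.ctr (tg k)) ≤
          (1 + δ) * ∑ i, ∑ j, σ i j * dist (S.ctr i) (S.ctr j) := by
  have src0 := S.src_nonneg
  have tgt0 := S.swap.src_nonneg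
  have hu0 : ∀ i, i ∉ iu → S.src i = 0 := fun i hi =>
    le_antisymm (not_lt.1 fun h => hi ((mu i).2 h)) (src0 i)
  have hv0 : ∀ i, i ∉ iv → S.tgt i = 0 := fun i hi =>
    le_antisymm (not_lt.1 fun h => hi ((mv i).2 h)) (tgt0 i)
  have sumU : (iu.map S.src).sum = ∑ i, S.src i := hu.sum_map_eq _ hu0
  have sumV : (iv.map S.tgt).sum = ∑ i, S.tgt i := hv.sum_map_eq _ hv0
  -- There is something to send, and the totals agree, so there is something to receive.
  have hneV : iv ≠ [] := by
    rintro rfl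
    simp only [List.map_nil, List.sum_nil] at sumV
    obtain ⟨i, hi⟩ := List.exists_mem_of_ne_nil _ hne
    have h1 : 0 < ∑ i, S.src i :=
      Finset.sum_pos' (fun _ _ => src0 _) ⟨i, Finset.mem_univ _, (mu i).1 hi⟩
    rw [S.sum_src_eq_sum_tgt, ← sumV] at h1
    exact h1.false
  have lenU : U.length = iu.length := by simp [hU]
  have lenV : V.length = iv.length := by simp [hV]
  obtain ⟨h1, h2, h3, h4, h5⟩ := hA U V (by simpa [hU] using hne) (by simpa [hV] using hneV)
    (by rw [hU]; intro p hp; obtain ⟨i, hi, rfl⟩ := List.mem_map.1 hp; exact (mu i).1 hi)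
    (by rw [hV]; intro p hp; obtain ⟨i, hi, rfl⟩ := List.mem_map.1 hp; exact (mv i).1 hi)
    (by
      have e1 : (U.map Prod.snd).sum = (iu.map S.src).sum := by
        rw [hU, List.map_map]; rfl
      have e2 : (V.map Prod.snd).sum = (iv.map S.tgt).sum := by
        rw [hV, List.map_map]; rfl
      rw [e1, e2, sumU, sumV, S.sum_src_eq_sum_tgt])
  rw [← hL] at h1 h2 h3 h4
  refine ⟨h4, by rw [← lenU, ← lenV]; exact h5, ?_⟩
  have b1 : ∀ k : Fin L.length, (L.get k).1 < iu.length := fun k =>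
    lenU ▸ (h1 _ (L.get_mem k)).1
  have b2 : ∀ k : Fin L.length, (L.get k).2.1 < iv.length := fun k =>
    lenV ▸ (h1 _ (L.get_mem k)).2.1
  have Uget : ∀ i : Fin U.length, U.get i =
      (S.ctr (iu[i.val]'(lenU ▸ i.2)), S.src (iu[i.val]'(lenU ▸ i.2))) := by
    intro i; subst hU; simp
  have Vget : ∀ i : Fin V.length, V.get i =
      (S.ctr (iv[i.val]'(lenV ▸ i.2)), S.tgt (iv[i.val]'(lenV ▸ i.2))) := by
    intro i; subst hV; simp
  have w0 : ∀ k : Fin L.length, 0 ≤ (L.get k).2.2 := fun k => (h1 _ (L.get_mem k)).2.2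
  refine ⟨fun k => iu[(L.get k).1]'(b1 k), fun k => iv[(L.get k).2.1]'(b2 k),
    fun k => List.getElem?_eq_getElem (b1 k), fun k => List.getElem?_eq_getElem (b2 k), w0,
    ?_, ?_, ?_⟩
  · intro i
    rw [Finset.sum_filter]
    by_cases hi : i ∈ iu
    · obtain ⟨a, ha, rfl⟩ := List.getElem_of_mem hi
      have := h2.2.1 ⟨a, lenU ▸ ha⟩
      rw [Uget] at this
      simp only at this
      rw [← this]
      have := L.sum_matrix_right (n := V.length) (fun e he => (h1 e he).2.1) a (fun _ => 1)
      simp only [mul_one] at this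
      rw [this]
      refine Finset.sum_congr rfl fun k _ => ?_
      simp only [hu.getElem_inj_iff]
    · rw [hu0 i hi]
      refine Finset.sum_eq_zero fun k _ => if_neg ?_
      rintro rfl
      exact hi (List.getElem_mem _)
  · intro i
    rw [Finset.sum_filter]
    by_cases hi : i ∈ iv
    · obtain ⟨a, ha, rfl⟩ := List.getElem_of_mem hi
      have := h2.2.2 ⟨a, lenV ▸ ha⟩
      rw [Vget] at this
      simp only at this
      rw [← this, L.sum_matrix_left (n := U.length) (fun e he => (h1 e he).1) a]
      refine Finset.sum_congr rfl fun k _ => ?_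
      simp only [hv.getElem_inj_iff]
    · rw [hv0 i hi]
      refine Finset.sum_eq_zero fun k _ => if_neg ?_
      rintro rfl
      exact hi (List.getElem_mem _)
  · intro σ s0 srow scol
    have sz1 : ∀ i j, i ∉ iu → σ i j = 0 := fun i j hi =>
      (Finset.sum_eq_zero_iff_of_nonneg fun j _ => s0 i j).1 ((srow i).trans (hu0 i hi)) j
        (Finset.mem_univ _)
    have sz2 : ∀ i j, j ∉ iv → σ i j = 0 := fun i j hj =>
      (Finset.sum_eq_zero_iff_of_nonneg fun i _ => s0 i j).1 ((scol j).trans (hv0 j hj)) i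
        (Finset.mem_univ _)
    -- A competing plan `σ` between all cells lives on the two lists only, because its rows and
    -- columns of sum zero vanish; hence it can be compared with the output of the solver.
    let τ : ℕ → ℕ → ℝ := fun a b =>
      if h : a < iu.length ∧ b < iv.length then σ (iu[a]'h.1) (iv[b]'h.2) else 0
    have sumUn : ∀ g : ι → ℝ, (∀ i, i ∉ iu → g i = 0) →
        ∑ a : Fin U.length, g (iu[a.val]'(lenU ▸ a.2)) = ∑ i, g i := by
      intro g hg
      rw [← hu.sum_map_eq g hg, ← List.sum_fin_get]
      exact Fintype.sum_equiv (finCongr lenU) _ _ fun a => by simp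
    have sumVn : ∀ g : ι → ℝ, (∀ i, i ∉ iv → g i = 0) →
        ∑ a : Fin V.length, g (iv[a.val]'(lenV ▸ a.2)) = ∑ i, g i := by
      intro g hg
      rw [← hv.sum_map_eq g hg, ← List.sum_fin_get]
      exact Fintype.sum_equiv (finCongr lenV) _ _ fun a => by simp
    have τeq : ∀ (a : Fin U.length) (b : Fin V.length), τ a b =
        σ (iu[a.val]'(lenU ▸ a.2)) (iv[b.val]'(lenV ▸ b.2)) := by
      intro a b
      simp only [τ]
      rw [dif_pos ⟨lenU ▸ a.2, lenV ▸ b.2⟩]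
    have hτ : IsPointPlan U V τ := by
      refine ⟨fun a _ b _ => ?_, fun a => ?_, fun b => ?_⟩
      · simp only [τ]; split_ifs
        · exact s0 _ _
        · rfl
      · rw [Uget]
        simp only [τeq]
        rw [sumVn (fun j => σ _ j) fun j hj => sz2 _ _ hj, srow]
      · rw [Vget]
        simp only [τeq]
        rw [sumUn (fun i => σ i _) fun j hj => sz1 _ _ hj, scol]
    have h6 := h3 τ hτ
    have e1 : pointPlanCost U V τ = ∑ i, ∑ j, σ i j * dist (S.ctr i) (S.ctr j) := by
      rw [pointPlanCost]
      simp only [τeq, Uget, Vget]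
      rw [sumUn (fun i => ∑ b : Fin V.length, σ i (iv[b.val]'(lenV ▸ b.2)) *
        dist (S.ctr i) (S.ctr (iv[b.val]'(lenV ▸ b.2))))
        fun i hi => Finset.sum_eq_zero fun b _ => by rw [sz1 _ _ hi, zero_mul]]
      refine Finset.sum_congr rfl fun i _ => ?_
      exact sumVn (fun j => σ i j * dist (S.ctr i) (S.ctr j)) fun j hj => by
        rw [sz2 _ _ hj, zero_mul]
    rw [e1] at h6
    refine le_trans (le_of_eq ?_) h6
    rw [pointPlanCost]
    have e2 : ∀ a : Fin U.length, ∑ b : Fin V.length,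
        L.matrix a b * dist (U.get a).1 (V.get b).1 = ∑ k : Fin L.length,
          if (L.get k).1 = a then (L.get k).2.2 *
            dist (U.get a).1 (S.ctr (iv[(L.get k).2.1]'(b2 k))) else 0 := by
      intro a
      have := L.sum_matrix_right (n := V.length) (fun e he => (h1 e he).2.1) a
        (fun b => if h : b < iv.length then dist (U.get a).1 (S.ctr (iv[b]'h)) else 0)
      refine Eq.trans ?_ (this.trans ?_)
      · refine Finset.sum_congr rfl fun b _ => ?_
        rw [dif_pos (lenV ▸ b.2), Vget]
      · refine Finset.sum_congr rfl fun k _ => ?_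
        rw [dif_pos (b2 k)]
    simp only [e2]
    rw [Finset.sum_comm]
    refine Finset.sum_congr rfl fun k _ => ?_
    rw [Finset.sum_eq_single (⟨(L.get k).1, lenU.symm ▸ b1 k⟩ : Fin U.length)]
    · rw [if_pos rfl, Uget]
    · intro a _ ha
      rw [if_neg]
      intro h
      exact ha (Fin.ext h.symm)
    · simp

/-- The cost of the plan that is built from an approximately optimal family of moves. -/
theorem transportCost_movesPlan_le_emd [IsProbabilityMeasure μ] [IsProbabilityMeasure ν] {δ : ℝ}
    (hδ : 0 < δ) (hη : η = δ / (1 + δ)) (hr₀ : 0 ≤ r₀) (S : CellSystem ι μ ν η r₀)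
    {M : Type*} [Fintype M] {fr tg : M → ι} {w : M → ℝ} (hw : ∀ k, 0 ≤ w k)
    (hfr : ∀ i, ∑ k with fr k = i, w k = S.src i)
    (hto : ∀ i, ∑ k with tg k = i, w k = S.tgt i)
    (hopt : ∀ σ : ι → ι → ℝ, (∀ i j, 0 ≤ σ i j) → (∀ i, ∑ j, σ i j = S.src i) →
        (∀ j, ∑ i, σ i j = S.tgt j) →
        ∑ k, w k * dist (S.ctr (fr k)) (S.ctr (tg k)) ≤
          (1 + δ) * ∑ i, ∑ j, σ i j * dist (S.ctr i) (S.ctr j)) :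
    transportCost (S.movesPlan fr tg w) ≤
      ENNReal.ofReal (1 + 5 * δ) * emd μ ν + ENNReal.ofReal (4 * (1 + δ) * r₀) := by
  by_cases htop : emd μ ν = ⊤
  · rw [htop, ENNReal.mul_top (by simp; positivity), top_add]; exact le_top
  refine (S.transportCost_movesPlan_le hw hfr hto).trans ?_
  rw [← ENNReal.ofReal_toReal htop, ← ENNReal.ofReal_mul (by positivity),
    ← ENNReal.ofReal_add (by positivity) (by positivity)]
  apply ENNReal.ofReal_le_ofReal
  refine le_of_forall_pos_le_add fun ε hε => ?_
  -- The infimum in `emd` need not be attained. One `e` is spent on a nearly optimal plan, the other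
  -- one on the discretization.
  set e := ε / (2 * (1 + 5 * δ)) with he
  have he0 : 0 < e := by positivity
  obtain ⟨π, hπ, hlt⟩ : ∃ π, IsTransportPlan μ ν π ∧
      transportCost π < emd μ ν + ENNReal.ofReal e := by
    have : emd μ ν < emd μ ν + ENNReal.ofReal e :=
      ENNReal.lt_add_right htop (by simpa using he0)
    rw [emd] at this
    simp only [iInf_lt_iff] at this
    obtain ⟨π, h1, h2⟩ := this
    exact ⟨π, h1, h2⟩
  have hc : transportCost π ≠ ⊤ := (hlt.trans_le le_top).ne
  have hlt' : (transportCost π).toReal ≤ (emd μ ν).toReal + e := by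
    have := ENNReal.toReal_mono (by finiteness) hlt.le
    rwa [ENNReal.toReal_add htop (by finiteness), ENNReal.toReal_ofReal he0.le] at this
  have hη0 : 0 ≤ η := by rw [hη]; positivity
  obtain ⟨σ, s0, s1, s2, s3, s4⟩ := S.exists_plan hη0 hr₀ hπ hc he0
  have h5 := hopt σ s0 s1 s2
  have h6 : (1 + δ) * ∑ i, ∑ j, σ i j * dist (S.ctr i) (S.ctr j) ≤
    (1 + δ) * ((1 + 2 * η) * ((transportCost π).toReal + e) + 2 * r₀) := by gcongr
  have hηδ : (1 + δ) * η = δ := by rw [hη]; field_simp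
  have hη1 : η ≤ δ := by
    rw [hη, div_le_iff₀ (by positivity)]; nlinarith
  set C := (transportCost π).toReal with hC
  have hC0 : 0 ≤ C := ENNReal.toReal_nonneg
  -- Since `(1 + δ) * η = δ`, the solver's factor gives `(1 + δ) * (1 + 2 * η) = 1 + 3 * δ`; the
  -- radii add `2 * η ≤ 2 * δ`, in total `1 + 5 * δ`. In the same way `2 * (1 + δ) + 2 ≤ 4 * (1 +
  -- δ)` copies of `r₀` arise.
  have h7 : (1 + δ) * ((1 + 2 * η) * (C + e) + 2 * r₀) + (2 * η * (C + e) + 2 * r₀) ≤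
      (1 + 5 * δ) * (C + e) + 4 * (1 + δ) * r₀ := by
    have : (1 + δ) * ((1 + 2 * η) * (C + e) + 2 * r₀) =
      (1 + δ + 2 * δ) * (C + e) + 2 * (1 + δ) * r₀ := by linear_combination 2 * (C + e) * hηδ
    rw [this]
    have := mul_le_mul_of_nonneg_right hη1 (by positivity : 0 ≤ C + e)
    nlinarith [mul_nonneg hδ.le hr₀]
  have h8 : (1 + 5 * δ) * (C + e) ≤ (1 + 5 * δ) * ((emd μ ν).toReal + e + e) := by gcongr
  have h9 : (1 + 5 * δ) * (2 * e) = ε := by rw [he]; field_simp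
  linarith

end CellSystem


/-! ### Coordinates in the plane -/

theorem Plane.dist_eq (x y : Plane) :
    dist x y = √((x 0 - y 0) * (x 0 - y 0) + (x 1 - y 1) * (x 1 - y 1)) := by
  rw [EuclideanSpace.dist_eq, Fin.sum_univ_two]
  simp only [Real.dist_eq, sq_abs]
  simp only [pow_two]

theorem Plane.dist_sq (x y : Plane) :
    dist x y ^ 2 = (x 0 - y 0) ^ 2 + (x 1 - y 1) ^ 2 := by
  rw [Plane.dist_eq, Real.sq_sqrt (add_nonneg (mul_self_nonneg _) (mul_self_nonneg _))]; ring

theorem Plane.abs_sub_le_dist (x y : Plane) (k : Fin 2) : |x k - y k| ≤ dist x y := by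
  apply abs_le_of_sq_le_sq _ dist_nonneg
  rw [Plane.dist_sq]
  fin_cases k <;> simp <;> exact sq_nonneg _

theorem Plane.dist_le_of {x y : Plane} {r : ℝ} (hr : 0 ≤ r)
    (h : (x 0 - y 0) ^ 2 + (x 1 - y 1) ^ 2 ≤ r ^ 2) : dist x y ≤ r := by
  rw [← Plane.dist_sq] at h
  exact (sq_le_sq₀ dist_nonneg hr).1 h

theorem Plane.volume_preserving :
    MeasurePreserving (fun p : ℝ × ℝ => (!₂[p.1, p.2] : Plane)) volume volume := by
  have h1 := (MeasureTheory.volume_preserving_finTwoArrow ℝ).symm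
  have h2 := (EuclideanSpace.volume_preserving_symm_measurableEquiv_toLp (Fin 2)).symm
  have := h2.comp h1
  exact this

theorem Plane.volume_eq_lintegral {A : Set Plane} (hA : MeasurableSet A) :
    volume A = ∫⁻ x : ℝ, volume {y : ℝ | (!₂[x, y] : Plane) ∈ A} := by
  rw [← Plane.volume_preserving.measure_preimage hA.nullMeasurableSet, Measure.volume_eq_prod,
    Measure.prod_apply (Plane.volume_preserving.measurable hA)]
  rfl

theorem Plane.volume_eq_lintegral_symm {A : Set Plane} (hA : MeasurableSet A) :
    volume A = ∫⁻ y : ℝ, volume {x : ℝ | (!₂[x, y] : Plane) ∈ A} := by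
  rw [← Plane.volume_preserving.measure_preimage hA.nullMeasurableSet, Measure.volume_eq_prod,
    Measure.prod_apply_symm (Plane.volume_preserving.measurable hA)]
  rfl

/-! ### Orientation -/

/-- Twice the signed area of the triangle `a b z`. -/
def cross (a b z : Plane) : ℝ := (b 0 - a 0) * (z 1 - a 1) - (b 1 - a 1) * (z 0 - a 0)

theorem continuous_cross (a b : Plane) : Continuous (cross a b) := by
  unfold cross; fun_prop

theorem cross_sub_cross (a b x y : Plane) :
    cross a b x - cross a b y = (b 0 - a 0) * (x 1 - y 1) - (b 1 - a 1) * (x 0 - y 0) := by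
  unfold cross; ring

/-- This is the Cauchy–Schwarz inequality; the hint is the square in Lagrange's identity. It says
that `cross a b z / dist a b`, the signed distance from the line, is Lipschitz with constant one. -/
theorem abs_cross_sub_le (a b x y : Plane) :
    |cross a b x - cross a b y| ≤ dist a b * dist x y := by
  apply abs_le_of_sq_le_sq _ (by positivity)
  rw [mul_pow, Plane.dist_sq, Plane.dist_sq, cross_sub_cross]
  nlinarith [sq_nonneg ((b 0 - a 0) * (x 0 - y 0) + (b 1 - a 1) * (x 1 - y 1))]

theorem cross_add_smul (a b x y : Plane) {s t : ℝ} (h : s + t = 1) :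
    cross a b (s • x + t • y) = s * cross a b x + t * cross a b y := by
  have hs : s = 1 - t := by linarith
  subst hs
  simp only [cross, PiLp.add_apply, PiLp.smul_apply, smul_eq_mul]
  ring

theorem convex_mul_cross_nonneg (D : ℝ) (a b : Plane) : Convex ℝ {z | 0 ≤ D * cross a b z} := by
  intro x hx y hy s t hs ht hst
  simp only [Set.mem_ofPred_eq] at *
  rw [cross_add_smul _ _ _ _ hst]
  nlinarith [mul_nonneg hs hx, mul_nonneg ht hy]

/-- Twice the signed area of a triangle. -/
def triDet (T : Fin 3 → Plane) : ℝ := cross (T 0) (T 1) (T 2)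

theorem vertex_mem (T : Fin 3 → Plane) (k : Fin 3) : T k ∈ solidTriangle T :=
  subset_convexHull ℝ _ ⟨k, rfl⟩

/-- The factor `triDet T` makes the three half-plane conditions independent of the orientation.
Conversely, the quotients of `cross` by `triDet T` are the barycentric coordinates of `z`. -/
theorem mem_solidTriangle {T : Fin 3 → Plane} (hD : triDet T ≠ 0) (z : Plane) :
    z ∈ solidTriangle T ↔ ∀ k : Fin 3, 0 ≤ triDet T * cross (T k) (T (k + 1)) z := by
  constructor
  · intro hz k
    refine convexHull_min (s := Set.range T) ?_ (convex_mul_cross_nonneg (triDet T) (T k) (T (k + 1))) hz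
    rintro _ ⟨j, rfl⟩
    have e1 : cross (T 1) (T 2) (T 0) = triDet T := by unfold triDet cross; ring
    have e2 : cross (T 2) (T 0) (T 1) = triDet T := by unfold triDet cross; ring
    have e3 : cross (T 0) (T 1) (T 2) = triDet T := rfl
    have e4 : ∀ a b, cross a b a = 0 := fun a b => by unfold cross; ring
    have e5 : ∀ a b, cross a b b = 0 := fun a b => by unfold cross; ring
    simp only [Set.mem_ofPred_eq]
    fin_cases k <;> fin_cases j <;> simp [e1, e2, e3, e4, e5, mul_self_nonneg]
  · intro h
    have hz : z = ∑ k : Fin 3, (cross (T (k + 1)) (T (k + 2)) z / triDet T) • T k := by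
      rw [Fin.sum_univ_three]
      ext j
      simp only [PiLp.add_apply, PiLp.smul_apply, smul_eq_mul]
      field_simp
      simp only [triDet, cross]
      fin_cases j <;> simp <;> ring
    rw [hz]
    refine (convex_convexHull ℝ _).sum_mem (fun k _ => ?_) ?_ fun k _ => vertex_mem T k
    · have := h (k + 1)
      rw [add_assoc] at this
      have h2 : (1 + 1 : Fin 3) = 2 := rfl
      rw [h2] at this
      -- The coefficient is written as the product of `triDet T * cross`, which is nonnegative, and
      -- the square of `(triDet T)⁻¹`; so the sign of the determinant plays no role.
      rw [div_eq_mul_inv, ← mul_self_mul_inv (triDet T)⁻¹]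
      rw [inv_inv]
      have h3 : cross (T (k + 1)) (T (k + 2)) z * ((triDet T)⁻¹ * (triDet T)⁻¹ * triDet T) =
        (triDet T * cross (T (k + 1)) (T (k + 2)) z) * ((triDet T)⁻¹ * (triDet T)⁻¹) := by ring
      rw [h3]
      exact mul_nonneg this (mul_self_nonneg _)
    · rw [Fin.sum_univ_three]
      field_simp
      simp only [triDet, cross]
      simp
      ring

theorem measurableSet_solidTriangle (T : Fin 3 → Plane) : MeasurableSet (solidTriangle T) :=
  ((Set.finite_range T).isCompact_convexHull (𝕜 := ℝ)).measurableSet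

theorem dist_le_of_mem_solidTriangle {T : Fin 3 → Plane} {W : ℝ}
    (hW : ∀ a b, dist (T a) (T b) ≤ W) {x y : Plane} (hx : x ∈ solidTriangle T)
    (hy : y ∈ solidTriangle T) : dist x y ≤ W := by
  have h1 : ∀ a, dist x (T a) ≤ W := by
    intro a
    have := convexHull_min (s := Set.range T) (t := Metric.closedBall (T a) W)
      (by rintro _ ⟨b, rfl⟩; exact hW b a) (convex_closedBall _ _) hx
    exact this
  have := convexHull_min (s := Set.range T) (t := Metric.closedBall x W)
      (by rintro _ ⟨b, rfl⟩; rw [Metric.mem_closedBall, dist_comm]; exact h1 b)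
      (convex_closedBall _ _) hy
  rwa [Metric.mem_closedBall, dist_comm] at this

/-! ### The area of a strip -/

/-- The strip is sliced parallel to a coordinate axis, chosen such that the coefficient `u` of the
free coordinate in `cross` satisfies `dist a b ≤ 2 * |u|`. Each slice then has length at most `4 *
r`, and the slices that meet the disk of radius `M` have a range of length `2 * M`. -/
theorem volume_strip_le (a b : Plane) (hab : a ≠ b) {r M : ℝ} (hr : 0 ≤ r) :
    volume {z : Plane | dist z a ≤ M ∧ |cross a b z| ≤ r * dist a b} ≤ ENNReal.ofReal (8 * r * M) := by
  have hd : 0 < dist a b := dist_pos.2 hab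
  have hm : MeasurableSet {z : Plane | dist z a ≤ M ∧ |cross a b z| ≤ r * dist a b} := by
    refine IsClosed.measurableSet ?_
    have h1 : IsClosed {z : Plane | dist z a ≤ M} := isClosed_le (by fun_prop) continuous_const
    exact h1.inter (isClosed_le (continuous_cross a b).abs continuous_const)
  have hdle : dist a b ≤ |b 0 - a 0| + |b 1 - a 1| := by
    apply Plane.dist_le_of (by positivity)
    have h0 := abs_nonneg (b 0 - a 0); have h1 := abs_nonneg (b 1 - a 1)
    have h2 := sq_abs (b 0 - a 0); have h3 := sq_abs (b 1 - a 1)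
    nlinarith [mul_nonneg h0 h1]
  -- a set of reals with `|u * y - c| ≤ r * d`
  have slice : ∀ u c : ℝ, dist a b ≤ 2 * |u| →
      volume {y : ℝ | |u * y - c| ≤ r * dist a b} ≤ ENNReal.ofReal (4 * r) := by
    intro u c hu
    have hu0 : 0 < |u| := by linarith
    have hu1 : u ≠ 0 := abs_pos.1 hu0
    refine (measure_mono (t := Set.Icc (c / u - 2 * r) (c / u + 2 * r)) ?_).trans ?_
    · intro y hy
      simp only [Set.mem_ofPred_eq] at hy
      have e : u * y - c = u * (y - c / u) := by field_simp
      rw [e, abs_mul] at hy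
      have : |u| * |y - c / u| ≤ |u| * (2 * r) := by nlinarith
      have := abs_le.1 (le_of_mul_le_mul_left this hu0)
      constructor <;> linarith [this.1, this.2]
    · rw [Real.volume_Icc]
      apply ENNReal.ofReal_le_ofReal
      linarith
  have total : ∀ (c : ℝ) (F : ℝ → ENNReal),
      (∀ x, F x ≤ (Set.Icc (c - M) (c + M)).indicator (fun _ => ENNReal.ofReal (4 * r)) x) →
      ∫⁻ x, F x ≤ ENNReal.ofReal (8 * r * M) := by
    intro c F hF
    refine (lintegral_mono hF).trans ?_
    rw [lintegral_indicator measurableSet_Icc, setLIntegral_const, Real.volume_Icc,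
      ← ENNReal.ofReal_mul (by positivity)]
    apply ENNReal.ofReal_le_ofReal
    nlinarith
  have sec : ∀ (k : Fin 2) (u : ℝ) (c : ℝ → ℝ) (z : ℝ → ℝ → Plane), dist a b ≤ 2 * |u| →
      (∀ x y, z x y k = x) → (∀ x y, |cross a b (z x y)| = |u * y - c x|) →
      ∫⁻ x, volume {y | z x y ∈ {z : Plane | dist z a ≤ M ∧ |cross a b z| ≤ r * dist a b}} ≤
        ENNReal.ofReal (8 * r * M) := by
    intro k u c z hu hk hz
    refine total (a k) _ fun x => ?_
    by_cases hx : x ∈ Set.Icc (a k - M) (a k + M)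
    · rw [Set.indicator_of_mem hx]
      exact (measure_mono fun y hy => (hz x y).symm.le.trans hy.2).trans (slice u (c x) hu)
    · rw [Set.indicator_of_notMem hx]
      refine le_of_eq (measure_mono_null (t := ∅) ?_ measure_empty)
      rintro y ⟨hy, -⟩
      have := abs_le.1 ((Plane.abs_sub_le_dist _ _ k).trans hy)
      rw [hk] at this
      exact hx ⟨by linarith [this.1], by linarith [this.2]⟩
  rcases le_total |b 1 - a 1| |b 0 - a 0| with h | h
  · rw [Plane.volume_eq_lintegral hm]
    refine sec 0 (b 0 - a 0) (fun x => (b 0 - a 0) * a 1 + (b 1 - a 1) * (x - a 0)) _ (by linarith)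
      (fun x y => by simp) fun x y => ?_
    simp only [cross]
    congr 1
    simp
    ring
  · rw [Plane.volume_eq_lintegral_symm hm]
    refine sec 1 (b 1 - a 1) (fun y => (b 1 - a 1) * a 0 + (b 0 - a 0) * (y - a 1))
      (fun y x => !₂[x, y]) (by linarith) (fun x y => by simp) fun x y => ?_
    rw [← abs_neg, cross]
    congr 1
    simp
    ring

/-- A degenerate triangle lies in a strip of width zero along an edge of positive length, or it is a
point. -/
theorem volume_solidTriangle_of_triDet_eq_zero {T : Fin 3 → Plane} (hD : triDet T = 0) :
    volume (solidTriangle T) = 0 := by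
  obtain ⟨W, hW⟩ : ∃ W, ∀ a b, dist (T a) (T b) ≤ W := by
    obtain ⟨W, hW⟩ := (Set.finite_range fun p : Fin 3 × Fin 3 => dist (T p.1) (T p.2)).bddAbove
    exact ⟨W, fun a b => hW ⟨(a, b), rfl⟩⟩
  have key : ∀ k, T k ≠ T (k + 1) → volume (solidTriangle T) = 0 := by
    intro k hk
    have hsub : ∀ z ∈ solidTriangle T, cross (T k) (T (k + 1)) z = 0 := by
      intro z hz
      have hv : ∀ j, cross (T k) (T (k + 1)) (T j) = 0 := by
        simp only [triDet, cross] at hD ⊢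
        intro j
        fin_cases k <;> fin_cases j <;> simp <;> linarith
      have h1 := convexHull_min (s := Set.range T) (by
        rintro _ ⟨j, rfl⟩
        show 0 ≤ 1 * cross _ _ _
        rw [hv j]; simp) (convex_mul_cross_nonneg 1 (T k) (T (k + 1))) hz
      have h2 := convexHull_min (s := Set.range T) (by
        rintro _ ⟨j, rfl⟩
        show 0 ≤ (-1) * cross _ _ _
        rw [hv j]; simp) (convex_mul_cross_nonneg (-1) (T k) (T (k + 1))) hz
      simp only [Set.mem_ofPred_eq] at h1 h2
      linarith
    have h3 := (measure_mono (μ := (volume : Measure Plane)) (s := solidTriangle T) fun z hz => (show z ∈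
      {z : Plane | dist z (T k) ≤ W ∧ |cross (T k) (T (k + 1)) z| ≤ 0 * dist (T k) (T (k + 1))} from
      ⟨dist_le_of_mem_solidTriangle hW hz (vertex_mem T k), by simp [hsub z hz]⟩)).trans
      (volume_strip_le _ _ hk le_rfl)
    simpa using h3
  by_cases h0 : T 0 = T 1
  · by_cases h1 : T 1 = T 2
    · have : Set.range T = {T 0} := by
        ext z
        simp only [Set.mem_range, Fin.exists_fin_succ, Set.mem_singleton_iff]
        simp [← h0, ← h1, eq_comm]
      rw [solidTriangle, this, convexHull_singleton, measure_singleton]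
    · exact key 1 h1
  · exact key 0 h0

/-! ### The position of a disk relative to a triangle -/

/-- A sufficient condition for the disk of radius `ρ` around `q` to be outside of `T`. -/
def IsOut (W ρ : ℝ) (T : Fin 3 → Plane) (q : Plane) : Prop :=
  (∃ k : Fin 3, triDet T * cross (T k) (T (k + 1)) q ≤ -(ρ * (|triDet T| * dist (T k) (T (k + 1))))) ∨
    W + ρ ≤ dist q (T 0)

/-- A sufficient condition for the disk of radius `ρ` around `q` to be inside of `T`. -/
def IsIn (ρ : ℝ) (T : Fin 3 → Plane) (q : Plane) : Prop :=
  ∀ k : Fin 3, ρ * (|triDet T| * dist (T k) (T (k + 1))) ≤ triDet T * cross (T k) (T (k + 1)) q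

theorem dist_pos_of_triDet_ne_zero {T : Fin 3 → Plane} (hD : triDet T ≠ 0) (k : Fin 3) :
    0 < dist (T k) (T (k + 1)) := by
  rw [dist_pos]
  intro h
  apply hD
  have h0 := congrArg (fun z : Plane => z 0) h
  have h1 := congrArg (fun z : Plane => z 1) h
  simp only [triDet, cross]
  fin_cases k <;> simp at h0 h1
  · rw [h0, h1]; ring
  · rw [h0, h1]; ring
  · rw [h0, h1]; ring

theorem abs_mul_cross_sub_lt {T : Fin 3 → Plane} (hD : triDet T ≠ 0) (k : Fin 3) {ρ : ℝ}
    {q x : Plane} (hx : x ∈ Metric.ball q ρ) :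
    |triDet T * cross (T k) (T (k + 1)) x - triDet T * cross (T k) (T (k + 1)) q| <
      ρ * (|triDet T| * dist (T k) (T (k + 1))) := by
  rw [← mul_sub, abs_mul]
  have h1 := abs_cross_sub_le (T k) (T (k + 1)) x q
  have h2 : 0 < |triDet T| := abs_pos.2 hD
  have h3 := dist_pos_of_triDet_ne_zero hD k
  rw [Metric.mem_ball] at hx
  calc _ ≤ |triDet T| * (dist (T k) (T (k + 1)) * dist x q) := by gcongr
    _ < |triDet T| * (dist (T k) (T (k + 1)) * ρ) := by gcongr
    _ = _ := by ring

/-- A degenerate triangle always satisfies `IsOut`, because both sides of the inequalities are zero.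
It may meet the disk, which is why the conclusion is about area and not about emptiness. -/
theorem IsOut.volume_inter_ball {W ρ : ℝ} {T : Fin 3 → Plane} {q : Plane}
    (hW : ∀ a b, dist (T a) (T b) ≤ W) (h : IsOut W ρ T q) :
    volume (solidTriangle T ∩ Metric.ball q ρ) = 0 := by
  by_cases hD : triDet T = 0
  · exact measure_mono_null Set.inter_subset_left (volume_solidTriangle_of_triDet_eq_zero hD)
  refine measure_mono_null (t := ∅) ?_ measure_empty
  rintro x ⟨hx1, hx2⟩
  rcases h with ⟨k, hk⟩ | h
  · have h1 := (mem_solidTriangle hD x).1 hx1 k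
    have h2 := (abs_lt.1 (abs_mul_cross_sub_lt hD k hx2)).2
    linarith
  · have h1 := dist_le_of_mem_solidTriangle hW hx1 (vertex_mem T 0)
    rw [Metric.mem_ball, dist_comm] at hx2
    have := dist_triangle q x (T 0)
    linarith

/-- For a degenerate triangle `IsIn` would hold trivially; this is excluded by the failure of
`IsOut`. -/
theorem IsIn.ball_subset {W ρ : ℝ} {T : Fin 3 → Plane} {q : Plane} (h : IsIn ρ T q)
    (h' : ¬ IsOut W ρ T q) : Metric.ball q ρ ⊆ solidTriangle T := by
  have hD : triDet T ≠ 0 := fun hD => h' (Or.inl ⟨0, by simp [hD]⟩)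
  intro x hx
  rw [mem_solidTriangle hD]
  intro k
  have h2 := (abs_lt.1 (abs_mul_cross_sub_lt hD k hx)).1
  have := h k
  linarith

/-- The edge for which `IsIn` fails bounds the signed distance from above, and the failure of
`IsOut` bounds it from below at the same edge. The second part of `IsOut` cuts the infinite strip to
a bounded length. -/
theorem strip_of_not_isOut_of_not_isIn {W ρ : ℝ} {T : Fin 3 → Plane} {q : Plane}
    (h : ¬ IsOut W ρ T q) (h' : ¬ IsIn ρ T q) : dist q (T 0) ≤ W + ρ ∧
      ∃ k : Fin 3, T k ≠ T (k + 1) ∧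
        |cross (T k) (T (k + 1)) q| ≤ ρ * dist (T k) (T (k + 1)) := by
  have hD : triDet T ≠ 0 := fun hD => h (Or.inl ⟨0, by simp [hD]⟩)
  simp only [IsOut, not_or, not_exists, not_le] at h
  simp only [IsIn, not_forall, not_le] at h'
  refine ⟨h.2.le, ?_⟩
  obtain ⟨k, hk⟩ := h'
  refine ⟨k, dist_pos.1 (dist_pos_of_triDet_ne_zero hD k), ?_⟩
  have h1 := (abs_lt.2 ⟨h.1 k, hk⟩).le
  rw [abs_mul] at h1
  refine le_of_mul_le_mul_left (h1.trans_eq ?_) (abs_pos.2 hD)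
  ring


/-! ### The area of the intersection of a triangle and a box -/

/-- The half-open box `[x₀, x₁) × [y₀, y₁)`. -/
def hbox (x₀ x₁ y₀ y₁ : ℝ) : Set Plane := {z | x₀ ≤ z 0 ∧ z 0 < x₁ ∧ y₀ ≤ z 1 ∧ z 1 < y₁}

theorem measurableSet_hbox (x₀ x₁ y₀ y₁ : ℝ) : MeasurableSet (hbox x₀ x₁ y₀ y₁) := by
  have h0 : Measurable fun z : Plane => z 0 := by fun_prop
  have h1 : Measurable fun z : Plane => z 1 := by fun_prop
  exact (measurableSet_le measurable_const h0).inter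
    ((measurableSet_lt h0 measurable_const).inter
    ((measurableSet_le measurable_const h1).inter (measurableSet_lt h1 measurable_const)))

/-- The length of the part of `[y₀, y₁]` below `t`. -/
def below (y₀ y₁ t : ℝ) : ℝ := max (t - y₀) 0 - max (t - y₁) 0

/-- The height of the line through `p` and `q` at the abscissa `u`. -/
noncomputable def lineAt (p q : Plane) (u : ℝ) : ℝ := p 1 + (q 1 - p 1) / (q 0 - p 0) * (u - p 0)

/-- The projection of `u` to the interval `[x₀, x₁]`. -/
noncomputable def clampTo (x₀ x₁ u : ℝ) : ℝ := max x₀ (min u x₁)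

/-- The signed area in the box `[x₀, x₁) × [y₀, y₁)` below the segment from `p` to `q`. -/
noncomputable def edgeArea (p q : Plane) (x₀ x₁ y₀ y₁ : ℝ) : ℝ :=
  (max (lineAt p q (clampTo x₀ x₁ (q 0)) - y₀) 0 * max (lineAt p q (clampTo x₀ x₁ (q 0)) - y₀) 0
    - max (lineAt p q (clampTo x₀ x₁ (p 0)) - y₀) 0 * max (lineAt p q (clampTo x₀ x₁ (p 0)) - y₀) 0
    - max (lineAt p q (clampTo x₀ x₁ (q 0)) - y₁) 0 * max (lineAt p q (clampTo x₀ x₁ (q 0)) - y₁) 0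
    + max (lineAt p q (clampTo x₀ x₁ (p 0)) - y₁) 0 * max (lineAt p q (clampTo x₀ x₁ (p 0)) - y₁) 0)
    / (2 * ((q 1 - p 1) / (q 0 - p 0)))
  + (1 - (q 1 - p 1) / (q 0 - p 0) / ((q 1 - p 1) / (q 0 - p 0))) *
    ((clampTo x₀ x₁ (q 0) - clampTo x₀ x₁ (p 0)) * (max (p 1 - y₀) 0 - max (p 1 - y₁) 0))

/-- A closed formula for the area of the intersection of a triangle and a box. -/
noncomputable def boxArea (T : Fin 3 → Plane) (x₀ x₁ y₀ y₁ : ℝ) : ℝ :=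
  triDet T / |triDet T| * (0 - (edgeArea (T 0) (T 1) x₀ x₁ y₀ y₁ + edgeArea (T 1) (T 2) x₀ x₁ y₀ y₁ +
    edgeArea (T 2) (T 0) x₀ x₁ y₀ y₁))

/-- The square of the positive part is differentiable also at zero. It provides the antiderivative
that makes the area formula free of case distinctions. -/
theorem hasDerivAt_max_zero_sq (t : ℝ) :
    HasDerivAt (fun t : ℝ => max t 0 * max t 0) (2 * max t 0) t := by
  rcases lt_trichotomy t 0 with h | rfl | h
  · rw [max_eq_right h.le, mul_zero]
    refine (hasDerivAt_const t (0 : ℝ)).congr_of_eventuallyEq ?_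
    filter_upwards [Iio_mem_nhds h] with u hu
    rw [max_eq_right (le_of_lt hu), mul_zero]
  · rw [max_self, mul_zero, hasDerivAt_iff_isLittleO_nhds_zero]
    simp only [zero_add, max_self, mul_zero, sub_zero, smul_zero]
    refine Asymptotics.IsBigO.trans_isLittleO (g := fun h : ℝ => h ^ 2) ?_ ?_
    · refine Asymptotics.isBigO_of_le _ fun h => ?_
      rw [Real.norm_eq_abs, Real.norm_eq_abs, abs_mul_self, abs_pow, ← pow_two]
      have h1 : |max h 0| ≤ |h| := by
        rcases le_total h 0 with h' | h'
        · rw [max_eq_right h']; simp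
        · rw [max_eq_left h']
      rw [← sq_abs]
      exact pow_le_pow_left₀ (abs_nonneg _) h1 2
    · exact Asymptotics.isLittleO_pow_id (by norm_num)
  · rw [max_eq_left h.le]
    have h1 : HasDerivAt (fun t : ℝ => t * t) (1 * t + t * 1) t :=
      (hasDerivAt_id t).mul (hasDerivAt_id t)
    have h2 : 1 * t + t * 1 = 2 * t := by ring
    rw [h2] at h1
    refine h1.congr_of_eventuallyEq ?_
    filter_upwards [Ioi_mem_nhds h] with u hu
    rw [max_eq_left (le_of_lt hu)]

theorem integral_max_line {a k c b u₀ u₁ : ℝ} (hk : k ≠ 0) :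
    ∫ u in u₀..u₁, max (a + k * (u - b) - c) 0 =
      (max (a + k * (u₁ - b) - c) 0 * max (a + k * (u₁ - b) - c) 0 -
        max (a + k * (u₀ - b) - c) 0 * max (a + k * (u₀ - b) - c) 0) / (2 * k) := by
  have hd : ∀ u ∈ Set.uIcc u₀ u₁, HasDerivAt
      (fun u => max (a + k * (u - b) - c) 0 * max (a + k * (u - b) - c) 0 / (2 * k))
      (max (a + k * (u - b) - c) 0) u := by
    intro u _
    have h1 : HasDerivAt (fun u => a + k * (u - b) - c) k u := by
      have := (((hasDerivAt_id u).sub_const b).const_mul k).const_add a |>.sub_const c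
      simpa using this
    have h2 := ((hasDerivAt_max_zero_sq (a + k * (u - b) - c)).comp u h1).div_const (2 * k)
    have e : 2 * max (a + k * (u - b) - c) 0 * k / (2 * k) = max (a + k * (u - b) - c) 0 := by
      field_simp
    rw [e] at h2
    exact h2
  rw [intervalIntegral.integral_eq_sub_of_hasDerivAt hd, ← sub_div]
  exact Continuous.intervalIntegrable (by fun_prop) _ _

theorem continuous_below_lineAt (p q : Plane) (y₀ y₁ : ℝ) :
    Continuous fun u => below y₀ y₁ (lineAt p q u) := by
  unfold below lineAt; fun_prop

/-- As division by zero gives zero, one of the two summands of `edgeArea` always vanishes. For slope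
zero the first quotient is zero and the factor `1 - k / k` is one, so a rectangle remains; for any
other slope `k` this factor is zero. A vertical edge counts as one of slope zero, and its rectangle
has width zero. -/
theorem edgeArea_eq_integral (p q : Plane) (x₀ x₁ y₀ y₁ : ℝ) :
    edgeArea p q x₀ x₁ y₀ y₁ =
      ∫ u in (clampTo x₀ x₁ (p 0))..(clampTo x₀ x₁ (q 0)), below y₀ y₁ (lineAt p q u) := by
  by_cases hk : (q 1 - p 1) / (q 0 - p 0) = 0
  · simp only [edgeArea, below, lineAt, hk]
    simp
    ring
  · simp only [below]
    rw [intervalIntegral.integral_sub]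
    · simp only [lineAt]
      rw [integral_max_line hk, integral_max_line hk]
      simp only [edgeArea, lineAt]
      rw [div_self hk]
      ring
    · exact Continuous.intervalIntegrable (by unfold lineAt; fun_prop) _ _
    · exact Continuous.intervalIntegrable (by unfold lineAt; fun_prop) _ _

/-- The signed height below the segment from `p` to `q`. -/
noncomputable def edgeHeight (p q : Plane) (y₀ y₁ x : ℝ) : ℝ :=
  (Set.Ioc (p 0) (q 0)).indicator (fun u => below y₀ y₁ (lineAt p q u)) x -
    (Set.Ioc (q 0) (p 0)).indicator (fun u => below y₀ y₁ (lineAt p q u)) x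

theorem Ioc_inter_eq_clampTo (x₀ x₁ a b : ℝ) :
    Set.Ioc x₀ x₁ ∩ Set.Ioc a b = Set.Ioc (clampTo x₀ x₁ a) (clampTo x₀ x₁ b) := by
  ext u
  simp only [Set.mem_inter_iff, Set.mem_Ioc, clampTo, max_lt_iff, le_max_iff, min_lt_iff, le_min_iff]
  constructor
  · rintro ⟨⟨h1, h2⟩, h3, h4⟩; exact ⟨⟨h1, Or.inl h3⟩, Or.inr ⟨h4, h2⟩⟩
  · rintro ⟨⟨h1, h2⟩, h3⟩
    rcases h3 with h3 | h3
    · linarith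
    · rcases h2 with h2 | h2
      · exact ⟨⟨h1, h3.2⟩, h2, h3.1⟩
      · linarith

theorem integrableOn_edgeHeight (p q : Plane) (x₀ x₁ y₀ y₁ : ℝ) :
    IntegrableOn (edgeHeight p q y₀ y₁) (Set.Ioc x₀ x₁) := by
  have h : IntegrableOn (fun u => below y₀ y₁ (lineAt p q u)) (Set.Ioc x₀ x₁) :=
    ((continuous_below_lineAt p q y₀ y₁).integrableOn_Icc).mono_set Set.Ioc_subset_Icc_self
  exact (h.indicator measurableSet_Ioc).sub (h.indicator measurableSet_Ioc)

theorem integral_edgeHeight (p q : Plane) (x₀ x₁ y₀ y₁ : ℝ) :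
    ∫ x in Set.Ioc x₀ x₁, edgeHeight p q y₀ y₁ x = edgeArea p q x₀ x₁ y₀ y₁ := by
  have hi : IntegrableOn (fun u => below y₀ y₁ (lineAt p q u)) (Set.Ioc x₀ x₁) :=
    ((continuous_below_lineAt p q y₀ y₁).integrableOn_Icc).mono_set Set.Ioc_subset_Icc_self
  simp only [edgeHeight]
  rw [integral_sub (hi.indicator measurableSet_Ioc) (hi.indicator measurableSet_Ioc),
    setIntegral_indicator measurableSet_Ioc, setIntegral_indicator measurableSet_Ioc,
    Ioc_inter_eq_clampTo, Ioc_inter_eq_clampTo, edgeArea_eq_integral]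
  rfl

theorem volume_slice {lo hi y₀ y₁ : ℝ} (h : lo ≤ hi) (hy : y₀ ≤ y₁) :
    volume (Set.Icc lo hi ∩ Set.Ico y₀ y₁) = ENNReal.ofReal (below y₀ y₁ hi - below y₀ y₁ lo) := by
  have e : below y₀ y₁ hi - below y₀ y₁ lo = max (min hi y₁ - max lo y₀) 0 := by
    simp only [below]
    rcases le_total hi y₀ with h1 | h1 <;> rcases le_total hi y₁ with h2 | h2 <;>
    rcases le_total lo y₀ with h3 | h3 <;> rcases le_total lo y₁ with h4 | h4 <;>
    simp only [min_eq_left, min_eq_right, max_eq_left, max_eq_right, sub_nonneg, sub_nonpos, h1, h2,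
      h3, h4] <;>
    first
      | linarith
      | (rw [max_eq_left (by linarith)]; linarith)
  have h2 : volume (Set.Icc lo hi ∩ Set.Ico y₀ y₁) = volume (Set.Icc lo hi ∩ Set.Icc y₀ y₁) := by
    apply measure_congr
    exact (Filter.EventuallyEq.refl _ _).inter Ico_ae_eq_Icc
  rw [h2, Set.Icc_inter_Icc, Real.volume_Icc, e]
  rcases le_total (min hi y₁ - max lo y₀) 0 with h3 | h3
  · rw [max_eq_right h3, ENNReal.ofReal_zero]; exact ENNReal.ofReal_of_nonpos h3
  · rw [max_eq_left h3]

theorem below_mono {y₀ y₁ : ℝ} (hy : y₀ ≤ y₁) : Monotone (below y₀ y₁) := by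
  intro s t h
  simp only [below]
  rcases le_total s y₀ with h1 | h1 <;> rcases le_total s y₁ with h2 | h2 <;>
    rcases le_total t y₀ with h3 | h3 <;> rcases le_total t y₁ with h4 | h4 <;>
    simp only [max_eq_left, max_eq_right, sub_nonneg, sub_nonpos, h1, h2, h3, h4] <;> linarith

theorem cross_eq_mul_sub_lineAt {p q : Plane} (h : p 0 ≠ q 0) (x y : ℝ) :
    cross p q !₂[x, y] = (q 0 - p 0) * (y - lineAt p q x) := by
  have : q 0 - p 0 ≠ 0 := sub_ne_zero.2 h.symm
  simp only [cross, lineAt]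
  field_simp
  simp
  ring

theorem lineAt_comm {p q : Plane} (h : p 0 ≠ q 0) (x : ℝ) : lineAt p q x = lineAt q p x := by
  have h1 : q 0 - p 0 ≠ 0 := sub_ne_zero.2 h.symm
  have h2 : p 0 - q 0 ≠ 0 := sub_ne_zero.2 h
  simp only [lineAt]
  field_simp
  ring

/-- If `A` lies on one side of the vertical line at `x`, and `B` and `C` lie on the other, the line
crosses only the edges `AB` and `CA`. The section is the segment between these crossings, and the
signs of the edge heights produce its length up to the orientation. -/
theorem volume_section {A B C : Plane} {D : ℝ} (hD : D = cross A B C) (hD0 : D ≠ 0) {x y₀ y₁ : ℝ}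
    (hy : y₀ ≤ y₁) (hx : (A 0 < x ∧ x < B 0 ∧ x < C 0) ∨ (B 0 < x ∧ C 0 < x ∧ x < A 0)) :
    volume {y : ℝ | 0 ≤ D * cross A B !₂[x, y] ∧ 0 ≤ D * cross B C !₂[x, y] ∧
        0 ≤ D * cross C A !₂[x, y] ∧ y₀ ≤ y ∧ y < y₁} =
      ENNReal.ofReal (D / |D| * (0 - (edgeHeight A B y₀ y₁ x + edgeHeight B C y₀ y₁ x +
        edgeHeight C A y₀ y₁ x))) ∧
    0 ≤ D / |D| * (0 - (edgeHeight A B y₀ y₁ x + edgeHeight B C y₀ y₁ x +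
        edgeHeight C A y₀ y₁ x)) := by
  have hAB : A 0 ≠ B 0 := by rcases hx with h | h <;> [exact (h.1.trans h.2.1).ne; exact (h.1.trans h.2.2).ne']
  have hCA : C 0 ≠ A 0 := by rcases hx with h | h <;> [exact (h.1.trans h.2.2).ne'; exact (h.2.1.trans h.2.2).ne]
  have hBAC : 0 < (B 0 - A 0) * (C 0 - A 0) := by
    rcases hx with h | h
    · exact mul_pos (by linarith) (by linarith)
    · exact mul_pos_of_neg_of_neg (by linarith) (by linarith)
  -- the third condition follows from the other two
  have third : ∀ y : ℝ, 0 ≤ D * cross A B !₂[x, y] → 0 ≤ D * cross C A !₂[x, y] →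
      0 ≤ D * cross B C !₂[x, y] := by
    intro y h1 h2
    -- On the vertical line the third linear function is a combination of the other two, with
    -- coefficients whose signs are known from the position of the vertices.
    have e : cross B C !₂[x, y] * (x - A 0) =
        cross C A !₂[x, y] * (B 0 - x) + cross A B !₂[x, y] * (C 0 - x) := by
      simp [cross]; ring
    rcases hx with h | h
    · refine nonneg_of_mul_nonneg_left (b := x - A 0) ?_ (by linarith)
      rw [show D * cross B C !₂[x, y] * (x - A 0) =
        (D * cross C A !₂[x, y]) * (B 0 - x) + (D * cross A B !₂[x, y]) * (C 0 - x) by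
          linear_combination D * e]
      exact add_nonneg (mul_nonneg h2 (by linarith)) (mul_nonneg h1 (by linarith))
    · refine nonneg_of_mul_nonneg_left (b := A 0 - x) ?_ (by linarith)
      rw [show D * cross B C !₂[x, y] * (A 0 - x) =
        (D * cross C A !₂[x, y]) * (x - B 0) + (D * cross A B !₂[x, y]) * (x - C 0) by
          linear_combination -D * e]
      exact add_nonneg (mul_nonneg h2 (by linarith)) (mul_nonneg h1 (by linarith))
  have ediff : (lineAt C A x - lineAt A B x) * ((B 0 - A 0) * (C 0 - A 0)) = D * (x - A 0) := by
    rw [lineAt_comm hCA, hD]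
    have h1 : B 0 - A 0 ≠ 0 := sub_ne_zero.2 hAB.symm
    have h2 : C 0 - A 0 ≠ 0 := sub_ne_zero.2 hCA
    simp only [lineAt, cross]
    field_simp
    ring
  have dle : D * (x - A 0) ≤ 0 → lineAt C A x ≤ lineAt A B x := fun h =>
    sub_nonpos.1 (nonpos_of_mul_nonpos_left (ediff.trans_le h) hBAC)
  have dge : 0 ≤ D * (x - A 0) → lineAt A B x ≤ lineAt C A x := fun h =>
    sub_nonneg.1 (nonneg_of_mul_nonneg_left (h.trans_eq ediff.symm) hBAC)
  have key : ∀ lo hi E : ℝ, lo ≤ hi → (∀ y, (0 ≤ D * cross A B !₂[x, y] ∧ 0 ≤ D * cross C A !₂[x, y]) ↔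
      lo ≤ y ∧ y ≤ hi) → E = below y₀ y₁ hi - below y₀ y₁ lo →
      volume {y : ℝ | 0 ≤ D * cross A B !₂[x, y] ∧ 0 ≤ D * cross B C !₂[x, y] ∧
        0 ≤ D * cross C A !₂[x, y] ∧ y₀ ≤ y ∧ y < y₁} = ENNReal.ofReal E ∧ 0 ≤ E := by
    rintro lo hi _ hle hiff rfl
    refine ⟨?_, sub_nonneg.2 (below_mono hy hle)⟩
    rw [← volume_slice hle hy]
    congr 1
    ext y
    have := hiff y
    constructor
    · rintro ⟨h1, -, h3, h4, h5⟩; exact ⟨this.1 ⟨h1, h3⟩, h4, h5⟩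
    · rintro ⟨h1, h4, h5⟩
      obtain ⟨h2, h3⟩ := this.2 h1
      exact ⟨h2, third y h2 h3, h3, h4, h5⟩
  have iffpos : ∀ {u v : ℝ}, 0 < u → (0 ≤ u * v ↔ 0 ≤ v) := fun hu => mul_nonneg_iff_of_pos_left hu
  have iffneg : ∀ {u v : ℝ}, u < 0 → (0 ≤ u * v ↔ v ≤ 0) := fun hu => by
    rw [← neg_mul_neg, mul_nonneg_iff_of_pos_left (by linarith), neg_nonneg]
  simp only [cross_eq_mul_sub_lineAt hAB, cross_eq_mul_sub_lineAt hCA, ← mul_assoc] at key ⊢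
  rcases hx with h | h
  · have s1 : edgeHeight A B y₀ y₁ x = below y₀ y₁ (lineAt A B x) := by
      rw [edgeHeight, Set.indicator_of_mem (Set.mem_Ioc.2 ⟨h.1, h.2.1.le⟩), Set.indicator_of_notMem, sub_zero]
      rintro ⟨h1, -⟩; linarith
    have s2 : edgeHeight B C y₀ y₁ x = 0 := by
      rw [edgeHeight, Set.indicator_of_notMem, Set.indicator_of_notMem, sub_zero] <;>
        (rintro ⟨h1, -⟩; linarith)
    have s3 : edgeHeight C A y₀ y₁ x = - below y₀ y₁ (lineAt C A x) := by
      rw [edgeHeight, Set.indicator_of_notMem, Set.indicator_of_mem (Set.mem_Ioc.2 ⟨h.1, h.2.2.le⟩), zero_sub]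
      rintro ⟨h1, -⟩; linarith
    rcases lt_or_gt_of_ne hD0 with hneg | hpos
    · refine key (lineAt C A x) (lineAt A B x) _ ?_ (fun y => ?_) ?_
      · exact dle (mul_nonpos_of_nonpos_of_nonneg hneg.le (by linarith))
      · rw [iffneg (mul_neg_of_neg_of_pos hneg (by linarith)),
          iffpos (mul_pos_of_neg_of_neg hneg (by linarith)), sub_nonpos, sub_nonneg, and_comm]
      · rw [s1, s2, s3, abs_of_neg hneg, div_neg, div_self hD0]; ring
    · refine key (lineAt A B x) (lineAt C A x) _ ?_ (fun y => ?_) ?_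
      · exact dge (mul_nonneg hpos.le (by linarith))
      · rw [iffpos (mul_pos hpos (by linarith)),
          iffneg (mul_neg_of_pos_of_neg hpos (by linarith)), sub_nonpos, sub_nonneg]
      · rw [s1, s2, s3, abs_of_pos hpos, div_self hD0]; ring
  · have s1 : edgeHeight A B y₀ y₁ x = - below y₀ y₁ (lineAt A B x) := by
      rw [edgeHeight, Set.indicator_of_notMem, Set.indicator_of_mem (Set.mem_Ioc.2 ⟨h.1, h.2.2.le⟩), zero_sub]
      rintro ⟨h1, -⟩; linarith
    have s2 : edgeHeight B C y₀ y₁ x = 0 := by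
      rw [edgeHeight, Set.indicator_of_notMem, Set.indicator_of_notMem, sub_zero] <;>
        (rintro ⟨-, h1⟩; linarith)
    have s3 : edgeHeight C A y₀ y₁ x = below y₀ y₁ (lineAt C A x) := by
      rw [edgeHeight, Set.indicator_of_mem (Set.mem_Ioc.2 ⟨h.2.1, h.2.2.le⟩), Set.indicator_of_notMem, sub_zero]
      rintro ⟨h1, -⟩; linarith
    rcases lt_or_gt_of_ne hD0 with hneg | hpos
    · refine key (lineAt A B x) (lineAt C A x) _ ?_ (fun y => ?_) ?_
      · exact dge (mul_nonneg_of_nonpos_of_nonpos hneg.le (by linarith))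
      · rw [iffpos (mul_pos_of_neg_of_neg hneg (by linarith)),
          iffneg (mul_neg_of_neg_of_pos hneg (by linarith)), sub_nonpos, sub_nonneg]
      · rw [s1, s2, s3, abs_of_neg hneg, div_neg, div_self hD0]; ring
    · refine key (lineAt C A x) (lineAt A B x) _ ?_ (fun y => ?_) ?_
      · exact dle (mul_nonpos_of_nonneg_of_nonpos hpos.le (by linarith))
      · rw [iffneg (mul_neg_of_pos_of_neg hpos (by linarith)),
          iffpos (mul_pos hpos (by linarith)), sub_nonpos, sub_nonneg, and_comm]
      · rw [s1, s2, s3, abs_of_pos hpos, div_self hD0]; ring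

theorem sum_nonpos_of_sum_mul_eq_zero {a b c u v w : ℝ} (ha : 0 ≤ a) (hb : 0 ≤ b) (hc : 0 ≤ c)
    (hu : 0 < u) (hv : 0 < v) (hw : 0 < w) (h : a * u + b * v + c * w = 0) : a + b + c ≤ 0 := by
  have h1 := mul_nonneg ha hu.le
  have h2 := mul_nonneg hb hv.le
  have h3 := mul_nonneg hc hw.le
  have := nonpos_of_mul_nonpos_left (a := a) (by linarith) hu
  have := nonpos_of_mul_nonpos_left (a := b) (by linarith) hv
  have := nonpos_of_mul_nonpos_left (a := c) (by linarith) hw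
  linarith

/-- In six of the eight positions of the vertices one vertex is alone on its side of the line, which
is the case of `volume_section` up to a rotation of the names. In the other two the section is
empty, since nonnegative barycentric coordinates cannot average abscissas on one side of `x` to `x`.
-/
theorem volume_section_triangle {T : Fin 3 → Plane} (hD : triDet T ≠ 0) {x y₀ y₁ : ℝ}
    (hy : y₀ ≤ y₁) (hx : ∀ k, T k 0 ≠ x) :
    volume {y : ℝ | (∀ k : Fin 3, 0 ≤ triDet T * cross (T k) (T (k + 1)) !₂[x, y]) ∧
        y₀ ≤ y ∧ y < y₁} =
      ENNReal.ofReal (triDet T / |triDet T| * (0 - (edgeHeight (T 0) (T 1) y₀ y₁ x +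
        edgeHeight (T 1) (T 2) y₀ y₁ x + edgeHeight (T 2) (T 0) y₀ y₁ x))) ∧
    0 ≤ triDet T / |triDet T| * (0 - (edgeHeight (T 0) (T 1) y₀ y₁ x +
        edgeHeight (T 1) (T 2) y₀ y₁ x + edgeHeight (T 2) (T 0) y₀ y₁ x)) := by
  have d1 : triDet T = cross (T 1) (T 2) (T 0) := by unfold triDet cross; ring
  have d2 : triDet T = cross (T 2) (T 0) (T 1) := by unfold triDet cross; ring
  have hset : {y : ℝ | (∀ k : Fin 3, 0 ≤ triDet T * cross (T k) (T (k + 1)) !₂[x, y]) ∧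
        y₀ ≤ y ∧ y < y₁} = {y : ℝ | 0 ≤ triDet T * cross (T 0) (T 1) !₂[x, y] ∧
        0 ≤ triDet T * cross (T 1) (T 2) !₂[x, y] ∧ 0 ≤ triDet T * cross (T 2) (T 0) !₂[x, y] ∧
        y₀ ≤ y ∧ y < y₁} := by
    ext y
    simp only [Fin.forall_fin_succ, Set.mem_ofPred_eq]
    simp [and_assoc]
  rw [hset]
  have ctop : ∀ p q : Plane, p 0 < x → q 0 < x → edgeHeight p q y₀ y₁ x = 0 := by
    intro p q h1 h2
    rw [edgeHeight, Set.indicator_of_notMem, Set.indicator_of_notMem, sub_zero]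
    · rintro ⟨-, h⟩; linarith
    · rintro ⟨-, h⟩; linarith
  have cbot : ∀ p q : Plane, x < p 0 → x < q 0 → edgeHeight p q y₀ y₁ x = 0 := by
    intro p q h1 h2
    rw [edgeHeight, Set.indicator_of_notMem, Set.indicator_of_notMem, sub_zero]
    · rintro ⟨h, -⟩; linarith
    · rintro ⟨h, -⟩; linarith
  have bary : ∀ y : ℝ, triDet T * cross (T 1) (T 2) !₂[x, y] * (T 0 0 - x) +
      triDet T * cross (T 2) (T 0) !₂[x, y] * (T 1 0 - x) +
      triDet T * cross (T 0) (T 1) !₂[x, y] * (T 2 0 - x) = 0 := by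
    intro y; simp [cross]; ring
  have barysum : ∀ y : ℝ, triDet T * cross (T 1) (T 2) !₂[x, y] +
      triDet T * cross (T 2) (T 0) !₂[x, y] + triDet T * cross (T 0) (T 1) !₂[x, y] =
      triDet T * triDet T := by
    intro y; simp [cross, triDet]; ring
  have hDD : 0 < triDet T * triDet T := mul_self_pos.2 hD
  have rot1 : ∀ a b c : ℝ, a + b + c = b + c + a := fun a b c => by ring
  rcases lt_or_gt_of_ne (hx 0) with h0 | h0 <;> rcases lt_or_gt_of_ne (hx 1) with h1 | h1 <;>
    rcases lt_or_gt_of_ne (hx 2) with h2 | h2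
  · rw [ctop _ _ h0 h1, ctop _ _ h1 h2, ctop _ _ h2 h0]
    simp only [add_zero, sub_zero, mul_zero, ENNReal.ofReal_zero, le_refl, and_true]
    refine measure_mono_null (t := ∅) ?_ measure_empty
    rintro y ⟨k1, k2, k3, -⟩
    have := sum_nonpos_of_sum_mul_eq_zero k2 k3 k1 (sub_pos.2 h0) (sub_pos.2 h1) (sub_pos.2 h2)
      (by linarith [bary y])
    linarith [barysum y]
  · have := volume_section d2 hD hy (Or.inr ⟨h0, h1, h2⟩)
    rw [rot1, rot1]
    convert this using 5
    tauto
  · have := volume_section d1 hD hy (Or.inr ⟨h2, h0, h1⟩)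
    rw [rot1]
    convert this using 5
    tauto
  · have := volume_section (A := T 0) (B := T 1) (C := T 2) rfl hD hy (Or.inl ⟨h0, h1, h2⟩)
    exact this
  · have := volume_section (A := T 0) (B := T 1) (C := T 2) rfl hD hy (Or.inr ⟨h1, h2, h0⟩)
    exact this
  · have := volume_section d1 hD hy (Or.inl ⟨h1, h2, h0⟩)
    rw [rot1]
    convert this using 5
    tauto
  · have := volume_section d2 hD hy (Or.inl ⟨h2, h0, h1⟩)
    rw [rot1, rot1]
    convert this using 5
    tauto
  · rw [cbot _ _ h0 h1, cbot _ _ h1 h2, cbot _ _ h2 h0]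
    simp only [add_zero, sub_zero, mul_zero, ENNReal.ofReal_zero, le_refl, and_true]
    refine measure_mono_null (t := ∅) ?_ measure_empty
    rintro y ⟨k1, k2, k3, -⟩
    have := sum_nonpos_of_sum_mul_eq_zero k2 k3 k1 (sub_pos.2 h0) (sub_pos.2 h1) (sub_pos.2 h2)
      (by linarith [bary y])
    linarith [barysum y]

/-- Fubini: the area is the integral of the vertical sections over the horizontal range of the box,
and the integral of each signed edge height is `edgeArea`. The sign of the determinant corrects the
orientation; for degenerate triangles it is `0 / 0 = 0`. -/
theorem boxArea_eq (T : Fin 3 → Plane) (x₀ x₁ : ℝ) {y₀ y₁ : ℝ} (hy : y₀ ≤ y₁) :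
    boxArea T x₀ x₁ y₀ y₁ = volume.real (solidTriangle T ∩ hbox x₀ x₁ y₀ y₁) := by
  by_cases hD : triDet T = 0
  · rw [Measure.real, measure_mono_null Set.inter_subset_left
      (volume_solidTriangle_of_triDet_eq_zero hD)]
    simp [boxArea, hD]
  set Φ : ℝ → ℝ := fun x => triDet T / |triDet T| * (0 - (edgeHeight (T 0) (T 1) y₀ y₁ x +
        edgeHeight (T 1) (T 2) y₀ y₁ x + edgeHeight (T 2) (T 0) y₀ y₁ x)) with hΦ
  have hint : IntegrableOn Φ (Set.Ioc x₀ x₁) :=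
    (((integrable_zero _ _ _).sub (((integrableOn_edgeHeight (T 0) (T 1) x₀ x₁ y₀ y₁).add
      (integrableOn_edgeHeight (T 1) (T 2) x₀ x₁ y₀ y₁)).add
      (integrableOn_edgeHeight (T 2) (T 0) x₀ x₁ y₀ y₁))).const_mul _)
  have e1 : ∫ x in Set.Ioc x₀ x₁, Φ x = boxArea T x₀ x₁ y₀ y₁ := by
    simp only [hΦ, zero_sub]
    rw [integral_const_mul, integral_neg, integral_add, integral_add, integral_edgeHeight,
      integral_edgeHeight, integral_edgeHeight, boxArea, zero_sub]
    · exact integrableOn_edgeHeight _ _ _ _ _ _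
    · exact integrableOn_edgeHeight _ _ _ _ _ _
    · exact (integrableOn_edgeHeight _ _ _ _ _ _).add (integrableOn_edgeHeight _ _ _ _ _ _)
    · exact integrableOn_edgeHeight _ _ _ _ _ _
  -- The formula for sections excludes the three abscissas of the vertices, which form a null set.
  have hae : ∀ᵐ x : ℝ, ∀ k, T k 0 ≠ x := by
    rw [ae_all_iff]
    intro k
    have := (measure_singleton (μ := (volume : Measure ℝ)) (T k 0))
    filter_upwards [compl_mem_ae_iff.2 this] with x hx h
    exact hx h.symm
  have hnn : 0 ≤ᵐ[volume.restrict (Set.Ioc x₀ x₁)] Φ := by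
    filter_upwards [ae_restrict_of_ae hae] with x hx
    exact (volume_section_triangle hD hy hx).2
  rw [Measure.real, Plane.volume_eq_lintegral
    ((measurableSet_solidTriangle T).inter (measurableSet_hbox _ _ _ _))]
  have e2 : ∫⁻ x : ℝ, volume {y : ℝ | (!₂[x, y] : Plane) ∈ solidTriangle T ∩ hbox x₀ x₁ y₀ y₁} =
      ∫⁻ x : ℝ, (Set.Ico x₀ x₁).indicator (fun x => ENNReal.ofReal (Φ x)) x := by
    refine lintegral_congr_ae ?_
    filter_upwards [hae] with x hx
    by_cases h : x ∈ Set.Ico x₀ x₁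
    · rw [Set.indicator_of_mem h, ← (volume_section_triangle hD hy hx).1]
      congr 1
      ext y
      simp only [Set.mem_inter_iff, Set.mem_ofPred_eq, mem_solidTriangle hD, hbox]
      simp [h.1, h.2]
    · rw [Set.indicator_of_notMem h]
      refine measure_mono_null (t := ∅) ?_ measure_empty
      rintro y ⟨-, h1, h2, -⟩
      exact h ⟨by simpa using h1, by simpa using h2⟩
  rw [e2, lintegral_indicator measurableSet_Ico, setLIntegral_congr Ico_ae_eq_Ioc,
    ← ofReal_integral_eq_lintegral_ofReal hint hnn, e1, ENNReal.toReal_ofReal]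
  rw [← e1]
  exact integral_nonneg_of_ae hnn


/-! ### The adaptive subdivision -/

/-- The data of the subdivision: the triangles `T 0, …, T (N - 1)`, of which the first `n` belong to
the source, a bound `W` for their diameters, the margin factor `κ` and the smallest size `sz`. -/
structure QParams where
  n : ℕ
  N : ℕ
  T : ℕ → Fin 3 → Plane
  W : ℝ
  κ : ℝ
  sz : ℝ

/-- A box of the subdivision: its corners, its size, the numbers of triangles of both families that
are known to contain it, and the triangles that are undecided. -/
structure QNode where
  x₀ : ℝ
  x₁ : ℝ
  y₀ : ℝ
  y₁ : ℝ
  l : ℝ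
  p : ℕ
  s : ℕ
  act : List ℕ

namespace QNode

/-- The box of a node. -/
def box (b : QNode) : Set Plane := hbox b.x₀ b.x₁ b.y₀ b.y₁

/-- The center of the box of a node. -/
noncomputable def ctr (b : QNode) : Plane := !₂[(b.x₀ + b.x₁) / 2, (b.y₀ + b.y₁) / 2]

/-- The area of the box of a node. -/
def area (b : QNode) : ℝ := (b.x₁ - b.x₀) * (b.y₁ - b.y₀)

end QNode

namespace QParams

variable (Q : QParams)

/-- The triangle `t` is recognized to be far outside of the box. -/
def Out (b : QNode) (t : ℕ) : Prop := IsOut Q.W (b.l * Q.κ) (Q.T t) b.ctr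

/-- The triangle `t` is recognized to contain the box and a neighborhood. -/
def Inn (b : QNode) (t : ℕ) : Prop := ¬ Q.Out b t ∧ IsIn (b.l * Q.κ) (Q.T t) b.ctr

/-- The triangle `t` is undecided. -/
def Act (b : QNode) (t : ℕ) : Prop := ¬ Q.Out b t ∧ ¬ IsIn (b.l * Q.κ) (Q.T t) b.ctr

open Classical in
/-- Sorting the undecided triangles of a node, one after the other. -/
noncomputable def sift (b : QNode) (t : ℕ) : QNode :=
  if Q.Inn b t then (if t < Q.n then { b with p := b.p + 1 } else { b with s := b.s + 1 })
  else if Q.Act b t then { b with act := t :: b.act } else b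

/-- A quarter of a node, before its undecided triangles are sorted. -/
noncomputable def quarter (b : QNode) (i j : Bool) : QNode where
  x₀ := if i then (b.x₀ + b.x₁) / 2 else b.x₀
  x₁ := if i then b.x₁ else (b.x₀ + b.x₁) / 2
  y₀ := if j then (b.y₀ + b.y₁) / 2 else b.y₀
  y₁ := if j then b.y₁ else (b.y₀ + b.y₁) / 2
  l := b.l / 2
  p := b.p
  s := b.s
  act := []

/-- A child of a node. -/
noncomputable def child (b : QNode) (i j : Bool) : QNode := b.act.foldl Q.sift (quarter b i j)

/-- The nodes that are not subdivided. -/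
def Leaf (b : QNode) : Prop := b.act = [] ∨ b.l ≤ Q.sz

/-- The four choices of a quarter. -/
def quarters : List (Bool × Bool) := [(false, false), (false, true), (true, false), (true, true)]

open Classical in
/-- The children of a node. -/
noncomputable def children (b : QNode) : List QNode :=
  if Q.Leaf b then [] else quarters.map fun k => Q.child b k.1 k.2

/-- The nodes of depth `j`. -/
noncomputable def level (roots : List QNode) : ℕ → List QNode
  | 0 => roots
  | j + 1 => (level roots j).flatMap Q.children

/-- The same box with other undecided triangles. -/
def SameBox (b c : QNode) : Prop :=
  b.x₀ = c.x₀ ∧ b.x₁ = c.x₁ ∧ b.y₀ = c.y₀ ∧ b.y₁ = c.y₁ ∧ b.l = c.l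

theorem sameBox_sift (b : QNode) (t : ℕ) : SameBox (Q.sift b t) b := by
  unfold sift SameBox; split_ifs <;> simp

theorem sameBox_foldl (l : List ℕ) (b : QNode) : SameBox (l.foldl Q.sift b) b := by
  induction l generalizing b with
  | nil => exact ⟨rfl, rfl, rfl, rfl, rfl⟩
  | cons t l ih =>
    obtain ⟨h1, h2, h3, h4, h5⟩ := ih (Q.sift b t)
    obtain ⟨k1, k2, k3, k4, k5⟩ := Q.sameBox_sift b t
    exact ⟨h1.trans k1, h2.trans k2, h3.trans k3, h4.trans k4, h5.trans k5⟩

theorem SameBox.box_eq {b c : QNode} (h : SameBox b c) : b.box = c.box := by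
  obtain ⟨h1, h2, h3, h4, -⟩ := h
  simp [QNode.box, h1, h2, h3, h4]

theorem SameBox.ctr_eq {b c : QNode} (h : SameBox b c) : b.ctr = c.ctr := by
  obtain ⟨h1, h2, h3, h4, -⟩ := h
  simp [QNode.ctr, h1, h2, h3, h4]

theorem SameBox.out_iff {b c : QNode} (h : SameBox b c) (t : ℕ) : Q.Out b t ↔ Q.Out c t := by
  simp only [Out, h.ctr_eq, h.2.2.2.2]

theorem SameBox.inn_iff {b c : QNode} (h : SameBox b c) (t : ℕ) : Q.Inn b t ↔ Q.Inn c t := by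
  simp only [Inn, h.out_iff, h.ctr_eq, h.2.2.2.2]

theorem SameBox.act_iff {b c : QNode} (h : SameBox b c) (t : ℕ) : Q.Act b t ↔ Q.Act c t := by
  simp only [Act, h.out_iff, h.ctr_eq, h.2.2.2.2]

/-- The undecided triangles among those that are sorted into a node. -/
theorem mem_act_foldl (l : List ℕ) (b : QNode) (t : ℕ) :
    t ∈ (l.foldl Q.sift b).act ↔ t ∈ b.act ∨ (t ∈ l ∧ Q.Act b t) := by
  induction l generalizing b with
  | nil => simp
  | cons u l ih =>
    rw [List.foldl_cons, ih, (Q.sameBox_sift b u).act_iff]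
    have : t ∈ (Q.sift b u).act ↔ t ∈ b.act ∨ (t = u ∧ Q.Act b u) := by
      unfold sift
      split_ifs with h1 h2 h3
      · simp only; exact ⟨Or.inl, fun h => h.resolve_right fun h => h.2.2 h1.2⟩
      · simp only; exact ⟨Or.inl, fun h => h.resolve_right fun h => h.2.2 h1.2⟩
      · simp [h3, or_comm]
      · simp [h3]
    rw [this, List.mem_cons]
    constructor
    · rintro ((h | ⟨rfl, h⟩) | ⟨h, h'⟩)
      · exact Or.inl h
      · exact Or.inr ⟨Or.inl rfl, h⟩
      · exact Or.inr ⟨Or.inr h, h'⟩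
    · rintro (h | ⟨rfl | h, h'⟩)
      · exact Or.inl (Or.inl h)
      · exact Or.inl (Or.inr ⟨rfl, h'⟩)
      · exact Or.inr ⟨h, h'⟩

theorem nodup_act_foldl (l : List ℕ) (b : QNode) (hl : l.Nodup) (hb : b.act.Nodup)
    (hd : ∀ t ∈ l, t ∉ b.act) : (l.foldl Q.sift b).act.Nodup := by
  induction l generalizing b with
  | nil => exact hb
  | cons u l ih =>
    rw [List.nodup_cons] at hl
    refine ih _ hl.2 ?_ ?_
    · unfold sift
      split_ifs <;> simp [hb, hd]
    · intro t ht
      have hne : t ≠ u := fun h => hl.1 (h ▸ ht)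
      unfold sift
      split_ifs <;> simp [hd t (List.mem_cons_of_mem _ ht), hne]

/-- The counters of a node are the numbers of elements of a set `I` of triangles that have been
recognized to contain the box. Undecided triangles are not in `I` and occur once, so none of them is
counted twice. -/
theorem counts_foldl (l : List ℕ) (b : QNode) (I : Finset ℕ) (hl : l.Nodup)
    (hd : ∀ t ∈ l, t ∉ I) (hp : b.p = (I.filter (· < Q.n)).card)
    (hs : b.s = (I.filter (¬ · < Q.n)).card) :
    ∃ I' : Finset ℕ, (∀ t, t ∈ I' ↔ t ∈ I ∨ (t ∈ l ∧ Q.Inn b t)) ∧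
      (l.foldl Q.sift b).p = (I'.filter (· < Q.n)).card ∧
      (l.foldl Q.sift b).s = (I'.filter (¬ · < Q.n)).card := by
  induction l generalizing b I with
  | nil => exact ⟨I, by simp, hp, hs⟩
  | cons u l ih =>
    rw [List.nodup_cons] at hl
    have hu : u ∉ I := hd u (by simp)
    have sb := Q.sameBox_sift b u
    by_cases h : Q.Inn b u
    · obtain ⟨I', h1, h2, h3⟩ := ih (Q.sift b u) (insert u I) hl.2 (by
        intro t ht
        have hne : t ≠ u := fun h => hl.1 (h ▸ ht)
        simp [hne, hd t (List.mem_cons_of_mem _ ht)])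
        (by
          unfold sift; rw [if_pos h, Finset.filter_insert]
          split_ifs <;> simp [hp, hu])
        (by
          unfold sift; rw [if_pos h, Finset.filter_insert]
          split_ifs <;> simp [hs, hu])
      refine ⟨I', fun t => ?_, h2, h3⟩
      rw [h1, sb.inn_iff, Finset.mem_insert, List.mem_cons]
      constructor
      · rintro ((rfl | h') | h')
        · exact Or.inr ⟨Or.inl rfl, h⟩
        · exact Or.inl h'
        · exact Or.inr ⟨Or.inr h'.1, h'.2⟩
      · rintro (h' | ⟨rfl | h', h''⟩)
        · exact Or.inl (Or.inr h')
        · exact Or.inl (Or.inl rfl)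
        · exact Or.inr ⟨h', h''⟩
    · obtain ⟨I', h1, h2, h3⟩ := ih (Q.sift b u) I hl.2
        (fun t ht => hd t (List.mem_cons_of_mem _ ht))
        (by unfold sift; rw [if_neg h]; split_ifs <;> exact hp)
        (by unfold sift; rw [if_neg h]; split_ifs <;> exact hs)
      refine ⟨I', fun t => ?_, h2, h3⟩
      rw [h1, sb.inn_iff, List.mem_cons]
      constructor
      · rintro (h' | h')
        · exact Or.inl h'
        · exact Or.inr ⟨Or.inr h'.1, h'.2⟩
      · rintro (h' | ⟨rfl | h', h''⟩)
        · exact Or.inl h'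
        · exact (h h'').elim
        · exact Or.inr ⟨h', h''⟩

/-- The invariant of the nodes of the subdivision. -/
structure Good (b : QNode) : Prop where
  l_pos : 0 < b.l
  dx_ge : b.l / 2 ≤ b.x₁ - b.x₀
  dx_le : b.x₁ - b.x₀ ≤ b.l
  dy_ge : b.l / 2 ≤ b.y₁ - b.y₀
  dy_le : b.y₁ - b.y₀ ≤ b.l
  nodup : b.act.Nodup
  act_lt : ∀ t ∈ b.act, t < Q.N
  counts : ∃ I : Finset ℕ, (∀ t ∈ I, t < Q.N) ∧ (∀ t ∈ b.act, t ∉ I) ∧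
    b.p = (I.filter (· < Q.n)).card ∧ b.s = (I.filter (¬ · < Q.n)).card ∧
    (∀ t ∈ I, ∀ z ∈ b.box, Metric.ball z (b.l * (Q.κ - 1)) ⊆ solidTriangle (Q.T t)) ∧
    ∀ t < Q.N, t ∉ I → t ∉ b.act → volume (solidTriangle (Q.T t) ∩ b.box) = 0 ∧
      ∀ z ∈ b.box,
        volume (solidTriangle (Q.T t) ∩ Metric.ball z (min (b.l * (Q.κ - 1)) Q.W)) = 0

theorem dist_ctr_le_of {b : QNode} (hl : 0 ≤ b.l) (hx : b.x₁ - b.x₀ ≤ b.l) (hy : b.y₁ - b.y₀ ≤ b.l)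
    {z : Plane} (hz : z ∈ b.box) : dist z b.ctr ≤ b.l := by
  obtain ⟨h1, h2, h3, h4⟩ := hz
  apply Plane.dist_le_of hl
  have e0 : b.ctr 0 = (b.x₀ + b.x₁) / 2 := rfl
  have e1 : b.ctr 1 = (b.y₀ + b.y₁) / 2 := rfl
  have a0 : |z 0 - b.ctr 0| ≤ b.l / 2 := by rw [e0, abs_le]; constructor <;> linarith
  have a1 : |z 1 - b.ctr 1| ≤ b.l / 2 := by rw [e1, abs_le]; constructor <;> linarith
  have := sq_le_sq' (abs_le.1 a0).1 (abs_le.1 a0).2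
  have := sq_le_sq' (abs_le.1 a1).1 (abs_le.1 a1).2
  nlinarith [sq_nonneg b.l]

theorem Good.dist_ctr_le {Q : QParams} {b : QNode} (h : Q.Good b) {z : Plane} (hz : z ∈ b.box) :
    dist z b.ctr ≤ b.l :=
  dist_ctr_le_of h.l_pos.le h.dx_le h.dy_le hz

theorem quarter_box_subset {Q : QParams} {b : QNode} (h : Q.Good b) (i j : Bool) :
    (quarter b i j).box ⊆ b.box := by
  rintro z ⟨h1, h2, h3, h4⟩
  have := h.dx_ge; have := h.dy_ge; have := h.l_pos
  cases i <;> cases j <;> simp [quarter] at h1 h2 h3 h4 <;>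
    exact ⟨by linarith, by linarith, by linarith, by linarith⟩

/-- A point of the box has distance at most `l` from the center, so its ball of radius `l * (κ - 1)`
lies in the tested disk of radius `l * κ`. Decisions that were made for the parent remain valid
because the radius shrinks with the box. -/
theorem Good.child {Q : QParams} (hκ : 1 < Q.κ)
    (hW : ∀ t < Q.N, ∀ a c, dist (Q.T t a) (Q.T t c) ≤ Q.W) {b : QNode} (h : Q.Good b)
    (i j : Bool) : Q.Good (Q.child b i j) := by
  have sb := Q.sameBox_foldl b.act (quarter b i j)
  have ebox := sb.box_eq
  obtain ⟨e1, e2, e3, e4, e5⟩ := sb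
  obtain ⟨I, I1, I2, I3, I4, I5, I6⟩ := h.counts
  obtain ⟨I', J1, J2, J3⟩ := Q.counts_foldl b.act (quarter b i j) I h.nodup I2 I3 I4
  have hl : (quarter b i j).l = b.l / 2 := rfl
  have hlpos := h.l_pos
  have hsub := quarter_box_subset h i j
  have h0 := h.dx_ge; have h0' := h.dx_le; have h1 := h.dy_ge; have h1' := h.dy_le
  have hmem := Q.mem_act_foldl b.act (quarter b i j)
  have hκ1 : 0 < Q.κ - 1 := by linarith
  have geom : ((quarter b i j).l / 2 ≤ (quarter b i j).x₁ - (quarter b i j).x₀ ∧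
      (quarter b i j).x₁ - (quarter b i j).x₀ ≤ (quarter b i j).l) ∧
      ((quarter b i j).l / 2 ≤ (quarter b i j).y₁ - (quarter b i j).y₀ ∧
      (quarter b i j).y₁ - (quarter b i j).y₀ ≤ (quarter b i j).l) := by
    cases i <;> cases j <;> simp [quarter] <;>
      exact ⟨⟨by linarith, by linarith⟩, by linarith, by linarith⟩
  have hdist : ∀ z ∈ (quarter b i j).box, dist z (quarter b i j).ctr ≤ (quarter b i j).l :=
    fun z hz => dist_ctr_le_of (by rw [hl]; linarith) geom.1.2 geom.2.2 hz
  have hball : ∀ z ∈ (quarter b i j).box,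
      Metric.ball z ((quarter b i j).l * (Q.κ - 1)) ⊆
        Metric.ball (quarter b i j).ctr ((quarter b i j).l * Q.κ) := by
    intro z hz x hx
    rw [Metric.mem_ball] at hx ⊢
    have := hdist z hz
    have := dist_triangle x z (quarter b i j).ctr
    linarith
  have hbox : (quarter b i j).box ⊆
      Metric.ball (quarter b i j).ctr ((quarter b i j).l * Q.κ) := by
    intro z hz
    exact hball z hz (Metric.mem_ball_self (mul_pos (by rw [hl]; linarith) hκ1))
  have hq0 : (quarter b i j).act = [] := rfl
  simp only [hq0, List.not_mem_nil, false_or] at hmem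
  unfold QParams.child
  constructor
  · rw [e5, hl]; linarith
  · rw [e5, e1, e2]; exact geom.1.1
  · rw [e5, e1, e2]; exact geom.1.2
  · rw [e5, e3, e4]; exact geom.2.1
  · rw [e5, e3, e4]; exact geom.2.2
  · exact Q.nodup_act_foldl _ _ h.nodup (by simp [hq0]) (by simp [hq0])
  · intro t ht
    exact h.act_lt t ((hmem t).1 ht).1
  · refine ⟨I', ?_, ?_, J2, J3, ?_, ?_⟩
    · intro t ht
      rcases (J1 t).1 ht with h | h
      exacts [I1 t h, Good.act_lt ‹_› t h.1]
    · intro t ht ht'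
      obtain ⟨k1, k2⟩ := (hmem t).1 ht
      rcases (J1 t).1 ht' with k | k
      exacts [I2 t k1 k, k2.2 k.2.2]
    · intro t ht z hz
      rw [ebox] at hz
      rw [e5]
      rcases (J1 t).1 ht with k | k
      · refine subset_trans (Metric.ball_subset_ball ?_) (I5 t k z (hsub hz))
        rw [hl]; nlinarith
      · exact (hball z hz).trans (k.2.2.ball_subset k.2.1)
    · intro t ht k1 k2
      rw [ebox, e5]
      by_cases hta : t ∈ b.act
      · have hout : Q.Out (quarter b i j) t := by
          by_contra ho
          by_cases hi : IsIn ((quarter b i j).l * Q.κ) (Q.T t) (quarter b i j).ctr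
          · exact k1 ((J1 t).2 (Or.inr ⟨hta, ho, hi⟩))
          · exact k2 ((hmem t).2 ⟨hta, ho, hi⟩)
        have hv := IsOut.volume_inter_ball (hW t ht) hout
        refine ⟨measure_mono_null (Set.inter_subset_inter_right _ hbox) hv, fun z hz => ?_⟩
        refine measure_mono_null (Set.inter_subset_inter_right _ ?_) hv
        exact (Metric.ball_subset_ball (min_le_left _ _)).trans (hball z hz)
      · obtain ⟨v1, v2⟩ := I6 t ht (fun h => k1 ((J1 t).2 (Or.inl h))) hta
        refine ⟨measure_mono_null (Set.inter_subset_inter_right _ hsub) v1, fun z hz => ?_⟩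
        refine measure_mono_null (Set.inter_subset_inter_right _ ?_) (v2 z (hsub hz))
        refine Metric.ball_subset_ball (min_le_min_right _ ?_)
        rw [hl]; nlinarith

/-- All undecided triangles have been tested for the box of the node. -/
def Tested (b : QNode) : Prop := ∀ t ∈ b.act, Q.Act b t

theorem tested_child (b : QNode) (i j : Bool) : Q.Tested (Q.child b i j) := by
  intro t ht
  have h := (Q.mem_act_foldl b.act (quarter b i j) t).1 ht
  have h0 : (quarter b i j).act = [] := rfl
  simp only [h0, List.not_mem_nil, false_or] at h
  exact ((Q.sameBox_foldl b.act (quarter b i j)).act_iff Q t).2 h.2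

/-! ### Counting -/

theorem sum_volume_le_of_pairwise {α : Type*} {l : List α} {f : α → Set Plane}
    (hm : ∀ a ∈ l, MeasurableSet (f a)) (hd : l.Pairwise fun a b => Disjoint (f a) (f b))
    {R : Set Plane} (hR : ∀ a ∈ l, f a ⊆ R) : (l.map fun a => volume (f a)).sum ≤ volume R := by
  induction l generalizing R with
  | nil => simp
  | cons a l ih =>
    rw [List.pairwise_cons] at hd
    rw [List.map_cons, List.sum_cons]
    have h1 := ih (fun b hb => hm b (by simp [hb])) hd.2 (R := R \ f a) (fun b hb =>
      Set.subset_sdiff.2 ⟨hR b (by simp [hb]), (hd.1 b hb).symm⟩)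
    calc volume (f a) + _ ≤ volume (f a) + volume (R \ f a) := by gcongr
      _ = volume R := by
        rw [← measure_inter_add_sdiff R (hm a (by simp)),
          Set.inter_eq_right.2 (hR a (by simp))]

theorem volume_hbox {x₀ x₁ y₀ y₁ : ℝ} (hx : x₀ ≤ x₁) :
    volume (hbox x₀ x₁ y₀ y₁) = ENNReal.ofReal ((x₁ - x₀) * (y₁ - y₀)) := by
  rw [← Plane.volume_preserving.measure_preimage (measurableSet_hbox _ _ _ _).nullMeasurableSet]
  have : (fun p : ℝ × ℝ => (!₂[p.1, p.2] : Plane)) ⁻¹' hbox x₀ x₁ y₀ y₁ =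
      Set.Ico x₀ x₁ ×ˢ Set.Ico y₀ y₁ := by
    ext ⟨x, y⟩
    simp [hbox, and_assoc]
  rw [this, Measure.volume_eq_prod, Measure.prod_prod, Real.volume_Ico, Real.volume_Ico,
    ENNReal.ofReal_mul (by linarith)]

theorem Good.volume_box {Q : QParams} {b : QNode} (h : Q.Good b) :
    volume b.box = ENNReal.ofReal b.area :=
  volume_hbox (by linarith [h.dx_ge, h.l_pos])

end QParams


namespace QParams

variable (Q : QParams)

/-- Few disjoint boxes of the same size have a given triangle undecided. -/
theorem count_act_le {Q : QParams} (hκ : 1 ≤ Q.κ)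
    (hT : ∀ t < Q.N, ∀ a c, dist (Q.T t a) (Q.T t c) ≤ Q.W) {ℓ : ℝ} (hℓ : 0 < ℓ)
    (hℓW : ℓ ≤ 4 * Q.W) {L : List QNode} (hL : ∀ b ∈ L, Q.Good b ∧ Q.Tested b ∧ b.l = ℓ)
    (hd : L.Pairwise fun b c => Disjoint b.box c.box) {t : ℕ} (ht : t < Q.N) :
    (L.countP (t ∈ ·.act) : ℝ) ≤ 576 * (Q.κ + 1) ^ 2 * Q.W / ℓ := by
  set L' := L.filter (t ∈ ·.act) with hL'
  have hW : 0 < Q.W := by linarith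
  have hmem : ∀ b ∈ L', (Q.Good b ∧ Q.Tested b ∧ b.l = ℓ) ∧ t ∈ b.act := by
    intro b hb
    rw [hL', List.mem_filter] at hb
    exact ⟨hL b hb.1, by simpa using hb.2⟩
  set r := (Q.κ + 1) * ℓ with hr
  have hr0 : 0 ≤ r := by positivity
  -- A point of such a box has distance at most `ℓ` from the center, the center `W + κ * ℓ` from the
  -- first vertex, and that one `W` from the others; as `ℓ ≤ 4 * W`, this is at most `6 * (κ + 1) *
  -- W`.
  set M := 6 * (Q.κ + 1) * Q.W with hM
  set R : Fin 3 → Set Plane := fun k => if Q.T t k = Q.T t (k + 1) then ∅ else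
    {z : Plane | dist z (Q.T t k) ≤ M ∧
      |cross (Q.T t k) (Q.T t (k + 1)) z| ≤ r * dist (Q.T t k) (Q.T t (k + 1))} with hR
  have hRv : ∀ k, volume (R k) ≤ ENNReal.ofReal (8 * r * M) := by
    intro k
    simp only [hR]
    split_ifs with h
    · simp
    · exact volume_strip_le _ _ h hr0
  have hsub : ∀ b ∈ L', b.box ⊆ ⋃ k, R k := by
    intro b hb z hz
    obtain ⟨⟨hg, hte, hbl⟩, hta⟩ := hmem b hb
    obtain ⟨ho, hi⟩ := hte t hta
    obtain ⟨h1, k, h2, h3⟩ := strip_of_not_isOut_of_not_isIn ho hi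
    have hzc := hg.dist_ctr_le hz
    rw [hbl] at h1 h3 hzc
    refine Set.mem_iUnion.2 ⟨k, ?_⟩
    simp only [hR, if_neg h2]
    constructor
    · have k1 := dist_triangle z b.ctr (Q.T t k)
      have k2 := dist_triangle b.ctr (Q.T t 0) (Q.T t k)
      have k3 := hT t ht 0 k
      rw [hM]
      nlinarith
    · have k1 := abs_cross_sub_le (Q.T t k) (Q.T t (k + 1)) z b.ctr
      have k2 := abs_sub_abs_le_abs_sub (cross (Q.T t k) (Q.T t (k + 1)) z)
        (cross (Q.T t k) (Q.T t (k + 1)) b.ctr)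
      have k3 : dist (Q.T t k) (Q.T t (k + 1)) * dist z b.ctr ≤
        dist (Q.T t k) (Q.T t (k + 1)) * ℓ := by gcongr
      rw [hr]
      nlinarith
  have hsum := sum_volume_le_of_pairwise (l := L') (f := QNode.box)
    (fun b _ => measurableSet_hbox _ _ _ _) (hd.filter _) hsub
  have hlow : L'.length • ENNReal.ofReal (ℓ ^ 2 / 4) ≤ (L'.map fun b => volume b.box).sum := by
    rw [← List.length_map (fun b : QNode => volume b.box)]
    refine List.card_nsmul_le_sum _ _ fun x hx => ?_
    obtain ⟨b, hb, rfl⟩ := List.mem_map.1 hx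
    obtain ⟨⟨hg, -, hbl⟩, -⟩ := hmem b hb
    rw [hg.volume_box]
    apply ENNReal.ofReal_le_ofReal
    have h1 := hg.dx_ge; have h2 := hg.dy_ge
    rw [hbl] at h1 h2
    unfold QNode.area
    nlinarith
  have hup : volume (⋃ k, R k) ≤ ENNReal.ofReal (3 * (8 * r * M)) := by
    refine (measure_iUnion_le _).trans ?_
    rw [tsum_fintype]
    refine (Finset.sum_le_sum fun k _ => hRv k).trans ?_
    rw [Finset.sum_const, Finset.card_univ, Fintype.card_fin, ← ENNReal.ofReal_nsmul, nsmul_eq_mul]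
    norm_num
  have hfin := hlow.trans (hsum.trans hup)
  have hcount : L.countP (t ∈ ·.act) = L'.length := by
    rw [hL', List.countP_eq_length_filter]
  rw [← ENNReal.ofReal_nsmul, ENNReal.ofReal_le_ofReal_iff (by positivity), nsmul_eq_mul] at hfin
  rw [hcount, le_div_iff₀ hℓ]
  -- Three strips of area at most `8 * r * M` contain disjoint boxes of area at least `ℓ ^ 2 / 4`:
  -- the constant is `3 * 8 * 6 * 4 = 576`.
  have : (L'.length : ℝ) * ℓ * ℓ ≤ 576 * (Q.κ + 1) ^ 2 * Q.W * ℓ := by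
    rw [hr, hM] at hfin
    nlinarith
  exact le_of_mul_le_mul_right this hℓ

/-- Double counting of the pairs of a box and one of its undecided triangles. -/
theorem sum_length_act {Q : QParams} {L : List QNode}
    (hL : ∀ b ∈ L, b.act.Nodup ∧ ∀ t ∈ b.act, t < Q.N) :
    (L.map fun b => b.act.length).sum = ∑ t ∈ Finset.range Q.N, L.countP (t ∈ ·.act) := by
  induction L with
  | nil => simp
  | cons b L ih =>
    rw [List.map_cons, List.sum_cons, ih fun c hc => hL c (by simp [hc])]
    have h1 : b.act.length = ∑ t ∈ Finset.range Q.N, if t ∈ b.act then 1 else 0 := by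
      rw [← Finset.card_filter, ← List.toFinset_card_of_nodup (hL b (by simp)).1]
      congr 1
      ext t
      simp only [Finset.mem_filter, Finset.mem_range, List.mem_toFinset]
      exact ⟨fun h => ⟨(hL b (by simp)).2 t h, h⟩, fun h => h.2⟩
    rw [h1, ← Finset.sum_add_distrib]
    refine Finset.sum_congr rfl fun t _ => ?_
    rw [List.countP_cons]
    simp [add_comm]

/-! ### Roots and generations of the subdivision -/

/-- The roots of the subdivision. -/
structure IsRoots (roots : List QNode) : Prop where
  good : ∀ b ∈ roots, Q.Good b
  l_eq : ∀ b ∈ roots, b.l = 4 * Q.W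
  disjoint : roots.Pairwise fun b c => Disjoint b.box c.box
  cover : ∀ t < Q.N, ∀ z ∈ solidTriangle (Q.T t), ∃ b ∈ roots, z ∈ b.box
  sum_act : (roots.map fun b => b.act.length).sum ≤ 9 * Q.N
  length_le : roots.length ≤ 9 * Q.N

open Classical in
/-- The region of a leaf; nothing for the other nodes. -/
noncomputable def leafBox (b : QNode) : Set Plane := if Q.Leaf b then b.box else ∅

theorem leafBox_subset (b : QNode) : Q.leafBox b ⊆ b.box := by
  unfold leafBox; split_ifs <;> simp

/-- The nodes of depth less than `j`. -/
noncomputable def upTo (roots : List QNode) : ℕ → List QNode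
  | 0 => []
  | j + 1 => upTo roots j ++ Q.level roots j

theorem mem_children {b c : QNode} : c ∈ Q.children b ↔ ¬ Q.Leaf b ∧ ∃ i j, c = Q.child b i j := by
  unfold children
  split_ifs with h
  · simp [h]
  · simp [h, quarters]
    tauto

variable {Q} {roots : List QNode}

/-- The properties of all nodes of depth `j`. -/
theorem IsRoots.level (hr : Q.IsRoots roots) (hκ : 1 < Q.κ)
    (hW : ∀ t < Q.N, ∀ a c, dist (Q.T t a) (Q.T t c) ≤ Q.W) (j : ℕ) :
    ∀ b ∈ Q.level roots j, Q.Good b ∧ b.l = 4 * Q.W / 2 ^ j ∧ (j ≠ 0 → Q.Tested b) := by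
  induction j with
  | zero => intro b hb; exact ⟨hr.good b hb, by simp [hr.l_eq b hb], by simp⟩
  | succ j ih =>
    intro b hb
    obtain ⟨a, ha, hb⟩ := List.mem_flatMap.1 hb
    obtain ⟨-, x, y, rfl⟩ := Q.mem_children.1 hb
    obtain ⟨h1, h2, -⟩ := ih a ha
    refine ⟨h1.child hκ hW x y, ?_, fun _ => Q.tested_child a x y⟩
    have : (Q.child a x y).l = a.l / 2 := (Q.sameBox_foldl a.act (quarter a x y)).2.2.2.2
    rw [this, h2, pow_succ]
    field_simp

theorem child_box {b : QNode} (i j : Bool) : (Q.child b i j).box = (quarter b i j).box :=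
  (Q.sameBox_foldl b.act (quarter b i j)).box_eq

theorem Good.children_subset {b c : QNode} (h : Q.Good b) (hc : c ∈ Q.children b) :
    c.box ⊆ b.box := by
  obtain ⟨-, i, j, rfl⟩ := Q.mem_children.1 hc
  rw [child_box]
  exact quarter_box_subset h i j

theorem Good.children_cover {b : QNode} (_h : Q.Good b) (hl : ¬ Q.Leaf b) {z : Plane}
    (hz : z ∈ b.box) : ∃ c ∈ Q.children b, z ∈ c.box := by
  obtain ⟨h1, h2, h3, h4⟩ := hz
  refine ⟨Q.child b (decide ((b.x₀ + b.x₁) / 2 ≤ z 0)) (decide ((b.y₀ + b.y₁) / 2 ≤ z 1)),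
    Q.mem_children.2 ⟨hl, _, _, rfl⟩, ?_⟩
  rw [child_box]
  by_cases hx : (b.x₀ + b.x₁) / 2 ≤ z 0 <;> by_cases hy : (b.y₀ + b.y₁) / 2 ≤ z 1 <;>
    simp [quarter, QNode.box, hbox, hx, hy, h1, h2, h3, h4, not_le.1]

theorem disjoint_quarter_box (b : QNode) {k k' : Bool × Bool} (h : k ≠ k') :
    Disjoint (quarter b k.1 k.2).box (quarter b k'.1 k'.2).box := by
  rw [Set.disjoint_left]
  rintro z ⟨h1, h2, h3, h4⟩ ⟨h5, h6, h7, h8⟩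
  rcases k with ⟨i, j⟩
  rcases k' with ⟨i', j'⟩
  cases i <;> cases j <;> cases i' <;> cases j' <;> simp [quarter] at * <;> linarith

theorem children_pairwise (b : QNode) :
    (Q.children b).Pairwise fun b c => Disjoint b.box c.box := by
  unfold children
  split_ifs
  · simp
  · rw [List.pairwise_map]
    have : quarters.Nodup := by decide
    refine this.imp fun h => ?_
    rw [child_box, child_box]
    exact disjoint_quarter_box b h

/-- The three claims support each other in the induction: a leaf has no children, so its box stays
disjoint from all nodes of later generations. -/
theorem IsRoots.pairwise (hr : Q.IsRoots roots) (hκ : 1 < Q.κ)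
    (hW : ∀ t < Q.N, ∀ a c, dist (Q.T t a) (Q.T t c) ≤ Q.W) (j : ℕ) :
    (Q.level roots j).Pairwise (fun b c => Disjoint b.box c.box) ∧
    (Q.upTo roots j).Pairwise (fun b c => Disjoint (Q.leafBox b) (Q.leafBox c)) ∧
    ∀ b ∈ Q.upTo roots j, ∀ c ∈ Q.level roots j, Disjoint (Q.leafBox b) c.box := by
  induction j with
  | zero => exact ⟨hr.disjoint, by simp [upTo], by simp [upTo]⟩
  | succ j ih =>
    obtain ⟨h1, h2, h3⟩ := ih
    have hg := fun b hb => (hr.level hκ hW j b hb).1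
    refine ⟨?_, ?_, ?_⟩
    · rw [QParams.level, List.pairwise_flatMap]
      refine ⟨fun a _ => children_pairwise a, ?_⟩
      refine h1.imp_of_mem fun ha hb hab x hx y hy => ?_
      exact hab.mono ((hg _ ha).children_subset hx) ((hg _ hb).children_subset hy)
    · rw [upTo, List.pairwise_append]
      refine ⟨h2, h1.imp fun h => h.mono (Q.leafBox_subset _) (Q.leafBox_subset _), ?_⟩
      intro b hb c hc
      exact (h3 b hb c hc).mono_right (Q.leafBox_subset _)
    · intro b hb c hc
      obtain ⟨a, ha, hc⟩ := List.mem_flatMap.1 hc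
      have hca := (hg a ha).children_subset hc
      rw [upTo, List.mem_append] at hb
      rcases hb with hb | hb
      · exact (h3 b hb a ha).mono_right hca
      · by_cases hl : Q.Leaf b
        · have hab : b ≠ a := by rintro rfl; exact (Q.mem_children.1 hc).1 hl
          have : Std.Symm fun b c : QNode => Disjoint b.box c.box := ⟨fun _ _ h => h.symm⟩
          have := h1.forall hb ha hab
          exact this.mono (Q.leafBox_subset _) hca
        · simp [leafBox, hl]

theorem IsRoots.cover_leaf (hr : Q.IsRoots roots) (hκ : 1 < Q.κ)
    (hW : ∀ t < Q.N, ∀ a c, dist (Q.T t a) (Q.T t c) ≤ Q.W) {z : Plane}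
    (hz : ∃ b ∈ roots, z ∈ b.box) (j : ℕ) :
    (∃ b ∈ Q.upTo roots j, z ∈ Q.leafBox b) ∨ ∃ b ∈ Q.level roots j, z ∈ b.box := by
  induction j with
  | zero => exact Or.inr hz
  | succ j ih =>
    rcases ih with ⟨b, hb, hzb⟩ | ⟨b, hb, hzb⟩
    · exact Or.inl ⟨b, by simp [upTo, hb], hzb⟩
    · by_cases hl : Q.Leaf b
      · exact Or.inl ⟨b, by simp [upTo, hb], by simpa [leafBox, hl] using hzb⟩
      · obtain ⟨c, hc, hzc⟩ := (hr.level hκ hW j b hb).1.children_cover hl hzb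
        exact Or.inr ⟨c, List.mem_flatMap.2 ⟨b, hb, hc⟩, hzc⟩

/-- Only nodes with undecided triangles are split. Hence the number of nodes is controlled by the
total length of the lists of undecided triangles. -/
theorem length_children_le (b : QNode) : (Q.children b).length ≤ 4 * b.act.length := by
  unfold children
  split_ifs with h
  · simp
  · have : b.act ≠ [] := fun h' => h (Or.inl h')
    have := List.length_pos_iff.2 this
    simp [quarters]
    omega

/-- The boxes of depth `j` have size `4 * W / 2 ^ j`, so the count `576 * (κ + 1) ^ 2 * W / ℓ` for
each triangle becomes `144 * (κ + 1) ^ 2 * 2 ^ j`. The lists of the roots have not been tested and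
are bounded by their construction instead. -/
theorem IsRoots.sum_act_level (hr : Q.IsRoots roots) (hκ : 1 < Q.κ) (hW0 : 0 < Q.W)
    (hW : ∀ t < Q.N, ∀ a c, dist (Q.T t a) (Q.T t c) ≤ Q.W) (j : ℕ) :
    ((((Q.level roots j).map fun b => b.act.length).sum : ℕ) : ℝ) ≤
      if j = 0 then (9 * Q.N : ℝ) else Q.N * (144 * (Q.κ + 1) ^ 2 * 2 ^ j) := by
  rcases eq_or_ne j 0 with rfl | hj
  · rw [if_pos rfl]
    exact_mod_cast hr.sum_act
  · have hl := hr.level hκ hW j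
    rw [sum_length_act (Q := Q) (fun b hb => ⟨(hl b hb).1.nodup, (hl b hb).1.act_lt⟩), if_neg hj]
    push_cast
    have h1 : ∀ t ∈ Finset.range Q.N, ((Q.level roots j).countP (t ∈ ·.act) : ℝ) ≤
        144 * (Q.κ + 1) ^ 2 * 2 ^ j := by
      intro t ht
      refine (count_act_le hκ.le hW (ℓ := 4 * Q.W / 2 ^ j) (by positivity) ?_
        (fun b hb => ⟨(hl b hb).1, (hl b hb).2.2 hj, (hl b hb).2.1⟩) (hr.pairwise hκ hW j).1
        (Finset.mem_range.1 ht)).trans_eq ?_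
      · exact div_le_self (by positivity) (one_le_pow₀ (by norm_num))
      · field_simp; norm_num
    have h2 := Finset.sum_le_sum h1
    rw [Finset.sum_const, Finset.card_range, nsmul_eq_mul] at h2
    exact h2

theorem IsRoots.sum_act_upTo (hr : Q.IsRoots roots) (hκ : 1 < Q.κ) (hW0 : 0 < Q.W)
    (hW : ∀ t < Q.N, ∀ a c, dist (Q.T t a) (Q.T t c) ≤ Q.W) (j : ℕ) :
    ((((Q.upTo roots (j + 1)).map fun b => b.act.length).sum : ℕ) : ℝ) ≤
      9 * Q.N + if j = 0 then 0 else Q.N * (144 * (Q.κ + 1) ^ 2 * (2 * 2 ^ j)) := by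
  induction j with
  | zero =>
    have := hr.sum_act_level hκ hW0 hW 0
    simpa [upTo] using this
  | succ j ih =>
    have h1 := hr.sum_act_level hκ hW0 hW (j + 1)
    rw [if_neg (by omega)] at h1
    rw [upTo, List.map_append, List.sum_append, if_neg (by omega), Nat.cast_add]
    have h2 : (if j = 0 then 0 else Q.N * (144 * (Q.κ + 1) ^ 2 * (2 * 2 ^ j)) : ℝ) ≤
        Q.N * (144 * (Q.κ + 1) ^ 2 * (2 * 2 ^ j)) := by
      split_ifs
      · positivity
      · exact le_rfl
    have e : (2 : ℝ) ^ (j + 1) = 2 ^ j * 2 := pow_succ _ _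
    rw [e] at h1 ⊢
    linarith

/-- The nodes of all depths, in the order of their creation. -/
structure IsTree (Q : QParams) (roots all : List QNode) : Prop where
  good : ∀ b ∈ all, Q.Good b
  disjoint : all.Pairwise fun b c => Disjoint (Q.leafBox b) (Q.leafBox c)
  cover : ∀ t < Q.N, ∀ z ∈ solidTriangle (Q.T t), ∃ b ∈ all, z ∈ Q.leafBox b
  eq : all = roots ++ all.flatMap Q.children
  lt_length : ∀ i < all.length, i < (roots ++ (all.take i).flatMap Q.children).length
  sum_act : (((all.map fun b => b.act.length).sum : ℕ) : ℝ) ≤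
    9 * Q.N + Q.N * (2304 * (Q.κ + 1) ^ 2 * Q.W / Q.sz)
  length_le : all.length ≤ 9 * Q.N + 4 * (all.map fun b => b.act.length).sum

theorem upTo_succ_eq (j : ℕ) :
    Q.upTo roots (j + 1) = roots ++ (Q.upTo roots j).flatMap Q.children := by
  induction j with
  | zero => simp [upTo, QParams.level]
  | succ j ih =>
    rw [upTo, ih, List.append_assoc]
    congr 1
    have : Q.upTo roots (j + 1) = Q.upTo roots j ++ Q.level roots j := rfl
    rw [← ih, this, List.flatMap_append]
    rfl

theorem IsTree.prefix {all : List QNode} (h : Q.IsTree roots all) (i : ℕ) :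
    roots ++ (all.take i).flatMap Q.children <+: all := by
  conv_rhs => rw [h.eq]
  refine (List.prefix_append_right_inj _).2 ?_
  obtain ⟨r, hr⟩ := List.take_prefix i all
  conv_rhs => rw [← hr, List.flatMap_append]
  exact List.prefix_append _ _

theorem flatMap_prefix {α β : Type*} (f : α → List β) {l l' : List α} (h : l <+: l') :
    l.flatMap f <+: l'.flatMap f := by
  obtain ⟨r, rfl⟩ := h
  rw [List.flatMap_append]
  exact List.prefix_append _ _

theorem IsRoots.exists_tree (hr : Q.IsRoots roots) (hκ : 1 < Q.κ) (hW0 : 0 < Q.W) (hsz : 0 < Q.sz)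
    (hW : ∀ t < Q.N, ∀ a c, dist (Q.T t a) (Q.T t c) ≤ Q.W) :
    ∃ all, Q.IsTree roots all := by
  classical
  have hex : ∃ J : ℕ, 4 * Q.W / 2 ^ J ≤ Q.sz := by
    obtain ⟨J, hJ⟩ := pow_unbounded_of_one_lt (4 * Q.W / Q.sz) (one_lt_two (α := ℝ))
    refine ⟨J, ?_⟩
    rw [div_lt_iff₀ hsz] at hJ
    rw [div_le_iff₀ (by positivity)]
    linarith
  -- `J` is the first depth at which the boxes have reached the smallest size, so there is no
  -- generation `J + 1`; minimality bounds `2 ^ J` from above.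
  set J := Nat.find hex with hJdef
  have hJ : 4 * Q.W / 2 ^ J ≤ Q.sz := Nat.find_spec hex
  have hleaf : ∀ b ∈ Q.level roots J, Q.Leaf b := fun b hb =>
    Or.inr (by rw [(hr.level hκ hW J b hb).2.1]; exact hJ)
  have hnil : Q.level roots (J + 1) = [] := by
    rw [QParams.level, List.flatMap_eq_nil_iff]
    intro b hb
    simp [children, hleaf b hb]
  have heq : Q.upTo roots (J + 1) =
      roots ++ (Q.upTo roots (J + 1)).flatMap Q.children := by
    have : Q.upTo roots (J + 1 + 1) = Q.upTo roots (J + 1) ++ Q.level roots (J + 1) := rfl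
    rw [← upTo_succ_eq, this, hnil, List.append_nil]
  have hgood : ∀ j, ∀ b ∈ Q.upTo roots j, Q.Good b := by
    intro j
    induction j with
    | zero => simp [upTo]
    | succ j ih =>
      intro b hb
      rw [upTo, List.mem_append] at hb
      exact hb.elim (ih b) fun hb => (hr.level hκ hW j b hb).1
  refine ⟨Q.upTo roots (J + 1), hgood _, (hr.pairwise hκ hW (J + 1)).2.1, ?_, heq, ?_, ?_, ?_⟩
  · intro t ht z hz
    have := hr.cover_leaf hκ hW (hr.cover t ht z hz) (J + 1)
    simpa [hnil] using this
  · intro i hi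
    by_contra! hcon
    -- If the queue were exhausted after `i` nodes, the set of nodes created so far would be closed
    -- under taking children, and thus would contain all generations.
    set A := roots ++ ((Q.upTo roots (J + 1)).take i).flatMap Q.children with hA
    have hAp : A <+: Q.upTo roots (J + 1) := by
      conv_rhs => rw [heq]
      exact (List.prefix_append_right_inj _).2 (flatMap_prefix _ (List.take_prefix _ _))
    have hAt : A <+: (Q.upTo roots (J + 1)).take i :=
      List.prefix_take_iff.2 ⟨hAp, hcon⟩
    have key : ∀ j, Q.upTo roots j <+: A := by
      intro j
      induction j with
      | zero => simp [upTo]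
      | succ j ih =>
        rw [upTo_succ_eq]
        exact (List.prefix_append_right_inj _).2 (flatMap_prefix _ (ih.trans hAt))
    have := (key (J + 1)).length_le
    omega
  · refine (hr.sum_act_upTo hκ hW0 hW J).trans ?_
    gcongr
    split_ifs with h0
    · positivity
    -- Minimality gives `2 ^ J < 8 * W / sz`, and `144 * 2 * 8 = 2304`.
    · have hlt := Nat.find_min hex (m := J - 1) (by omega)
      obtain ⟨J', hJ'⟩ : ∃ J', J = J' + 1 := ⟨J - 1, by omega⟩
      rw [hJ', Nat.add_sub_cancel, not_le, lt_div_iff₀ (by positivity)] at hlt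
      have e : (2 : ℝ) ^ (J' + 1) = 2 ^ J' * 2 := pow_succ _ _
      rw [hJ', e]
      gcongr
      rw [le_div_iff₀ hsz]
      have : 0 < (Q.κ + 1) ^ 2 := by have : 0 < Q.κ + 1 := by linarith
                                     positivity
      nlinarith
  · have h1 : ∀ l : List QNode, (l.flatMap Q.children).length ≤
        4 * (l.map fun b => b.act.length).sum := by
      intro l
      induction l with
      | nil => simp
      | cons b l ih =>
        rw [List.flatMap_cons, List.length_append, List.map_cons, List.sum_cons]
        have := Q.length_children_le b
        omega
    have h2 := hr.length_le
    conv_lhs => rw [heq]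
    rw [List.length_append]
    have := h1 (Q.upTo roots (J + 1))
    omega

end QParams


/-! ### The weights of the nodes, and the leaves as a cell system -/

namespace QParams

variable (Q : QParams)

open Classical in
/-- The mass of the undecided triangles with `g` in the box of a node. -/
noncomputable def actArea (b : QNode) (g : ℕ → Prop) : ℝ :=
  (b.act.map fun t => if g t then boxArea (Q.T t) b.x₀ b.x₁ b.y₀ b.y₁ else 0).sum

open Classical in
/-- The mass that is sent from the box of a node. -/
noncomputable def srcW (b : QNode) : ℝ :=
  if Q.Leaf b then if b.act = [] then (b.p - b.s : ℕ) * b.area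
    else b.p * b.area + Q.actArea b (· < Q.n) else 0

open Classical in
/-- The mass that is received in the box of a node. -/
noncomputable def tgtW (b : QNode) : ℝ :=
  if Q.Leaf b then if b.act = [] then (b.s - b.p : ℕ) * b.area
    else b.s * b.area + Q.actArea b (¬ · < Q.n) else 0

/-- The density of the mass that stays in the box of a node. -/
noncomputable def stayW (b : QNode) : ℝ := if b.act = [] then (b.p - (b.p - b.s) : ℕ) else 0

/-- The measure with the mass of the triangles with `g`. -/
def HasMass (μ : Measure Plane) (g : ℕ → Prop) [DecidablePred g] : Prop :=
  ∀ X, MeasurableSet X →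
    μ X = ∑ t ∈ (Finset.range Q.N).filter g, volume (solidTriangle (Q.T t) ∩ X)

variable {Q} {μ ν : Measure Plane} {g : ℕ → Prop} [DecidablePred g]

theorem mass_eq_mul (hμ : Q.HasMass μ g) {I : Finset ℕ} (hI : ∀ t ∈ I, t < Q.N) {X : Set Plane}
    (hX : MeasurableSet X) (h1 : ∀ t ∈ I, X ⊆ solidTriangle (Q.T t))
    (h2 : ∀ t < Q.N, t ∉ I → volume (solidTriangle (Q.T t) ∩ X) = 0) :
    μ X = (I.filter g).card * volume X := by
  rw [hμ X hX, ← nsmul_eq_mul, ← Finset.sum_const]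
  symm
  refine (Finset.sum_congr rfl fun t ht => ?_).trans (Finset.sum_subset (s₁ := I.filter g)
    (f := fun t => volume (solidTriangle (Q.T t) ∩ X)) ?_ ?_)
  · rw [Set.inter_eq_right.2 (h1 t (Finset.mem_filter.1 ht).1)]
  · intro t ht
    simp only [Finset.mem_filter, Finset.mem_range] at ht ⊢
    exact ⟨hI t ht.1, ht.2⟩
  · intro t ht ht'
    simp only [Finset.mem_filter, Finset.mem_range, not_and] at ht ht'
    exact h2 t ht.1 fun h => ht' h ht.2

theorem Good.volumeReal_box {b : QNode} (h : Q.Good b) : volume.real b.box = b.area := by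
  rw [Measure.real, h.volume_box, ENNReal.toReal_ofReal]
  have := h.l_pos; have := h.dx_ge; have := h.dy_ge
  exact mul_nonneg (by linarith) (by linarith)

/-- Each triangle either covers the box, or misses it up to a null set, or is undecided; the
undecided ones contribute their exact areas in the box. -/
theorem Good.mass_box {b : QNode} (h : Q.Good b) (hμ : Q.HasMass μ g) (hκ : 1 < Q.κ) {I : Finset ℕ}
    (hI : ∀ t ∈ I, t < Q.N) (hd : ∀ t ∈ b.act, t ∉ I)
    (h1 : ∀ t ∈ I, ∀ z ∈ b.box, Metric.ball z (b.l * (Q.κ - 1)) ⊆ solidTriangle (Q.T t))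
    (h2 : ∀ t < Q.N, t ∉ I → t ∉ b.act → volume (solidTriangle (Q.T t) ∩ b.box) = 0) :
    μ.real b.box = (I.filter g).card * b.area + Q.actArea b g := by
  have hb : MeasurableSet b.box := measurableSet_hbox _ _ _ _
  have hfin : volume b.box ≠ ⊤ := by rw [h.volume_box]; exact ENNReal.ofReal_ne_top
  have hfin' : ∀ t, volume (solidTriangle (Q.T t) ∩ b.box) ≠ ⊤ := fun t =>
    measure_ne_top_of_subset Set.inter_subset_right hfin
  have hl := h.l_pos
  have harea := h.volumeReal_box
  rw [Measure.real, hμ _ hb, ENNReal.toReal_sum fun t _ => hfin' t]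
  have key : ∀ t ∈ (Finset.range Q.N).filter g, (volume (solidTriangle (Q.T t) ∩ b.box)).toReal =
      (if t ∈ I.filter g then b.area else 0) + if t ∈ b.act.toFinset then
        (if g t then boxArea (Q.T t) b.x₀ b.x₁ b.y₀ b.y₁ else 0) else 0 := by
    intro t ht
    simp only [Finset.mem_filter, Finset.mem_range, List.mem_toFinset] at ht ⊢
    by_cases hta : t ∈ b.act
    · rw [if_neg (fun h => hd t hta h.1), if_pos hta, if_pos ht.2, zero_add, boxArea_eq]
      · rfl
      · linarith [h.dy_ge]
    · rw [if_neg hta, add_zero]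
      by_cases hti : t ∈ I
      · rw [if_pos ⟨hti, ht.2⟩, Set.inter_eq_right.2, ← harea]
        · rfl
        · intro z hz
          exact h1 t hti z hz (Metric.mem_ball_self (mul_pos hl (by linarith)))
      · rw [if_neg (fun h => hti h.1), h2 t ht.1 hti hta]
        rfl
  rw [Finset.sum_congr rfl key, Finset.sum_add_distrib]
  congr 1
  · rw [Finset.sum_ite_mem, Finset.sum_const, nsmul_eq_mul, Finset.inter_eq_right.2]
    intro t ht
    simp only [Finset.mem_filter, Finset.mem_range] at ht ⊢
    exact ⟨hI t ht.1, ht.2⟩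
  · have hsub : b.act.toFinset ⊆ Finset.range Q.N := fun t ht =>
      Finset.mem_range.2 (h.act_lt t (List.mem_toFinset.1 ht))
    rw [actArea, ← List.sum_toFinset _ h.nodup, Finset.sum_filter,
      ← Finset.sum_subset hsub fun t _ ht => by simp only [if_neg ht, ite_self]]
    refine Finset.sum_congr rfl fun t ht => ?_
    rw [if_pos ht]
    split_ifs <;> rfl

theorem natCast_sub_eq_max (p s : ℕ) : ((p - s : ℕ) : ℝ) = max ((p : ℝ) - s) 0 := by
  rcases le_total p s with h | h
  · rw [Nat.sub_eq_zero_of_le h, max_eq_right (by have : (p : ℝ) ≤ s := by exact_mod_cast h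
                                                  linarith), Nat.cast_zero]
  · rw [Nat.cast_sub h, max_eq_left (by have : (s : ℝ) ≤ p := by exact_mod_cast h
                                        linarith)]

/-- A ball in a triangle is not larger than the triangle. -/
theorem le_of_ball_subset {T : Fin 3 → Plane} {W r : ℝ} (hT : ∀ a c, dist (T a) (T c) ≤ W)
    {z : Plane} (h : Metric.ball z r ⊆ solidTriangle T) : r ≤ W := by
  by_contra! hlt
  have hW : 0 ≤ W := dist_nonneg.trans (hT 0 0)
  obtain ⟨ρ, h1, h2⟩ := exists_between hlt
  have hz := h (Metric.mem_ball_self (hW.trans_lt hlt))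
  have hd : dist (z + EuclideanSpace.single 0 ρ) z = ρ := by
    simp [abs_of_pos (hW.trans_lt h1)]
  have hx := @h (z + EuclideanSpace.single 0 ρ) (by rw [Metric.mem_ball, hd]; exact h2)
  have := dist_le_of_mem_solidTriangle hT hx hz
  linarith

theorem IsTree.measure_compl {roots all : List QNode} (h : Q.IsTree roots all) (hμ : Q.HasMass μ g) :
    μ (⋃ i, Q.leafBox (all.get i))ᶜ = 0 := by
  have hm : MeasurableSet (⋃ i, Q.leafBox (all.get i))ᶜ := by
    refine (MeasurableSet.iUnion fun i => ?_).compl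
    unfold leafBox
    split_ifs
    exacts [measurableSet_hbox _ _ _ _, MeasurableSet.empty]
  rw [hμ _ hm]
  refine Finset.sum_eq_zero fun t ht => measure_mono_null (t := ∅) ?_ measure_empty
  rintro z ⟨hz, hz'⟩
  obtain ⟨b, hb, hzb⟩ := h.cover t (Finset.mem_range.1 (Finset.mem_filter.1 ht).1) z hz
  obtain ⟨i, rfl⟩ := List.mem_iff_get.1 hb
  exact hz' (Set.mem_iUnion.2 ⟨i, hzb⟩)

open Classical in
/-- The leaves of the subdivision form a cell system. -/
noncomputable def IsTree.cells {roots all : List QNode} (h : Q.IsTree roots all) (hκ : 1 < Q.κ)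
    (hsz : 0 ≤ Q.sz) {η : ℝ} (hη : η * (Q.κ - 1) = 1)
    (hT : ∀ t < Q.N, ∀ a c, dist (Q.T t a) (Q.T t c) ≤ Q.W)
    (hμ : Q.HasMass μ (· < Q.n)) (hν : Q.HasMass ν (¬ · < Q.n)) :
    CellSystem (Fin all.length) μ ν η Q.sz where
  box i := Q.leafBox (all.get i)
  ctr i := (all.get i).ctr
  rad i := if Q.Leaf (all.get i) then (all.get i).l else 0
  src i := Q.srcW (all.get i)
  tgt i := Q.tgtW (all.get i)
  stay i := stayW (all.get i)
  measurable i := by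
    unfold leafBox
    split_ifs
    exacts [measurableSet_hbox _ _ _ _, MeasurableSet.empty]
  disjoint := by
    intro i j hij
    have := List.pairwise_iff_get.1 h.disjoint
    rcases lt_or_gt_of_ne hij with h' | h'
    exacts [this i j h', (this j i h').symm]
  cover_left := h.measure_compl hμ
  cover_right := h.measure_compl hν
  bounded := by
    refine ⟨∑ i : Fin all.length, ((all.get i).l + ‖(all.get i).ctr‖), fun i z hz => ?_⟩
    have hg := h.good _ (List.get_mem all i)
    have h1 := hg.dist_ctr_le (Q.leafBox_subset _ hz)
    have h2 : ‖z‖ ≤ (all.get i).l + ‖(all.get i).ctr‖ := by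
      rw [dist_eq_norm] at h1
      have := norm_sub_norm_le z (all.get i).ctr
      linarith
    refine h2.trans (Finset.single_le_sum (f := fun i => (all.get i).l + ‖(all.get i).ctr‖)
      (fun j _ => ?_) (Finset.mem_univ i))
    have := (h.good _ (List.get_mem all j)).l_pos
    positivity
  rad_nonneg i := by
    split_ifs
    · exact (h.good _ (List.get_mem all i)).l_pos.le
    · exact le_rfl
  dist_ctr i z hz := by
    unfold leafBox at hz
    split_ifs at hz ⊢
    · exact (h.good _ (List.get_mem all i)).dist_ctr_le hz
    · exact hz.elim
  kind i := by
    set b := all.get i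
    have hg : Q.Good b := h.good _ (List.get_mem all i)
    obtain ⟨I, I1, I2, I3, I4, I5, I6⟩ := hg.counts
    by_cases hl : Q.Leaf b
    -- Nodes that are not leaves are kept as empty cells of radius and weight zero, so that the
    -- index of a cell is its position in memory.
    swap
    · have hne : b.act ≠ [] := fun h => hl (Or.inl h)
      left
      simp [hl, hsz, leafBox, srcW, tgtW, stayW, hne]
    by_cases ha : b.act = []
    swap
    · left
      refine ⟨by simpa [hl] using hl.resolve_left ha, ?_, ?_, by simp [stayW, ha]⟩
      · simp only [leafBox, srcW, if_pos hl, if_neg ha]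
        rw [hg.mass_box hμ hκ I1 I2 I5 fun t h1 h2 h3 => (I6 t h1 h2 h3).1, I3]
      · simp only [leafBox, tgtW, if_pos hl, if_neg ha]
        rw [hg.mass_box hν hκ I1 I2 I5 fun t h1 h2 h3 => (I6 t h1 h2 h3).1, I4]
    · right
      have hna : ∀ t, t ∉ b.act := by simp [ha]
      have hlpos := hg.l_pos
      have harea := hg.volumeReal_box
      refine ⟨b.p, b.s, ?_, ?_, ?_, ?_, ?_⟩
      · intro X hX hXb
        simp only [leafBox, if_pos hl] at hXb
        have h1 : ∀ t ∈ I, X ⊆ solidTriangle (Q.T t) := fun t ht z hz =>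
          I5 t ht z (hXb hz) (Metric.mem_ball_self (mul_pos hlpos (by linarith)))
        have h2 : ∀ t < Q.N, t ∉ I → volume (solidTriangle (Q.T t) ∩ X) = 0 := fun t ht ht' =>
          measure_mono_null (Set.inter_subset_inter_right _ hXb) (I6 t ht ht' (hna t)).1
        rw [I3, I4]
        exact ⟨mass_eq_mul hμ I1 hX h1 h2, mass_eq_mul hν I1 hX h1 h2⟩
      · simp only [leafBox, srcW, if_pos hl, if_pos ha, harea, natCast_sub_eq_max]
      · simp only [leafBox, tgtW, if_pos hl, if_pos ha, harea, natCast_sub_eq_max]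
      · simp only [stayW, if_pos ha]
        rw [← Nat.cast_min]
        congr 1
        omega
      · intro hps
        refine ⟨b.l * (Q.κ - 1), ?_, fun z hz X hX hXb => ?_⟩
        · rw [if_pos hl]
          apply le_of_eq
          linear_combination -b.l * hη
        · simp only [leafBox, if_pos hl] at hz
          -- Triangles dropped at the roots are known to be far away only up to the distance `W`. If
          -- `p ≠ s`, some triangle contains a ball of radius `l * (κ - 1)`; hence this radius is at
          -- most `W` and the truncation has no effect.
          have hI : I.Nonempty := by
            rw [Finset.nonempty_iff_ne_empty]
            rintro rfl
            simp [I3, I4] at hps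
          obtain ⟨t₀, ht₀⟩ := hI
          have hr : b.l * (Q.κ - 1) ≤ Q.W :=
            le_of_ball_subset (hT t₀ (I1 t₀ ht₀)) (I5 t₀ ht₀ z hz)
          have h1 : ∀ t ∈ I, X ⊆ solidTriangle (Q.T t) := fun t ht =>
            hXb.trans (I5 t ht z hz)
          have h2 : ∀ t < Q.N, t ∉ I → volume (solidTriangle (Q.T t) ∩ X) = 0 :=
              fun t ht ht' => by
            have := (I6 t ht ht' (hna t)).2 z hz
            rw [min_eq_left hr] at this
            exact measure_mono_null (Set.inter_subset_inter_right _ hXb) this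
          rw [I3, I4]
          exact ⟨mass_eq_mul hμ I1 hX h1 h2, mass_eq_mul hν I1 hX h1 h2⟩

end QParams


/-! ### Selection of the smallest key -/

theorem Tot.solve {A : PointSolver} {u k v l a r : NatExpr} {s : MemState} {Q : MemState → Prop}
    {U V : WeightedPoints} (hU : readPoints s.real (u.eval s) (k.eval s) = U)
    (hV : readPoints s.real (v.eval s) (l.eval s) = V)
    (hQ : Q (writePlan s (a.eval s) (r.eval s) (A.plan U V))) :
    Tot A (.solve u k v l a r) s (A.time U V) Q := by
  refine ⟨_, _, .solve u k v l a r s U V hU.symm hV.symm, ?_, hQ⟩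
  simp only [Program.size]
  nlinarith [Nat.zero_le ((u.cost + k.cost + v.cost + l.cost + a.cost + r.cost) * A.time U V)]

theorem Tot.seqs_flat {A : PointSolver} {c : Program} {l : List Program} {s : MemState} {k : ℕ}
    {Q : MemState → Prop} (hc : c.Flat) (h : Tot A (Program.seqs l) (c.run s) k Q) :
    Tot A (Program.seqs (c :: l)) s k Q :=
  (Tot.seqs_cons (k₁ := 0) (Tot.flat hc h)).mono (by simp) fun _ h => h

theorem Tot.seqs_step {A : PointSolver} {c : Program} {l : List Program} {s : MemState}
    {k₁ k₂ k : ℕ} {Q Q' : MemState → Prop} (h : Tot A c s k₁ Q')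
    (h' : ∀ s', Q' s' → Tot A (Program.seqs l) s' k₂ Q) (hk : k₁ + k₂ ≤ k) :
    Tot A (Program.seqs (c :: l)) s k Q :=
  (Tot.seqs_cons (h.mono le_rfl h')).mono hk fun _ h => h

theorem Tot.seqs_one {A : PointSolver} {c : Program} {s : MemState} {k : ℕ}
    {Q : MemState → Prop} (h : Tot A c s k Q) : Tot A (Program.seqs [c]) s k Q :=
  Tot.seqs_step h (fun _ h => Tot.seqs_nil h) (by simp)

/-- The entry of a real array at an index that is counted from the start of the free memory. -/
def RealExpr.off (j : Fin 64) (i : NatExpr) : RealExpr := .at j (.add (.var 3) i)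

@[simp] theorem RealExpr.eval_off (s : MemState) (j : Fin 64) (i : NatExpr) :
    (RealExpr.off j i).eval s = s.real (_root_.addr j (s.nat (_root_.addr 3 0) + i.eval s)) := rfl

/-- A real variable. -/
def RealExpr.var (j : Fin 64) : RealExpr := .at j (.var 3)

@[simp] theorem RealExpr.eval_var (s : MemState) (j : Fin 64) :
    (RealExpr.var j).eval s = s.real (_root_.addr j (s.nat (_root_.addr 3 0))) := rfl

/-- The test `x < y`. -/
def TestExpr.natLt (x y : NatExpr) : TestExpr := .neg (.natLe y x)

@[simp] theorem TestExpr.holds_natLt (s : MemState) (x y : NatExpr) :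
    (TestExpr.natLt x y).Holds s ↔ x.eval s < y.eval s := by
  simp [TestExpr.natLt, TestExpr.Holds]

@[simp] theorem TestExpr.holds_natLe (s : MemState) (x y : NatExpr) :
    (TestExpr.natLe x y).Holds s ↔ x.eval s ≤ y.eval s := Iff.rfl

@[simp] theorem TestExpr.holds_realLe (s : MemState) (x y : RealExpr) :
    (TestExpr.realLe x y).Holds s ↔ x.eval s ≤ y.eval s := Iff.rfl

@[simp] theorem TestExpr.holds_neg (s : MemState) (p : TestExpr) :
    (TestExpr.neg p).Holds s ↔ ¬ p.Holds s := Iff.rfl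

@[simp] theorem TestExpr.holds_both (s : MemState) (p q : TestExpr) :
    (TestExpr.both p q).Holds s ↔ p.Holds s ∧ q.Holds s := Iff.rfl

@[simp] theorem NatExpr.eval_lit (s : MemState) (k : ℕ) : (NatExpr.lit k).eval s = k := rfl
@[simp] theorem NatExpr.eval_add (s : MemState) (x y : NatExpr) :
    (NatExpr.add x y).eval s = x.eval s + y.eval s := rfl
@[simp] theorem NatExpr.eval_sub (s : MemState) (x y : NatExpr) :
    (NatExpr.sub x y).eval s = x.eval s - y.eval s := rfl
@[simp] theorem NatExpr.eval_mul (s : MemState) (x y : NatExpr) :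
    (NatExpr.mul x y).eval s = x.eval s * y.eval s := rfl
@[simp] theorem RealExpr.eval_add (s : MemState) (x y : RealExpr) :
    (RealExpr.add x y).eval s = x.eval s + y.eval s := rfl
@[simp] theorem RealExpr.eval_sub (s : MemState) (x y : RealExpr) :
    (RealExpr.sub x y).eval s = x.eval s - y.eval s := rfl
@[simp] theorem RealExpr.eval_mul (s : MemState) (x y : RealExpr) :
    (RealExpr.mul x y).eval s = x.eval s * y.eval s := rfl
@[simp] theorem RealExpr.eval_div (s : MemState) (x y : RealExpr) :
    (RealExpr.div x y).eval s = x.eval s / y.eval s := rfl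
@[simp] theorem RealExpr.eval_sqrt (s : MemState) (x : RealExpr) :
    (RealExpr.sqrt x).eval s = Real.sqrt (x.eval s) := rfl
@[simp] theorem RealExpr.eval_ofNat (s : MemState) (x : NatExpr) :
    (RealExpr.ofNat x).eval s = (x.eval s : ℝ) := rfl

@[simp] theorem Program.run_skip (s : MemState) : Program.skip.run s = s := rfl
@[simp] theorem Program.run_setVar (s : MemState) (j : Fin 64) (v : NatExpr) :
    (Program.setVar j v).run s =
      { s with nat := Function.update s.nat (_root_.addr j 0) (v.eval s) } := rfl
@[simp] theorem Program.run_incr (s : MemState) (j : Fin 64) :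
    (Program.incr j).run s =
      { s with nat := Function.update s.nat (_root_.addr j 0) (s.nat (_root_.addr j 0) + 1) } := rfl
@[simp] theorem Program.run_setNat (s : MemState) (a v : NatExpr) :
    (Program.setNat a v).run s = { s with nat := Function.update s.nat (a.eval s) (v.eval s) } := rfl
@[simp] theorem Program.run_setReal (s : MemState) (a : NatExpr) (v : RealExpr) :
    (Program.setReal a v).run s =
      { s with real := Function.update s.real (a.eval s) (v.eval s) } := rfl
@[simp] theorem Program.run_seq (s : MemState) (c d : Program) :
    (Program.seq c d).run s = d.run (c.run s) := rfl
@[simp] theorem Program.run_seqs_nil (s : MemState) : (Program.seqs []).run s = s := rfl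
@[simp] theorem Program.run_seqs_cons (s : MemState) (c : Program) (l : List Program) :
    (Program.seqs (c :: l)).run s = (Program.seqs l).run (c.run s) := rfl
open Classical in
@[simp] theorem Program.run_branch (s : MemState) (p : TestExpr) (c d : Program) :
    (Program.branch p c d).run s = if p.Holds s then c.run s else d.run s := rfl
@[simp] theorem Program.flat_seqs_nil : (Program.seqs []).Flat ↔ True := Iff.rfl
@[simp] theorem Program.flat_seqs_cons (c : Program) (l : List Program) :
    (Program.seqs (c :: l)).Flat ↔ c.Flat ∧ (Program.seqs l).Flat := Iff.rfl
@[simp] theorem Program.flat_setVar (j : Fin 64) (v : NatExpr) :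
    (Program.setVar j v).Flat ↔ True := Iff.rfl
@[simp] theorem Program.flat_incr (j : Fin 64) : (Program.incr j).Flat ↔ True := Iff.rfl

theorem update_addr {α : Type*} (f : ℕ → α) (j j' : Fin 64) (i i' : ℕ) (v : α) :
    Function.update f (addr j i) v (addr j' i') = if j' = j ∧ i' = i then v else f (addr j' i') := by
  rw [Function.update_apply]
  simp only [addr_inj]

/-- The index with the smallest key among the candidates, and the number of this candidate; there
are as many candidates as there are blocks. -/
def argmin (kc : Fin 64) (cand : NatExpr) : Program :=
  .seqs [.setVar 6 (.lit 0), .setVar 7 cand, .setVar 8 (.lit 0),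
    .loop (.natLt (.var 6) (.var 4)) (.seq
      (.branch (.realLe (.off kc (.var 7)) (.off kc cand)) .skip
        (.seq (.setVar 7 cand) (.setVar 8 (.var 6)))) (.incr 6))]

/-- The expression for the candidates may depend on the loop counter but on no other scratch
variable, which is the role of `g`. -/
theorem tot_argmin {A : PointSolver} (kc : Fin 64) (cand : NatExpr) (s : MemState) (g : ℕ → ℕ)
    {B off : ℕ} (hB : s.nat (addr 4 0) = B) (hB0 : 0 < B) (hoff : s.nat (addr 3 0) = off)
    (hg : ∀ s', SameOff [6, 7, 8] s.nat s'.nat → cand.eval s' = g (s'.nat (addr 6 0))) :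
    Tot A (argmin kc cand) s B fun s' => s'.real = s.real ∧ SameOff [6, 7, 8] s.nat s'.nat ∧
      ∃ j < B, s'.nat (addr 7 0) = g j ∧ s'.nat (addr 8 0) = j ∧
        ∀ j' < B, s.real (addr kc (off + g j)) ≤ s.real (addr kc (off + g j')) := by
  have hfr : ∀ s' : MemState, SameOff [6, 7, 8] s.nat s'.nat →
      s'.nat (addr 4 0) = B ∧ s'.nat (addr 3 0) = off := fun s' h =>
    ⟨(h 4 0 (by decide)).trans hB, (h 3 0 (by decide)).trans hoff⟩
  have key := Tot.loopConst (A := A) (p := .natLt (.var 6) (.var 4)) (c := .seq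
      (.branch (.realLe (.off kc (.var 7)) (.off kc cand)) .skip
        (.seq (.setVar 7 cand) (.setVar 8 (.var 6)))) (.incr 6))
    B (fun i s' => s'.real = s.real ∧ SameOff [6, 7, 8] s.nat s'.nat ∧ s'.nat (addr 6 0) = i ∧
      ∃ j < B, s'.nat (addr 7 0) = g j ∧ s'.nat (addr 8 0) = j ∧
        ∀ j' < i, s.real (addr kc (off + g j)) ≤ s.real (addr kc (off + g j'))) 0 ?_ ?_
    (s := (Program.seqs [.setVar 6 (.lit 0), .setVar 7 cand, .setVar 8 (.lit 0)]).run s) ?_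
  · refine Tot.seqs_flat (by simp) (Tot.seqs_flat (by simp) (Tot.seqs_flat (by simp)
      (Tot.seqs_one ?_)))
    refine key.mono (by simp) ?_
    rintro s' ⟨h1, h2, -, h3⟩
    exact ⟨h1, h2, h3⟩
  · rintro i hi s' ⟨h1, h2, h3, j, hj, h4, h4', h5⟩
    obtain ⟨e1, e2⟩ := hfr s' h2
    have hc : cand.eval s' = g i := by rw [hg s' h2, h3]
    refine ⟨by simp [h3, e1, hi], Tot.flat (by simp [Program.Flat]) ?_⟩
    simp only [Program.run_seq, Program.run_branch, TestExpr.holds_realLe, RealExpr.eval_off,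
      NatExpr.eval_var, h1, e2, h4, hc]
    split_ifs with hle
    · refine ⟨h1, h2.update (by simp) _ _, by simp [h3], j, hj, by simp [update_addr, h4],
        by simp [update_addr, h4'], fun j' hj' => ?_⟩
      rcases Nat.lt_succ_iff_lt_or_eq.1 hj' with h | rfl
      exacts [h5 j' h, hle]
    · refine ⟨h1, ((h2.update (by simp) _ _).update (by simp) _ _).update (by simp) _ _,
        by simp [update_addr, h3], i, hi,
        by simp [update_addr, hc], by simp [update_addr, h3], fun j' hj' => ?_⟩
      rcases Nat.lt_succ_iff_lt_or_eq.1 hj' with h | rfl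
      exacts [(not_le.1 hle).le.trans (h5 j' h), le_rfl]
  · rintro s' ⟨-, h2, h3, -⟩
    simp [h3, (hfr s' h2).1]
  · have := hg { s with nat := Function.update s.nat (addr 6 0) 0 }
      ((SameOff.refl _ _).update (by simp) _ _)
    simp only [Function.update_self] at this
    refine ⟨rfl, (((SameOff.refl _ _).update (by simp) _ _).update (by simp) _ _).update (by simp) _ _,
      by simp [update_addr], 0, hB0, by simp [update_addr, this], by simp, by simp⟩

/-! ### Covering numbers by strips -/

/-- The cell of the number with index `i` starts at `start (cell i)`. All cells have a distance of at
least `2 * W`. -/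
structure IsStrips (N : ℕ) (W : ℝ) (key : ℕ → ℝ) (C : ℕ) (start : ℕ → ℝ) (cell : ℕ → ℕ) : Prop where
  le : C ≤ N
  step : ∀ k ≤ C + 1, start k + 2 * W ≤ start (k + 1)
  cell_pos : ∀ i < N, 1 ≤ cell i
  cell_le : ∀ i < N, cell i ≤ C
  start_le : ∀ i < N, start (cell i) ≤ key i
  lt_start : ∀ i < N, key i < start (cell i) + 2 * W

/-- The removal of the element with the smallest key, which was found before, with its number. -/
def removeMin (kc sc cc : Fin 64) : Program :=
  .seqs [
    .branch (.both (.natLe (.lit 1) (.var 9)) (.neg (.realLe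
        (.add (.off sc (.var 9)) (.mul (.num 2) (.var 40))) (.off kc (.var 7))))) .skip
      (.seq (.incr 9) (.setReal (.addr sc (.add (.var 3) (.var 9))) (.off kc (.var 7)))),
    .setNat (.addr cc (.var 7)) (.var 9),
    .setReal (.addr kc (.add (.var 3) (.var 7))) (.var 44),
    .setVar 16 (.var 8)]

/-- One element of the computation of strips. -/
def stripStep (kc sc cc : Fin 64) : Program :=
  .seqs [argmin kc (.at 32 (.var 6)), removeMin kc sc cc,
    argmin kc (.add (.mul (.var 4) (.var 16)) (.var 6)),
    .setNat (.addr 32 (.var 16)) (.var 7), .incr 5]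

/-- The computation of strips for the keys in the column `kc`. -/
def strips (kc sc cc : Fin 64) : Program :=
  .seqs [.setVar 5 (.var 2),
    .loop (.natLt (.var 5) (.mul (.var 4) (.var 4))) (.seq
      (.setReal (.addr kc (.add (.var 3) (.var 5))) (.var 44)) (.incr 5)),
    .setVar 16 (.lit 0),
    .loop (.natLt (.var 16) (.var 4)) (.seqs [
      argmin kc (.add (.mul (.var 4) (.var 16)) (.var 6)),
      .setNat (.addr 32 (.var 16)) (.var 7), .incr 16]),
    .setVar 9 (.lit 0), .setVar 5 (.lit 0),
    .loop (.natLt (.var 5) (.var 2)) (stripStep kc sc cc),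
    .setReal (.addr sc (.add (.var 3) (.lit 0)))
      (.sub (.off sc (.lit 1)) (.mul (.num 2) (.var 40))),
    .setReal (.addr sc (.add (.var 3) (.add (.var 9) (.lit 1))))
      (.add (.off sc (.var 9)) (.mul (.num 4) (.var 40))),
    .setReal (.addr sc (.add (.var 3) (.add (.var 9) (.lit 2))))
      (.add (.off sc (.var 9)) (.mul (.num 8) (.var 40)))]

/-- The state of the computation of strips: the elements of `D` have been removed. -/
structure StripState (N B off : ℕ) (W big : ℝ) (key : ℕ → ℝ) (kc sc cc : Fin 64) (D : Finset ℕ)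
    (s : MemState) : Prop where
  N_eq : s.nat (addr 2 0) = N
  off_eq : s.nat (addr 3 0) = off
  B_eq : s.nat (addr 4 0) = B
  W_eq : s.real (addr 40 off) = W
  big_eq : s.real (addr 44 off) = big
  key_eq : ∀ i < B * B, s.real (addr kc (off + i)) = if i < N ∧ i ∉ D then key i else big
  D_lt : ∀ i ∈ D, i < N
  D_pos : 0 < D.card → 0 < s.nat (addr 9 0)
  le_card : s.nat (addr 9 0) ≤ D.card
  step : ∀ k, 1 ≤ k → k < s.nat (addr 9 0) →
    s.real (addr sc (off + k)) + 2 * W ≤ s.real (addr sc (off + (k + 1)))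
  le_key : 0 < s.nat (addr 9 0) → ∀ i < N, i ∉ D → s.real (addr sc (off + s.nat (addr 9 0))) ≤ key i
  cell_pos : ∀ i ∈ D, 1 ≤ s.nat (addr cc i)
  cell_le : ∀ i ∈ D, s.nat (addr cc i) ≤ s.nat (addr 9 0)
  start_le : ∀ i ∈ D, s.real (addr sc (off + s.nat (addr cc i))) ≤ key i
  lt_start : ∀ i ∈ D, key i < s.real (addr sc (off + s.nat (addr cc i))) + 2 * W

/-- The block with number `b` has a correct smallest element. -/
def BlockMin (B off : ℕ) (kc : Fin 64) (s : MemState) (b : ℕ) : Prop :=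
  ∃ j < B, s.nat (addr 32 b) = B * b + j ∧ ∀ j' < B,
    s.real (addr kc (off + (B * b + j))) ≤ s.real (addr kc (off + (B * b + j')))


theorem StripState.frame {N B off : ℕ} {W big : ℝ} {key : ℕ → ℝ} {kc sc cc : Fin 64} {D : Finset ℕ}
    {s s' : MemState} (h : StripState N B off W big key kc sc cc D s) (hr : s'.real = s.real)
    {J : List (Fin 64)} (hn : SameOff J s.nat s'.nat) (hJ : ∀ j ∈ [2, 3, 4, 9, cc], j ∉ J) :
    StripState N B off W big key kc sc cc D s' := by
  have h9 : s'.nat (addr 9 0) = s.nat (addr 9 0) := hn 9 0 (hJ _ (by simp))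
  have hc : ∀ i, s'.nat (addr cc i) = s.nat (addr cc i) := fun i => hn cc i (hJ _ (by simp))
  obtain ⟨h1, h2, h3, h4, h5, h6, h7, h8, h10, h11, h12, h13, h14, h15, h16⟩ := h
  constructor
  · rw [hn 2 0 (hJ _ (by simp)), h1]
  · rw [hn 3 0 (hJ _ (by simp)), h2]
  · rw [hn 4 0 (hJ _ (by simp)), h3]
  all_goals (try simp only [hr, h9, hc]); assumption

/-- The elements are removed in increasing order. If the next key is less than `2 * W` above the
start of the current strip, it joins this strip; otherwise it starts a new one. In both cases the
start of the current strip is a lower bound for all keys that remain. -/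
theorem StripState.remove {N B off : ℕ} {W big : ℝ} {key : ℕ → ℝ} {kc sc cc : Fin 64} {D : Finset ℕ}
    {s : MemState} (h : StripState N B off W big key kc sc cc D s) (hW : 0 < W)
    (hks : kc ≠ sc) (hk : kc ∉ [40, 44]) (hs : sc ∉ [40, 44]) (hcc : cc ∉ [2, 3, 4, 5, 6, 7, 8, 9, 16, 32])
    {e b : ℕ} (he : s.nat (addr 7 0) = e) (hb : s.nat (addr 8 0) = b)
    (heN : e < N) (hNB : N ≤ B * B) (heD : e ∉ D) (hmin : ∀ i < N, i ∉ D → key e ≤ key i)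
    (hblock : ∀ b' < B, b' ≠ b → BlockMin B off kc s b') (hblock' : ∃ j < B, e = B * b + j)
    {t : MemState} (ht : t = (removeMin kc sc cc).run s) :
    StripState N B off W big key kc sc cc (Insert.insert e D) t ∧
      SameOff [9, cc, 16] s.nat t.nat ∧ SameOff [kc, sc] s.real t.real ∧
      t.nat (addr 16 0) = b ∧ ∀ b' < B, b' ≠ b → BlockMin B off kc t b' := by
  simp only [List.mem_cons, List.not_mem_nil, or_false, not_or] at hk hs hcc
  have hk' := hk; have hs' := hs; have hcc' := hcc; have hks' := hks.symm
  simp only [@eq_comm _ kc] at hk'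
  simp only [@eq_comm _ sc] at hs'
  simp only [@eq_comm _ cc] at hcc'
  obtain ⟨h1, h2, h3, h4, h5, h6, h7, h8, h10, h11, h12, h13, h14, h15, h16⟩ := h
  have hke : s.real (addr kc (off + e)) = key e := by
    rw [h6 e (by omega), if_pos ⟨heN, heD⟩]
  -- The removed element lies in block `b` only, so the minima of the other blocks stay correct.
  have hblk : ∀ b' < B, b' ≠ b → ∀ j' < B, B * b' + j' ≠ e := by
    obtain ⟨j, hj, rfl⟩ := hblock'
    intro b' _ hne j' hj' heq
    apply hne
    rcases lt_trichotomy b' b with h | h | h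
    · nlinarith
    · exact h
    · nlinarith
  have hcard : (Insert.insert e D).card = D.card + 1 := Finset.card_insert_of_notMem heD
  have hne : ∀ i ∈ D, i ≠ e := by rintro i hi rfl; exact heD hi
  set c := s.nat (addr 9 0) with hc
  -- First case: the element joins the current strip. For the very first element there is no strip
  -- yet, whence the condition `1 ≤ c`.
  by_cases hbr : 1 ≤ c ∧ ¬ s.real (addr sc (off + c)) + 2 * W ≤ key e
  · have hrun : t = ⟨Function.update (Function.update s.nat (addr cc e) c) (addr 16 0) b,
        Function.update s.real (addr kc (off + e)) big⟩ := by
      rw [ht, removeMin]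
      simp [update_addr, h2, h4, h5, he, hb, hke, ← hc, hbr.1, not_le.1 hbr.2, hcc, hcc']
    clear ht
    subst hrun
    obtain ⟨hc1, hc2⟩ := hbr
    rw [not_le] at hc2
    refine ⟨⟨?_, ?_, ?_, ?_, ?_, ?_, ?_, ?_, ?_, ?_, ?_, ?_, ?_, ?_, ?_⟩, ?_, ?_, ?_, ?_⟩
    · simp [update_addr, hcc', h1]
    · simp [update_addr, hcc', h2]
    · simp [update_addr, hcc', h3]
    · simp [update_addr, hk', h4]
    · simp [update_addr, hk', h5]
    · intro i hi
      simp only [update_addr, true_and, Nat.add_left_cancel_iff, Finset.mem_insert, h6 i hi]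
      by_cases h : i = e <;> simp [h]
    · simpa [heN] using h7
    · simp [update_addr, hcc', ← hc]; omega
    · simp [update_addr, hcc', ← hc, hcard]; omega
    · simpa [update_addr, hcc', ← hc, hks'] using h11
    · simp only [update_addr, hcc', ← hc, hks', false_and, if_false, reduceCtorEq]
      intro hh i hi hi'
      have := h12 hc1 i hi fun h => hi' (Finset.mem_insert_of_mem h)
      simpa [update_addr, hcc', ← hc, hks'] using this
    · intro i hi
      rcases Finset.mem_insert.1 hi with rfl | hi
      · simpa [update_addr, hcc] using hc1
      · simpa [update_addr, hcc, hne i hi] using h13 i hi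
    · intro i hi
      rcases Finset.mem_insert.1 hi with rfl | hi
      · simp [update_addr, hcc, hcc', ← hc]
      · simpa [update_addr, hcc, hcc', hne i hi, ← hc] using h14 i hi
    · intro i hi
      rcases Finset.mem_insert.1 hi with rfl | hi
      · simpa [update_addr, hcc, hks'] using h12 hc1 _ heN heD
      · simpa [update_addr, hcc, hks', hne i hi] using h15 i hi
    · intro i hi
      rcases Finset.mem_insert.1 hi with rfl | hi
      · simpa [update_addr, hcc, hks'] using hc2
      · simpa [update_addr, hcc, hks', hne i hi] using h16 i hi
    · exact ((SameOff.refl _ _).update (by simp) _ _).update (by simp) _ _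
    · exact (SameOff.refl _ _).update (by simp) _ _
    · simp
    · intro b' hb' hbb
      obtain ⟨j, hj, k1, k2⟩ := hblock b' hb' hbb
      refine ⟨j, hj, by simpa [update_addr, hcc'] using k1, fun j' hj' => ?_⟩
      simpa [update_addr, hblk b' hb' hbb j hj, hblk b' hb' hbb j' hj'] using k2 j' hj'
  · have hrun : t = ⟨Function.update (Function.update (Function.update s.nat (addr 9 0) (c + 1))
          (addr cc e) (c + 1)) (addr 16 0) b,
        Function.update (Function.update s.real (addr sc (off + (c + 1))) (key e))
          (addr kc (off + e)) big⟩ := by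
      rw [ht, removeMin]
      have hbr' : ¬ (1 ≤ c ∧ s.real (addr sc (off + c)) + 2 * W > key e) := by
        simpa using hbr
      simp [update_addr, h2, h4, h5, he, hb, hke, ← hc, hcc, hcc', hk, hk', hs, hs', hks, hks']
      split_ifs with h
      · exact (hbr ⟨h.1, not_le.2 h.2⟩).elim
      · simp [update_addr, h2, h4, h5, he, hb, hke, ← hc, hcc, hcc', hk, hk', hs, hs', hks, hks']
    clear ht
    subst hrun
    have hstep : 1 ≤ c → s.real (addr sc (off + c)) + 2 * W ≤ key e := by
      intro h; by_contra h'; exact hbr ⟨h, h'⟩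
    have hcle : ∀ i ∈ D, s.nat (addr cc i) ≠ c + 1 := fun i hi h => by have := h14 i hi; omega
    refine ⟨⟨?_, ?_, ?_, ?_, ?_, ?_, ?_, ?_, ?_, ?_, ?_, ?_, ?_, ?_, ?_⟩, ?_, ?_, ?_, ?_⟩
    · simp [update_addr, hcc', h1]
    · simp [update_addr, hcc', h2]
    · simp [update_addr, hcc', h3]
    · simp [update_addr, hk', hs', h4]
    · simp [update_addr, hk', hs', h5]
    · intro i hi
      simp only [update_addr, true_and, Nat.add_left_cancel_iff, Finset.mem_insert, h6 i hi, hks,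
        false_and, if_false]
      by_cases h : i = e <;> simp [h]
    · simpa [heN] using h7
    · simp [update_addr, hcc']
    · simp [update_addr, hcc', hcard]; omega
    · simp only [update_addr, hcc', hks', true_and, false_and, if_false, if_true,
        Nat.add_left_cancel_iff, add_left_inj, reduceCtorEq, Fin.reduceEq]
      intro k hk1 hk2
      rw [if_neg (by omega)]
      rcases Nat.lt_succ_iff_lt_or_eq.1 hk2 with h | rfl
      · rw [if_neg (by omega)]
        exact h11 k hk1 h
      · rw [if_pos rfl]
        exact hstep hk1
    · intro hh i hi hi'
      have := hmin i hi fun h => hi' (Finset.mem_insert_of_mem h)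
      simpa [update_addr, hcc', hks'] using this
    · intro i hi
      rcases Finset.mem_insert.1 hi with rfl | hi
      · simp [update_addr, hcc]
      · simpa [update_addr, hcc, hne i hi] using h13 i hi
    · intro i hi
      rcases Finset.mem_insert.1 hi with rfl | hi
      · simp [update_addr, hcc, hcc']
      · simpa [update_addr, hcc, hcc', hne i hi] using (h14 i hi).trans (Nat.le_succ _)
    · intro i hi
      rcases Finset.mem_insert.1 hi with rfl | hi
      · simp [update_addr, hcc, hks']
      · simpa [update_addr, hcc, hks', hne i hi, hcle i hi] using h15 i hi
    · intro i hi
      rcases Finset.mem_insert.1 hi with rfl | hi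
      · simp [update_addr, hcc, hks', hW]
      · simpa [update_addr, hcc, hks', hne i hi, hcle i hi] using h16 i hi
    · exact (((SameOff.refl _ _).update (by simp) _ _).update (by simp) _ _).update (by simp) _ _
    · exact ((SameOff.refl _ _).update (by simp) _ _).update (by simp) _ _
    · simp
    · intro b' hb' hbb
      obtain ⟨j, hj, k1, k2⟩ := hblock b' hb' hbb
      refine ⟨j, hj, by simpa [update_addr, hcc'] using k1, fun j' hj' => ?_⟩
      simpa [update_addr, hks, hblk b' hb' hbb j hj, hblk b' hb' hbb j' hj'] using k2 j' hj'

theorem SameOff.eq {α : Type*} {J : List (Fin 64)} {f g : ℕ → α} (h : SameOff J f g) (j : Fin 64)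
    (i : ℕ) (hj : j ∉ J := by decide) : g (addr j i) = f (addr j i) := h j i hj

theorem SameOff.of_eq {α : Type*} {J : List (Fin 64)} {f g : ℕ → α} (h : g = f) : SameOff J f g := by
  rw [h]; exact SameOff.refl _ _

/-- The smallest of the `B` block minima is the smallest of all keys, and after its removal only its
own block has to be searched again. So a step costs `2 * B` instead of `N`. -/
theorem tot_strips_step {A : PointSolver} {N B off : ℕ} {W big : ℝ} {key : ℕ → ℝ}
    {kc sc cc : Fin 64} {D : Finset ℕ}
    {s : MemState} (h : StripState N B off W big key kc sc cc D s) (hW : 0 < W)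
    (hks : kc ≠ sc) (hk : kc ∉ [40, 44]) (hs : sc ∉ [40, 44])
    (hcc : cc ∉ [2, 3, 4, 5, 6, 7, 8, 9, 16, 32]) (hB0 : 0 < B) (hNB : N ≤ B * B)
    (hbig : ∀ i < N, key i < big) (hD : D.card < N) (hblock : ∀ b < B, BlockMin B off kc s b) :
    Tot A (stripStep kc sc cc) s (2 * B) fun s' =>
      (∃ e ∉ D, StripState N B off W big key kc sc cc (insert e D) s') ∧
      (∀ b < B, BlockMin B off kc s' b) ∧ s'.nat (addr 5 0) = s.nat (addr 5 0) + 1 ∧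
      SameOff [5, 6, 7, 8, 9, 16, 32, cc] s.nat s'.nat ∧ SameOff [kc, sc] s.real s'.real := by
  have hcc1 := hcc
  simp only [List.mem_cons, List.not_mem_nil, or_false, not_or] at hcc1
  have hcc' := hcc1
  simp only [@eq_comm _ cc] at hcc'
  have hJ : ∀ J ∈ ([[6, 7, 8], [32, 5]] : List (List (Fin 64))), ∀ j ∈ [2, 3, 4, 9, cc], j ∉ J := by
    simp [hcc1]
  refine Tot.seqs_step (k₁ := B) (k₂ := B) (tot_argmin kc (.at 32 (.var 6)) s
    (fun j => s.nat (addr 32 j)) h.B_eq hB0 h.off_eq ?_) ?_ (by omega)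
  · intro s' hs'
    simp [hs'.eq 32]
  rintro s₁ ⟨r1, n1, b, hb, he, hb', hmin⟩
  have hst1 := h.frame r1 n1 (hJ _ (by simp))
  have hbm1 : ∀ b < B, BlockMin B off kc s₁ b := by
    intro b hb
    obtain ⟨j, hj, k1, k2⟩ := hblock b hb
    exact ⟨j, hj, by rw [n1.eq 32, k1], by rw [r1]; exact k2⟩
  obtain ⟨j, hj, k1, k2⟩ := hblock b hb
  set e := s.nat (addr 32 b) with hedef
  -- the minimum over all blocks
  have hlt : ∀ b' < B, ∀ j' < B, B * b' + j' < B * B := fun b' h1 j' h2 => by nlinarith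
  have hall : ∀ i < B * B, s.real (addr kc (off + e)) ≤ s.real (addr kc (off + i)) := by
    intro i hi
    have h1 : i / B < B := Nat.div_lt_of_lt_mul hi
    obtain ⟨j₂, hj₂, m1, m2⟩ := hblock (i / B) h1
    have m3 := hmin (i / B) h1
    have m4 := m2 (i % B) (Nat.mod_lt _ hB0)
    rw [Nat.div_add_mod] at m4
    rw [m1] at m3
    exact m3.trans m4
  have heB : e < B * B := by rw [k1]; exact hlt b hb j hj
  obtain ⟨i₀, hi₀, hi₀D⟩ : ∃ i₀ < N, i₀ ∉ D := by
    by_contra! hcon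
    have : Finset.range N ⊆ D := fun i hi => hcon i (Finset.mem_range.1 hi)
    have := Finset.card_le_card this
    rw [Finset.card_range] at this
    omega
  -- Removed and padded positions hold the value `big`, which exceeds all keys, so the minimum is
  -- attained at an element that remains.
  have hekey : e < N ∧ e ∉ D := by
    by_contra hcon
    have h1 := hall i₀ (by omega)
    rw [h.key_eq e heB, if_neg hcon, h.key_eq i₀ (by omega), if_pos ⟨hi₀, hi₀D⟩] at h1
    exact absurd (hbig i₀ hi₀) (not_lt.2 h1)
  have hemin : ∀ i < N, i ∉ D → key e ≤ key i := by
    intro i hi hiD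
    have h1 := hall i (by omega)
    rwa [h.key_eq e heB, if_pos hekey, h.key_eq i (by omega), if_pos ⟨hi, hiD⟩] at h1
  obtain ⟨h2, n2, r2, hb2, hbm2⟩ := hst1.remove hW hks hk hs hcc he hb' hekey.1 hNB hekey.2 hemin
    (fun b' hb' _ => hbm1 b' hb') ⟨j, hj, k1⟩ rfl
  refine Tot.seqs_flat (by simp [Program.Flat, removeMin]) ?_
  generalize (removeMin kc sc cc).run _ = s₂ at h2 n2 r2 hb2 hbm2 ⊢
  refine Tot.seqs_step (k₁ := B) (k₂ := 0) (tot_argmin kc (.add (.mul (.var 4) (.var 16)) (.var 6))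
    s₂ (fun j => B * b + j) h2.B_eq hB0 h2.off_eq ?_) ?_ (by omega)
  · intro s' hs'
    simp [hs'.eq 4, hs'.eq 16, h2.B_eq, hb2]
  rintro s₃ ⟨r3, n3, j3, hj3, he3, -, hmin3⟩
  have h3 := h2.frame r3 n3 (hJ _ (by simp))
  have h16 : s₃.nat (addr 16 0) = b := by rw [n3.eq 16, hb2]
  refine Tot.seqs_flat (by simp [Program.Flat]) (Tot.seqs_flat (by simp) (Tot.seqs_nil ?_))
  have hfin : SameOff [32, 5] s₃.nat (Function.update (Function.update s₃.nat (addr 32 b) (B * b + j3))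
      (addr 5 0) (s₃.nat (addr 5 0) + 1)) :=
    ((SameOff.refl _ _).update (by simp) _ _).update (by simp) _ _
  have hrun : (Program.incr 5).run ((Program.setNat (NatExpr.addr 32 (NatExpr.var 16))
      (NatExpr.var 7)).run s₃) = ⟨Function.update (Function.update s₃.nat (addr 32 b) (B * b + j3))
      (addr 5 0) (s₃.nat (addr 5 0) + 1), s₃.real⟩ := by
    simp [h16, he3, update_addr]
  rw [hrun]
  refine ⟨⟨e, hekey.2, h3.frame rfl hfin (hJ _ (by simp))⟩, ?_, ?_, ?_, ?_⟩
  · intro b' hb'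
    by_cases hbb : b' = b
    · subst hbb
      refine ⟨j3, hj3, by simp [update_addr], fun j' hj' => ?_⟩
      simpa [r3] using hmin3 j' hj'
    · obtain ⟨j', hj', m1, m2⟩ := hbm2 b' hb' hbb
      exact ⟨j', hj', by simp [update_addr, hbb, n3.eq 32, m1], by simpa [r3] using m2⟩
  · have : s₂.nat (addr 5 0) = s₁.nat (addr 5 0) := n2 5 0 (by simp [hcc'])
    simp [n3.eq 5, this, n1.eq 5]
  · refine ((n1.mono ?_).trans (n2.mono ?_)).trans ((n3.mono ?_).trans (hfin.mono ?_)) <;> simp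
  · exact (((SameOff.of_eq r1).trans r2).trans (SameOff.of_eq r3)).trans (SameOff.refl _ _)


/-- The three summands of the budget are the padding of the keys to `B * B`, the first search in all
blocks, and the removal of `N` elements. For `B` of order `√N` this is `O(N √N)`. -/
theorem tot_strips {A : PointSolver} {N B off : ℕ} {W big : ℝ} {key : ℕ → ℝ}
    {kc sc cc : Fin 64} {s : MemState} (hN : s.nat (addr 2 0) = N) (hoff : s.nat (addr 3 0) = off)
    (hB : s.nat (addr 4 0) = B) (hWs : s.real (addr 40 off) = W) (hbs : s.real (addr 44 off) = big)
    (hkey : ∀ i < N, s.real (addr kc (off + i)) = key i) (hW : 0 < W)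
    (hks : kc ≠ sc) (hk : kc ∉ [40, 44]) (hs : sc ∉ [40, 44])
    (hcc : cc ∉ [2, 3, 4, 5, 6, 7, 8, 9, 16, 32]) (hB0 : 0 < B) (hNB : N ≤ B * B) (hN0 : 0 < N)
    (hbig : ∀ i < N, key i < big) :
    Tot A (strips kc sc cc) s (B * B + B * (B + 1) + N * (2 * B + 1)) fun s' =>
      SameOff [5, 6, 7, 8, 9, 16, 32, cc] s.nat s'.nat ∧ SameOff [kc, sc] s.real s'.real ∧
      ∃ C, IsStrips N W key C (fun k => s'.real (addr sc (off + k))) fun i => s'.nat (addr cc i) := by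
  have hcc' := hcc
  simp only [List.mem_cons, List.not_mem_nil, or_false, not_or, @eq_comm _ cc] at hcc'
  have hk' := hk
  simp only [List.mem_cons, List.not_mem_nil, or_false, not_or, @eq_comm _ kc] at hk'
  have hs' := hs
  simp only [List.mem_cons, List.not_mem_nil, or_false, not_or, @eq_comm _ sc] at hs'
  have hks' := hks.symm
  -- padding of the keys
  refine Tot.seqs_flat (by simp) ?_
  set s₀ := (Program.setVar 5 (NatExpr.var 2)).run s with hs₀
  have n0 : SameOff [5] s.nat s₀.nat := (SameOff.refl _ _).update (by simp) _ _
  have r0 : s₀.real = s.real := rfl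
  refine Tot.seqs_step (k₁ := B * B) (k₂ := B * (B + 1) + N * (2 * B + 1))
    ((Tot.loopConst (B * B - N) (fun i s' => SameOff [5] s.nat s'.nat ∧ SameOff [kc] s.real s'.real ∧
      s'.nat (addr 5 0) = N + i ∧
      ∀ j < N + i, s'.real (addr kc (off + j)) = if j < N then key j else big) 0 ?_ ?_ ?_).mono
      (by omega) fun _ h => h) ?_ (by omega)
  · rintro i hi s₁ ⟨n1, r1, h5, hkk⟩
    have e44 : s₁.real (addr 44 off) = big := by rw [r1 44 off (by simp [hk']), hbs]
    refine ⟨by simp [n1.eq 4, hB, h5]; omega, Tot.flat (by simp [Program.Flat]) ?_⟩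
    have hrun : (Program.seq (.setReal (.addr kc (.add (.var 3) (.var 5))) (.var 44)) (.incr 5)).run
        s₁ = ⟨Function.update s₁.nat (addr 5 0) (N + i + 1),
          Function.update s₁.real (addr kc (off + (N + i))) big⟩ := by
      simp [n1.eq 3, hoff, h5, e44]
    rw [hrun]
    refine ⟨n1.update (by simp) _ _, r1.update (by simp) _ _, by simp [add_assoc], fun j hj => ?_⟩
    simp only [update_addr, true_and, Nat.add_left_cancel_iff]
    rcases Nat.lt_succ_iff_lt_or_eq.1 (show j < (N + i) + 1 by omega) with h | rfl
    · rw [if_neg (by omega)]; exact hkk j h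
    · simp
  · rintro s₁ ⟨n1, -, h5, -⟩
    simp [n1.eq 4, hB, h5]; omega
  · refine ⟨n0, SameOff.refl _ _, by simp [hs₀, hN], fun j hj => ?_⟩
    rw [if_pos (by omega), r0]
    exact hkey j (by omega)
  rintro s₁ ⟨n1, r1, -, hkk⟩
  have hkk' : ∀ j < B * B, s₁.real (addr kc (off + j)) = if j < N then key j else big :=
    fun j hj => hkk j (by omega)
  clear hkk
  clear_value s₀
  -- the blocks
  refine Tot.seqs_flat (by simp) ?_
  refine Tot.seqs_step (k₁ := B * (B + 1)) (k₂ := N * (2 * B + 1))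
    (Tot.loopConst B (fun i s' => SameOff [5, 6, 7, 8, 16, 32] s.nat s'.nat ∧ s'.real = s₁.real ∧
      s'.nat (addr 16 0) = i ∧ ∀ b < i, BlockMin B off kc s' b) B ?_ ?_ ?_) ?_ (by omega)
  · rintro i hi s₂ ⟨n2, r2, h16, hbm⟩
    refine ⟨by simp [n2.eq 4, hB, h16, hi], ?_⟩
    refine Tot.seqs_step (k₁ := B) (k₂ := 0) (tot_argmin kc
      (.add (.mul (.var 4) (.var 16)) (.var 6)) s₂ (fun j => B * i + j) (by rw [n2.eq 4, hB]) hB0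
      (by rw [n2.eq 3, hoff]) ?_) ?_ (by omega)
    · intro s' hs'
      simp [hs'.eq 4, hs'.eq 16, n2.eq 4, hB, h16]
    rintro s₃ ⟨r3, n3, j3, hj3, he3, -, hmin3⟩
    refine Tot.seqs_flat (by simp [Program.Flat]) (Tot.seqs_flat (by simp) (Tot.seqs_nil ?_))
    have hrun : (Program.incr 16).run ((Program.setNat (NatExpr.addr 32 (NatExpr.var 16))
        (NatExpr.var 7)).run s₃) = ⟨Function.update (Function.update s₃.nat (addr 32 i) (B * i + j3))
        (addr 16 0) (i + 1), s₃.real⟩ := by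
      simp [n3.eq 16, h16, he3, update_addr]
    rw [hrun]
    refine ⟨(((n2.trans (n3.mono ?_)).update ?_ _ _).update ?_ _ _), by rw [← r2, ← r3],
      by simp, fun b hb => ?_⟩
    · simp
    · simp
    · simp
    · rcases Nat.lt_succ_iff_lt_or_eq.1 hb with h | rfl
      · obtain ⟨j', hj', m1, m2⟩ := hbm b h
        exact ⟨j', hj', by simp [update_addr, h.ne, n3.eq 32, m1], by simpa [r3] using m2⟩
      · exact ⟨j3, hj3, by simp [update_addr], by simpa [r3] using hmin3⟩
  · rintro s₂ ⟨n2, -, h16, -⟩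
    simp [n2.eq 4, hB, h16]
  · exact ⟨(n1.mono (by simp)).update (by simp) _ _, rfl, by simp, by simp⟩
  rintro s₂ ⟨n2, r2, -, hbm2⟩
  -- the main loop
  refine Tot.seqs_flat (by simp) (Tot.seqs_flat (by simp) ?_)
  refine Tot.seqs_step (k₁ := N * (2 * B + 1)) (k₂ := 0)
    (Tot.loopConst N (fun i s' => (∃ D, D.card = i ∧ StripState N B off W big key kc sc cc D s') ∧
      (∀ b < B, BlockMin B off kc s' b) ∧ s'.nat (addr 5 0) = i ∧
      SameOff [5, 6, 7, 8, 9, 16, 32, cc] s.nat s'.nat ∧ SameOff [kc, sc] s.real s'.real)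
      (2 * B) ?_ ?_ ?_) ?_ (by omega)
  · rintro i hi s₃ ⟨⟨D, hD, h⟩, hbm, h5, n3, r3⟩
    refine ⟨by simp [h5, h.N_eq, hi], (tot_strips_step h hW hks hk hs hcc hB0 hNB hbig (by omega)
      hbm).mono le_rfl ?_⟩
    rintro s₄ ⟨⟨e, he, h4⟩, hbm4, h54, n4, r4⟩
    exact ⟨⟨insert e D, by rw [Finset.card_insert_of_notMem he, hD], h4⟩, hbm4, by rw [h54, h5],
      n3.trans n4, r3.trans r4⟩
  · rintro s₃ ⟨⟨D, hD, h⟩, -, h5, -, -⟩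
    simp [h5, h.N_eq]
  · have e2 : ∀ j ∉ [kc, sc], ∀ i, s₂.real (addr j i) = s.real (addr j i) := by
      intro j hj i
      rw [r2, r1 j i fun h => hj (by simp at h ⊢; exact Or.inl h)]
    refine ⟨⟨∅, rfl, ?_⟩, ?_, by simp, ?_, ?_⟩
    · constructor
      · simp [update_addr, n2.eq 2, hN]
      · simp [update_addr, n2.eq 3, hoff]
      · simp [update_addr, n2.eq 4, hB]
      · simp [e2 40, hk', hs', hWs]
      · simp [e2 44, hk', hs', hbs]
      · intro i hi
        simp [r2, hkk' i hi]
      all_goals simp [update_addr]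
    · intro b hb
      obtain ⟨j', hj', m1, m2⟩ := hbm2 b hb
      exact ⟨j', hj', by simp [update_addr, m1], by simpa using m2⟩
    · exact ((n2.mono (by simp)).update (by simp) _ _).update (by simp) _ _
    · exact (r1.mono (by simp)).trans (SameOff.of_eq r2)
  rintro s₃ ⟨⟨D, hD, h⟩, -, -, n3, r3⟩
  have hDall : ∀ i, i ∈ D ↔ i < N := by
    have : D = Finset.range N := Finset.eq_of_subset_of_card_le
      (fun i hi => Finset.mem_range.2 (h.D_lt i hi)) (by simp [hD])
    simp [this]
  set c := s₃.nat (addr 9 0) with hc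
  have hc0 : 0 < c := h.D_pos (by omega)
  refine Tot.seqs_flat (by simp [Program.Flat]) (Tot.seqs_flat (by simp [Program.Flat])
    (Tot.seqs_flat (by simp [Program.Flat]) (Tot.seqs_nil ?_)))
  -- Starts are added before the first strip and twice after the last one, so that every occupied
  -- strip has two neighbors and each of these has an end.
  set st := fun k => s₃.real (addr sc (off + k)) with hst
  have hrun : (Program.setReal (NatExpr.addr sc ((NatExpr.var 3).add ((NatExpr.var 9).add
      (NatExpr.lit 2)))) ((RealExpr.off sc (NatExpr.var 9)).add ((RealExpr.num 8).mul
      (RealExpr.var 40)))).run ((Program.setReal (NatExpr.addr sc ((NatExpr.var 3).add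
      ((NatExpr.var 9).add (NatExpr.lit 1)))) ((RealExpr.off sc (NatExpr.var 9)).add
      ((RealExpr.num 4).mul (RealExpr.var 40)))).run ((Program.setReal (NatExpr.addr sc
      ((NatExpr.var 3).add (NatExpr.lit 0))) ((RealExpr.off sc (NatExpr.lit 1)).sub
      ((RealExpr.num 2).mul (RealExpr.var 40)))).run s₃)) =
      ⟨s₃.nat, Function.update (Function.update (Function.update s₃.real (addr sc (off + 0))
        (st 1 - 2 * W)) (addr sc (off + (c + 1))) (st c + 4 * W)) (addr sc (off + (c + 2)))
        (st c + 8 * W)⟩ := by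
    simp [update_addr, h.off_eq, h.W_eq, ← hc, hs', hst, hc0.ne']
  rw [hrun]
  have hval : ∀ k, (Function.update (Function.update (Function.update s₃.real (addr sc (off + 0))
      (st 1 - 2 * W)) (addr sc (off + (c + 1))) (st c + 4 * W)) (addr sc (off + (c + 2)))
        (st c + 8 * W)) (addr sc (off + k)) = if k = c + 2 then st c + 8 * W else
        if k = c + 1 then st c + 4 * W else if k = 0 then st 1 - 2 * W else st k := by
    intro k
    simp only [update_addr, true_and, Nat.add_left_cancel_iff, hst]
  refine ⟨n3, ((r3.update (by simp) _ _).update (by simp) _ _).update (by simp) _ _, c, ?_⟩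
  have hcl : ∀ i < N, 1 ≤ s₃.nat (addr cc i) ∧ s₃.nat (addr cc i) ≤ c := fun i hi =>
    ⟨h.cell_pos i ((hDall i).2 hi), h.cell_le i ((hDall i).2 hi)⟩
  have hcell : ∀ i < N, (Function.update (Function.update (Function.update s₃.real (addr sc (off + 0))
      (st 1 - 2 * W)) (addr sc (off + (c + 1))) (st c + 4 * W)) (addr sc (off + (c + 2)))
        (st c + 8 * W)) (addr sc (off + s₃.nat (addr cc i))) = st (s₃.nat (addr cc i)) := by
    intro i hi
    have := hcl i hi
    rw [hval, if_neg (by omega), if_neg (by omega), if_neg (by omega)]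
  constructor
  · have := h.le_card
    rw [← hc] at this
    omega
  · intro k hk
    simp only [hval]
    rcases eq_or_ne k (c + 1) with rfl | h1
    · simp; linarith
    rw [if_neg (show k ≠ c + 2 by omega), if_neg h1, if_neg (show k + 1 ≠ c + 2 by omega)]
    rcases eq_or_ne k c with rfl | h2
    · rw [if_neg hc0.ne', if_pos rfl]; linarith
    rw [if_neg (show k + 1 ≠ c + 1 by omega), if_neg (show k + 1 ≠ 0 by omega)]
    rcases eq_or_ne k 0 with rfl | h3
    · simp
    · rw [if_neg h3]
      exact h.step k (by omega) (by omega)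
  · exact fun i hi => (hcl i hi).1
  · exact fun i hi => (hcl i hi).2
  · intro i hi
    simp only [hcell i hi]
    exact h.start_le i ((hDall i).2 hi)
  · intro i hi
    simp only [hcell i hi]
    exact h.lt_start i ((hDall i).2 hi)


/-! ### The roots of the subdivision -/

/-- Lists of triangles for cells of a grid, after the pairs `(triangle, cell)` in `ops` have been
recorded. -/
structure CellLists (ops : List (ℕ × ℕ × ℕ)) (R : List ((ℕ × ℕ) × List ℕ)) : Prop where
  keys : (R.map Prod.fst).Nodup
  nodup : ∀ e ∈ R, e.2.Nodup
  ne_nil : ∀ e ∈ R, e.2 ≠ []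
  mem : ∀ e ∈ R, ∀ t, t ∈ e.2 ↔ (t, e.1) ∈ ops
  ex : ∀ o ∈ ops, ∃ e ∈ R, e.1 = o.2
  sum : (R.map fun e => e.2.length).sum = ops.length

namespace CellLists

variable {ops : List (ℕ × ℕ × ℕ)} {R : List ((ℕ × ℕ) × List ℕ)}

theorem nil : CellLists [] [] := by constructor <;> simp

theorem append (h : CellLists ops R) {o : ℕ × ℕ × ℕ} (ho : o.2 ∉ R.map Prod.fst) :
    CellLists (ops ++ [o]) (R ++ [(o.2, [o.1])]) := by
  have hno : ∀ o' ∈ ops, o'.2 ≠ o.2 := by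
    intro o' ho' heq
    obtain ⟨e, he, he'⟩ := h.ex o' ho'
    exact ho (List.mem_map.2 ⟨e, he, he'.trans heq⟩)
  have hne : ∀ e ∈ R, e.1 ≠ o.2 := fun e he heq => ho (List.mem_map.2 ⟨e, he, heq⟩)
  constructor
  · simp only [List.map_append, List.map_cons, List.map_nil]
    rw [List.nodup_append]
    refine ⟨h.keys, by simp, ?_⟩
    intro a ha b hb
    rw [List.mem_singleton] at hb
    subst hb
    rintro rfl
    exact ho ha
  · intro e he
    rcases List.mem_append.1 he with he | he
    · exact h.nodup e he
    · rw [List.mem_singleton] at he; subst he; simp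
  · intro e he
    rcases List.mem_append.1 he with he | he
    · exact h.ne_nil e he
    · rw [List.mem_singleton] at he; subst he; simp
  · intro e he t
    rcases List.mem_append.1 he with he | he
    · rw [h.mem e he, List.mem_append, List.mem_singleton]
      refine ⟨Or.inl, fun h' => h'.resolve_right fun heq => ?_⟩
      exact hne e he (congrArg Prod.snd heq)
    · rw [List.mem_singleton] at he
      subst he
      simp only [List.mem_singleton, List.mem_append]
      refine ⟨fun h' => Or.inr (by rw [h']), fun h' => ?_⟩
      rcases h' with h' | h'
      · exact (hno _ h' rfl).elim
      · rw [← h']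
  · intro o' ho'
    rcases List.mem_append.1 ho' with ho' | ho'
    · obtain ⟨e, he, he'⟩ := h.ex o' ho'
      exact ⟨e, List.mem_append_left _ he, he'⟩
    · rw [List.mem_singleton] at ho'
      subst ho'
      exact ⟨(o'.2, [o'.1]), by simp, rfl⟩
  · simp [h.sum]

theorem set (h : CellLists ops R) {o : ℕ × ℕ × ℕ} (hno : o ∉ ops) {j : ℕ} (hj : j < R.length)
    (ho : R[j].1 = o.2) : CellLists (ops ++ [o]) (R.set j (o.2, o.1 :: R[j].2)) := by
  have hmem := List.getElem_mem hj
  have hkeys : (R.set j (o.2, o.1 :: R[j].2)).map Prod.fst = R.map Prod.fst := by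
    rw [List.map_set]
    simp only
    rw [← ho]
    have : R[j].1 = (R.map Prod.fst)[j]'(by simpa using hj) := by simp
    rw [this, List.set_getElem_self]
  have hother : ∀ i (hi : i < R.length), i ≠ j → R[i].1 ≠ o.2 := by
    intro i hi hne heq
    have := (List.nodup_iff_injective_get.1 h.keys) (a₁ := ⟨i, by simpa using hi⟩)
      (a₂ := ⟨j, by simpa using hj⟩) (by simp [heq, ho])
    exact hne (by simpa using this)
  have hnew : ∀ e ∈ R.set j (o.2, o.1 :: R[j].2), e = (o.2, o.1 :: R[j].2) ∨
      (e ∈ R ∧ e.1 ≠ o.2) := by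
    intro e he
    obtain ⟨i, hi, rfl⟩ := List.mem_iff_getElem.1 he
    rw [List.length_set] at hi
    rw [List.getElem_set]
    split_ifs with hij
    · exact Or.inl rfl
    · exact Or.inr ⟨List.getElem_mem hi, hother i hi (Ne.symm hij)⟩
  have hnt : o.1 ∉ R[j].2 := by
    rw [h.mem _ hmem, ho]
    exact hno
  constructor
  · rw [hkeys]; exact h.keys
  · intro e he
    rcases hnew e he with rfl | ⟨he, -⟩
    · exact List.nodup_cons.2 ⟨hnt, h.nodup _ hmem⟩
    · exact h.nodup e he
  · intro e he
    rcases hnew e he with rfl | ⟨he, -⟩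
    · simp
    · exact h.ne_nil e he
  · intro e he t
    rcases hnew e he with rfl | ⟨he, hne⟩
    · simp only [List.mem_cons, List.mem_append, List.not_mem_nil, or_false]
      rw [h.mem _ hmem, ho, or_comm]
      refine or_congr Iff.rfl ⟨fun h => by rw [h], fun h => by rw [← h]⟩
    · rw [h.mem e he, List.mem_append, List.mem_singleton]
      refine ⟨Or.inl, fun h' => h'.resolve_right ?_⟩
      rintro rfl
      exact hne rfl
  · intro o' ho'
    have : o'.2 ∈ (R.set j (o.2, o.1 :: R[j].2)).map Prod.fst := by
      rw [hkeys]
      rcases List.mem_append.1 ho' with ho' | ho'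
      · obtain ⟨e, he, he'⟩ := h.ex o' ho'
        exact List.mem_map.2 ⟨e, he, he'⟩
      · rw [List.mem_singleton] at ho'
        subst ho'
        exact List.mem_map.2 ⟨_, hmem, ho⟩
    obtain ⟨e, he, he'⟩ := List.mem_map.1 this
    exact ⟨e, he, he'⟩
  · have h1 := h.sum
    have hj' : j < (R.map fun e => e.2.length).length := by simpa using hj
    rw [List.map_set, List.length_append, List.length_singleton, ← h1, List.sum_set, if_pos hj']
    conv_rhs => rw [← List.take_append_drop j (R.map fun e => e.2.length),
      List.drop_eq_getElem_cons hj', List.sum_append, List.sum_cons]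
    simp
    omega

theorem length_le (h : CellLists ops R) : R.length ≤ ops.length := by
  rw [← h.sum]
  have : ∀ l : List ((ℕ × ℕ) × List ℕ), (∀ e ∈ l, e.2 ≠ []) →
      l.length ≤ (l.map fun e => e.2.length).sum := by
    intro l hl
    induction l with
    | nil => simp
    | cons e l ih =>
      have h1 := ih fun e he => hl e (by simp [he])
      have h2 := List.length_pos_iff.2 (hl e (by simp))
      simp only [List.length_cons, List.map_cons, List.sum_cons]
      omega
  exact this R h.ne_nil

end CellLists

/-- The offsets of the neighbors of a cell. -/
def offsets : List (ℕ × ℕ) :=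
  [(0, 0), (0, 1), (0, 2), (1, 0), (1, 1), (1, 2), (2, 0), (2, 1), (2, 2)]

theorem mem_offsets (o : ℕ × ℕ) : o ∈ offsets ↔ o.1 ≤ 2 ∧ o.2 ≤ 2 := by
  obtain ⟨a, b⟩ := o
  constructor
  · intro h
    simp only [offsets, List.mem_cons, List.not_mem_nil, or_false, Prod.mk.injEq] at h
    omega
  · rintro ⟨h1, h2⟩
    simp only at h1 h2
    interval_cases a <;> interval_cases b <;> simp [offsets]

/-- The pair of the triangle `t` and a cell next to its own. -/
def cellOp (cx cy : ℕ → ℕ) (t : ℕ) (o : ℕ × ℕ) : ℕ × ℕ × ℕ := (t, cx t + o.1 - 1, cy t + o.2 - 1)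

/-- The pairs of triangles and cells for the first `N` triangles. -/
def cellOps (cx cy : ℕ → ℕ) (N : ℕ) : List (ℕ × ℕ × ℕ) :=
  (List.range N).flatMap fun t => offsets.map (cellOp cx cy t)

theorem cellOps_succ (cx cy : ℕ → ℕ) (N : ℕ) :
    cellOps cx cy (N + 1) = cellOps cx cy N ++ offsets.map (cellOp cx cy N) := by
  simp [cellOps, List.range_succ]

theorem length_cellOps (cx cy : ℕ → ℕ) (N : ℕ) : (cellOps cx cy N).length = 9 * N := by
  induction N with
  | zero => rfl
  | succ N ih => rw [cellOps_succ, List.length_append, ih]; simp [offsets]; ring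

/-- Cell numbers are at least one, so the truncated subtraction is exact. -/
theorem cellOp_inj {cx cy : ℕ → ℕ} {t : ℕ} (h1 : 1 ≤ cx t) (h2 : 1 ≤ cy t) {o o' : ℕ × ℕ}
    (h : cellOp cx cy t o = cellOp cx cy t o') : o = o' := by
  obtain ⟨a, b⟩ := o
  obtain ⟨a', b'⟩ := o'
  simp only [cellOp, Prod.mk.injEq] at h ⊢
  omega

theorem mem_cellOps {cx cy : ℕ → ℕ} {N : ℕ} {o : ℕ × ℕ × ℕ} : o ∈ cellOps cx cy N ↔
    o.1 < N ∧ ∃ a ≤ 2, ∃ b ≤ 2, o.2 = (cx o.1 + a - 1, cy o.1 + b - 1) := by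
  obtain ⟨t, k⟩ := o
  simp only [cellOps, List.mem_flatMap, List.mem_range, List.mem_map, cellOp, mem_offsets,
    Prod.mk.injEq, Prod.exists]
  constructor
  · rintro ⟨t', h1, a, b, ⟨h2, h3⟩, rfl, rfl⟩
    exact ⟨h1, a, h2, b, h3, rfl⟩
  · rintro ⟨h1, a, h2, b, h3, rfl⟩
    exact ⟨t, h1, a, b, ⟨h2, h3⟩, rfl, rfl⟩

/-! ### The geometry of the roots -/

namespace QParams

variable (Q : QParams)

/-- The root for a cell. -/
noncomputable def rootNode (sx sy : ℕ → ℝ) (e : (ℕ × ℕ) × List ℕ) : QNode where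
  x₀ := sx e.1.1
  x₁ := min (sx (e.1.1 + 1)) (sx e.1.1 + 4 * Q.W)
  y₀ := sy e.1.2
  y₁ := min (sy (e.1.2 + 1)) (sy e.1.2 + 4 * Q.W)
  l := 4 * Q.W
  p := 0
  s := 0
  act := e.2

/-- The smallest coordinate of the triangle `t` in one direction. -/
noncomputable def minCoord (k : Fin 2) (t : ℕ) : ℝ :=
  min (min (Q.T t 0 k) (Q.T t 1 k)) (Q.T t 2 k)

variable {Q}

theorem minCoord_le (hT : ∀ t < Q.N, ∀ a c, dist (Q.T t a) (Q.T t c) ≤ Q.W) (k : Fin 2) {t : ℕ}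
    (ht : t < Q.N) {z : Plane} (hz : z ∈ solidTriangle (Q.T t)) :
    Q.minCoord k t ≤ z k ∧ z k ≤ Q.minCoord k t + Q.W := by
  have hlin : ∀ z : Plane, (EuclideanSpace.proj k : Plane →L[ℝ] ℝ) z = z k := fun z => rfl
  constructor
  · have hconv : Convex ℝ {z : Plane | Q.minCoord k t ≤ z k} :=
      convex_halfSpace_ge (EuclideanSpace.proj k : Plane →L[ℝ] ℝ).toLinearMap.isLinear _
    refine convexHull_min ?_ hconv hz
    rintro _ ⟨a, rfl⟩
    simp only [Set.mem_ofPred_eq, minCoord]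
    fin_cases a <;> simp
  · have : ∃ a, Q.minCoord k t = Q.T t a k := by
      unfold minCoord
      rcases min_choice (min (Q.T t 0 k) (Q.T t 1 k)) (Q.T t 2 k) with h | h <;> rw [h]
      · rcases min_choice (Q.T t 0 k) (Q.T t 1 k) with h | h <;> rw [h]
        exacts [⟨0, rfl⟩, ⟨1, rfl⟩]
      · exact ⟨2, rfl⟩
    obtain ⟨a, ha⟩ := this
    have h1 := dist_le_of_mem_solidTriangle (hT t ht) hz (vertex_mem (Q.T t) a)
    have h2 := (abs_le.1 (Plane.abs_sub_le_dist z (Q.T t a) k)).2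
    linarith

theorem strips_mono {N C : ℕ} {W : ℝ} {key start : ℕ → ℝ} {cell : ℕ → ℕ}
    (h : IsStrips N W key C start cell) (hW : 0 < W) {c d : ℕ} (hcd : c < d) (hd : d ≤ C + 2) :
    start c + 2 * W * (d - c : ℕ) ≤ start d := by
  obtain ⟨k, rfl⟩ := Nat.exists_eq_add_of_lt hcd
  induction k with
  | zero => simpa using h.step c (by omega)
  | succ k ih =>
    have h1 := ih (by omega) (by omega)
    have h2 := h.step (c + k + 1) (by omega)
    have e1 : c + k + 1 - c = k + 1 := by omega
    have e2 : c + (k + 1) + 1 - c = k + 2 := by omega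
    rw [e1] at h1
    rw [e2, show c + (k + 1) + 1 = c + k + 1 + 1 by ring]
    push_cast at h1 ⊢
    linarith

/-- A triangle reaches at most `W` beyond its smallest coordinate, hence less than `3 * W` beyond
the start of its strip. So it lies in its own strip and the next one, and all strips that are not
adjacent to its own have distance at least `W` from it. Therefore nine cells for each triangle
suffice, and the triangles that are missing in the list of a root are far away. -/
theorem isRoots {sx sy : ℕ → ℝ} {cx cy : ℕ → ℕ} {Cx Cy : ℕ}
    (hT : ∀ t < Q.N, ∀ a c, dist (Q.T t a) (Q.T t c) ≤ Q.W) (hW : 0 < Q.W)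
    (hx : IsStrips Q.N Q.W (Q.minCoord 0) Cx sx cx) (hy : IsStrips Q.N Q.W (Q.minCoord 1) Cy sy cy)
    {R : List ((ℕ × ℕ) × List ℕ)} (hR : CellLists (cellOps cx cy Q.N) R) :
    Q.IsRoots (R.map (Q.rootNode sx sy)) := by
  have hkey : ∀ e ∈ R, e.1.1 ≤ Cx + 1 ∧ e.1.2 ≤ Cy + 1 := by
    intro e he
    obtain ⟨t, ht⟩ := List.exists_mem_of_ne_nil _ (hR.ne_nil e he)
    obtain ⟨h1, a, ha, b, hb, h2⟩ := mem_cellOps.1 ((hR.mem e he t).1 ht)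
    simp only at h1 h2
    have := hx.cell_le t h1; have := hy.cell_le t h1
    rw [h2]
    simp only
    omega
  -- Consecutive starts may be far apart, so cells are cut off at `4 * W`. Their widths are then
  -- between `2 * W` and `4 * W`, which is the proportion that `Good` allows for the size `4 * W`.
  have hwidth : ∀ {C : ℕ} {key : ℕ → ℝ} {s : ℕ → ℝ} {cell : ℕ → ℕ}, IsStrips Q.N Q.W key C s cell →
      ∀ c ≤ C + 1, 2 * Q.W ≤ min (s (c + 1)) (s c + 4 * Q.W) - s c ∧
        min (s (c + 1)) (s c + 4 * Q.W) - s c ≤ 4 * Q.W := by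
    intro C key s cell h c hc
    have h1 := h.step c hc
    constructor
    · rcases min_choice (s (c + 1)) (s c + 4 * Q.W) with h' | h' <;> rw [h'] <;> linarith
    · have := min_le_right (s (c + 1)) (s c + 4 * Q.W)
      linarith
  -- a cell that is not next to the cell of a triangle is far from it
  have hfar : ∀ {C : ℕ} {k : Fin 2} {s : ℕ → ℝ} {cell : ℕ → ℕ},
      IsStrips Q.N Q.W (Q.minCoord k) C s cell → ∀ c ≤ C + 1, ∀ t < Q.N,
      (∀ a ≤ 2, c ≠ cell t + a - 1) → ∀ z ∈ solidTriangle (Q.T t), ∀ y : Plane, s c ≤ y k →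
        y k < min (s (c + 1)) (s c + 4 * Q.W) → Q.W ≤ dist z y := by
    intro C k s cell h c hc t ht hne z hz y hy1 hy2
    obtain ⟨z1, z2⟩ := minCoord_le hT k ht hz
    have k1 := h.cell_pos t ht
    have k2 := h.cell_le t ht
    have k3 := h.start_le t ht
    have k4 := h.lt_start t ht
    have n0 := hne 0 (by omega)
    have n1 := hne 1 (by omega)
    have n2 := hne 2 (by omega)
    have hd := Plane.abs_sub_le_dist z y k
    refine le_trans ?_ hd
    have hy3 : y k < s (c + 1) := hy2.trans_le (min_le_left _ _)
    -- On the left a whole strip lies in between, of length at least `2 * W`. On the right the cell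
    -- starts at least `4 * W` after the start of the strip of the triangle, which ends before `3 *
    -- W`.
    rcases lt_or_ge c (cell t) with h' | h'
    · have := strips_mono h hW (c := c + 1) (d := cell t) (by omega) (by omega)
      have h2 : (1 : ℝ) ≤ (cell t - (c + 1) : ℕ) := by exact_mod_cast (by omega)
      rw [le_abs]; left
      nlinarith
    · have := strips_mono h hW (c := cell t) (d := c) (by omega) (by omega)
      have h2 : (2 : ℝ) ≤ (c - cell t : ℕ) := by exact_mod_cast (by omega)
      rw [le_abs]; right
      nlinarith
  -- the cells next to the cell of a triangle cover it
  have hcov : ∀ {C : ℕ} {k : Fin 2} {s : ℕ → ℝ} {cell : ℕ → ℕ},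
      IsStrips Q.N Q.W (Q.minCoord k) C s cell → ∀ t < Q.N, ∀ z ∈ solidTriangle (Q.T t),
        ∃ a ≤ 2, s (cell t + a - 1) ≤ z k ∧
          z k < min (s (cell t + a - 1 + 1)) (s (cell t + a - 1) + 4 * Q.W) := by
    intro C k s cell h t ht z hz
    obtain ⟨z1, z2⟩ := minCoord_le hT k ht hz
    have k2 := h.cell_le t ht
    have k3 := h.start_le t ht
    have k4 := h.lt_start t ht
    have s1 := h.step (cell t) (by omega)
    have s2 := h.step (cell t + 1) (by omega)
    -- The coordinate is less than `3 * W` beyond the start of the strip of the triangle; it is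
    -- either in this strip or in the next one, and the cut at `4 * W` does not matter.
    by_cases hlt : z k < s (cell t + 1)
    · refine ⟨1, by omega, ?_⟩
      rw [Nat.add_sub_cancel]
      exact ⟨by linarith, lt_min hlt (by linarith)⟩
    · refine ⟨2, le_rfl, ?_⟩
      rw [show cell t + 2 - 1 = cell t + 1 by omega]
      exact ⟨not_lt.1 hlt, lt_min (by linarith) (by linarith)⟩
  refine ⟨?_, ?_, ?_, ?_, ?_, ?_⟩
  · intro b hb
    obtain ⟨e, he, rfl⟩ := List.mem_map.1 hb
    obtain ⟨k1, k2⟩ := hkey e he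
    obtain ⟨w1, w2⟩ := hwidth hx e.1.1 k1
    obtain ⟨w3, w4⟩ := hwidth hy e.1.2 k2
    refine ⟨by simp [rootNode, hW], by simp only [rootNode]; linarith, by simpa [rootNode] using w2,
      by simp only [rootNode]; linarith, by simpa [rootNode] using w4, hR.nodup e he, ?_, ∅, by simp,
      by simp, by simp [rootNode], by simp [rootNode], by simp, ?_⟩
    · intro t ht
      exact (mem_cellOps.1 ((hR.mem e he t).1 ht)).1
    · intro t ht _ hta
      have hdist : ∀ z ∈ solidTriangle (Q.T t), ∀ y ∈ (Q.rootNode sx sy e).box, Q.W ≤ dist z y := by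
        intro z hz y hy'
        obtain ⟨y1, y2, y3, y4⟩ := hy'
        by_cases hex : ∃ a ≤ 2, e.1.1 = cx t + a - 1
        · obtain ⟨a, ha, hea⟩ := hex
          refine hfar hy e.1.2 k2 t ht (fun b hb heb => hta ?_) z hz y y3 y4
          exact (hR.mem e he t).2 (mem_cellOps.2 ⟨ht, a, ha, b, hb, Prod.ext hea heb⟩)
        · push Not at hex
          exact hfar hx e.1.1 k1 t ht hex z hz y y1 y2
      constructor
      · refine measure_mono_null (t := ∅) ?_ measure_empty
        rintro z ⟨hz1, hz2⟩
        have := hdist z hz1 z hz2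
        rw [dist_self] at this
        linarith
      · intro y hy'
        refine measure_mono_null (t := ∅) ?_ measure_empty
        rintro z ⟨hz1, hz2⟩
        have := hdist z hz1 y hy'
        have h2 := (Metric.mem_ball.1 hz2).trans_le (min_le_right _ _)
        linarith
  · intro b hb
    obtain ⟨e, he, rfl⟩ := List.mem_map.1 hb
    rfl
  · rw [List.pairwise_map]
    have := hR.keys
    rw [List.nodup_iff_pairwise_ne, List.pairwise_map] at this
    refine this.imp_of_mem fun {e e'} he he' hne => ?_
    obtain ⟨k1, k2⟩ := hkey e he
    obtain ⟨k1', k2'⟩ := hkey e' he'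
    have hsep : ∀ {C : ℕ} {key : ℕ → ℝ} {s : ℕ → ℝ} {cell : ℕ → ℕ}, IsStrips Q.N Q.W key C s cell →
        ∀ c ≤ C + 1, ∀ d ≤ C + 1, ∀ v : ℝ, s c ≤ v → v < min (s (c + 1)) (s c + 4 * Q.W) →
        s d ≤ v → v < min (s (d + 1)) (s d + 4 * Q.W) → c = d := by
      intro C key s cell h
      have hm : ∀ c d, c < d → d ≤ C + 1 → s (c + 1) ≤ s d := by
        intro c d hcd hd
        rcases Nat.lt_or_ge (c + 1) d with h' | h'
        · have := strips_mono h hW h' (by omega)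
          have h0 : 0 ≤ 2 * Q.W * (d - (c + 1) : ℕ) := by positivity
          linarith
        · rw [show d = c + 1 by omega]
      intro c hc d hd v h1 h2 h3 h4
      have h2' := h2.trans_le (min_le_left _ _)
      have h4' := h4.trans_le (min_le_left _ _)
      rcases lt_trichotomy c d with h' | h' | h'
      · have := hm c d h' hd; linarith
      · exact h'
      · have := hm d c h' hc; linarith
    rw [Set.disjoint_left]
    rintro z ⟨h1, h2, h3, h4⟩ ⟨h5, h6, h7, h8⟩
    exact hne (Prod.ext (hsep hx _ k1 _ k1' (z 0) h1 h2 h5 h6) (hsep hy _ k2 _ k2' (z 1) h3 h4 h7 h8))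
  · intro t ht z hz
    obtain ⟨a, ha, h1, h2⟩ := hcov hx t ht z hz
    obtain ⟨b, hb, h3, h4⟩ := hcov hy t ht z hz
    obtain ⟨e, he, hek⟩ := hR.ex (t, cx t + a - 1, cy t + b - 1)
      (mem_cellOps.2 ⟨ht, a, ha, b, hb, rfl⟩)
    refine ⟨Q.rootNode sx sy e, List.mem_map_of_mem he, ?_⟩
    simp only [QNode.box, rootNode, hek]
    exact ⟨h1, h2, h3, h4⟩
  · rw [List.map_map]
    exact (hR.sum.trans (length_cellOps _ _ _)).le
  · rw [List.length_map]
    exact hR.length_le.trans (length_cellOps _ _ _).le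

end QParams


/-! ### Nodes in memory -/

/-- The list `l` is stored as a chain of the cells `1, …, b` that starts at the given cell. -/
def ListAt (f : ℕ → ℕ) (b : ℕ) : ℕ → List ℕ → Prop
  | p, [] => p = 0
  | p, t :: l => 0 < p ∧ p ≤ b ∧ f (addr 27 p) = t ∧ ListAt f b (f (addr 28 p)) l

/-- A chain uses only the cells up to the counter `b`; new cells are allocated above it and do not
disturb the existing chains. -/
theorem ListAt.congr {f g : ℕ → ℕ} {b b' : ℕ} (hb : b ≤ b')
    (h27 : ∀ p ≤ b, g (addr 27 p) = f (addr 27 p)) (h28 : ∀ p ≤ b, g (addr 28 p) = f (addr 28 p))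
    {p : ℕ} {l : List ℕ} (h : ListAt f b p l) : ListAt g b' p l := by
  induction l generalizing p with
  | nil => exact h
  | cons t l ih =>
    obtain ⟨h1, h2, h3, h4⟩ := h
    exact ⟨h1, h2.trans hb, by rw [h27 p h2, h3], by rw [h28 p h2]; exact ih h4⟩

/-- The node `b` is stored with the number `id`. -/
structure NodeAt (s : MemState) (id : ℕ) (b : QNode) : Prop where
  x₀ : s.real (addr 10 id) = b.x₀
  x₁ : s.real (addr 11 id) = b.x₁
  y₀ : s.real (addr 12 id) = b.y₀
  y₁ : s.real (addr 13 id) = b.y₁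
  l : s.real (addr 14 id) = b.l
  p_eq : s.nat (addr 24 id) = b.p
  s_eq : s.nat (addr 25 id) = b.s
  act : ListAt s.nat (s.nat (addr 11 0)) (s.nat (addr 26 id)) b.act

theorem NodeAt.congr {s s' : MemState} {id : ℕ} {b : QNode} (h : NodeAt s id b)
    (hr : ∀ j ∈ [10, 11, 12, 13, 14], s'.real (addr j id) = s.real (addr j id))
    (hn : ∀ j ∈ [24, 25, 26], s'.nat (addr j id) = s.nat (addr j id))
    (hl : ∀ j ∈ [27, 28], ∀ p ≤ s.nat (addr 11 0), s'.nat (addr j p) = s.nat (addr j p))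
    (hb : s.nat (addr 11 0) ≤ s'.nat (addr 11 0)) : NodeAt s' id b := by
  obtain ⟨h1, h2, h3, h4, h5, h6, h7, h8⟩ := h
  refine ⟨?_, ?_, ?_, ?_, ?_, ?_, ?_, ?_⟩
  · rw [hr _ (by simp), h1]
  · rw [hr _ (by simp), h2]
  · rw [hr _ (by simp), h3]
  · rw [hr _ (by simp), h4]
  · rw [hr _ (by simp), h5]
  · rw [hn _ (by simp), h6]
  · rw [hn _ (by simp), h7]
  · rw [hn _ (by simp)]
    exact h8.congr hb (hl _ (by simp)) (hl _ (by simp))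

/-- The nodes in `L` are stored with the numbers from `off` on. -/
structure NodesAt (s : MemState) (off : ℕ) (L : List QNode) : Prop where
  node : ∀ j (h : j < L.length), NodeAt s (off + j) L[j]

theorem NodesAt.congr {s s' : MemState} {off : ℕ} {L : List QNode} (h : NodesAt s off L)
    (hr : ∀ j ∈ [10, 11, 12, 13, 14], ∀ i < L.length, s'.real (addr j (off + i)) = s.real (addr j (off + i)))
    (hn : ∀ j ∈ [24, 25, 26], ∀ i < L.length, s'.nat (addr j (off + i)) = s.nat (addr j (off + i)))
    (hl : ∀ j ∈ [27, 28], ∀ p ≤ s.nat (addr 11 0), s'.nat (addr j p) = s.nat (addr j p))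
    (hb : s.nat (addr 11 0) ≤ s'.nat (addr 11 0)) : NodesAt s' off L :=
  ⟨fun j hj => (h.node j hj).congr (fun c hc => hr c hc j hj) (fun c hc => hn c hc j hj) hl hb⟩

theorem NodesAt.frame {s s' : MemState} {off : ℕ} {L : List QNode} (h : NodesAt s off L)
    {J J' : List (Fin 64)} (hn : SameOff J s.nat s'.nat) (hr : SameOff J' s.real s'.real)
    (hJ : ∀ j ∈ [11, 24, 25, 26, 27, 28], j ∉ J := by decide)
    (hJ' : ∀ j ∈ [10, 11, 12, 13, 14], j ∉ J' := by decide) : NodesAt s' off L :=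
  h.congr (fun j hj i _ => hr j _ (hJ' j hj))
    (fun j hj i _ => hn j _ (hJ j (by simp at hj ⊢; tauto)))
    (fun j hj p _ => hn j _ (hJ j (by simp at hj ⊢; tauto))) (hn 11 0 (hJ _ (by simp))).ge

theorem NodesAt.snoc {s : MemState} {off : ℕ} {L : List QNode} {b : QNode} (h : NodesAt s off L)
    (hb : NodeAt s (off + L.length) b) : NodesAt s off (L ++ [b]) := by
  refine ⟨fun j hj => ?_⟩
  rw [List.getElem_append]
  split_ifs with h'
  · exact h.node j h'
  · have : j = L.length := by simp at hj; omega
    subst this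
    simpa using hb

theorem NodesAt.set {s : MemState} {off : ℕ} {L : List QNode} {b : QNode} {i : ℕ}
    (h : ∀ j (h : j < L.length), j ≠ i → NodeAt s (off + j) L[j]) (hb : NodeAt s (off + i) b) :
    NodesAt s off (L.set i b) := by
  refine ⟨fun j hj => ?_⟩
  rw [List.length_set] at hj
  rw [List.getElem_set]
  split_ifs with h'
  · subst h'; exact hb
  · exact h j hj (Ne.symm h')

/-- Adding the triangle with number `var 14` to the undecided triangles of the node `var 15`. -/
def pushTri : Program :=
  .seqs [.incr 11, .setNat (.addr 27 (.var 11)) (.var 14),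
    .setNat (.addr 28 (.var 11)) (.at 26 (.var 15)), .setNat (.addr 26 (.var 15)) (.var 11)]

theorem flat_pushTri : pushTri.Flat := by simp [pushTri, Program.Flat]

theorem run_pushTri {s : MemState} {t id lc : ℕ} (ht : s.nat (addr 14 0) = t)
    (hid : s.nat (addr 15 0) = id) (hlc : s.nat (addr 11 0) = lc) :
    pushTri.run s = ⟨Function.update (Function.update (Function.update (Function.update s.nat
      (addr 11 0) (lc + 1)) (addr 27 (lc + 1)) t) (addr 28 (lc + 1)) (s.nat (addr 26 id)))
      (addr 26 id) (lc + 1), s.real⟩ := by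
  simp [pushTri, update_addr, ht, hid, hlc]

theorem NodeAt.push {s : MemState} {id : ℕ} {b : QNode} (h : NodeAt s id b)
    (hid : s.nat (addr 15 0) = id) :
    NodeAt (pushTri.run s) id { b with act := s.nat (addr 14 0) :: b.act } := by
  rw [run_pushTri rfl hid rfl]
  obtain ⟨h1, h2, h3, h4, h5, h6, h7, h8⟩ := h
  refine ⟨h1, h2, h3, h4, h5, by simp [update_addr, h6], by simp [update_addr, h7], ?_⟩
  simp only [update_addr, ListAt]
  refine ⟨by simp, by simp, by simp, ?_⟩
  simp only [Fin.reduceEq, false_and, and_self, if_true, if_false]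
  refine h8.congr (Nat.le_succ _) ?_ ?_
  · intro p hp
    simp [update_addr, show p ≠ s.nat (addr 11 0) + 1 by omega]
  · intro p hp
    simp [update_addr, show p ≠ s.nat (addr 11 0) + 1 by omega]

theorem NodeAt.push_ne {s : MemState} {id : ℕ} {b : QNode} (h : NodeAt s id b)
    (hid : s.nat (addr 15 0) ≠ id) : NodeAt (pushTri.run s) id b := by
  rw [run_pushTri rfl rfl rfl]
  refine h.congr (fun _ _ => rfl) ?_ ?_ (by simp [update_addr])
  · intro j hj
    simp only [List.mem_cons, List.not_mem_nil, or_false] at hj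
    rcases hj with rfl | rfl | rfl <;> simp [update_addr, hid.symm]
  · intro j hj p hp
    simp only [List.mem_cons, List.not_mem_nil, or_false] at hj
    rcases hj with rfl | rfl <;> simp [update_addr, show p ≠ s.nat (addr 11 0) + 1 by omega]

theorem sameOff_pushTri (s : MemState) : SameOff [11, 26, 27, 28] s.nat (pushTri.run s).nat := by
  rw [run_pushTri rfl rfl rfl]
  exact ((((SameOff.refl _ _).update (by simp) _ _).update (by simp) _ _).update (by simp) _ _).update
    (by simp) _ _

theorem real_pushTri (s : MemState) : (pushTri.run s).real = s.real := by
  rw [run_pushTri rfl rfl rfl]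

theorem count_pushTri (s : MemState) : (pushTri.run s).nat (addr 11 0) = s.nat (addr 11 0) + 1 := by
  rw [run_pushTri rfl rfl rfl]
  simp [update_addr]

/-- The data of the problem are stored in memory. -/
structure Env (Q : QParams) (off : ℕ) (s : MemState) : Prop where
  off_pos : 0 < off
  n_eq : s.nat (addr 0 0) = Q.n
  N_eq : s.nat (addr 2 0) = Q.N
  off_eq : s.nat (addr 3 0) = off
  W_eq : s.real (addr 40 off) = Q.W
  sz_eq : s.real (addr 41 off) = Q.sz
  κ_eq : s.real (addr 42 off) = Q.κ
  x0 : ∀ t < Q.N, s.real (addr 0 (off + t)) = Q.T t 0 0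
  y0 : ∀ t < Q.N, s.real (addr 1 (off + t)) = Q.T t 0 1
  x1 : ∀ t < Q.N, s.real (addr 2 (off + t)) = Q.T t 1 0
  y1 : ∀ t < Q.N, s.real (addr 3 (off + t)) = Q.T t 1 1
  x2 : ∀ t < Q.N, s.real (addr 4 (off + t)) = Q.T t 2 0
  y2 : ∀ t < Q.N, s.real (addr 5 (off + t)) = Q.T t 2 1

theorem Env.frame {Q : QParams} {off : ℕ} {s s' : MemState} (h : Env Q off s)
    {J J' : List (Fin 64)} (hn : SameOff J s.nat s'.nat) (hr : SameOff J' s.real s'.real)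
    (hJ : ∀ j ∈ [0, 2, 3], j ∉ J := by decide)
    (hJ' : ∀ j ∈ [0, 1, 2, 3, 4, 5, 40, 41, 42], j ∉ J' := by decide) : Env Q off s' := by
  obtain ⟨h0, h1, h2, h3, h4, h5, h6, h7, h8, h9, h10, h11, h12⟩ := h
  refine ⟨h0, ?_, ?_, ?_, ?_, ?_, ?_, ?_, ?_, ?_, ?_, ?_, ?_⟩
  · rw [hn 0 0 (hJ _ (by simp)), h1]
  · rw [hn 2 0 (hJ _ (by simp)), h2]
  · rw [hn 3 0 (hJ _ (by simp)), h3]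
  · rw [hr 40 _ (hJ' _ (by simp)), h4]
  · rw [hr 41 _ (hJ' _ (by simp)), h5]
  · rw [hr 42 _ (hJ' _ (by simp)), h6]
  · intro t ht; rw [hr 0 _ (hJ' _ (by simp)), h7 t ht]
  · intro t ht; rw [hr 1 _ (hJ' _ (by simp)), h8 t ht]
  · intro t ht; rw [hr 2 _ (hJ' _ (by simp)), h9 t ht]
  · intro t ht; rw [hr 3 _ (hJ' _ (by simp)), h10 t ht]
  · intro t ht; rw [hr 4 _ (hJ' _ (by simp)), h11 t ht]
  · intro t ht; rw [hr 5 _ (hJ' _ (by simp)), h12 t ht]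

/-! ### The computation of the roots -/

/-- The place where the node of the cell `(var 12, var 13)` is recorded. -/
def bucketExpr : NatExpr := .add (.mul (.var 12) (.add (.var 2) (.lit 3))) (.var 13)

/-- Creating the node of the cell `(var 12, var 13)` unless there is one. -/
def cellProg : Program :=
  .branch (.natLt (.lit 0) (.at 29 bucketExpr)) .skip (.seqs [
    .setNat (.addr 29 bucketExpr) (.var 10),
    .setReal (.addr 10 (.var 10)) (.off 7 (.var 12)),
    .setReal (.addr 11 (.var 10)) (.min (.off 7 (.add (.var 12) (.lit 1)))
      (.add (.off 7 (.var 12)) (.mul (.num 4) (.var 40)))),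
    .setReal (.addr 12 (.var 10)) (.off 8 (.var 13)),
    .setReal (.addr 13 (.var 10)) (.min (.off 8 (.add (.var 13) (.lit 1)))
      (.add (.off 8 (.var 13)) (.mul (.num 4) (.var 40)))),
    .setReal (.addr 14 (.var 10)) (.mul (.num 4) (.var 40)),
    .setNat (.addr 24 (.var 10)) (.lit 0), .setNat (.addr 25 (.var 10)) (.lit 0),
    .setNat (.addr 26 (.var 10)) (.lit 0), .incr 10])

/-- Recording the triangle `var 14` for a cell next to its own. -/
def rootStep (o : ℕ × ℕ) : Program :=
  .seqs [.setVar 12 (.sub (.add (.at 30 (.var 14)) (.lit o.1)) (.lit 1)),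
    .setVar 13 (.sub (.add (.at 31 (.var 14)) (.lit o.2)) (.lit 1)),
    cellProg,
    .setVar 15 (.at 29 bucketExpr), pushTri]

/-- The roots of the subdivision, from the strips in both directions. -/
def rootsProg : Program :=
  .seqs [.setVar 10 (.var 3), .setVar 11 (.lit 0), .setVar 14 (.lit 0),
    .loop (.natLt (.var 14) (.var 2)) (.seq (.seqs (offsets.map rootStep)) (.incr 14))]

/-- The state of the computation of the roots, after the pairs of triangles and cells in `ops` have
been recorded. -/
structure RootState (Q : QParams) (off : ℕ) (sx sy : ℕ → ℝ) (cx cy : ℕ → ℕ)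
    (ops : List (ℕ × ℕ × ℕ)) (s : MemState) : Prop where
  env : Env Q off s
  sx_eq : ∀ k, s.real (addr 7 (off + k)) = sx k
  sy_eq : ∀ k, s.real (addr 8 (off + k)) = sy k
  cx_eq : ∀ t, s.nat (addr 30 t) = cx t
  cy_eq : ∀ t, s.nat (addr 31 t) = cy t
  lists : s.nat (addr 11 0) = ops.length
  nodes : ∃ R, CellLists ops R ∧ NodesAt s off (R.map (Q.rootNode sx sy)) ∧
    s.nat (addr 10 0) = off + R.length ∧
    (∀ j (h : j < R.length), s.nat (addr 29 (R[j].1.1 * (Q.N + 3) + R[j].1.2)) = off + j) ∧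
    ∀ c ≤ Q.N + 1, ∀ d ≤ Q.N + 1, (c, d) ∉ R.map Prod.fst → s.nat (addr 29 (c * (Q.N + 3) + d)) = 0

/-- The node of a cell is found in a table indexed by pairs of strip numbers. An entry zero means
that there is no node yet; this is unambiguous because node numbers start at `off > 0`. -/
theorem rootStep_run {Q : QParams} {off : ℕ} {sx sy : ℕ → ℝ} {cx cy : ℕ → ℕ}
    {ops : List (ℕ × ℕ × ℕ)} {s : MemState} (h : RootState Q off sx sy cx cy ops s) {t : ℕ}
    (ht : s.nat (addr 14 0) = t) (hcx : 1 ≤ cx t ∧ cx t ≤ Q.N) (hcy : 1 ≤ cy t ∧ cy t ≤ Q.N)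
    (hops : ∀ o ∈ ops, o.2.1 ≤ Q.N + 1 ∧ o.2.2 ≤ Q.N + 1) {o : ℕ × ℕ} (ho : o ∈ offsets)
    (hnew : cellOp cx cy t o ∉ ops) :
    RootState Q off sx sy cx cy (ops ++ [cellOp cx cy t o]) ((rootStep o).run s) ∧
      ((rootStep o).run s).nat (addr 14 0) = t ∧
      SameOff [10, 11, 12, 13, 15, 24, 25, 26, 27, 28, 29] s.nat ((rootStep o).run s).nat ∧
      SameOff [10, 11, 12, 13, 14] s.real ((rootStep o).run s).real := by
  obtain ⟨henv, hsx, hsy, hcxe, hcye, hlists, R, hR, hnodes, hcnt, hb1, hb2⟩ := h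
  set c := cx t + o.1 - 1 with hc
  set d := cy t + o.2 - 1 with hd
  have hoff := (mem_offsets o).1 ho
  have hcN : c ≤ Q.N + 1 := by omega
  have hdN : d ≤ Q.N + 1 := by omega
  set B := c * (Q.N + 3) + d with hB
  -- Strip numbers are at most `N + 1`, so the row length `N + 3` makes the encoding of pairs
  -- injective.
  have hBinj : ∀ c' d', d' ≤ Q.N + 1 → c' * (Q.N + 3) + d' = B → (c', d') = (c, d) := by
    intro c' d' hd' heq
    have h1 : c' = c := by
      rcases lt_trichotomy c' c with h | h | h
      · nlinarith
      · exact h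
      · nlinarith
    subst h1
    exact Prod.ext rfl (by simpa [hB] using heq)
  have hRle : ∀ j (h : j < R.length), R[j].1.1 ≤ Q.N + 1 ∧ R[j].1.2 ≤ Q.N + 1 := by
    intro j hj
    have hm := List.getElem_mem hj
    obtain ⟨u, hu⟩ := List.exists_mem_of_ne_nil _ (hR.ne_nil _ hm)
    exact hops _ ((hR.mem _ hm u).1 hu)
  set s₁ := (Program.setVar 13 (.sub (.add (.at 31 (.var 14)) (.lit o.2)) (.lit 1))).run
    ((Program.setVar 12 (.sub (.add (.at 30 (.var 14)) (.lit o.1)) (.lit 1))).run s) with hs₁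
  have hs₁' : s₁ = ⟨Function.update (Function.update s.nat (addr 12 0) c) (addr 13 0) d, s.real⟩ := by
    simp [hs₁, update_addr, ht, hcxe, hcye, ← hc, ← hd]
  -- find or create the node of the cell
  obtain ⟨s₂, hs₂, L, j, hj, n2, r2, hnodes2, hlists2, h15, hcnt2, hLR⟩ : ∃ s₂, (Program.seqs [cellProg, .setVar 15 (.at 29 bucketExpr)]).run s₁ = s₂ ∧ ∃ (L : List QNode) (j : ℕ) (hj : j < L.length),
      SameOff [10, 12, 13, 15, 24, 25, 26, 29] s.nat s₂.nat ∧ SameOff [10, 11, 12, 13, 14] s.real s₂.real ∧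
      NodesAt s₂ off L ∧ s₂.nat (addr 11 0) = ops.length ∧ s₂.nat (addr 15 0) = off + j ∧
      s₂.nat (addr 10 0) = off + L.length ∧
      ∃ R', CellLists (ops ++ [cellOp cx cy t o]) R' ∧ R'.length = L.length ∧
        R'.map (Q.rootNode sx sy) = L.set j { L[j] with act := t :: L[j].act } ∧
        (∀ j (h : j < R'.length), s₂.nat (addr 29 (R'[j].1.1 * (Q.N + 3) + R'[j].1.2)) = off + j) ∧
        ∀ c ≤ Q.N + 1, ∀ d ≤ Q.N + 1, (c, d) ∉ R'.map Prod.fst →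
          s₂.nat (addr 29 (c * (Q.N + 3) + d)) = 0 := by
    refine ⟨_, rfl, ?_⟩
    by_cases hin : (c, d) ∈ R.map Prod.fst
    · obtain ⟨e, he, hek⟩ := List.mem_map.1 hin
      obtain ⟨j, hj, rfl⟩ := List.mem_iff_getElem.1 he
      have hbj := hb1 j hj
      rw [hek] at hbj
      have hbj' : s.nat (addr 29 B) = off + j := hbj
      have hrun : (Program.seqs [cellProg, .setVar 15 (.at 29 bucketExpr)]).run s₁ = ⟨Function.update (Function.update (Function.update
            s.nat (addr 12 0) c) (addr 13 0) d) (addr 15 0) (off + j), s.real⟩ := by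
        rw [hs₁']
        simp [cellProg, bucketExpr, update_addr, henv.N_eq, ← hB, hbj', henv.off_pos]
      rw [hrun]
      have hmem := List.getElem_mem hj
      refine ⟨R.map (Q.rootNode sx sy), j, by simpa using hj,
        (((SameOff.refl _ _).update (by simp) _ _).update (by simp) _ _).update (by simp) _ _,
        SameOff.refl _ _, ?_, by simp [update_addr, hlists], by simp, by simp [update_addr, hcnt],
        _, hR.set hnew hj (by simpa [cellOp] using hek), by simp, ?_, ?_, ?_⟩
      · exact hnodes.frame (J := [12, 13, 15]) (J' := [])
          ((((SameOff.refl _ _).update (by simp) _ _).update (by simp) _ _).update (by simp) _ _)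
          (SameOff.refl _ _)
      · rw [List.map_set]
        congr 1
        simp [QParams.rootNode, cellOp, hek, ← hc, ← hd]
      · intro i hi
        rw [List.length_set] at hi
        have : (R.set j ((cellOp cx cy t o).2, (cellOp cx cy t o).1 :: R[j].2))[i].1 = R[i].1 := by
          rw [List.getElem_set]
          split_ifs with hij
          · subst hij; simp [hek, cellOp, ← hc, ← hd]
          · rfl
        rw [this]
        simpa [update_addr] using hb1 i hi
      · intro c' hc' d' hd' hcd
        simp only [update_addr, Fin.reduceEq, false_and, if_false]
        refine hb2 c' hc' d' hd' fun h => hcd ?_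
        rw [List.map_set]
        have : (cellOp cx cy t o).2 = (R.map Prod.fst)[j]'(by simpa using hj) := by
          simp [hek, cellOp, ← hc, ← hd]
        simp only [this, List.set_getElem_self]
        exact h
    · have hz : s.nat (addr 29 B) = 0 := hb2 c hcN d hdN hin
      set id := off + R.length with hid
      have hrun : (Program.seqs [cellProg, .setVar 15 (.at 29 bucketExpr)]).run s₁ = ⟨Function.update (Function.update (Function.update
            (Function.update (Function.update (Function.update (Function.update (Function.update
            s.nat (addr 12 0) c) (addr 13 0) d) (addr 29 B) id) (addr 24 id) 0) (addr 25 id) 0)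
            (addr 26 id) 0) (addr 10 0) (id + 1)) (addr 15 0) id,
            Function.update (Function.update (Function.update (Function.update (Function.update
            s.real (addr 10 id) (sx c)) (addr 11 id) (min (sx (c + 1)) (sx c + 4 * Q.W)))
            (addr 12 id) (sy d)) (addr 13 id) (min (sy (d + 1)) (sy d + 4 * Q.W)))
            (addr 14 id) (4 * Q.W)⟩ := by
        rw [hs₁']
        simp [cellProg, bucketExpr, update_addr, henv.N_eq, ← hB, hz, hcnt, henv.off_eq, hsx, hsy, henv.W_eq, ← hid]
      rw [hrun]
      have hsn : SameOff [10, 12, 13, 15, 24, 25, 26, 29] s.nat (Function.update (Function.update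
            (Function.update
            (Function.update (Function.update (Function.update (Function.update (Function.update
            s.nat (addr 12 0) c) (addr 13 0) d) (addr 29 B) id) (addr 24 id) 0) (addr 25 id) 0)
            (addr 26 id) 0) (addr 10 0) (id + 1)) (addr 15 0) id) := by
        refine SameOff.update (SameOff.update (SameOff.update (SameOff.update (SameOff.update
          (SameOff.update (SameOff.update (SameOff.update (SameOff.refl _ _) ?_ _ _) ?_ _ _) ?_ _ _)
          ?_ _ _) ?_ _ _) ?_ _ _) ?_ _ _) ?_ _ _ <;> simp
      refine ⟨R.map (Q.rootNode sx sy) ++ [Q.rootNode sx sy ((c, d), [])], R.length, by simp, hsn,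
        ?_, ?_, by simp [update_addr, hlists], by simp [hid], by simp [update_addr, hid, add_assoc],
        _, hR.append (by simpa [cellOp] using hin), by simp, ?_, ?_, ?_⟩
      · refine SameOff.update (SameOff.update (SameOff.update (SameOff.update
          (SameOff.update (SameOff.refl _ _) ?_ _ _) ?_ _ _) ?_ _ _) ?_ _ _) ?_ _ _ <;> simp
      · refine (hnodes.congr ?_ ?_ ?_ ?_).snoc ?_
        · intro j hj i hi
          rw [List.length_map] at hi
          simp only [update_addr, hid, Nat.add_left_cancel_iff, hi.ne, and_false, if_false]
        · intro j hj i hi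
          rw [List.length_map] at hi
          simp only [List.mem_cons, List.not_mem_nil, or_false] at hj
          rcases hj with rfl | rfl | rfl <;> simp [update_addr, hid, hi.ne]
        · intro j hj p _
          simp only [List.mem_cons, List.not_mem_nil, or_false] at hj
          rcases hj with rfl | rfl <;> simp [update_addr]
        · simp [update_addr]
        · rw [List.length_map, ← hid]
          constructor <;> simp [update_addr, QParams.rootNode, ListAt]
      · simp [QParams.rootNode, cellOp, ← hc, ← hd]
      · intro i hi
        rw [List.length_append, List.length_singleton] at hi
        rw [List.getElem_append]
        split_ifs with h'
        · have hne : R[i].1.1 * (Q.N + 3) + R[i].1.2 ≠ B := fun heq =>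
            hin (List.mem_map.2 ⟨R[i], List.getElem_mem h', hBinj _ _ (hRle i h').2 heq⟩)
          simpa [update_addr, hne] using hb1 i h'
        · have : i = R.length := by omega
          subst this
          simp [update_addr, cellOp, ← hc, ← hd, ← hB, hid]
      · intro c' hc' d' hd' hcd
        have hne : c' * (Q.N + 3) + d' ≠ B := fun heq => hcd (by
          rw [hBinj _ _ hd' heq]
          simp [cellOp, ← hc, ← hd])
        simp only [update_addr, Fin.reduceEq, hne, and_false, false_and, if_false]
        exact hb2 c' hc' d' hd' fun h => hcd (by
          rw [List.map_append]; exact List.mem_append_left _ h)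
  obtain ⟨R', hR', hlen, hmap, hb1', hb2'⟩ := hLR
  have hfull : (rootStep o).run s = pushTri.run s₂ := by
    rw [← hs₂, hs₁]; rfl
  have ht2 : s₂.nat (addr 14 0) = t := by rw [n2.eq 14, ht]
  have n3 := n2.mono (J' := [10, 11, 12, 13, 15, 24, 25, 26, 27, 28, 29]) (by simp) |>.trans
    ((sameOff_pushTri s₂).mono (by simp))
  have r3 : SameOff [10, 11, 12, 13, 14] s.real (pushTri.run s₂).real := by
    rw [real_pushTri]; exact r2
  have n4 := sameOff_pushTri s₂
  rw [hfull]
  refine ⟨⟨henv.frame n3 r3, fun k => by rw [r3.eq 7, hsx], fun k => by rw [r3.eq 8, hsy],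
    fun k => by rw [n3.eq 30, hcxe], fun k => by rw [n3.eq 31, hcye],
    by rw [count_pushTri, hlists2]; simp, R', hR', ?_, ?_, ?_, ?_⟩, by rw [n3.eq 14, ht], n3, r3⟩
  · rw [hmap]
    refine NodesAt.set (fun i hi hij => (hnodes2.node i hi).push_ne (by rw [h15]; omega)) ?_
    have := (hnodes2.node j hj).push h15
    rwa [ht2] at this
  · rw [n4.eq 10, hcnt2, hlen]
  · intro i hi
    rw [n4.eq 29, hb1' i hi]
  · intro c' hc' d' hd' hcd
    rw [n4.eq 29, hb2' c' hc' d' hd' hcd]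

theorem flat_rootStep (o : ℕ × ℕ) : (rootStep o).Flat := by
  simp [rootStep, cellProg, Program.Flat, flat_pushTri]

theorem mem_cellOps_le {cx cy : ℕ → ℕ} {N : ℕ} (hcx : ∀ t < N, 1 ≤ cx t ∧ cx t ≤ N)
    (hcy : ∀ t < N, 1 ≤ cy t ∧ cy t ≤ N) {t : ℕ} (ht : t < N) {o : ℕ × ℕ} (ho : o ∈ offsets) :
    (cellOp cx cy t o).2.1 ≤ N + 1 ∧ (cellOp cx cy t o).2.2 ≤ N + 1 := by
  have h1 := hcx t ht
  have h2 := hcy t ht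
  have h3 := (mem_offsets o).1 ho
  simp only [cellOp]
  omega

/-- The table has quadratically many entries, but it need not be initialized, because its memory is
zero at the start. Only the `9 * N` pairs of triangles and cells cost time. -/
theorem tot_rootsProg {A : PointSolver} {Q : QParams} {off : ℕ} {sx sy : ℕ → ℝ} {cx cy : ℕ → ℕ}
    {s : MemState} (henv : Env Q off s) (hsx : ∀ k, s.real (addr 7 (off + k)) = sx k)
    (hsy : ∀ k, s.real (addr 8 (off + k)) = sy k) (hcx : ∀ t, s.nat (addr 30 t) = cx t)
    (hcy : ∀ t, s.nat (addr 31 t) = cy t) (hcx1 : ∀ t < Q.N, 1 ≤ cx t ∧ cx t ≤ Q.N)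
    (hcy1 : ∀ t < Q.N, 1 ≤ cy t ∧ cy t ≤ Q.N) (hbucket : ∀ i, s.nat (addr 29 i) = 0) :
    Tot A rootsProg s Q.N fun s' => Env Q off s' ∧
      s'.nat (addr 11 0) = 9 * Q.N ∧ ∃ R, CellLists (cellOps cx cy Q.N) R ∧
        NodesAt s' off (R.map (Q.rootNode sx sy)) ∧ s'.nat (addr 10 0) = off + R.length := by
  refine Tot.seqs_flat (by simp) (Tot.seqs_flat (by simp) (Tot.seqs_flat (by simp) (Tot.seqs_one ?_)))
  refine (Tot.loopConst Q.N (fun t s' => RootState Q off sx sy cx cy (cellOps cx cy t) s' ∧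
    s'.nat (addr 14 0) = t) 0 ?_ ?_ ?_).mono (by simp) ?_
  · rintro t ht s₁ ⟨h, h14⟩
    refine ⟨by simp [h14, h.env.N_eq, ht], ?_⟩
    -- The invariant assumes that the treated offsets form a prefix of `offsets`; as this list has
    -- no repetitions, the next pair is new.
    refine (Tot.seq' (k₁ := 9 * 0) (k₂ := 0) (Tot.seqs_map rootStep 0 offsets (fun pre s' => 
      (∃ suf, pre ++ suf = offsets) → RootState Q off sx sy cx cy
        (cellOps cx cy t ++ pre.map (cellOp cx cy t)) s' ∧ s'.nat (addr 14 0) = t) ?_ [] s₁ ?_) ?_)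
    · intro pre o s₂ ho h₂
      refine Tot.flat (flat_rootStep o) ?_
      rintro ⟨suf, hsuf⟩
      obtain ⟨h₂, h14₂⟩ := h₂ ⟨o :: suf, by simpa using hsuf⟩
      have hnd : offsets.Nodup := by decide
      have hpre : ∀ o' ∈ pre, o' ∈ offsets := fun o' ho' => by
        rw [← hsuf]; simp [ho']
      have hle : ∀ o' ∈ cellOps cx cy t ++ pre.map (cellOp cx cy t),
          o'.2.1 ≤ Q.N + 1 ∧ o'.2.2 ≤ Q.N + 1 := by
        intro o' ho'
        rcases List.mem_append.1 ho' with ho' | ho'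
        · obtain ⟨m1, a, ha, b, hb, m2⟩ := mem_cellOps.1 ho'
          have q1 := hcx1 o'.1 (by omega)
          have q2 := hcy1 o'.1 (by omega)
          rw [m2]
          simp only
          omega
        · obtain ⟨o₁, ho₁, rfl⟩ := List.mem_map.1 ho'
          exact mem_cellOps_le hcx1 hcy1 ht (hpre o₁ ho₁)
      have hnew : cellOp cx cy t o ∉ cellOps cx cy t ++ pre.map (cellOp cx cy t) := by
        intro hmem
        rcases List.mem_append.1 hmem with hmem | hmem
        · have := (mem_cellOps.1 hmem).1
          simp [cellOp] at this
        · obtain ⟨o₁, ho₁, heq⟩ := List.mem_map.1 hmem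
          have := cellOp_inj (hcx1 t ht).1 (hcy1 t ht).1 heq
          subst this
          rw [← hsuf, List.append_assoc, List.nodup_append] at hnd
          exact hnd.2.2 o₁ ho₁ o₁ (by simp) rfl
      obtain ⟨k1, k2, -, -⟩ := rootStep_run h₂ h14₂ (hcx1 t ht) (hcy1 t ht) hle ho hnew
      exact ⟨by simpa using k1, k2⟩
    · exact fun _ => ⟨by simpa using h, h14⟩
    · intro s₂ h₂
      obtain ⟨h₂, h14₂⟩ := h₂ ⟨[], by simp⟩
      refine Tot.flat (by simp) ?_
      have hn : SameOff [14] s₂.nat ((Program.incr 14).run s₂).nat :=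
        (SameOff.refl _ _).update (by simp) _ _
      have hr : SameOff [] s₂.real ((Program.incr 14).run s₂).real := SameOff.refl _ _
      obtain ⟨k1, k2, k3, k4, k5, k6, R, k7, k8, k9, k10, k11⟩ := h₂
      refine ⟨⟨k1.frame hn hr, k2, k3, fun t => by rw [hn.eq 30, k4], fun t => by rw [hn.eq 31, k5],
        by rw [hn.eq 11, k6, cellOps_succ]; rfl, R, ?_, k8.frame hn hr, by rw [hn.eq 10, k9],
        fun j hj => by rw [hn.eq 29, k10 j hj], fun c hc d hd hcd => by
          rw [hn.eq 29, k11 c hc d hd hcd]⟩, by simp [h14₂]⟩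
      rw [cellOps_succ]
      exact k7
  · rintro s₁ ⟨h, h14⟩
    simp [h14, h.env.N_eq]
  · have hn : SameOff [10, 11, 14] s.nat ((Program.setVar 14 (.lit 0)).run
        ((Program.setVar 11 (.lit 0)).run ((Program.setVar 10 (.var 3)).run s))).nat :=
      (((SameOff.refl _ _).update (by simp) _ _).update (by simp) _ _).update (by simp) _ _
    refine ⟨⟨henv.frame (J' := []) hn (SameOff.refl _ _), hsx, hsy, fun t => by rw [hn.eq 30, hcx],
      fun t => by rw [hn.eq 31, hcy], by simp [update_addr, cellOps], [], CellLists.nil, ⟨by simp⟩,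
      by simp [update_addr, henv.off_eq], by simp, fun c _ d _ _ => by rw [hn.eq 29, hbucket]⟩,
      by simp⟩
  · rintro s' ⟨⟨k1, k2, k3, k4, k5, k6, R, k7, k8, k9, k10, k11⟩, -⟩
    exact ⟨k1, by rw [k6, length_cellOps], R, k7, k8, k9⟩


/-! ### Geometric expressions -/

namespace RealExpr

/-- The signed area of a parallelogram, see `cross`. -/
def cross (ax ay bx by' zx zy : RealExpr) : RealExpr :=
  .sub (.mul (.sub bx ax) (.sub zy ay)) (.mul (.sub by' ay) (.sub zx ax))

/-- The distance of two points. -/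
def dist (ax ay bx by' : RealExpr) : RealExpr :=
  .sqrt (.add (.mul (.sub ax bx) (.sub ax bx)) (.mul (.sub ay by') (.sub ay by')))

/-- The first coordinate of a vertex of the triangle `var 14`. -/
def vx : Fin 3 → RealExpr
  | 0 => .off 0 (.var 14)
  | 1 => .off 2 (.var 14)
  | 2 => .off 4 (.var 14)

/-- The second coordinate of a vertex of the triangle `var 14`. -/
def vy : Fin 3 → RealExpr
  | 0 => .off 1 (.var 14)
  | 1 => .off 3 (.var 14)
  | 2 => .off 5 (.var 14)

/-- The signed area of the triangle `var 14`, see `triDet`. -/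
def triDet : RealExpr := cross (vx 0) (vy 0) (vx 1) (vy 1) (vx 2) (vy 2)

/-- The product of `triDet` and `cross` for an edge and the center of a box. -/
def edgeSide (k : Fin 3) : RealExpr :=
  .mul triDet (cross (vx k) (vy k) (vx (k + 1)) (vy (k + 1)) (.var 45) (.var 46))

/-- The bound for `edgeSide` in the tests `IsIn` and `IsOut`. -/
def edgeBound (k : Fin 3) : RealExpr :=
  .mul (.var 47) (.mul (.abs triDet) (dist (vx k) (vy k) (vx (k + 1)) (vy (k + 1))))

end RealExpr

/-- The test `IsIn`. -/
def TestExpr.inTest : TestExpr :=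
  .both (.realLe (.edgeBound 0) (.edgeSide 0)) (.both (.realLe (.edgeBound 1) (.edgeSide 1))
    (.realLe (.edgeBound 2) (.edgeSide 2)))

/-- The test `IsOut`. -/
def TestExpr.outTest : TestExpr :=
  .neg (.both (.neg (.realLe (.edgeSide 0) (.sub (.num 0) (.edgeBound 0))))
    (.both (.neg (.realLe (.edgeSide 1) (.sub (.num 0) (.edgeBound 1))))
    (.both (.neg (.realLe (.edgeSide 2) (.sub (.num 0) (.edgeBound 2))))
    (.neg (.realLe (.add (.var 40) (.var 47)) (.dist (.var 45) (.var 46) (.vx 0) (.vy 0)))))))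

section

variable {Q : QParams} {off : ℕ} {s : MemState} {t : ℕ}

theorem Env.eval_vx (h : Env Q off s) (ht : t < Q.N) (h14 : s.nat (addr 14 0) = t) (k : Fin 3) :
    (RealExpr.vx k).eval s = Q.T t k 0 := by
  fin_cases k <;> simp [RealExpr.vx, h.off_eq, h14, h.x0 t ht, h.x1 t ht, h.x2 t ht]

theorem Env.eval_vy (h : Env Q off s) (ht : t < Q.N) (h14 : s.nat (addr 14 0) = t) (k : Fin 3) :
    (RealExpr.vy k).eval s = Q.T t k 1 := by
  fin_cases k <;> simp [RealExpr.vy, h.off_eq, h14, h.y0 t ht, h.y1 t ht, h.y2 t ht]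

theorem Env.eval_triDet (h : Env Q off s) (ht : t < Q.N) (h14 : s.nat (addr 14 0) = t) :
    RealExpr.triDet.eval s = triDet (Q.T t) := by
  simp only [RealExpr.triDet, RealExpr.cross, RealExpr.eval_sub, RealExpr.eval_mul,
    h.eval_vx ht h14, h.eval_vy ht h14, triDet, cross]

theorem Env.eval_edgeSide (h : Env Q off s) (ht : t < Q.N) (h14 : s.nat (addr 14 0) = t) {q : Plane}
    (hq0 : s.real (addr 45 off) = q 0) (hq1 : s.real (addr 46 off) = q 1) (k : Fin 3) :
    (RealExpr.edgeSide k).eval s = triDet (Q.T t) * cross (Q.T t k) (Q.T t (k + 1)) q := by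
  simp only [RealExpr.edgeSide, RealExpr.cross, RealExpr.eval_sub, RealExpr.eval_mul,
    h.eval_vx ht h14, h.eval_vy ht h14, h.eval_triDet ht h14, RealExpr.eval_var, h.off_eq, hq0, hq1,
    cross]

theorem Env.eval_edgeBound (h : Env Q off s) (ht : t < Q.N) (h14 : s.nat (addr 14 0) = t) {ρ : ℝ}
    (hρ : s.real (addr 47 off) = ρ) (k : Fin 3) : (RealExpr.edgeBound k).eval s =
      ρ * (|triDet (Q.T t)| * dist (Q.T t k) (Q.T t (k + 1))) := by
  simp only [RealExpr.edgeBound, RealExpr.dist, RealExpr.eval_sub, RealExpr.eval_mul,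
    RealExpr.eval_abs, RealExpr.eval_sqrt, RealExpr.eval_add,
    h.eval_vx ht h14, h.eval_vy ht h14, h.eval_triDet ht h14, RealExpr.eval_var, h.off_eq, hρ,
    Plane.dist_eq]

theorem Env.holds_inTest (h : Env Q off s) (ht : t < Q.N) (h14 : s.nat (addr 14 0) = t) {q : Plane}
    (hq0 : s.real (addr 45 off) = q 0) (hq1 : s.real (addr 46 off) = q 1) {ρ : ℝ}
    (hρ : s.real (addr 47 off) = ρ) : TestExpr.inTest.Holds s ↔ IsIn ρ (Q.T t) q := by
  simp only [TestExpr.inTest, TestExpr.holds_both, TestExpr.holds_realLe,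
    h.eval_edgeSide ht h14 hq0 hq1, h.eval_edgeBound ht h14 hρ, IsIn, Fin.forall_fin_succ]
  simp

theorem Env.holds_outTest (h : Env Q off s) (ht : t < Q.N) (h14 : s.nat (addr 14 0) = t) {q : Plane}
    (hq0 : s.real (addr 45 off) = q 0) (hq1 : s.real (addr 46 off) = q 1) {ρ : ℝ}
    (hρ : s.real (addr 47 off) = ρ) : TestExpr.outTest.Holds s ↔ IsOut Q.W ρ (Q.T t) q := by
  have hd : (RealExpr.dist (.var 45) (.var 46) (.vx 0) (.vy 0)).eval s = dist q (Q.T t 0) := by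
    simp only [RealExpr.dist, RealExpr.eval_sub, RealExpr.eval_mul, RealExpr.eval_sqrt,
      RealExpr.eval_add, h.eval_vx ht h14, h.eval_vy ht h14, RealExpr.eval_var, h.off_eq, hq0, hq1,
      Plane.dist_eq]
  simp only [TestExpr.outTest, TestExpr.holds_both, TestExpr.holds_neg, TestExpr.holds_realLe,
    h.eval_edgeSide ht h14 hq0 hq1, h.eval_edgeBound ht h14 hρ, IsOut, hd, RealExpr.eval_add,
    RealExpr.eval_var, h.off_eq, h.W_eq, hρ, RealExpr.eval_sub, RealExpr.eval_num]
  have : (∃ k : Fin 3, triDet (Q.T t) * cross (Q.T t k) (Q.T t (k + 1)) q ≤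
      -(ρ * (|triDet (Q.T t)| * dist (Q.T t k) (Q.T t (k + 1))))) ↔
      triDet (Q.T t) * cross (Q.T t 0) (Q.T t 1) q ≤
        -(ρ * (|triDet (Q.T t)| * dist (Q.T t 0) (Q.T t 1))) ∨
      triDet (Q.T t) * cross (Q.T t 1) (Q.T t 2) q ≤
        -(ρ * (|triDet (Q.T t)| * dist (Q.T t 1) (Q.T t 2))) ∨
      triDet (Q.T t) * cross (Q.T t 2) (Q.T t 0) q ≤
        -(ρ * (|triDet (Q.T t)| * dist (Q.T t 2) (Q.T t 0))) := by
    simp [Fin.exists_fin_succ]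
  rw [this]
  simp only [Nat.cast_zero, zero_sub, zero_add, show (1 : Fin 3) + 1 = 2 from rfl,
    show (2 : Fin 3) + 1 = 0 from rfl]
  tauto

end

/-! ### The computation of the subdivision -/

/-- Sorting the triangle `var 14` into the node `var 15`. -/
def siftProg : Program :=
  .branch .outTest .skip (.branch .inTest
    (.branch (.natLt (.var 14) (.var 0))
      (.setNat (.addr 24 (.var 15)) (.add (.at 24 (.var 15)) (.lit 1)))
      (.setNat (.addr 25 (.var 15)) (.add (.at 25 (.var 15)) (.lit 1))))
    pushTri)

/-- `s'` arises from `s` by changes of the node `id` and new cells for lists. -/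
structure OnlyNode (id : ℕ) (s s' : MemState) : Prop where
  list : ∀ p l, ListAt s.nat (s.nat (addr 11 0)) p l → ListAt s'.nat (s'.nat (addr 11 0)) p l
  node : ∀ id' ≠ id, ∀ c, NodeAt s id' c → NodeAt s' id' c
  sameOff : SameOff [11, 24, 25, 26, 27, 28] s.nat s'.nat
  real : s'.real = s.real

theorem onlyNode_refl (id : ℕ) (s : MemState) : OnlyNode id s s :=
  ⟨fun _ _ h => h, fun _ _ _ h => h, SameOff.refl _ _, rfl⟩

theorem onlyNode_pushTri {s : MemState} {id : ℕ} (h : s.nat (addr 15 0) = id) :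
    OnlyNode id s (pushTri.run s) := by
  refine ⟨fun p l hl => ?_, fun id' hid' c hc => hc.push_ne (by rw [h]; exact hid'.symm),
    (sameOff_pushTri s).mono (by simp), real_pushTri s⟩
  refine hl.congr (by rw [count_pushTri]; omega) ?_ ?_ <;> intro q hq <;>
    rw [run_pushTri rfl rfl rfl] <;> simp [update_addr, show q ≠ s.nat (addr 11 0) + 1 by omega]

theorem onlyNode_update {s : MemState} {id : ℕ} {j : Fin 64} (hj : j = 24 ∨ j = 25) (v : ℕ) :
    OnlyNode id s { s with nat := Function.update s.nat (addr j id) v } := by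
  refine ⟨fun p l hl => ?_, fun id' hid' c hc => ?_, ?_, rfl⟩
  · rcases hj with rfl | rfl <;>
      exact hl.congr (by simp [update_addr]) (by simp [update_addr]) (by simp [update_addr])
  · refine hc.congr (fun _ _ => rfl) ?_ ?_ ?_
    · intro k _; simp [update_addr, hid']
    · intro k hk p _
      simp only [List.mem_cons, List.not_mem_nil, or_false] at hk
      rcases hj with rfl | rfl <;> rcases hk with rfl | rfl <;> simp [update_addr]
    · rcases hj with rfl | rfl <;> simp [update_addr]
  · refine (SameOff.refl _ _).update ?_ _ _
    rcases hj with rfl | rfl <;> simp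

theorem siftProg_run {Q : QParams} {off : ℕ} {s : MemState} {t id : ℕ} {b : QNode}
    (h : Env Q off s) (ht : t < Q.N) (h14 : s.nat (addr 14 0) = t) (h15 : s.nat (addr 15 0) = id)
    (hb : NodeAt s id b) (hq0 : s.real (addr 45 off) = b.ctr 0)
    (hq1 : s.real (addr 46 off) = b.ctr 1) (hρ : s.real (addr 47 off) = b.l * Q.κ) :
    NodeAt (siftProg.run s) id (Q.sift b t) ∧ OnlyNode id s (siftProg.run s) := by
  have hin := h.holds_inTest ht h14 hq0 hq1 hρ
  have hout := h.holds_outTest ht h14 hq0 hq1 hρ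
  simp only [siftProg, Program.run_branch, QParams.sift, QParams.Inn, QParams.Act, QParams.Out]
  by_cases ho : IsOut Q.W (b.l * Q.κ) (Q.T t) b.ctr
  · rw [if_pos (hout.2 ho)]
    simp only [ho, not_true, false_and, if_false]
    exact ⟨hb, onlyNode_refl _ _⟩
  rw [if_neg (mt hout.1 ho)]
  by_cases hi : IsIn (b.l * Q.κ) (Q.T t) b.ctr
  · rw [if_pos (hin.2 hi)]
    simp only [ho, hi, not_false_eq_true, true_and, if_true]
    obtain ⟨h1, h2, h3, h4, h5, h6, h7, h8⟩ := hb
    by_cases hn : t < Q.n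
    · have hrun : (Program.setNat (NatExpr.addr 24 (NatExpr.var 15)) ((NatExpr.at 24
          (NatExpr.var 15)).add (NatExpr.lit 1))).run s =
          { s with nat := Function.update s.nat (addr 24 id) (b.p + 1) } := by
        simp [h15, h6]
      rw [if_pos (by simpa [h14, h.n_eq] using hn), if_pos hn, hrun]
      refine ⟨⟨h1, h2, h3, h4, h5, by simp, by simp [update_addr, h7], ?_⟩,
        onlyNode_update (Or.inl rfl) _⟩
      simp only [update_addr, Fin.reduceEq, false_and, if_false]
      exact h8.congr le_rfl (by simp [update_addr]) (by simp [update_addr])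
    · have hrun : (Program.setNat (NatExpr.addr 25 (NatExpr.var 15)) ((NatExpr.at 25
          (NatExpr.var 15)).add (NatExpr.lit 1))).run s =
          { s with nat := Function.update s.nat (addr 25 id) (b.s + 1) } := by
        simp [h15, h7]
      rw [if_neg (by simpa [h14, h.n_eq] using hn), if_neg hn, hrun]
      refine ⟨⟨h1, h2, h3, h4, h5, by simp [update_addr, h6], by simp, ?_⟩,
        onlyNode_update (Or.inr rfl) _⟩
      simp only [update_addr, Fin.reduceEq, false_and, if_false]
      exact h8.congr le_rfl (by simp [update_addr]) (by simp [update_addr])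
  · rw [if_neg (mt hin.1 hi)]
    simp only [ho, hi, not_false_eq_true, and_true, and_false, if_true, if_false]
    have := hb.push h15
    rw [h14] at this
    exact ⟨this, onlyNode_pushTri h15⟩

theorem flat_siftProg : siftProg.Flat := by simp [siftProg, Program.Flat, flat_pushTri]

/-- A corner coordinate of a quarter. -/
def cornerExpr (lo hi : Fin 64) (i : Bool) (upper : Bool) : RealExpr :=
  if i = upper then .at (if upper then hi else lo) (.var 5)
  else .div (.add (.at lo (.var 5)) (.at hi (.var 5))) (.num 2)

/-- The creation of a quarter of the node `var 5`. -/
def quarterProg (i j : Bool) : Program :=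
  .seqs [.setVar 15 (.var 10),
    .setReal (.addr 10 (.var 10)) (cornerExpr 10 11 i false),
    .setReal (.addr 11 (.var 10)) (cornerExpr 10 11 i true),
    .setReal (.addr 12 (.var 10)) (cornerExpr 12 13 j false),
    .setReal (.addr 13 (.var 10)) (cornerExpr 12 13 j true),
    .setReal (.addr 14 (.var 10)) (.div (.at 14 (.var 5)) (.num 2)),
    .setNat (.addr 24 (.var 10)) (.at 24 (.var 5)), .setNat (.addr 25 (.var 10)) (.at 25 (.var 5)),
    .setNat (.addr 26 (.var 10)) (.lit 0),
    .setReal (.addr 45 (.var 3)) (.div (.add (.at 10 (.var 10)) (.at 11 (.var 10))) (.num 2)),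
    .setReal (.addr 46 (.var 3)) (.div (.add (.at 12 (.var 10)) (.at 13 (.var 10))) (.num 2)),
    .setReal (.addr 47 (.var 3)) (.mul (.at 14 (.var 10)) (.var 42)),
    .setVar 13 (.at 26 (.var 5))]

/-- The creation of a child of the node `var 5`. -/
def childProg (i j : Bool) : Program :=
  .seqs [quarterProg i j,
    .loop (.natLt (.lit 0) (.var 13)) (.seqs [.setVar 14 (.at 27 (.var 13)), siftProg,
      .setVar 13 (.at 28 (.var 13))]),
    .incr 10]

theorem quarterProg_run {Q : QParams} {off : ℕ} {s : MemState} {k id : ℕ} {b : QNode}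
    (h : Env Q off s) (h5 : s.nat (addr 5 0) = k) (h10 : s.nat (addr 10 0) = id) (hk : k ≠ id)
    (hb : NodeAt s k b) (i j : Bool) :
    (quarterProg i j).run s = ⟨Function.update (Function.update (Function.update (Function.update
      (Function.update s.nat (addr 15 0) id) (addr 24 id) b.p) (addr 25 id) b.s) (addr 26 id) 0)
      (addr 13 0) (s.nat (addr 26 k)),
      Function.update (Function.update (Function.update (Function.update (Function.update
      (Function.update (Function.update (Function.update s.real
      (addr 10 id) (QParams.quarter b i j).x₀) (addr 11 id) (QParams.quarter b i j).x₁)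
      (addr 12 id) (QParams.quarter b i j).y₀) (addr 13 id) (QParams.quarter b i j).y₁)
      (addr 14 id) (QParams.quarter b i j).l) (addr 45 off) ((QParams.quarter b i j).ctr 0))
      (addr 46 off) ((QParams.quarter b i j).ctr 1))
      (addr 47 off) ((QParams.quarter b i j).l * Q.κ)⟩ := by
  obtain ⟨h1, h2, h3, h4, h5', h6, h7, h8⟩ := hb
  have hx0 : ∀ r : ℕ → ℝ, r (addr 10 k) = b.x₀ → r (addr 11 k) = b.x₁ → ∀ nt : ℕ → ℕ,
      nt (addr 5 0) = k → (cornerExpr 10 11 i false).eval ⟨nt, r⟩ = (QParams.quarter b i j).x₀ ∧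
      (cornerExpr 10 11 i true).eval ⟨nt, r⟩ = (QParams.quarter b i j).x₁ := by
    intro r e1 e2 nt e3
    cases i <;> simp [cornerExpr, QParams.quarter, e1, e2, e3]
  have hy0 : ∀ r : ℕ → ℝ, r (addr 12 k) = b.y₀ → r (addr 13 k) = b.y₁ → ∀ nt : ℕ → ℕ,
      nt (addr 5 0) = k → (cornerExpr 12 13 j false).eval ⟨nt, r⟩ = (QParams.quarter b i j).y₀ ∧
      (cornerExpr 12 13 j true).eval ⟨nt, r⟩ = (QParams.quarter b i j).y₁ := by
    intro r e1 e2 nt e3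
    cases j <;> simp [cornerExpr, QParams.quarter, e1, e2, e3]
  have c0 : (QParams.quarter b i j).ctr 0 =
    ((QParams.quarter b i j).x₀ + (QParams.quarter b i j).x₁) / 2 := rfl
  have c1 : (QParams.quarter b i j).ctr 1 =
    ((QParams.quarter b i j).y₀ + (QParams.quarter b i j).y₁) / 2 := rfl
  have cl : (QParams.quarter b i j).l = b.l / 2 := rfl
  rw [c0, c1, cl]
  simp only [quarterProg, Program.run_seqs_cons, Program.run_seqs_nil, Program.run_setVar,
    Program.run_setReal, Program.run_setNat, NatExpr.eval_var, NatExpr.eval_addr]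
  simp only [update_addr, h5, h10, Fin.reduceEq, false_and, if_false]
  rw [(hx0 _ h1 h2 _ (by simp [update_addr, h5])).1]
  rw [(hx0 _ (by simp [update_addr, h1, hk]) (by simp [update_addr, h2]) _ (by simp [update_addr, h5])).2]
  rw [(hy0 _ (by simp [update_addr, h3, hk]) (by simp [update_addr, h4]) _ (by simp [update_addr, h5])).1]
  rw [(hy0 _ (by simp [update_addr, h3, hk]) (by simp [update_addr, h4]) _ (by simp [update_addr, h5])).2]
  simp [update_addr, h5, h10, h5', h6, h7, h.off_eq, h.κ_eq, hk]


theorem NodeAt.of_sameOff {s s' : MemState} {id : ℕ} {b : QNode} (h : NodeAt s id b)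
    {J J' : List (Fin 64)} (hn : SameOff J s.nat s'.nat) (hr : SameOff J' s.real s'.real)
    (hJ : ∀ j ∈ [11, 24, 25, 26, 27, 28], j ∉ J := by decide)
    (hJ' : ∀ j ∈ [10, 11, 12, 13, 14], j ∉ J' := by decide) : NodeAt s' id b :=
  h.congr (fun j hj => hr j _ (hJ' j hj)) (fun j hj => hn j _ (hJ j (by simp at hj ⊢; tauto)))
    (fun j hj p _ => hn j _ (hJ j (by simp at hj ⊢; tauto))) (hn 11 0 (hJ _ (by simp))).ge

theorem NodeAt.frame {s s' : MemState} {id : ℕ} {b : QNode} (h : NodeAt s id b)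
    {J : List (Fin 64)} (hn : SameOff J s.nat s'.nat) (hr : s'.real = s.real)
    (hJ : ∀ j ∈ [11, 24, 25, 26, 27, 28], j ∉ J := by decide) : NodeAt s' id b :=
  h.of_sameOff hn (SameOff.of_eq (J := []) hr) hJ

theorem ListAt.frame {f g : ℕ → ℕ} {p : ℕ} {l : List ℕ} (h : ListAt f (f (addr 11 0)) p l)
    {J : List (Fin 64)} (hn : SameOff J f g) (hJ : ∀ j ∈ [11, 27, 28], j ∉ J := by decide) :
    ListAt g (g (addr 11 0)) p l :=
  h.congr (hn 11 0 (hJ _ (by simp))).ge (fun p _ => hn 27 p (hJ _ (by simp)))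
    (fun p _ => hn 28 p (hJ _ (by simp)))

/-- The list of the parent is read while the list of the child is being built in the same storage.
This is safe because entries are only added, as expressed by `OnlyNode`. -/
theorem tot_childProg {A : PointSolver} {Q : QParams} {off : ℕ} {s : MemState} {L : List QNode}
    {k : ℕ} {b : QNode} (h : Env Q off s) (h5 : s.nat (addr 5 0) = off + k)
    (h10 : s.nat (addr 10 0) = off + L.length) (hL : NodesAt s off L) (hk : k < L.length)
    (hb : L[k] = b) (hact : ∀ t ∈ b.act, t < Q.N) (i j : Bool) :
    Tot A (childProg i j) s b.act.length fun s' => Env Q off s' ∧ s'.nat (addr 5 0) = off + k ∧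
      s'.nat (addr 10 0) = off + (L.length + 1) ∧ NodesAt s' off (L ++ [Q.child b i j]) := by
  have hbk := hL.node k hk
  rw [hb] at hbk
  set id := off + L.length with hid
  have hrun := quarterProg_run h h5 h10 (by omega) hbk i j
  set q := QParams.quarter b i j with hq
  have hflat : (quarterProg i j).Flat := by simp [quarterProg, Program.Flat]
  refine Tot.seqs_flat hflat ?_
  set s₁ := (quarterProg i j).run s with hs₁
  have hn₁ : SameOff [13, 15, 24, 25, 26] s.nat s₁.nat := by
    rw [hrun]
    exact (((((SameOff.refl _ _).update (by simp) _ _).update (by simp) _ _).update (by simp) _ _).update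
      (by simp) _ _).update (by simp) _ _
  have hr₁ : SameOff [10, 11, 12, 13, 14, 45, 46, 47] s.real s₁.real := by
    rw [hrun]
    exact ((((((((SameOff.refl _ _).update (by simp) _ _).update (by simp) _ _).update (by simp) _ _).update
      (by simp) _ _).update (by simp) _ _).update (by simp) _ _).update (by simp) _ _).update
      (by simp) _ _
  have henv₁ : Env Q off s₁ := h.frame hn₁ hr₁
  have hq₁ : NodeAt s₁ id q := by
    rw [hrun]
    constructor <;> simp [update_addr, hq, QParams.quarter, ListAt]
  have hL₁ : ∀ id' ≠ id, ∀ c, NodeAt s id' c → NodeAt s₁ id' c := by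
    intro id' hid' c hc
    rw [hrun]
    refine hc.congr ?_ ?_ ?_ (by simp [update_addr])
    · intro j hj
      simp only [List.mem_cons, List.not_mem_nil, or_false] at hj
      rcases hj with rfl | rfl | rfl | rfl | rfl <;> simp [update_addr, hid']
    · intro j hj
      simp only [List.mem_cons, List.not_mem_nil, or_false] at hj
      rcases hj with rfl | rfl | rfl <;> simp [update_addr, hid']
    · intro j hj p _
      simp only [List.mem_cons, List.not_mem_nil, or_false] at hj
      rcases hj with rfl | rfl <;> simp [update_addr]
  have hc0 : s₁.real (addr 45 off) = q.ctr 0 := by rw [hrun]; simp [update_addr]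
  have hc1 : s₁.real (addr 46 off) = q.ctr 1 := by rw [hrun]; simp [update_addr]
  have hρ : s₁.real (addr 47 off) = q.l * Q.κ := by rw [hrun]; simp [update_addr]
  have h15 : s₁.nat (addr 15 0) = id := by rw [hrun]; simp [update_addr]
  have hlist : ListAt s₁.nat (s₁.nat (addr 11 0)) (s₁.nat (addr 13 0)) b.act := by
    have e : s₁.nat (addr 13 0) = s.nat (addr 26 (off + k)) := by rw [hrun]; simp
    rw [e]
    exact hbk.act.frame hn₁
  refine Tot.seqs_step (k₂ := 0) (Tot.loopConst b.act.length
    (fun i s' => NodeAt s' id ((b.act.take i).foldl Q.sift q) ∧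
      ListAt s'.nat (s'.nat (addr 11 0)) (s'.nat (addr 13 0)) (b.act.drop i) ∧
      (∀ id' ≠ id, ∀ c, NodeAt s₁ id' c → NodeAt s' id' c) ∧
      SameOff [11, 13, 14, 24, 25, 26, 27, 28] s₁.nat s'.nat ∧ s'.real = s₁.real) 0 ?_ ?_ ?_) ?_
    (by simp)
  · rintro i hi s₂ ⟨k1, k2, k3, k4, k5⟩
    rw [List.drop_eq_getElem_cons hi] at k2
    set t := b.act[i] with ht
    have htN : t < Q.N := hact t (List.getElem_mem _)
    have k2c := k2
    obtain ⟨p1, p2, p3, p4⟩ := k2c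
    refine ⟨by simpa using p1, ?_⟩
    refine Tot.seqs_flat (by simp) (Tot.seqs_flat flat_siftProg (Tot.seqs_flat (by simp)
      (Tot.seqs_nil ?_)))
    set s₃ := (Program.setVar 14 (.at 27 (.var 13))).run s₂ with hs₃
    have hs₃' : s₃ = ⟨Function.update s₂.nat (addr 14 0) t, s₂.real⟩ := by simp [hs₃, p3]
    have n3 : SameOff [14] s₂.nat s₃.nat := by
      rw [hs₃']; exact (SameOff.refl _ _).update (by simp) _ _
    have r3 : s₃.real = s₂.real := by rw [hs₃']
    have n13 := k4.trans (n3.mono (by simp))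
    have sb := Q.sameBox_foldl (b.act.take i) q
    obtain ⟨m1, m2⟩ := siftProg_run (henv₁.frame n13 (SameOff.of_eq (J := []) (r3.trans k5))) htN
      (by rw [hs₃']; simp) (by rw [n13.eq 15, h15]) (k1.frame n3 r3)
      (by rw [r3, k5, hc0, sb.ctr_eq]) (by rw [r3, k5, hc1, sb.ctr_eq])
      (by rw [r3, k5, hρ, sb.2.2.2.2])
    set s₄ := siftProg.run s₃ with hs₄
    have hl4 := m2.list _ _ (k2.frame n3)
    have e13 : s₄.nat (addr 13 0) = s₂.nat (addr 13 0) := by rw [m2.sameOff.eq 13, n3.eq 13]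
    have n5 : SameOff [13] s₄.nat ((Program.setVar 13 (.at 28 (.var 13))).run s₄).nat :=
      (SameOff.refl _ _).update (by simp) _ _
    refine ⟨?_, ?_, ?_, ?_, ?_⟩
    · rw [List.take_succ_eq_append_getElem hi, List.foldl_append]
      exact m1.frame n5 rfl
    · have : ListAt s₄.nat (s₄.nat (addr 11 0)) (s₄.nat (addr 28 (s₂.nat (addr 13 0))))
          (b.act.drop (i + 1)) := hl4.2.2.2
      have e : ((Program.setVar 13 (.at 28 (.var 13))).run s₄).nat (addr 13 0) =
          s₄.nat (addr 28 (s₂.nat (addr 13 0))) := by simp [e13]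
      rw [e]
      exact this.frame n5
    · exact fun id' hid' c hc => (m2.node id' hid' c ((k3 id' hid' c hc).frame n3 r3)).frame n5 rfl
    · exact (n13.trans (m2.sameOff.mono (by simp))).trans (n5.mono (by simp))
    · exact m2.real.trans (r3.trans k5)
  · rintro s₂ ⟨-, k2, -⟩
    rw [List.drop_length] at k2
    simpa [ListAt] using k2
  · exact ⟨by simpa using hq₁, by simpa using hlist, fun _ _ _ h => h, SameOff.refl _ _, rfl⟩
  · rintro s₂ ⟨k1, k2, k3, k4, k5⟩
    refine Tot.seqs_one (Tot.flat (by simp) ?_)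
    have n3 : SameOff [10] s₂.nat ((Program.incr 10).run s₂).nat :=
      (SameOff.refl _ _).update (by simp) _ _
    refine ⟨(henv₁.frame k4 (SameOff.of_eq (J := []) k5)).frame n3 (SameOff.refl [] _), ?_, ?_, ?_⟩
    · rw [n3.eq 5, k4.eq 5, hn₁.eq 5, h5]
    · simp [k4.eq 10, hn₁.eq 10, h10, hid, add_assoc]
    · refine NodesAt.snoc ⟨fun j hj => ?_⟩ ?_
      · exact (k3 _ (by omega) _ (hL₁ _ (by omega) _ (hL.node j hj))).frame n3 rfl
      · rw [List.take_length] at k1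
        exact k1.frame n3 rfl

/-- The nodes below the roots. -/
def treeProg : Program :=
  .seqs [.setVar 5 (.var 3),
    .loop (.natLt (.var 5) (.var 10)) (.seq
      (.branch (.both (.natLt (.lit 0) (.at 26 (.var 5))) (.neg (.realLe (.at 14 (.var 5)) (.var 41))))
        (.seqs (QParams.quarters.map fun k => childProg k.1 k.2)) .skip)
      (.incr 5))]

theorem ListAt.pos_iff {f : ℕ → ℕ} {b p : ℕ} {l : List ℕ} (h : ListAt f b p l) : 0 < p ↔ l ≠ [] := by
  cases l with
  | nil => simp_all [ListAt]
  | cons t l => simp [h.1]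

theorem sum_range_getD (l : List ℕ) : ∑ i ∈ Finset.range l.length, l.getD i 0 = l.sum := by
  induction l with
  | nil => simp
  | cons a l ih => rw [List.length_cons, Finset.sum_range_succ', List.sum_cons, ← ih]; simp [add_comm]

/-- The nodes form a queue that is traversed while children are appended to it. After `i` passes it
consists of the roots and the children of the first `i` nodes, and `IsTree.lt_length` guarantees
that it does not run empty too early. -/
theorem tot_treeProg {A : PointSolver} {Q : QParams} {off : ℕ} {s : MemState}
    {roots all : List QNode} (h : Env Q off s) (h10 : s.nat (addr 10 0) = off + roots.length)
    (hR : NodesAt s off roots) (ht : Q.IsTree roots all) :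
    Tot A treeProg s (4 * (all.map fun b => b.act.length).sum + all.length) fun s' =>
      Env Q off s' ∧ s'.nat (addr 10 0) = off + all.length ∧ NodesAt s' off all := by
  set M : ℕ → List QNode := fun i => roots ++ (all.take i).flatMap Q.children with hM
  refine Tot.seqs_flat (by simp) (Tot.seqs_one ?_)
  refine (Tot.loopFor all.length (fun i s' => Env Q off s' ∧ s'.nat (addr 5 0) = off + i ∧
    s'.nat (addr 10 0) = off + (M i).length ∧ NodesAt s' off (M i))
    (fun i => 4 * (all.map fun b => b.act.length).getD i 0) ?_ ?_ ?_).mono ?_ ?_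
  · rintro i hi s₁ ⟨k1, k2, k3, k4⟩
    have hiM : i < (M i).length := ht.lt_length i hi
    refine ⟨by simp [k2, k3, hiM], ?_⟩
    set b := all[i] with hb
    have hMb : (M i)[i] = b := by
      obtain ⟨r, hr⟩ := ht.prefix i
      rw [hb]
      conv_rhs => rw [List.getElem_of_eq hr.symm, List.getElem_append_left hiM]
    have hbn := k4.node i hiM
    rw [hMb] at hbn
    have hM1 : M (i + 1) = M i ++ Q.children b := by
      simp only [hM]
      rw [List.take_succ_eq_append_getElem hi, List.flatMap_append]
      simp [hb]
    have hbud : 4 * (all.map fun b => b.act.length).getD i 0 = 4 * b.act.length := by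
      simp [List.getD, hi, hb]
    rw [hbud]
    refine Tot.seq' (k₁ := 4 * b.act.length) (k₂ := 0) (Q' := fun s' => Env Q off s' ∧
      s'.nat (addr 5 0) = off + i ∧ s'.nat (addr 10 0) = off + (M (i + 1)).length ∧
      NodesAt s' off (M (i + 1))) ?_ ?_
    · have hleaf : (TestExpr.both (.natLt (.lit 0) (.at 26 (.var 5)))
          (.neg (.realLe (.at 14 (.var 5)) (.var 41)))).Holds s₁ ↔ ¬ Q.Leaf b := by
        simp only [TestExpr.holds_both, TestExpr.holds_natLt, TestExpr.holds_neg,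
          TestExpr.holds_realLe, RealExpr.eval_at, RealExpr.eval_var, NatExpr.eval_lit,
          NatExpr.eval_at, NatExpr.eval_var, k2, hbn.l, k1.off_eq, k1.sz_eq, hbn.act.pos_iff,
          QParams.Leaf, not_or]
      by_cases hl : Q.Leaf b
      · refine Tot.branchFalse (by simpa [hleaf] using hl) (Tot.mono (Tot.flat trivial ?_) (Nat.zero_le _)
          fun _ h => h)
        have : Q.children b = [] := by simp [QParams.children, hl]
        rw [hM1, this, List.append_nil]
        exact ⟨k1, k2, k3, k4⟩
      · refine Tot.branchTrue (hleaf.2 hl) ?_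
        have hch : Q.children b = QParams.quarters.map fun k => Q.child b k.1 k.2 := by
          simp [QParams.children, hl]
        rw [hM1, hch]
        have := Tot.seqs_map (A := A) (fun k : Bool × Bool => childProg k.1 k.2) b.act.length
          QParams.quarters (fun pre s' => Env Q off s' ∧ s'.nat (addr 5 0) = off + i ∧
            s'.nat (addr 10 0) = off + (M i ++ pre.map fun k => Q.child b k.1 k.2).length ∧
            NodesAt s' off (M i ++ pre.map fun k => Q.child b k.1 k.2)) ?_ [] s₁
            ⟨k1, k2, by simpa using k3, by simpa using k4⟩
        · simpa [QParams.quarters] using this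
        · rintro pre x s₂ - ⟨l1, l2, l3, l4⟩
          refine (tot_childProg (b := b) l1 l2 l3 l4 (by simp; omega) ?_
            (ht.good b (List.getElem_mem _)).act_lt x.1 x.2).mono le_rfl ?_
          · rw [List.getElem_append_left hiM, hMb]
          · rintro s' ⟨m1, m2, m3, m4⟩
            refine ⟨m1, m2, ?_, ?_⟩
            · rw [m3]; simp; omega
            · simpa using m4
    · rintro s₂ ⟨l1, l2, l3, l4⟩
      refine Tot.flat (by simp) ?_
      have n3 : SameOff [5] s₂.nat ((Program.incr 5).run s₂).nat :=
        (SameOff.refl _ _).update (by simp) _ _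
      exact ⟨l1.frame n3 (SameOff.refl [] _), by simp [l2]; ring, by rw [n3.eq 10, l3],
        l4.frame n3 (SameOff.refl [] _)⟩
  · rintro s₁ ⟨k1, k2, k3, k4⟩
    have : M all.length = all := by
      simp only [hM, List.take_length]
      exact ht.eq.symm
    rw [this] at k3
    simp [k2, k3]
  · have n3 : SameOff [5] s.nat ((Program.setVar 5 (.var 3)).run s).nat :=
      (SameOff.refl _ _).update (by simp) _ _
    refine ⟨h.frame n3 (SameOff.refl [] _), by simp [h.off_eq], ?_, ?_⟩
    · rw [n3.eq 10, h10]; simp [hM]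
    · simpa [hM] using hR.frame n3 (SameOff.refl [] _)
  · rw [Finset.sum_add_distrib, ← Finset.mul_sum]
    have h2 := sum_range_getD (all.map fun b => b.act.length)
    rw [List.length_map] at h2
    rw [h2]
    simp
  · rintro s' ⟨k1, k2, k3, k4⟩
    have : M all.length = all := by
      simp only [hM, List.take_length]
      exact ht.eq.symm
    rw [this] at k3 k4
    exact ⟨k1, k3, k4⟩


/-! ### Preparations -/

/-- The coordinate with number `c` of the triangle `var 14` in the input. -/
def RealExpr.input (c : ℕ) : RealExpr := .load (.add (.mul (.lit 6) (.var 14)) (.lit (c + 1)))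

/-- Setting an entry for the triangle `var 14`. -/
def Program.setCol (j : Fin 64) (x : RealExpr) : Program :=
  .setReal (.addr j (.add (.var 3) (.var 14))) x

/-- Setting a real variable. -/
def Program.setRVar (j : Fin 64) (x : RealExpr) : Program := .setReal (.addr j (.var 3)) x

/-- Reading the triangle `var 14`. -/
def prepStep : Program :=
  .seqs [.setCol 0 (.input 0), .setCol 1 (.input 1), .setCol 2 (.input 2), .setCol 3 (.input 3),
    .setCol 4 (.input 4), .setCol 5 (.input 5),
    .setCol 6 (.min (.min (.vx 0) (.vx 1)) (.vx 2)), .setCol 9 (.min (.min (.vy 0) (.vy 1)) (.vy 2)),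
    .setRVar 40 (.max (.var 40) (.max (.max (.dist (.vx 0) (.vy 0) (.vx 1) (.vy 1))
      (.dist (.vx 1) (.vy 1) (.vx 2) (.vy 2))) (.dist (.vx 2) (.vy 2) (.vx 0) (.vy 0)))),
    .setRVar 44 (.max (.var 44) (.add (.max (.off 6 (.var 14)) (.off 9 (.var 14))) (.num 1))),
    .incr 14]

/-- The first part of the program: reading the input. -/
def prepProg : Program :=
  .seqs [.setVar 2 (.add (.var 0) (.var 1)), .setVar 3 (.add (.var 2) (.lit 1)),
    .setRVar 40 (.num 0),
    .setRVar 41 (.div (.div (.load (.lit 0)) (.add (.num 1) (.load (.lit 0))))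
      (.sqrt (.mul (.ofNat (.var 0)) (.ofNat (.var 1))))),
    .setRVar 42 (.add (.num 2) (.div (.num 1) (.load (.lit 0)))),
    .setRVar 44 (.num 0), .setVar 14 (.lit 0), .loop (.natLt (.var 14) (.var 2)) prepStep,
    .setVar 4 (.lit 1), .loop (.natLe (.mul (.var 4) (.var 4)) (.var 2)) (.incr 4)]

/-- The input of the algorithm. -/
structure IsInput (n m : ℕ) (δ : ℝ) (T : ℕ → Fin 3 → Plane) (s : MemState) : Prop where
  nat_zero : s.nat 0 = n
  nat_one : s.nat 1 = m
  nat_eq : ∀ a, 2 ≤ a → s.nat a = 0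
  real_zero : s.real 0 = δ
  x0 : ∀ t < n + m, s.real (6 * t + 1) = T t 0 0
  y0 : ∀ t < n + m, s.real (6 * t + 2) = T t 0 1
  x1 : ∀ t < n + m, s.real (6 * t + 3) = T t 1 0
  y1 : ∀ t < n + m, s.real (6 * t + 4) = T t 1 1
  x2 : ∀ t < n + m, s.real (6 * t + 5) = T t 2 0
  y2 : ∀ t < n + m, s.real (6 * t + 6) = T t 2 1

/-- The state after reading the input up to the triangle `t`. -/
structure PrepState (n N : ℕ) (T : ℕ → Fin 3 → Plane) (κ sz Δ : ℝ) (t : ℕ) (s₀ s : MemState)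
    (W big : ℝ) : Prop where
  nat_eq : s.nat = s₀.nat
  low : ∀ a < 64 * (N + 1), s.real a = s₀.real a
  W_nonneg : 0 ≤ W
  W_le : W ≤ Δ
  le_W : ∀ u < t, ∀ a c, dist (T u a) (T u c) ≤ W
  minx : ∀ u < t, min (min (T u 0 0) (T u 1 0)) (T u 2 0) < big
  miny : ∀ u < t, min (min (T u 0 1) (T u 1 1)) (T u 2 1) < big
  W_eq : s.real (addr 40 (N + 1)) = W
  sz_eq : s.real (addr 41 (N + 1)) = sz
  κ_eq : s.real (addr 42 (N + 1)) = κ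
  big_eq : s.real (addr 44 (N + 1)) = big
  x0 : ∀ u < t, s.real (addr 0 (N + 1 + u)) = T u 0 0
  y0 : ∀ u < t, s.real (addr 1 (N + 1 + u)) = T u 0 1
  x1 : ∀ u < t, s.real (addr 2 (N + 1 + u)) = T u 1 0
  y1 : ∀ u < t, s.real (addr 3 (N + 1 + u)) = T u 1 1
  x2 : ∀ u < t, s.real (addr 4 (N + 1 + u)) = T u 2 0
  y2 : ∀ u < t, s.real (addr 5 (N + 1 + u)) = T u 2 1
  keyx : ∀ u < t, s.real (addr 6 (N + 1 + u)) = min (min (T u 0 0) (T u 1 0)) (T u 2 0)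
  keyy : ∀ u < t, s.real (addr 9 (N + 1 + u)) = min (min (T u 0 1) (T u 1 1)) (T u 2 1)

/-- The input occupies real cells up to `6 * N`, all below `64 * (N + 1)`. Real arrays and variables
are used with indices from `N + 1` on, so the input is not overwritten while it is read. -/
theorem update_addr_of_lt {α : Type*} (f : ℕ → α) {j : Fin 64} {i a : ℕ} (v : α) (h : a < 64 * i) :
    Function.update f (addr j i) v a = f a :=
  Function.update_of_ne (by unfold addr; omega) _ _

theorem prepStep_eq {N : ℕ} {T : ℕ → Fin 3 → Plane} {t : ℕ} {s : MemState} {W big mx my : ℝ}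
    (hn3 : s.nat (addr 3 0) = N + 1) (hn14 : s.nat (addr 14 0) = t)
    (f0 : s.real (6 * t + 1) = T t 0 0) (f1 : s.real (6 * t + 2) = T t 0 1)
    (f2 : s.real (6 * t + 3) = T t 1 0) (f3 : s.real (6 * t + 4) = T t 1 1)
    (f4 : s.real (6 * t + 5) = T t 2 0) (f5 : s.real (6 * t + 6) = T t 2 1)
    (q1 : s.real (addr 40 (N + 1)) = W) (q4 : s.real (addr 44 (N + 1)) = big)
    (hmx : mx = min (min (T t 0 0) (T t 1 0)) (T t 2 0))
    (hmy : my = min (min (T t 0 1) (T t 1 1)) (T t 2 1)) :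
    prepStep.run s = ⟨Function.update s.nat (addr 14 0) (t + 1), Function.update (Function.update
      (Function.update (Function.update (Function.update (Function.update (Function.update
      (Function.update (Function.update (Function.update s.real (addr 0 (N + 1 + t)) (T t 0 0))
      (addr 1 (N + 1 + t)) (T t 0 1)) (addr 2 (N + 1 + t)) (T t 1 0)) (addr 3 (N + 1 + t)) (T t 1 1))
      (addr 4 (N + 1 + t)) (T t 2 0)) (addr 5 (N + 1 + t)) (T t 2 1)) (addr 6 (N + 1 + t)) mx)
      (addr 9 (N + 1 + t)) my) (addr 40 (N + 1))
        (max W (max (max (dist (T t 0) (T t 1)) (dist (T t 1) (T t 2))) (dist (T t 2) (T t 0)))))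
      (addr 44 (N + 1)) (max big (max mx my + 1))⟩ := by
  have g : ∀ c ≤ 6, 6 * t + c < 64 * (N + 1 + t) := fun c _ => by omega
  simp only [prepStep, Program.run_seqs_cons, Program.run_seqs_nil, Program.setCol, Program.setRVar,
    Program.run_setReal, Program.run_incr, NatExpr.eval_addr, NatExpr.eval_add, NatExpr.eval_var,
    hn3, hn14, RealExpr.eval_max, RealExpr.eval_min, RealExpr.vx, RealExpr.vy, RealExpr.eval_off,
    RealExpr.eval_var, RealExpr.input, RealExpr.eval, NatExpr.eval_mul, NatExpr.eval_lit,
    RealExpr.dist, update_addr_of_lt _ _ (g 1 (by omega)), update_addr_of_lt _ _ (g 2 (by omega)), update_addr_of_lt _ _ (g 3 (by omega)),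
    update_addr_of_lt _ _ (g 4 (by omega)), update_addr_of_lt _ _ (g 5 (by omega)), update_addr_of_lt _ _ (g 6 (by omega)),
    f0, f1, f2, f3, f4, f5, zero_add, Nat.reduceAdd, hmx, hmy, Plane.dist_eq]
  simp [update_addr, q1, q4]

set_option maxHeartbeats 800000 in
theorem prepStep_run {n N : ℕ} {T : ℕ → Fin 3 → Plane} {κ sz Δ : ℝ} {t : ℕ} {s₀ s : MemState}
    {W big : ℝ} (h : PrepState n N T κ sz Δ t { s₀ with nat := Function.update s₀.nat (addr 14 0) t } s W big)
    (h3 : s₀.nat (addr 3 0) = N + 1) (ht : t < N)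
    (e0 : s₀.real (6 * t + 1) = T t 0 0) (e1 : s₀.real (6 * t + 2) = T t 0 1)
    (e2 : s₀.real (6 * t + 3) = T t 1 0) (e3 : s₀.real (6 * t + 4) = T t 1 1)
    (e4 : s₀.real (6 * t + 5) = T t 2 0) (e5 : s₀.real (6 * t + 6) = T t 2 1)
    (hΔ : ∀ a c, dist (T t a) (T t c) ≤ Δ) :
    ∃ W big, PrepState n N T κ sz Δ (t + 1)
      { s₀ with nat := Function.update s₀.nat (addr 14 0) (t + 1) } (prepStep.run s) W big := by
  obtain ⟨h1, h2, hW0, hWΔ, hW, hbx, hby, q1, q2, q3, q4, q5, q6, q7, q8, q9, q10, q11, q12⟩ := h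
  simp only at h1 h2
  have f0 := (h2 (6 * t + 1) (by omega)).trans e0
  have f1 := (h2 (6 * t + 2) (by omega)).trans e1
  have f2 := (h2 (6 * t + 3) (by omega)).trans e2
  have f3 := (h2 (6 * t + 4) (by omega)).trans e3
  have f4 := (h2 (6 * t + 5) (by omega)).trans e4
  have f5 := (h2 (6 * t + 6) (by omega)).trans e5
  set mx := min (min (T t 0 0) (T t 1 0)) (T t 2 0) with hmx
  set my := min (min (T t 0 1) (T t 1 1)) (T t 2 1) with hmy
  set W' := max W (max (max (dist (T t 0) (T t 1)) (dist (T t 1) (T t 2))) (dist (T t 2) (T t 0))) with hW'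
  set big' := max big (max mx my + 1) with hbig'
  have hn3 : s.nat (addr 3 0) = N + 1 := by rw [h1]; simp [update_addr, h3]
  have hn14 : s.nat (addr 14 0) = t := by rw [h1]; simp [update_addr]
  have hrun := prepStep_eq hn3 hn14 f0 f1 f2 f3 f4 f5 q1 q4 hmx hmy
  rw [← hW', ← hbig', h1, Function.update_idem] at hrun
  rw [hrun]
  clear hrun
  have hcol : ∀ (r : ℕ → ℝ) (j : Fin 64) (g : ℕ → ℝ), (∀ u < t, r (addr j (N + 1 + u)) = g u) →
      r (addr j (N + 1 + t)) = g t → ∀ u < t + 1, r (addr j (N + 1 + u)) = g u := by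
    intro r j g h h' u hu
    rcases Nat.lt_succ_iff_lt_or_eq.1 hu with hu | rfl
    exacts [h u hu, h']
  have hne : ∀ u < t, u ≠ t := fun u hu => hu.ne
  refine ⟨W', big', rfl, ?_, ?_, ?_, ?_, ?_, ?_, ?_, ?_, ?_, ?_, ?_, ?_, ?_, ?_, ?_, ?_, ?_, ?_⟩
  · intro a ha
    have hlt : a < 64 * (N + 1 + t) := by omega
    simp only [update_addr_of_lt _ _ ha, update_addr_of_lt _ _ hlt]
    exact h2 a ha
  · exact hW0.trans (le_max_left _ _)
  · simp only [hW', max_le_iff]; exact ⟨hWΔ, ⟨hΔ _ _, hΔ _ _⟩, hΔ _ _⟩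
  · intro u hu a c
    rcases Nat.lt_succ_iff_lt_or_eq.1 hu with hu | rfl
    · exact (hW u hu a c).trans (le_max_left _ _)
    · have a1 : dist (T u 0) (T u 1) ≤ W' := by simp [hW']
      have a2 : dist (T u 1) (T u 2) ≤ W' := by simp [hW']
      have a3 : dist (T u 2) (T u 0) ≤ W' := by simp [hW']
      have a0 : 0 ≤ W' := hW0.trans (le_max_left _ _)
      have b1 := a1; have b2 := a2; have b3 := a3
      rw [dist_comm] at b1 b2 b3
      clear_value W'
      clear hW'
      fin_cases a <;> fin_cases c <;> first | assumption | simpa using a0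
  · intro u hu
    rcases Nat.lt_succ_iff_lt_or_eq.1 hu with hu | rfl
    · exact (hbx u hu).trans_le (le_max_left _ _)
    · calc mx < max mx my + 1 := by linarith [le_max_left mx my]
        _ ≤ _ := le_max_right _ _
  · intro u hu
    rcases Nat.lt_succ_iff_lt_or_eq.1 hu with hu | rfl
    · exact (hby u hu).trans_le (le_max_left _ _)
    · calc my < max mx my + 1 := by linarith [le_max_right mx my]
        _ ≤ _ := le_max_right _ _
  · simp [update_addr]
  · simp [update_addr, q2]
  · simp [update_addr, q3]
  · simp
  all_goals
    refine hcol _ _ _ (fun u hu => ?_) (by simp [update_addr, mx, my])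
    simp only [update_addr, Fin.reduceEq, false_and, and_false, if_false, add_right_inj, hne u hu]
    first | exact q5 u hu | exact q6 u hu | exact q7 u hu | exact q8 u hu | exact q9 u hu | exact q10 u hu | exact q11 u hu | exact q12 u hu

/-- The bound on the edges is computed as the actual maximum `W`, since `Δ` is not part of the
input. The number of blocks is found by counting up to the first square that exceeds `N`. -/
theorem tot_prepProg {A : PointSolver} {n m : ℕ} {δ : ℝ} {T : ℕ → Fin 3 → Plane} {s : MemState}
    (h : IsInput n m δ T s) {Δ : ℝ} (hΔ0 : 0 ≤ Δ)
    (hΔ : ∀ t < n + m, ∀ a c, dist (T t a) (T t c) ≤ Δ) :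
    Tot A prepProg s (2 * (n + m)) fun s' => ∃ W big, 0 ≤ W ∧ W ≤ Δ ∧
      ∃ Q : QParams, Q = ⟨n, n + m, T, W, 2 + 1 / δ, δ / (1 + δ) / Real.sqrt (n * m)⟩ ∧
      (∀ t < Q.N, ∀ a c, dist (T t a) (T t c) ≤ W) ∧ Env Q (n + m + 1) s' ∧
      s'.nat (addr 4 0) = Nat.sqrt (n + m) + 1 ∧ s'.real (addr 44 (n + m + 1)) = big ∧
      (∀ t < Q.N, s'.real (addr 6 (n + m + 1 + t)) = Q.minCoord 0 t) ∧
      (∀ t < Q.N, s'.real (addr 9 (n + m + 1 + t)) = Q.minCoord 1 t) ∧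
      (∀ t < Q.N, Q.minCoord 0 t < big) ∧ (∀ t < Q.N, Q.minCoord 1 t < big) ∧
      ∀ i, s'.nat (addr 29 i) = 0 := by
  obtain ⟨h0, h1, h2, h3, c0, c1, c2, c3, c4, c5⟩ := h
  have hz := h2
  set N := n + m with hN
  set κ : ℝ := 2 + 1 / δ with hκ
  set sz : ℝ := δ / (1 + δ) / Real.sqrt (n * m) with hsz
  have a0 : s.nat (addr 0 0) = n := h0
  have a1 : s.nat (addr 1 0) = m := h1
  set s₀ : MemState := ⟨Function.update (Function.update s.nat (addr 2 0) N) (addr 3 0) (N + 1),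
    s.real⟩ with hs₀
  set s₁ : MemState := ⟨Function.update (Function.update (Function.update s.nat (addr 2 0) N)
    (addr 3 0) (N + 1)) (addr 14 0) 0, Function.update (Function.update (Function.update
      (Function.update s.real (addr 40 (N + 1)) 0) (addr 41 (N + 1)) sz) (addr 42 (N + 1)) κ)
      (addr 44 (N + 1)) 0⟩ with hs₁
  -- The state after the initial assignments is computed once, in closed form.
  have hstart : ∀ l, Tot A (Program.seqs l) s₁ (2 * N) = Tot A (Program.seqs l)
      ((Program.seqs [.setVar 2 (.add (.var 0) (.var 1)), .setVar 3 (.add (.var 2) (.lit 1)),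
      .setRVar 40 (.num 0),
      .setRVar 41 (.div (.div (.load (.lit 0)) (.add (.num 1) (.load (.lit 0))))
        (.sqrt (.mul (.ofNat (.var 0)) (.ofNat (.var 1))))),
      .setRVar 42 (.add (.num 2) (.div (.num 1) (.load (.lit 0)))),
      .setRVar 44 (.num 0), .setVar 14 (.lit 0)]).run s) (2 * N) := by
    intro l
    congr 1
    have hlt : 0 < 64 * (N + 1) := by omega
    simp only [hs₁, Program.run_seqs_cons, Program.run_seqs_nil, Program.run_setVar, Program.setRVar,
      Program.run_setReal, NatExpr.eval_addr, NatExpr.eval_add, NatExpr.eval_var, NatExpr.eval_lit,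
      RealExpr.eval_num, RealExpr.eval_div, RealExpr.eval_add, RealExpr.eval_sqrt, RealExpr.eval_mul,
      RealExpr.eval_ofNat, RealExpr.eval, update_addr, Fin.reduceEq, false_and, true_and, if_false,
      if_true, a0, a1, ← hN]
    simp only [update_addr_of_lt _ _ hlt, h3, hκ, hsz, Nat.cast_one, Nat.cast_ofNat, Nat.cast_zero]
  refine Tot.seqs_flat (by simp) (Tot.seqs_flat (by simp) (Tot.seqs_flat trivial (Tot.seqs_flat trivial
    (Tot.seqs_flat trivial (Tot.seqs_flat trivial (Tot.seqs_flat (by simp) ?_))))))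
  have hstart' := fun l => congrFun (hstart l)
  simp only [Program.run_seqs_cons, Program.run_seqs_nil] at hstart'
  rw [← hstart']
  clear hstart hstart'
  refine Tot.seqs_step (k₁ := N) (k₂ := N) ((Tot.loopConst N (fun t s' => ∃ W big, PrepState n N T κ sz Δ t
    { s₀ with nat := Function.update s₀.nat (addr 14 0) t } s' W big) 0 ?_ ?_ ?_).mono (by simp)
    fun _ h => h) ?_ (by omega)
  · rintro t ht s₂ ⟨W, big, k⟩
    have e := k.nat_eq
    simp only at e
    refine ⟨by simp [e, hs₀, update_addr, ht], Tot.flat (by simp [prepStep, Program.setCol, Program.setRVar, Program.Flat]) ?_⟩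
    exact prepStep_run k (by simp [hs₀, update_addr]) ht (c0 t ht) (c1 t ht) (c2 t ht) (c3 t ht)
      (c4 t ht) (c5 t ht) (hΔ t ht)
  · rintro s₂ ⟨W, big, k⟩
    have e := k.nat_eq
    simp only at e
    simp [e, hs₀, update_addr]
  · refine ⟨0, 0, rfl, ?_, le_rfl, hΔ0, ?_, ?_, ?_, ?_, ?_, ?_, ?_, ?_, ?_, ?_, ?_, ?_, ?_, ?_, ?_⟩
    · intro a ha
      simp only [hs₁, update_addr_of_lt _ _ ha]
      rfl
    all_goals first | (intro u hu; omega) | simp [hs₁, update_addr]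
  · rintro s₂ ⟨W, big, k⟩
    have e := k.nat_eq
    simp only at e
    refine Tot.seqs_flat (by simp) (Tot.seqs_one ((Tot.loopConst (Nat.sqrt N) (fun i s' =>
      s'.real = s₂.real ∧ SameOff [4] s₂.nat s'.nat ∧ s'.nat (addr 4 0) = i + 1) 0 ?_ ?_ ?_).mono
      (by simpa using Nat.sqrt_le_self N) ?_))
    · rintro i hi s₃ ⟨k1, k2, k3⟩
      have e2 : s₃.nat (addr 2 0) = N := by rw [k2.eq 2, e]; simp [hs₀, update_addr]
      refine ⟨?_, Tot.flat (by simp) ⟨k1, k2.update (by simp) _ _, by simp [k3]⟩⟩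
      simp only [TestExpr.holds_natLe, NatExpr.eval_mul, NatExpr.eval_var, k3, e2]
      exact Nat.le_sqrt.1 hi
    · rintro s₃ ⟨k1, k2, k3⟩
      have e2 : s₃.nat (addr 2 0) = N := by rw [k2.eq 2, e]; simp [hs₀, update_addr]
      simp only [TestExpr.holds_natLe, NatExpr.eval_mul, NatExpr.eval_var, k3, e2, not_le]
      exact Nat.lt_succ_sqrt N
    · exact ⟨rfl, (SameOff.refl _ _).update (by simp) _ _, by simp⟩
    · rintro s₃ ⟨k1, k2, k3⟩
      obtain ⟨-, h2, hW0, hWΔ, hW, hbx, hby, q1, q2, q3, q4, q5, q6, q7, q8, q9, q10, q11, q12⟩ := k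
      refine ⟨W, big, hW0, hWΔ, _, rfl, hW, ?_, k3, by rw [k1, q4], by rw [k1]; exact q11,
        by rw [k1]; exact q12, hbx, hby, ?_⟩
      · refine ⟨by omega, ?_, ?_, ?_, by rw [k1, q1], by rw [k1, q2], by rw [k1, q3],
          by rw [k1]; exact q5, by rw [k1]; exact q6, by rw [k1]; exact q7, by rw [k1]; exact q8,
          by rw [k1]; exact q9, by rw [k1]; exact q10⟩
        · rw [k2.eq 0, e]; simp [hs₀, update_addr, a0]
        · rw [k2.eq 2, e]; simp [hs₀, update_addr]
        · rw [k2.eq 3, e]; simp [hs₀, update_addr]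
      · intro i
        rw [k2.eq 29, e]
        simp only [hs₀, update_addr, Fin.reduceEq, false_and, if_false]
        exact hz _ (by simp [addr])


/-! ### Areas and weights -/

namespace RealExpr

/-- The positive part. -/
def pos (x : RealExpr) : RealExpr := .max x (.num 0)

/-- The square of the positive part of a difference. -/
def posSq (x y : RealExpr) : RealExpr := .mul (pos (.sub x y)) (pos (.sub x y))

/-- The slope of a line. -/
def slope (px py qx qy : RealExpr) : RealExpr := .div (.sub qy py) (.sub qx px)

/-- See `_root_.lineAt`. -/
def lineAt (px py qx qy u : RealExpr) : RealExpr := .add py (.mul (slope px py qx qy) (.sub u px))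

/-- The projection of a number to the horizontal range of the box of the node `var 5`. -/
def clampBox (u : RealExpr) : RealExpr := .max (.at 10 (.var 5)) (.min u (.at 11 (.var 5)))

/-- See `_root_.edgeArea`, for the box of the node `var 5`. -/
def edgeArea (px py qx qy : RealExpr) : RealExpr :=
  .add (.div (.add (.sub (.sub
      (posSq (lineAt px py qx qy (clampBox qx)) (.at 12 (.var 5)))
      (posSq (lineAt px py qx qy (clampBox px)) (.at 12 (.var 5))))
      (posSq (lineAt px py qx qy (clampBox qx)) (.at 13 (.var 5))))
      (posSq (lineAt px py qx qy (clampBox px)) (.at 13 (.var 5))))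
      (.mul (.num 2) (slope px py qx qy)))
    (.mul (.sub (.num 1) (.div (slope px py qx qy) (slope px py qx qy)))
      (.mul (.sub (clampBox qx) (clampBox px))
        (.sub (pos (.sub py (.at 12 (.var 5)))) (pos (.sub py (.at 13 (.var 5)))))))

/-- See `_root_.boxArea`, for the triangle `var 14` and the box of the node `var 5`. -/
def boxArea : RealExpr :=
  .mul (.div triDet (.abs triDet)) (.sub (.num 0) (.add (.add
    (edgeArea (vx 0) (vy 0) (vx 1) (vy 1)) (edgeArea (vx 1) (vy 1) (vx 2) (vy 2)))
    (edgeArea (vx 2) (vy 2) (vx 0) (vy 0))))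

/-- The area of the box of the node `var 5`. -/
def nodeArea : RealExpr :=
  .mul (.sub (.at 11 (.var 5)) (.at 10 (.var 5))) (.sub (.at 13 (.var 5)) (.at 12 (.var 5)))

end RealExpr

theorem Env.eval_boxArea {Q : QParams} {off t id : ℕ} {b : QNode} {s : MemState} (h : Env Q off s)
    (ht : t < Q.N) (h14 : s.nat (addr 14 0) = t) (h5 : s.nat (addr 5 0) = id) (hb : NodeAt s id b) :
    RealExpr.boxArea.eval s = boxArea (Q.T t) b.x₀ b.x₁ b.y₀ b.y₁ := by
  simp only [RealExpr.boxArea, RealExpr.edgeArea, RealExpr.posSq, RealExpr.pos, RealExpr.lineAt,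
    RealExpr.slope, RealExpr.clampBox, RealExpr.eval_add, RealExpr.eval_sub, RealExpr.eval_mul,
    RealExpr.eval_div, RealExpr.eval_max, RealExpr.eval_min, RealExpr.eval_abs, RealExpr.eval_num,
    RealExpr.eval_at, NatExpr.eval_var, h5, hb.x₀, hb.x₁, hb.y₀, hb.y₁, h.eval_vx ht h14,
    h.eval_vy ht h14, h.eval_triDet ht h14, boxArea, edgeArea, lineAt, clampTo, Nat.cast_zero,
    Nat.cast_one, Nat.cast_ofNat]

/-- The weights of the node `var 5`, from the areas of its undecided triangles. -/
def storeWeights : Program :=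
  .branch (.natLe (.at 26 (.var 5)) (.lit 0))
    (.seqs [.setReal (.addr 16 (.var 5))
        (.mul (.ofNat (.sub (.at 24 (.var 5)) (.at 25 (.var 5)))) .nodeArea),
      .setReal (.addr 17 (.var 5))
        (.mul (.ofNat (.sub (.at 25 (.var 5)) (.at 24 (.var 5)))) .nodeArea),
      .setReal (.addr 18 (.var 5))
        (.ofNat (.sub (.at 24 (.var 5)) (.sub (.at 24 (.var 5)) (.at 25 (.var 5)))))])
    (.branch (.realLe (.at 14 (.var 5)) (.var 41))
      (.seqs [.setReal (.addr 16 (.var 5))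
          (.add (.mul (.ofNat (.at 24 (.var 5))) .nodeArea) (.var 48)),
        .setReal (.addr 17 (.var 5)) (.add (.mul (.ofNat (.at 25 (.var 5))) .nodeArea) (.var 49)),
        .setReal (.addr 18 (.var 5)) (.num 0)])
      (.seqs [.setReal (.addr 16 (.var 5)) (.num 0), .setReal (.addr 17 (.var 5)) (.num 0),
        .setReal (.addr 18 (.var 5)) (.num 0)]))

theorem flat_storeWeights : storeWeights.Flat := by simp [storeWeights, Program.Flat]

open Classical in
theorem storeWeights_run {Q : QParams} {off id : ℕ} {b : QNode} {s : MemState} (h : Env Q off s)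
    (h5 : s.nat (addr 5 0) = id) (hb : NodeAt s id b)
    (hu : s.real (addr 48 off) = Q.actArea b (· < Q.n))
    (hv : s.real (addr 49 off) = Q.actArea b (¬ · < Q.n)) :
    storeWeights.run s = ⟨s.nat, Function.update (Function.update (Function.update s.real
      (addr 16 id) (Q.srcW b)) (addr 17 id) (Q.tgtW b)) (addr 18 id) (QParams.stayW b)⟩ := by
  obtain ⟨h1, h2, h3, h4, h6, h7, h8, h9⟩ := hb
  have hact : s.nat (addr 26 id) ≤ 0 ↔ b.act = [] := by
    rw [← not_iff_not, not_le, h9.pos_iff]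
  have ho := h.off_eq
  have hsz := h.sz_eq
  by_cases ha : b.act = []
  · have hl : Q.Leaf b := Or.inl ha
    rw [storeWeights, Program.run_branch, if_pos (by simpa [h5] using hact.2 ha)]
    simp [QParams.srcW, QParams.tgtW, QParams.stayW, hl, ha, RealExpr.nodeArea, update_addr, h5, h1, h2,
      h3, h4, h7, h8, QNode.area]
  rw [storeWeights, Program.run_branch, if_neg (by simpa [h5] using mt hact.1 ha)]
  by_cases hl : b.l ≤ Q.sz
  · have hl' : Q.Leaf b := Or.inr hl
    rw [Program.run_branch, if_pos (by simpa [h5, h6, ho, hsz] using hl)]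
    simp [QParams.srcW, QParams.tgtW, QParams.stayW, hl', ha, RealExpr.nodeArea, update_addr, h5, h1, h2,
      h3, h4, h7, h8, QNode.area, ho, hu, hv]
  · have hl' : ¬ Q.Leaf b := by simp [QParams.Leaf, ha, hl]
    rw [Program.run_branch, if_neg (by simpa [h5, h6, ho, hsz] using hl)]
    simp [QParams.srcW, QParams.tgtW, QParams.stayW, hl', ha, update_addr, h5]

/-- The weights of all nodes. -/
def weightsProg : Program :=
  .seqs [.setVar 5 (.var 3), .loop (.natLt (.var 5) (.var 10)) (.seqs [
    .setRVar 48 (.num 0), .setRVar 49 (.num 0), .setVar 13 (.at 26 (.var 5)),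
    .loop (.natLt (.lit 0) (.var 13)) (.seqs [.setVar 14 (.at 27 (.var 13)),
      .branch (.natLt (.var 14) (.var 0)) (.setRVar 48 (.add (.var 48) .boxArea))
        (.setRVar 49 (.add (.var 49) .boxArea)),
      .setVar 13 (.at 28 (.var 13))]),
    storeWeights, .incr 5])]

open Classical in
theorem tot_weightsProg {A : PointSolver} {Q : QParams} {off : ℕ} {s : MemState} {all : List QNode}
    (h : Env Q off s) (h10 : s.nat (addr 10 0) = off + all.length) (hN : NodesAt s off all)
    (hact : ∀ b ∈ all, ∀ t ∈ b.act, t < Q.N) :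
    Tot A weightsProg s ((all.map fun b => b.act.length).sum + all.length) fun s' =>
      SameOff [5, 13, 14] s.nat s'.nat ∧ SameOff [16, 17, 18, 48, 49] s.real s'.real ∧
      ∀ j (hj : j < all.length), s'.real (addr 16 (off + j)) = Q.srcW all[j] ∧
        s'.real (addr 17 (off + j)) = Q.tgtW all[j] ∧
        s'.real (addr 18 (off + j)) = QParams.stayW all[j] := by
  refine Tot.seqs_flat (by simp) (Tot.seqs_one ?_)
  refine (Tot.loopFor all.length (fun i s' => s'.nat (addr 5 0) = off + i ∧
    SameOff [5, 13, 14] s.nat s'.nat ∧ SameOff [16, 17, 18, 48, 49] s.real s'.real ∧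
      ∀ j (hj : j < all.length), j < i → s'.real (addr 16 (off + j)) = Q.srcW all[j] ∧
        s'.real (addr 17 (off + j)) = Q.tgtW all[j] ∧
        s'.real (addr 18 (off + j)) = QParams.stayW all[j])
    (fun i => (all.map fun b => b.act.length).getD i 0) ?_ ?_ ?_).mono ?_ ?_
  · rintro i hi s₁ ⟨k1, k2, k3, k4⟩
    refine ⟨by simp [k1, k2.eq 10, h10, hi], ?_⟩
    have hb₁ := (hN.frame k2 k3).node i hi
    have he₁ := h.frame k2 k3
    have hactb := hact _ (List.getElem_mem hi)
    set b := all[i] with hb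
    have hbud : (all.map fun b => b.act.length).getD i 0 = b.act.length := by
      simp [List.getD, hi, hb]
    rw [hbud]
    refine Tot.seqs_flat trivial (Tot.seqs_flat trivial (Tot.seqs_flat (by simp) ?_))
    set s₂ : MemState := (Program.setVar 13 (.at 26 (.var 5))).run
      ((Program.setRVar 49 (.num 0)).run ((Program.setRVar 48 (.num 0)).run s₁)) with hs₂
    have e₂ : s₂ = ⟨Function.update s₁.nat (addr 13 0) (s₁.nat (addr 26 (off + i))),
        Function.update (Function.update s₁.real (addr 48 off) 0) (addr 49 off) 0⟩ := by
      simp [hs₂, Program.setRVar, k1, he₁.off_eq]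
    have n₂ : SameOff [13, 14] s₁.nat s₂.nat := by
      rw [e₂]; exact (SameOff.refl _ _).update (by simp) _ _
    have r₂ : SameOff [48, 49] s₁.real s₂.real := by
      rw [e₂]; exact ((SameOff.refl _ _).update (by simp) _ _).update (by simp) _ _
    refine Tot.seqs_step (k₂ := 0) (Tot.loopConst b.act.length (fun j s' =>
      SameOff [13, 14] s₁.nat s'.nat ∧ SameOff [48, 49] s₁.real s'.real ∧
      ListAt s'.nat (s'.nat (addr 11 0)) (s'.nat (addr 13 0)) (b.act.drop j) ∧
      s'.real (addr 48 off) = ((b.act.take j).map fun t =>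
        if t < Q.n then boxArea (Q.T t) b.x₀ b.x₁ b.y₀ b.y₁ else 0).sum ∧
      s'.real (addr 49 off) = ((b.act.take j).map fun t =>
        if ¬ t < Q.n then boxArea (Q.T t) b.x₀ b.x₁ b.y₀ b.y₁ else 0).sum) 0 ?_ ?_ ?_) ?_ (by simp)
    · rintro j hj s₃ ⟨l1, l2, l3, l4, l5⟩
      rw [List.drop_eq_getElem_cons hj] at l3
      set t := b.act[j] with ht
      have htN : t < Q.N := hactb t (List.getElem_mem _)
      obtain ⟨p1, p2, p3, p4⟩ := id (show _ ∧ _ ∧ _ ∧ _ from l3)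
      refine ⟨by simpa using p1, ?_⟩
      refine Tot.flat (by simp [Program.setRVar, Program.Flat]) ?_
      simp only [Program.run_seqs_cons, Program.run_seqs_nil]
      set s₄ := (Program.setVar 14 (.at 27 (.var 13))).run s₃ with hs₄
      have e₄ : s₄ = ⟨Function.update s₃.nat (addr 14 0) t, s₃.real⟩ := by simp [hs₄, p3]
      have n₄ : SameOff [14] s₃.nat s₄.nat := by
        rw [e₄]; exact (SameOff.refl _ _).update (by simp) _ _
      have n₄' : SameOff [13, 14] s₁.nat s₄.nat := l1.trans (n₄.mono (by simp))
      have r₄ : s₄.real = s₃.real := by rw [e₄]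
      have r₄' : SameOff [48, 49] s₁.real s₄.real := by rw [r₄]; exact l2
      have env₄ := he₁.frame n₄' r₄'
      have h14 : s₄.nat (addr 14 0) = t := by rw [e₄]; simp
      have hev : RealExpr.boxArea.eval s₄ = boxArea (Q.T t) b.x₀ b.x₁ b.y₀ b.y₁ :=
        env₄.eval_boxArea htN h14 (by rw [n₄'.eq 5, k1]) (hb₁.of_sameOff n₄' r₄')
      have hl := l3.frame n₄
      have h13 : s₄.nat (addr 13 0) = s₃.nat (addr 13 0) := n₄.eq 13 0
      have hl2 : ∀ r, ListAt ((Program.setVar 13 (.at 28 (.var 13))).run ⟨s₄.nat, r⟩).nat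
          (((Program.setVar 13 (.at 28 (.var 13))).run ⟨s₄.nat, r⟩).nat (addr 11 0))
          (((Program.setVar 13 (.at 28 (.var 13))).run ⟨s₄.nat, r⟩).nat (addr 13 0))
          (b.act.drop (j + 1)) := by
        intro r
        have e : ((Program.setVar 13 (.at 28 (.var 13))).run ⟨s₄.nat, r⟩).nat (addr 13 0) =
          s₄.nat (addr 28 (s₃.nat (addr 13 0))) := by simp [h13]
        rw [e]
        have : ListAt s₄.nat (s₄.nat (addr 11 0)) (s₄.nat (addr 28 (s₃.nat (addr 13 0))))
          (b.act.drop (j + 1)) := hl.2.2.2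
        exact this.frame (J := [13]) ((SameOff.refl _ _).update (by simp) _ _)
      have hn2 : ∀ r, SameOff [13, 14] s₁.nat
          ((Program.setVar 13 (.at 28 (.var 13))).run ⟨s₄.nat, r⟩).nat := fun r =>
        n₄'.update (by simp) _ _
      have hm : ∀ g : ℕ → ℝ, ((b.act.take (j + 1)).map g).sum = ((b.act.take j).map g).sum + g t := by
        intro g
        rw [List.take_succ_eq_append_getElem hj, List.map_append, List.sum_append]
        simp [ht]
      rw [hm, hm]
      by_cases htn : t < Q.n
      · rw [Program.run_branch, if_pos (by simpa [h14, env₄.n_eq] using htn)]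
        have e : (Program.setRVar 48 (.add (.var 48) .boxArea)).run s₄ = ⟨s₄.nat,
            Function.update s₄.real (addr 48 off) (s₄.real (addr 48 off) +
              boxArea (Q.T t) b.x₀ b.x₁ b.y₀ b.y₁)⟩ := by
          simp [Program.setRVar, env₄.off_eq, hev]
        rw [e]
        refine ⟨hn2 _, r₄'.update (by simp) _ _, hl2 _, ?_, ?_⟩
        · simp [htn, r₄, l4]
        · simp [htn, r₄, l5, update_addr]
      · rw [Program.run_branch, if_neg (by simpa [h14, env₄.n_eq] using htn)]
        have e : (Program.setRVar 49 (.add (.var 49) .boxArea)).run s₄ = ⟨s₄.nat,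
            Function.update s₄.real (addr 49 off) (s₄.real (addr 49 off) +
              boxArea (Q.T t) b.x₀ b.x₁ b.y₀ b.y₁)⟩ := by
          simp [Program.setRVar, env₄.off_eq, hev]
        rw [e]
        refine ⟨hn2 _, r₄'.update (by simp) _ _, hl2 _, ?_, ?_⟩
        · simp [htn, r₄, l4, update_addr]
        · simp [htn, r₄, l5]
    · rintro s₃ ⟨-, -, l3, -⟩
      rw [List.drop_length] at l3
      simpa [ListAt] using l3
    · refine ⟨n₂, r₂, ?_, by rw [e₂]; simp [update_addr], by rw [e₂]; simp⟩
      have e : s₂.nat (addr 13 0) = s₁.nat (addr 26 (off + i)) := by rw [e₂]; simp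
      rw [e]
      exact hb₁.act.frame n₂
    · rintro s₃ ⟨l1, l2, -, l4, l5⟩
      rw [List.take_length] at l4 l5
      refine Tot.seqs_flat flat_storeWeights (Tot.seqs_one (Tot.flat (by simp) ?_))
      have hb₃ : NodeAt s₃ (off + i) b := hb₁.of_sameOff l1 l2
      have hrun := storeWeights_run (he₁.frame l1 l2) (by rw [l1.eq 5, k1]) hb₃
        (by rw [l4]; unfold QParams.actArea; congr!) (by rw [l5]; unfold QParams.actArea; congr!)
      rw [hrun]
      refine ⟨by simp [l1.eq 5, k1, add_assoc], ((k2.trans (l1.mono (by simp))).update (by simp) _ _),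
        (((k3.trans (l2.mono (by simp))).update (by simp) _ _).update (by simp) _ _).update
          (by simp) _ _, ?_⟩
      intro j hj hji
      rcases Nat.lt_succ_iff_lt_or_eq.1 hji with hlt | rfl
      · have := k4 j hj hlt
        simpa [update_addr, hlt.ne, l2.eq 16, l2.eq 17, l2.eq 18] using this
      · simp [update_addr, hb]
  · rintro s₁ ⟨k1, k2, -⟩
    simp [k1, k2.eq 10, h10]
  · exact ⟨by simp [h.off_eq], (SameOff.refl _ _).update (by simp) _ _, SameOff.refl _ _, by simp⟩
  · rw [Finset.sum_add_distrib, ← List.length_map (as := all) (f := fun b => b.act.length),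
      sum_range_getD]
    simp
  · rintro s' ⟨-, k2, k3, k4⟩
    exact ⟨k2, k3, fun j hj => k4 j hj hj⟩


/-! ### Records in memory -/

theorem writeBlock_of_lt {α : Type} (f : ℕ → α) {b a : ℕ} (l : List α) (h : a < b) :
    writeBlock f b l a = f a := by
  simp [writeBlock, not_le.2 h]

theorem writeBlock_of_le {α : Type} (f : ℕ → α) {b a : ℕ} (l : List α) (h : b + l.length ≤ a) :
    writeBlock f b l a = f a := by
  rw [writeBlock]
  split_ifs
  · rw [List.getD_eq_default]; omega
  · rfl

theorem writeBlock_add {α : Type} (f : ℕ → α) {b i : ℕ} (l : List α) (h : i < l.length) :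
    writeBlock f b l (b + i) = l[i] := by
  simp [writeBlock, h]

theorem writeBlock_update {α : Type} (f : ℕ → α) (b : ℕ) (v : α) (l : List α) :
    writeBlock (Function.update f b v) (b + 1) l = writeBlock f b (v :: l) := by
  funext a
  rcases lt_trichotomy a b with h | rfl | h
  · rw [writeBlock_of_lt _ _ h, writeBlock_of_lt _ _ (by omega), Function.update_of_ne h.ne]
  · rw [writeBlock_of_lt _ _ (by omega)]
    have := writeBlock_add f (b := a) (i := 0) (v :: l) (by simp)
    simpa using this.symm
  · obtain ⟨i, rfl⟩ := Nat.exists_eq_add_of_lt h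
    by_cases hi : i < l.length
    · have h1 := writeBlock_add (Function.update f b v) (b := b + 1) (i := i) l hi
      have h2 := writeBlock_add f (b := b) (i := i + 1) (v :: l) (by simpa using hi)
      rw [show b + i + 1 = b + 1 + i by ring, h1, show b + 1 + i = b + (i + 1) by ring, h2]
      simp
    · rw [writeBlock_of_le _ _ (by omega), writeBlock_of_le _ _ (by simp; omega),
        Function.update_of_ne (by omega)]

/-- The records `g 0, …, g (n - 1)` of `w` numbers each are stored from `b` on. -/
def Records (r : ℕ → ℝ) (b w n : ℕ) (g : ℕ → List ℝ) : Prop :=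
  ∀ k < n, ∀ c < w, r (b + w * k + c) = (g k).getD c 0

theorem Records.snoc {r : ℕ → ℝ} {b w n : ℕ} {g : ℕ → List ℝ} (h : Records r b w n g)
    (hl : (g n).length = w) : Records (writeBlock r (b + w * n) (g n)) b w (n + 1) g := by
  intro k hk c hc
  rcases Nat.lt_succ_iff_lt_or_eq.1 hk with hk | rfl
  · rw [writeBlock_of_lt, h k hk c hc]
    have : w * (k + 1) ≤ w * n := Nat.mul_le_mul_left _ hk
    rw [Nat.mul_succ] at this
    omega
  · rw [writeBlock_add _ _ (by omega)]
    simp [hl, hc]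

theorem Records.congr {r r' : ℕ → ℝ} {b w n : ℕ} {g g' : ℕ → List ℝ} (h : Records r b w n g)
    (hr : ∀ a, b ≤ a → a < b + w * n → r' a = r a) (hg : ∀ k < n, g' k = g k) :
    Records r' b w n g' := by
  intro k hk c hc
  have : w * (k + 1) ≤ w * n := Nat.mul_le_mul_left _ hk
  rw [Nat.mul_succ] at this
  rw [hr _ (by omega) (by omega), h k hk c hc, hg k hk]

/-- Writing the values of expressions to consecutive cells. -/
def store (a : NatExpr) : List RealExpr → Program
  | [] => .skip
  | e :: l => .seq (.setReal a e) (store (.add a (.lit 1)) l)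

theorem flat_store (a : NatExpr) (l : List RealExpr) : (store a l).Flat := by
  induction l generalizing a with
  | nil => trivial
  | cons e l ih => exact ⟨trivial, ih _⟩

theorem NatExpr.eval_congr {s s' : MemState} (h : s'.nat = s.nat) (a : NatExpr) :
    a.eval s' = a.eval s := by
  induction a with
  | lit k => rfl
  | load a ih => simp only [NatExpr.eval, ih, h]
  | add a b iha ihb => simp only [NatExpr.eval, iha, ihb]
  | sub a b iha ihb => simp only [NatExpr.eval, iha, ihb]
  | mul a b iha ihb => simp only [NatExpr.eval, iha, ihb]

/-- The expressions are evaluated while earlier results are being written. They keep their values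
because they depend only on real cells below `Z`, and all results are written from `b ≥ Z` on. -/
theorem store_run {Z : ℕ} {s : MemState} {a : NatExpr} {l : List RealExpr} {vs : List ℝ} {b : ℕ}
    (ha : a.eval s = b) (hZ : Z ≤ b)
    (hl : List.Forall₂ (fun (e : RealExpr) v => ∀ r : ℕ → ℝ, (∀ c < Z, r c = s.real c) → e.eval ⟨s.nat, r⟩ = v) l vs) :
    (store a l).run s = ⟨s.nat, writeBlock s.real b vs⟩ := by
  induction l generalizing s a b vs with
  | nil => 
    cases hl
    have : writeBlock s.real b [] = s.real := by funext c; simp [writeBlock]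
    rw [this]
    rfl
  | cons e l ih =>
    obtain _ | @⟨_, v, _, vs, he, hl⟩ := hl
    rw [store, Program.run_seq, Program.run_setReal, ha, he s.real fun _ _ => rfl]
    rw [ih (vs := vs) (b := b + 1) (by
      have : a.eval ⟨s.nat, Function.update s.real b v⟩ = b :=
        (NatExpr.eval_congr (s := s) (s' := ⟨s.nat, Function.update s.real b v⟩) rfl a).trans ha
      simp only [NatExpr.eval_add, NatExpr.eval_lit, this]) (by omega)]
    · simp only [writeBlock_update]
    · refine hl.imp fun e v h r hr => h r fun c hc => ?_
      exact (hr c hc).trans (Function.update_of_ne (by omega) _ _)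

/-- Collecting the nodes with a positive weight in the column `wc`. -/
def collect (wc nc cv bv : Fin 64) : Program :=
  .seqs [.setVar 5 (.var 3), .setVar cv (.lit 0), .loop (.natLt (.var 5) (.var 10)) (.seq
    (.branch (.realLe (.at wc (.var 5)) (.num 0)) .skip (.seqs [
      store (.add (.var bv) (.mul (.lit 3) (.var cv))) [
        .div (.add (.at 10 (.var 5)) (.at 11 (.var 5))) (.num 2),
        .div (.add (.at 12 (.var 5)) (.at 13 (.var 5))) (.num 2), .at wc (.var 5)],
      .setNat (.addr nc (.var cv)) (.var 5), .incr cv]))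
    (.incr 5))]

open Classical in
/-- The indices with positive weights. -/
noncomputable def positives (w : ℕ → ℝ) (n : ℕ) : List ℕ := (List.range n).filter (0 < w ·)

theorem positives_succ (w : ℕ → ℝ) (n : ℕ) :
    positives w (n + 1) = positives w n ++ if 0 < w n then [n] else [] := by
  simp only [positives, List.range_succ, List.filter_append, List.filter_singleton]
  by_cases h : 0 < w n <;> simp [h]

theorem length_positives_le (w : ℕ → ℝ) (n : ℕ) : (positives w n).length ≤ n := by
  simpa [positives] using List.length_filter_le (fun i => decide (0 < w i)) (List.range n)

theorem mem_positives {w : ℕ → ℝ} {n j : ℕ} : j ∈ positives w n ↔ j < n ∧ 0 < w j := by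
  simp [positives]

/-- The points go to a block of `3 * M` free cells beyond all arrays in use; the node of each point
is recorded, in order to translate the indices in the solver's answer back to nodes. -/
theorem tot_collect {A : PointSolver} {wc nc cv bv : Fin 64} (hd : [3, 5, 10, bv, cv, nc].Nodup)
    {s : MemState} {off M b : ℕ} {w : ℕ → ℝ} {P : ℕ → Plane} (h3 : s.nat (addr 3 0) = off)
    (h10 : s.nat (addr 10 0) = off + M) (hbv : s.nat (addr bv 0) = b) (hb : 64 * (off + M) ≤ b)
    (hw : ∀ j < M, s.real (addr wc (off + j)) = w j)
    (hx : ∀ j < M, (s.real (addr 10 (off + j)) + s.real (addr 11 (off + j))) / 2 = P j 0)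
    (hy : ∀ j < M, (s.real (addr 12 (off + j)) + s.real (addr 13 (off + j))) / 2 = P j 1) :
    Tot A (collect wc nc cv bv) s M fun s' => SameOff [5, nc, cv] s.nat s'.nat ∧
      (∀ a, a < b ∨ b + 3 * M ≤ a → s'.real a = s.real a) ∧
      s'.nat (addr cv 0) = (positives w M).length ∧
      (∀ k (h : k < (positives w M).length), s'.nat (addr nc k) = off + (positives w M)[k]) ∧
      readPoints s'.real b (positives w M).length = (positives w M).map fun j => (P j, w j) := by
  have hd' := hd
  simp only [List.nodup_cons, List.mem_cons, List.not_mem_nil, or_false, not_or, List.nodup_nil,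
    and_true, not_false_eq_true] at hd'
  obtain ⟨⟨-, -, d1, d2, d3⟩, ⟨-, d4, d5, d6⟩, ⟨d7, d8, d9⟩, ⟨d10, d11⟩, d12⟩ := hd'
  have d12' := Ne.symm d12
  have d5' := Ne.symm d5
  have d6' := Ne.symm d6
  set g : List ℕ → ℕ → List ℝ := fun l k => [P (l.getD k 0) 0, P (l.getD k 0) 1, w (l.getD k 0)] with hg
  have hcol : ∀ (c : Fin 64), ∀ i < M, addr c (off + i) < 64 * (off + M) := fun c i hi =>
    addr_lt.2 (by omega)
  refine Tot.seqs_flat (by simp) (Tot.seqs_flat (by simp) (Tot.seqs_one ?_))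
  refine (Tot.loopConst M (fun i s' => s'.nat (addr 5 0) = off + i ∧ SameOff [5, nc, cv] s.nat s'.nat ∧
    (∀ a, a < b ∨ b + 3 * M ≤ a → s'.real a = s.real a) ∧
    s'.nat (addr cv 0) = (positives w i).length ∧
    (∀ k (h : k < (positives w i).length), s'.nat (addr nc k) = off + (positives w i)[k]) ∧
    Records s'.real b 3 (positives w i).length (g (positives w i))) 0 ?_ ?_ ?_).mono (by simp) ?_
  · rintro i hi s₁ ⟨k1, k2, k3, k4, k5, k6⟩
    refine ⟨by simp [k1, k2 10 0 (by simp [d8, d9]), h10, hi], ?_⟩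
    set l := positives w i with hl
    have hli : l.length ≤ i := length_positives_le w i
    refine Tot.flat (by simp [Program.Flat, flat_store]) ?_
    have hlow : ∀ (c : Fin 64), s₁.real (addr c (off + i)) = s.real (addr c (off + i)) := fun c =>
      k3 _ (Or.inl ((hcol c i hi).trans_le hb))
    rw [Program.run_seq, Program.run_branch, positives_succ, ← hl]
    by_cases hp : w i ≤ 0
    · rw [if_pos (by simpa [k1, hlow, hw i hi] using hp), if_neg (not_lt.2 hp), List.append_nil]
      have d4' := Ne.symm d4
      refine ⟨by simp [k1, add_assoc], k2.update (by simp) _ _, k3, ?_, ?_, k6⟩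
      · simp [update_addr, d5', k4]
      · intro k hk; simp [update_addr, d6', k5 k hk]
    · rw [if_neg (by simpa [k1, hlow, hw i hi] using hp), if_pos (not_le.1 hp)]
      have hstore : (store (.add (.var bv) (.mul (.lit 3) (.var cv))) [
          .div (.add (.at 10 (.var 5)) (.at 11 (.var 5))) (.num 2),
          .div (.add (.at 12 (.var 5)) (.at 13 (.var 5))) (.num 2), .at wc (.var 5)]).run s₁ =
          ⟨s₁.nat, writeBlock s₁.real (b + 3 * l.length) [P i 0, P i 1, w i]⟩ := by
        refine store_run (Z := 64 * (off + M)) ?_ (by omega) ?_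
        · have : s₁.nat (addr bv 0) = b := (k2 bv 0 (by simp [Ne.symm d4, d10, d11])).trans hbv
          simp [this, k4]
        · have hv : ∀ r : ℕ → ℝ, (∀ c < 64 * (off + M), r c = s₁.real c) → ∀ c : Fin 64,
              r (addr c (off + i)) = s.real (addr c (off + i)) := fun r hr c =>
            (hr _ (hcol c i hi)).trans (hlow c)
          refine .cons (fun r hr => ?_) (.cons (fun r hr => ?_) (.cons (fun r hr => ?_) .nil)) <;>
            simp [k1, hv r hr, ← hx i hi, ← hy i hi, hw i hi]
      rw [Program.run_seqs_cons, hstore]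
      have hgl : g (l ++ [i]) l.length = [P i 0, P i 1, w i] := by simp [hg]
      refine ⟨by simp [update_addr, d5, d6, k1, add_assoc], ?_, ?_, ?_, ?_, ?_⟩
      · exact ((k2.update (by simp) _ _).update (by simp) _ _).update (by simp) _ _
      · intro a ha
        simp only [Program.run_seqs_cons, Program.run_seqs_nil, Program.run_setNat, Program.run_incr]
        rcases ha with ha | ha
        · rw [writeBlock_of_lt _ _ (by omega), k3 a (Or.inl ha)]
        · rw [writeBlock_of_le _ _ (by simp; omega), k3 a (Or.inr ha)]
      · simp [update_addr, d12, d12', d5', k4]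
      · intro k hk
        simp only [Program.run_seqs_cons, Program.run_seqs_nil, Program.run_setNat, Program.run_incr,
          NatExpr.eval_addr, NatExpr.eval_var, k4, update_addr, d6', d12', false_and, if_false, true_and]
        by_cases h1 : k = l.length
        · subst h1; simp [k1]
        · have h2 : k < l.length := by simp at hk; omega
          rw [if_neg h1, k5 k h2, List.getElem_append_left h2]
      · simp only [Program.run_seqs_cons, Program.run_seqs_nil, Program.run_setNat, Program.run_incr]
        have := (k6.congr (r' := s₁.real) (g' := g (l ++ [i])) (fun _ _ _ => rfl) (fun k hk => by
          simp only [hg, List.getD_append _ _ _ _ hk])).snoc (by simp [hg])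
        rw [hgl] at this
        simpa using this
  · rintro s₁ ⟨k1, k2, -⟩
    simp [k1, k2 10 0 (by simp [d8, d9]), h10]
  · refine ⟨?_, ((SameOff.refl _ _).update (by simp) _ _).update (by simp) _ _, fun _ _ => rfl, ?_, ?_, ?_⟩
    · simp [update_addr, d5, h3]
    · simp [positives]
    · simp [positives]
    · simp [positives, Records]
  · rintro s' ⟨-, k2, k3, k4, k5, k6⟩
    refine ⟨k2, k3, k4, k5, ?_⟩
    refine List.ext_getElem (by simp [readPoints]) fun k hk hk' => ?_
    have hk'' : k < (positives w M).length := by simpa using hk'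
    have e0 := k6 k hk'' 0 (by omega)
    have e1 := k6 k hk'' 1 (by omega)
    have e2 := k6 k hk'' 2 (by omega)
    simp only [add_zero] at e0
    simp only [readPoints, List.getElem_map, List.getElem_range, e0, e1, e2, hg]
    simp only [List.getD_cons_zero, List.getD_cons_succ, List.getD_eq_getElem _ _ hk'']
    congr 1
    ext c
    fin_cases c <;> simp


/-! ### The output -/

@[simp] theorem NatExpr.eval_load (s : MemState) (a : NatExpr) :
    (NatExpr.load a).eval s = s.nat (a.eval s) := rfl

/-- The corners of the box of a node. -/
def cornersAt (v : Fin 64) : List RealExpr :=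
  [.at 10 (.var v), .at 11 (.var v), .at 12 (.var v), .at 13 (.var v)]

/-- The corners of the box of a node. -/
def QNode.corners (b : QNode) : List ℝ := [b.x₀, b.x₁, b.y₀, b.y₁]

theorem eval_cornersAt {Z id : ℕ} {s : MemState} {v : Fin 64} {b : QNode}
    (hb : ∀ c ∈ [10, 11, 12, 13], addr c id < Z) (hv : s.nat (addr v 0) = id)
    (h0 : s.real (addr 10 id) = b.x₀) (h1 : s.real (addr 11 id) = b.x₁)
    (h2 : s.real (addr 12 id) = b.y₀) (h3 : s.real (addr 13 id) = b.y₁) :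
    List.Forall₂ (fun (e : RealExpr) v => ∀ r : ℕ → ℝ, (∀ c < Z, r c = s.real c) → e.eval ⟨s.nat, r⟩ = v)
      (cornersAt v) b.corners := by
  refine .cons (fun r hr => ?_) (.cons (fun r hr => ?_) (.cons (fun r hr => ?_)
    (.cons (fun r hr => ?_) .nil))) <;>
    simp only [RealExpr.eval_at, NatExpr.eval_var, hv] <;> rw [hr _ (hb _ (by simp))] <;> assumption

/-- Writing down which mass stays. -/
def stayProg : Program :=
  .seqs [.setVar 5 (.var 3), .loop (.natLt (.var 5) (.var 10)) (.seq
    (store (.add (.var 36) (.mul (.lit 5) (.sub (.var 5) (.var 3)))) (cornersAt 5 ++ [.at 18 (.var 5)]))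
    (.incr 5))]

theorem tot_stayProg {A : PointSolver} {s : MemState} {off b : ℕ} {all : List QNode}
    (h3 : s.nat (addr 3 0) = off) (h10 : s.nat (addr 10 0) = off + all.length)
    (h36 : s.nat (addr 36 0) = b) (hb : 64 * (off + all.length) ≤ b) (hN : NodesAt s off all)
    (hst : ∀ j (hj : j < all.length), s.real (addr 18 (off + j)) = QParams.stayW all[j]) :
    Tot A stayProg s all.length fun s' => SameOff [5] s.nat s'.nat ∧
      (∀ a, a < b ∨ b + 5 * all.length ≤ a → s'.real a = s.real a) ∧
      Records s'.real b 5 all.length fun j =>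
        ((all.map fun b => b.corners ++ [QParams.stayW b]).getD j []) := by
  refine Tot.seqs_flat (by simp) (Tot.seqs_one ?_)
  refine (Tot.loopConst all.length (fun i s' => s'.nat (addr 5 0) = off + i ∧ SameOff [5] s.nat s'.nat ∧
    (∀ a, a < b ∨ b + 5 * all.length ≤ a → s'.real a = s.real a) ∧
      Records s'.real b 5 i fun j =>
        ((all.map fun b => b.corners ++ [QParams.stayW b]).getD j [])) 0 ?_ ?_ ?_).mono (by simp) ?_
  · rintro i hi s₁ ⟨k1, k2, k3, k4⟩
    refine ⟨by simp [k1, k2.eq 10, h10, hi], Tot.flat (by simp [Program.Flat, flat_store]) ?_⟩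
    have hlow : ∀ c : Fin 64, addr c (off + i) < 64 * (off + all.length) := fun c => addr_lt.2 (by omega)
    have hlow' : ∀ c : Fin 64, s₁.real (addr c (off + i)) = s.real (addr c (off + i)) := fun c =>
      k3 _ (Or.inl ((hlow c).trans_le hb))
    have hbi := hN.node i hi
    rw [Program.run_seq, store_run (Z := 64 * (off + all.length)) (b := b + 5 * i)
      (vs := all[i].corners ++ [QParams.stayW all[i]]) ?_ (by omega) ?_]
    · refine ⟨by simp [k1, add_assoc], k2.update (by simp) _ _, ?_, ?_⟩
      · intro a ha
        simp only [Program.run_incr]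
        rcases ha with ha | ha
        · rw [writeBlock_of_lt _ _ (by omega), k3 a (Or.inl ha)]
        · rw [writeBlock_of_le _ _ (by simp [QNode.corners]; omega), k3 a (Or.inr ha)]
      · have e : (all.map fun b => b.corners ++ [QParams.stayW b]).getD i [] =
            all[i].corners ++ [QParams.stayW all[i]] := by simp [hi]
        have := k4.snoc (by rw [e]; simp [QNode.corners])
        rw [e] at this
        exact this
    · simp [k1, k2.eq 36, k2.eq 3, h36, h3]
    · refine List.rel_append (eval_cornersAt (fun c _ => hlow c) k1 ?_ ?_ ?_ ?_)
        (.cons (fun r hr => ?_) .nil)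
      · rw [hlow', hbi.x₀]
      · rw [hlow', hbi.x₁]
      · rw [hlow', hbi.y₀]
      · rw [hlow', hbi.y₁]
      · simp only [RealExpr.eval_at, NatExpr.eval_var, k1]
        rw [hr _ (hlow _), hlow', hst i hi]
  · rintro s₁ ⟨k1, k2, -⟩
    simp [k1, k2.eq 10, h10]
  · exact ⟨by simp [h3], (SameOff.refl _ _).update (by simp) _ _, fun _ _ => rfl, by simp [Records]⟩
  · rintro s' ⟨-, h⟩
    exact h

/-- Writing down the moves. -/
def movesProg : Program :=
  .seqs [.setVar 5 (.lit 0), .loop (.natLt (.var 5) (.load (.var 22))) (.seqs [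
    .setVar 6 (.at 33 (.load (.add (.var 22) (.add (.mul (.lit 2) (.var 5)) (.lit 1))))),
    .setVar 7 (.at 34 (.load (.add (.var 22) (.add (.mul (.lit 2) (.var 5)) (.lit 2))))),
    store (.add (.var 38) (.mul (.lit 9) (.var 5)))
      (cornersAt 6 ++ (cornersAt 7 ++ [.load (.add (.var 37) (.var 5))])),
    .incr 5])]

theorem tot_movesProg {A : PointSolver} {s : MemState} {off Z r₀ O mv : ℕ} {all : List QNode}
    (h22 : s.nat (addr 22 0) = Z) (h37 : s.nat (addr 37 0) = r₀) (h38 : s.nat (addr 38 0) = O)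
    (hmv : s.nat Z = mv) (hZ : 64 * (off + all.length) ≤ Z) (hZ0 : 64 < Z) (hr₀ : Z ≤ r₀)
    (hO : r₀ + mv ≤ O)
    (hN : ∀ j (hj : j < all.length), s.real (addr 10 (off + j)) = all[j].x₀ ∧
      s.real (addr 11 (off + j)) = all[j].x₁ ∧ s.real (addr 12 (off + j)) = all[j].y₀ ∧
      s.real (addr 13 (off + j)) = all[j].y₁) {fr tg : ℕ → Fin all.length} {w : ℕ → ℝ}
    (hfr : ∀ k < mv, s.nat (addr 33 (s.nat (Z + (2 * k + 1)))) = off + fr k)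
    (htg : ∀ k < mv, s.nat (addr 34 (s.nat (Z + (2 * k + 2)))) = off + tg k)
    (hw : ∀ k < mv, s.real (r₀ + k) = w k) :
    Tot A movesProg s mv fun s' => SameOff [5, 6, 7] s.nat s'.nat ∧
      (∀ a < O, s'.real a = s.real a) ∧
      Records s'.real O 9 mv fun k => all[fr k].corners ++ (all[tg k].corners ++ [w k]) := by
  -- The list of the solver is a contiguous block that runs across all 64 arrays. Therefore the
  -- invariant speaks of the three single cells 5, 6 and 7 that change, which is stronger than
  -- `SameOff`.
  have hnat : ∀ s' : MemState, (∀ a, a ∉ [5, 6, 7] → s'.nat a = s.nat a) →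
      SameOff [5, 6, 7] s.nat s'.nat := by
    intro s' h j i hj
    apply h
    simp only [List.mem_cons, List.not_mem_nil, or_false] at hj ⊢
    unfold addr
    rintro (h | h | h) <;> apply hj <;> simp only [Fin.ext_iff] <;> omega
  have a5 : addr 5 0 = 5 := rfl
  have a6 : addr 6 0 = 6 := rfl
  have a7 : addr 7 0 = 7 := rfl
  refine Tot.seqs_flat (by simp) (Tot.seqs_one ?_)
  refine (Tot.loopConst mv (fun i s' => s'.nat (addr 5 0) = i ∧ (∀ a, a ∉ [5, 6, 7] → s'.nat a = s.nat a) ∧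
    (∀ a < O, s'.real a = s.real a) ∧
      Records s'.real O 9 i fun k => all[fr k].corners ++ (all[tg k].corners ++ [w k]))
      0 ?_ ?_ ?_).mono (by simp) ?_
  · rintro i hi s₁ ⟨k1, k2, k3, k4⟩
    have n1 := hnat s₁ k2
    have kZ : ∀ x, s₁.nat (Z + x) = s.nat (Z + x) := fun x => k2 _ (by
      simp only [List.mem_cons, List.not_mem_nil, or_false]; omega)
    have kZ0 : s₁.nat Z = mv := (kZ 0).trans hmv
    refine ⟨by simp [k1, n1.eq 22, h22, kZ0, hi], Tot.flat (by simp [flat_store]) ?_⟩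
    set s₂ : MemState := ⟨Function.update (Function.update s₁.nat (addr 6 0) (off + fr i)) (addr 7 0)
      (off + tg i), s₁.real⟩ with hs₂
    have e₂ : (Program.setVar 7 (.at 34 (.load (.add (.var 22) (.add (.mul (.lit 2) (.var 5))
        (.lit 2)))))).run ((Program.setVar 6 (.at 33 (.load (.add (.var 22) (.add (.mul (.lit 2)
        (.var 5)) (.lit 1)))))).run s₁) = s₂ := by
      have x6 : ∀ x v, Function.update s₁.nat (addr 6 0) v (Z + x) = s.nat (Z + x) := fun x v => by
        rw [Function.update_of_ne (by rw [a6]; omega), kZ]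
      simp only [Program.run_setVar, NatExpr.eval_at, NatExpr.eval, NatExpr.eval_add, NatExpr.eval_var,
        NatExpr.eval_mul, NatExpr.eval_lit, update_addr, Fin.reduceEq, false_and, if_false, n1.eq 22, h22,
        k1, kZ, x6, n1 33 _ (by simp), n1 34 _ (by simp), hfr i hi, htg i hi, hs₂]
    have n2 : SameOff [5, 6, 7] s.nat s₂.nat :=
      (n1.update (by simp) _ _).update (by simp) _ _
    simp only [Program.run_seqs_cons, Program.run_seqs_nil, e₂]
    have hlow : ∀ (c : Fin 64) (j : Fin all.length), addr c (off + j) < r₀ + mv := fun c j =>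
      (addr_lt.2 (by omega : off + j < off + all.length)).trans_le (by omega)
    have hlow' : ∀ (c : Fin 64) (j : Fin all.length), s₂.real (addr c (off + j)) =
        s.real (addr c (off + j)) := fun c j => k3 _ ((hlow c j).trans_le hO)
    have hcor : ∀ (v : Fin 64) (j : Fin all.length), s₂.nat (addr v 0) = off + j → List.Forall₂
        (fun (e : RealExpr) v => ∀ r : ℕ → ℝ, (∀ c < r₀ + mv, r c = s₂.real c) → e.eval ⟨s₂.nat, r⟩ = v)
        (cornersAt v) all[j].corners := by
      intro v j hv
      have hj := hN j j.2
      refine eval_cornersAt (fun c _ => hlow c j) hv ?_ ?_ ?_ ?_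
      · rw [hlow', hj.1]; rfl
      · rw [hlow', hj.2.1]; rfl
      · rw [hlow', hj.2.2.1]; rfl
      · rw [hlow', hj.2.2.2]; rfl
    have h5 : s₂.nat (addr 5 0) = i := by simp [hs₂, update_addr, k1]
    rw [store_run (Z := r₀ + mv) (b := O + 9 * i)
      (vs := all[fr i].corners ++ (all[tg i].corners ++ [w i])) ?_ (by omega) ?_]
    · refine ⟨by simp [h5], ?_, ?_, k4.snoc (by simp [QNode.corners])⟩
      · intro a ha
        simp only [Program.run_incr, hs₂]
        simp only [List.mem_cons, List.not_mem_nil, or_false, not_or] at ha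
        rw [a5, a6, a7, Function.update_of_ne ha.1, Function.update_of_ne ha.2.2,
          Function.update_of_ne ha.2.1, k2 a (by simp [ha])]
      · intro a ha
        simp only [Program.run_incr]
        rw [writeBlock_of_lt _ _ (by omega)]
        exact k3 a ha
    · simp [n2.eq 38, h38, h5]
    · refine List.rel_append (hcor 6 (fr i) (by simp [hs₂, update_addr])) (List.rel_append
        (hcor 7 (tg i) (by simp [hs₂])) (.cons (fun r hr => ?_) .nil))
      simp only [RealExpr.eval, NatExpr.eval_add, NatExpr.eval_var, n2.eq 37, h37, h5]
      rw [hr _ (by omega), ← hw i hi]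
      exact k3 _ (by omega)
  · rintro s₁ ⟨k1, k2, -⟩
    have kZ0 : s₁.nat Z = mv := (k2 _ (by
      simp only [List.mem_cons, List.not_mem_nil, or_false]; omega)).trans hmv
    simp [k1, (hnat s₁ k2).eq 22, h22, kZ0]
  · refine ⟨by simp, ?_, fun _ _ => rfl, by simp [Records]⟩
    intro a ha
    simp only [List.mem_cons, List.not_mem_nil, or_false, not_or] at ha
    simp [a5, Function.update_of_ne ha.1]
  · rintro s' ⟨-, h1, h2⟩
    exact ⟨hnat s' h1, h2⟩


theorem readPoints_congr {r r' : ℕ → ℝ} {b k : ℕ} (h : ∀ a, b ≤ a → a < b + 3 * k → r' a = r a) :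
    readPoints r' b k = readPoints r b k := by
  refine List.map_congr_left fun i hi => ?_
  have hi := List.mem_range.1 hi
  rw [h _ (by omega) (by omega), h _ (by omega) (by omega), h _ (by omega) (by omega)]

theorem getElem_flatMap_pair {α β : Type*} (f g : α → β) (l : List α) (k : ℕ) (hk : k < l.length) :
    (l.flatMap fun e => [f e, g e])[2 * k]? = some (f l[k]) ∧
      (l.flatMap fun e => [f e, g e])[2 * k + 1]? = some (g l[k]) := by
  induction l generalizing k with
  | nil => simp at hk
  | cons a l ih =>
    cases k with
    | zero => simp
    | succ k =>
      have := ih k (by simpa using hk)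
      simpa [Nat.mul_succ] using this

/-- The last part of the program. -/
def outputProg : Program :=
  .seqs [weightsProg, .setVar 35 (.sub (.var 10) (.var 3)),
    .setVar 22 (.mul (.lit 64) (.add (.var 10) (.var 3))),
    .setVar 23 (.add (.var 22) (.mul (.lit 3) (.var 35))),
    .setVar 36 (.add (.var 22) (.mul (.lit 6) (.var 35))),
    .setVar 37 (.add (.var 22) (.mul (.lit 11) (.var 35))),
    collect 16 33 20 22, collect 17 34 21 23, stayProg,
    .branch (.natLt (.lit 0) (.var 20))
      (.solve (.var 22) (.var 20) (.var 23) (.var 21) (.var 22) (.var 37)) (.setNat (.var 22) (.lit 0)),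
    .setVar 38 (.add (.var 37) (.load (.var 22))), movesProg,
    .setVar 0 (.load (.var 22)), .setVar 1 (.var 38), .setVar 2 (.var 35), .setVar 3 (.var 36)]

open Classical in
/-- The moves of the solver between the points with positive weights. -/
noncomputable def solverMoves (A : PointSolver) (P : ℕ → Plane) (wu wv : ℕ → ℝ) (M : ℕ) : SparsePlan :=
  if positives wu M = [] then [] else A.plan ((positives wu M).map fun j => (P j, wu j))
    ((positives wv M).map fun j => (P j, wv j))

/-- If no node has mass to send, the answer is the empty list and the solver is not called, since it
is specified for nonempty families only. -/
theorem tot_solve_positives {A : PointSolver} {s : MemState} {P : ℕ → Plane} {wu wv : ℕ → ℝ} {M Z τ : ℕ}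
    (h20 : s.nat (addr 20 0) = (positives wu M).length)
    (h21 : s.nat (addr 21 0) = (positives wv M).length) (h22 : s.nat (addr 22 0) = Z)
    (h23 : s.nat (addr 23 0) = Z + 3 * M) (h37 : s.nat (addr 37 0) = Z + 11 * M)
    (hU : readPoints s.real Z (positives wu M).length = (positives wu M).map fun j => (P j, wu j))
    (hV : readPoints s.real (Z + 3 * M) (positives wv M).length =
      (positives wv M).map fun j => (P j, wv j))
    (hτ : positives wu M ≠ [] → A.time ((positives wu M).map fun j => (P j, wu j))
      ((positives wv M).map fun j => (P j, wv j)) ≤ τ) :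
    Tot A (.branch (.natLt (.lit 0) (.var 20))
      (.solve (.var 22) (.var 20) (.var 23) (.var 21) (.var 22) (.var 37)) (.setNat (.var 22) (.lit 0)))
      s τ fun s' => (∀ a < Z, s'.nat a = s.nat a) ∧ (∀ a < Z + 11 * M, s'.real a = s.real a) ∧
        s'.nat Z = (solverMoves A P wu wv M).length ∧
        ∀ k (h : k < (solverMoves A P wu wv M).length),
          s'.nat (Z + (2 * k + 1)) = (solverMoves A P wu wv M)[k].1 ∧
          s'.nat (Z + (2 * k + 2)) = (solverMoves A P wu wv M)[k].2.1 ∧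
          s'.real (Z + 11 * M + k) = (solverMoves A P wu wv M)[k].2.2 := by
  by_cases hn : positives wu M = []
  · have hL : solverMoves A P wu wv M = [] := by simp [solverMoves, hn]
    rw [hL]
    have hf : (Program.setNat (.var 22) (.lit 0)).Flat := trivial
    refine Tot.branchFalse (by simp [h20, hn]) (Tot.mono (Tot.flat hf (Q := fun s' =>
      (∀ a < Z, s'.nat a = s.nat a) ∧ (∀ a < Z + 11 * M, s'.real a = s.real a) ∧
        s'.nat Z = ([] : SparsePlan).length ∧ ∀ k (h : k < ([] : SparsePlan).length),
          s'.nat (Z + (2 * k + 1)) = ([] : SparsePlan)[k].1 ∧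
          s'.nat (Z + (2 * k + 2)) = ([] : SparsePlan)[k].2.1 ∧
          s'.real (Z + 11 * M + k) = ([] : SparsePlan)[k].2.2) ?_) (Nat.zero_le τ) fun _ h => h)
    simp only [Program.run_setNat, NatExpr.eval_var, h22, NatExpr.eval_lit]
    exact ⟨fun a ha => Function.update_of_ne ha.ne _ _, fun _ _ => True.intro, by simp, by simp⟩
  · have hL : solverMoves A P wu wv M = A.plan ((positives wu M).map fun j => (P j, wu j))
        ((positives wv M).map fun j => (P j, wv j)) := by simp [solverMoves, hn]
    rw [hL]
    set L := A.plan ((positives wu M).map fun j => (P j, wu j))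
        ((positives wv M).map fun j => (P j, wv j)) with hLd
    refine Tot.branchTrue (by simpa [h20, List.length_pos_iff] using hn)
      ((Tot.solve (by simp only [NatExpr.eval_var, h20, h22]; exact hU)
        (by simp only [NatExpr.eval_var, h21, h23]; exact hV) ?_).mono (hτ hn) fun _ h => h)
    simp only [NatExpr.eval_var, h22, h37, ← hLd, writePlan]
    refine ⟨fun a ha => writeBlock_of_lt _ _ ha, fun a ha => writeBlock_of_lt _ _ ha, ?_, ?_⟩
    · have := writeBlock_add s.nat (b := Z) (i := 0) (L.length :: L.flatMap fun e => [e.1, e.2.1]) (by simp)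
      simpa using this
    · intro k hk
      obtain ⟨e1, e2⟩ := getElem_flatMap_pair (fun e : ℕ × ℕ × ℝ => e.1) (fun e => e.2.1) L k hk
      obtain ⟨l1, e1⟩ := List.getElem?_eq_some_iff.1 e1
      obtain ⟨l2, e2⟩ := List.getElem?_eq_some_iff.1 e2
      refine ⟨?_, ?_, ?_⟩
      · rw [writeBlock_add _ _ (by simp at l1 ⊢; omega), List.getElem_cons_succ, e1]
      · rw [writeBlock_add _ _ (by simp at l2 ⊢; omega), List.getElem_cons_succ, e2]
      · rw [writeBlock_add _ _ (by simpa using hk)]; simp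

theorem tot_outputProg {A : PointSolver} {Q : QParams} {off : ℕ} {s : MemState} {all : List QNode}
    (h : Env Q off s) (h10 : s.nat (addr 10 0) = off + all.length) (hN : NodesAt s off all)
    (hact : ∀ b ∈ all, ∀ t ∈ b.act, t < Q.N) {P : ℕ → Plane} {wu wv : ℕ → ℝ}
    (hP : ∀ j (hj : j < all.length), P j = all[j].ctr)
    (hwu : ∀ j (hj : j < all.length), wu j = Q.srcW all[j])
    (hwv : ∀ j (hj : j < all.length), wv j = Q.tgtW all[j]) {L : SparsePlan}
    (hL : L = solverMoves A P wu wv all.length) {τ : ℕ}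
    (hτ : positives wu all.length ≠ [] → A.time ((positives wu all.length).map fun j => (P j, wu j))
      ((positives wv all.length).map fun j => (P j, wv j)) ≤ τ)
    {fr tg : ℕ → Fin all.length}
    (hfr : ∀ k (hk : k < L.length), (positives wu all.length)[L[k].1]? = some (fr k : ℕ))
    (htg : ∀ k (hk : k < L.length), (positives wv all.length)[L[k].2.1]? = some (tg k : ℕ)) :
    Tot A outputProg s ((all.map fun b => b.act.length).sum + 4 * all.length + τ + L.length)
      fun s' => s'.nat 0 = L.length ∧ s'.nat 2 = all.length ∧
        Records s'.real (s'.nat 1) 9 L.length (fun k => all[fr k].corners ++ (all[tg k].corners ++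
          [(L.getD k (0, 0, 0)).2.2])) ∧
        Records s'.real (s'.nat 3) 5 all.length fun j =>
          ((all.map fun b => b.corners ++ [QParams.stayW b]).getD j []) := by
  -- The free memory starts at `Z`, beyond all node data. In the real memory there follow, with `M`
  -- the number of nodes, the sources (`3 * M` cells reserved), the targets (`3 * M`), the records
  -- of mass that stays (`5 * M`), the amounts from the solver and the final records of moves; the
  -- index pairs of the solver go to the natural-number cells from `Z` on.
  set Z := 64 * (off + all.length + off) with hZ
  have hoff := h.off_pos
  have hZpos : 64 ≤ Z := by omega
  refine Tot.seqs_step (k₂ := 3 * all.length + τ + L.length) (tot_weightsProg h h10 hN hact) ?_ (by omega)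
  rintro s₁ ⟨n1, r1, w1⟩
  have hN1 := hN.frame n1 r1
  have g10 : s₁.nat (addr 10 0) = off + all.length := (n1.eq 10 0).trans h10
  have g3 : s₁.nat (addr 3 0) = off := (n1.eq 3 0).trans h.off_eq
  refine Tot.seqs_flat (by simp) (Tot.seqs_flat (by simp) (Tot.seqs_flat (by simp)
    (Tot.seqs_flat (by simp) (Tot.seqs_flat (by simp) ?_))))
  have e2 : (Program.seqs [.setVar 35 (.sub (.var 10) (.var 3)),
      .setVar 22 (.mul (.lit 64) (.add (.var 10) (.var 3))),
      .setVar 23 (.add (.var 22) (.mul (.lit 3) (.var 35))),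
      .setVar 36 (.add (.var 22) (.mul (.lit 6) (.var 35))),
      .setVar 37 (.add (.var 22) (.mul (.lit 11) (.var 35)))]).run s₁ =
      ⟨Function.update (Function.update (Function.update (Function.update (Function.update s₁.nat
        (addr 35 0) all.length) (addr 22 0) Z) (addr 23 0) (Z + 3 * all.length)) (addr 36 0) (Z + 6 * all.length)) (addr 37 0)
        (Z + 11 * all.length), s₁.real⟩ := by
    simp [update_addr, g10, g3, hZ]
  simp only [Program.run_seqs_cons, Program.run_seqs_nil] at e2
  rw [e2]
  set s₂ : MemState := ⟨Function.update (Function.update (Function.update (Function.update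
    (Function.update s₁.nat (addr 35 0) all.length) (addr 22 0) Z) (addr 23 0) (Z + 3 * all.length)) (addr 36 0)
    (Z + 6 * all.length)) (addr 37 0) (Z + 11 * all.length), s₁.real⟩ with hs₂
  clear e2
  have n2 : SameOff [35, 22, 23, 36, 37] s₁.nat s₂.nat :=
    (((((SameOff.refl _ _).update (by simp) _ _).update (by simp) _ _).update (by simp) _ _).update
      (by simp) _ _).update (by simp) _ _
  have v35 : s₂.nat (addr 35 0) = all.length := by simp [hs₂, update_addr]
  have v22 : s₂.nat (addr 22 0) = Z := by simp [hs₂, update_addr]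
  have v23 : s₂.nat (addr 23 0) = Z + 3 * all.length := by simp [hs₂, update_addr]
  have v36 : s₂.nat (addr 36 0) = Z + 6 * all.length := by simp [hs₂, update_addr]
  have v37 : s₂.nat (addr 37 0) = Z + 11 * all.length := by simp [hs₂]
  have v3 : s₂.nat (addr 3 0) = off := (n2.eq 3 0).trans g3
  have v10 : s₂.nat (addr 10 0) = off + all.length := (n2.eq 10 0).trans g10
  have hlow : ∀ (c : Fin 64), ∀ j < all.length, addr c (off + j) < Z := fun c j hj => addr_lt.2 (by omega)
  have hx : ∀ r : ℕ → ℝ, (∀ a < Z, r a = s₁.real a) → ∀ j (hj : j < all.length),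
      (r (addr 10 (off + j)) + r (addr 11 (off + j))) / 2 = P j 0 ∧
      (r (addr 12 (off + j)) + r (addr 13 (off + j))) / 2 = P j 1 := by
    intro r hr j hj
    have hj' := hN1.node j hj
    rw [hr _ (hlow _ j hj), hr _ (hlow _ j hj), hr _ (hlow _ j hj), hr _ (hlow _ j hj),
      hj'.x₀, hj'.x₁, hj'.y₀, hj'.y₁, hP j hj]
    exact ⟨rfl, rfl⟩
  -- the sources
  refine Tot.seqs_step (k₂ := 2 * all.length + τ + L.length) (tot_collect (by decide) v3 v10 v22 (by omega)
    (fun j hj => (w1 j hj).1.trans (hwu j hj).symm) (fun j hj => (hx _ (fun _ _ => rfl) j hj).1)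
    (fun j hj => (hx _ (fun _ _ => rfl) j hj).2)) ?_ (by omega)
  rintro s₃ ⟨n3, r3, c3, d3, p3⟩
  have r3' : ∀ a < Z, s₃.real a = s₁.real a := fun a ha => r3 a (Or.inl ha)
  -- the targets
  refine Tot.seqs_step (k₂ := all.length + τ + L.length) (tot_collect (by decide) ((n3.eq 3 0).trans v3)
    ((n3.eq 10 0).trans v10) ((n3.eq 23 0).trans v23) (by omega)
    (fun j hj => (r3' _ (hlow _ j hj)).trans ((w1 j hj).2.1.trans (hwv j hj).symm))
    (fun j hj => (hx _ r3' j hj).1) (fun j hj => (hx _ r3' j hj).2)) ?_ (by omega)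
  rintro s₄ ⟨n4, r4, c4, d4, p4⟩
  have r4' : ∀ a < Z, s₄.real a = s₁.real a := fun a ha => (r4 a (Or.inl (by omega))).trans (r3' a ha)
  -- the mass that stays
  refine Tot.seqs_step (k₂ := τ + L.length) (tot_stayProg (all := all) ((n4.eq 3 0).trans ((n3.eq 3 0).trans v3))
    ((n4.eq 10 0).trans ((n3.eq 10 0).trans v10)) ((n4.eq 36 0).trans ((n3.eq 36 0).trans v36)) (by omega)
    (hN1.congr (fun c _ i hi => r4' _ (hlow c i hi))
      (fun c hc i _ => by
        simp only [List.mem_cons, List.not_mem_nil, or_false] at hc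
        rcases hc with rfl | rfl | rfl
        exacts [(n4.eq 24 _).trans ((n3.eq 24 _).trans (n2.eq 24 _)),
          (n4.eq 25 _).trans ((n3.eq 25 _).trans (n2.eq 25 _)),
          (n4.eq 26 _).trans ((n3.eq 26 _).trans (n2.eq 26 _))])
      (fun c hc i _ => by
        simp only [List.mem_cons, List.not_mem_nil, or_false] at hc
        rcases hc with rfl | rfl
        exacts [(n4.eq 27 i).trans ((n3.eq 27 i).trans (n2.eq 27 i)),
          (n4.eq 28 i).trans ((n3.eq 28 i).trans (n2.eq 28 i))])
      ((n4.eq 11 0).trans ((n3.eq 11 0).trans (n2.eq 11 0))).ge)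
    (fun j hj => (r4' _ (hlow _ j hj)).trans (w1 j hj).2.2)) ?_ (by omega)
  rintro s₅ ⟨n5, r5, q5⟩
  have lu := length_positives_le wu all.length
  have lv := length_positives_le wv all.length
  -- the solver
  refine Tot.seqs_step (k₂ := L.length) (tot_solve_positives (P := P) (wu := wu) (wv := wv) (M := all.length) (Z := Z)
    ((n5.eq 20 0).trans ((n4.eq 20 0).trans c3)) ((n5.eq 21 0).trans c4)
    ((n5.eq 22 0).trans ((n4.eq 22 0).trans ((n3.eq 22 0).trans v22)))
    ((n5.eq 23 0).trans ((n4.eq 23 0).trans ((n3.eq 23 0).trans v23)))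
    ((n5.eq 37 0).trans ((n4.eq 37 0).trans ((n3.eq 37 0).trans v37)))
    ((readPoints_congr fun a h1 h2 => (r5 a (Or.inl (by omega))).trans
      (r4 a (Or.inl (by omega)))).trans p3)
    ((readPoints_congr fun a h1 h2 => r5 a (Or.inl (by omega))).trans p4) hτ) ?_ le_rfl
  rw [← hL]
  rintro s₆ ⟨n6, r6, z6, l6⟩
  have hv : ∀ c : Fin 64, ∀ i < all.length, s₆.nat (addr c i) = s₅.nat (addr c i) := fun c i hi =>
    n6 _ (addr_lt.2 (by omega))
  have hv0 : ∀ c : Fin 64, s₆.nat (addr c 0) = s₅.nat (addr c 0) := fun c =>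
    n6 _ (addr_lt.2 (by omega))
  have u22 : s₆.nat (addr 22 0) = Z := by rw [hv0, n5.eq 22, n4.eq 22, n3.eq 22, v22]
  have u37 : s₆.nat (addr 37 0) = Z + 11 * all.length := by rw [hv0, n5.eq 37, n4.eq 37, n3.eq 37, v37]
  have u35 : s₆.nat (addr 35 0) = all.length := by rw [hv0, n5.eq 35, n4.eq 35, n3.eq 35, v35]
  have u36 : s₆.nat (addr 36 0) = Z + 6 * all.length := by rw [hv0, n5.eq 36, n4.eq 36, n3.eq 36, v36]
  have r6' : ∀ a < Z, s₆.real a = s₁.real a := fun a ha =>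
    (r6 a (by omega)).trans ((r5 a (Or.inl (by omega))).trans (r4' a ha))
  refine Tot.seqs_flat (by simp) ?_
  set s₇ : MemState := (Program.setVar 38 (.add (.var 37) (.load (.var 22)))).run s₆ with hs₇
  have e7 : s₇ = ⟨Function.update s₆.nat (addr 38 0) (Z + 11 * all.length + L.length), s₆.real⟩ := by
    simp [hs₇, u37, u22, z6]
  have n7 : SameOff [38] s₆.nat s₇.nat := (SameOff.refl _ _).update (by simp) _ _
  have m7 : ∀ a, Z ≤ a → s₇.nat a = s₆.nat a := by
    intro a ha
    rw [e7]
    exact Function.update_of_ne (by have : addr 38 0 = 38 := rfl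
                                    omega) _ _
  have r7 : s₇.real = s₆.real := by rw [e7]
  -- the moves
  refine Tot.seqs_step (k₂ := 0) (tot_movesProg (off := off) (Z := Z) (r₀ := Z + 11 * all.length)
    (O := Z + 11 * all.length + L.length) (mv := L.length) (all := all) (fr := fr) (tg := tg)
    (w := fun k => (L.getD k (0, 0, 0)).2.2) ((n7.eq 22 0).trans u22) ((n7.eq 37 0).trans u37)
    (by rw [e7]; simp) ((m7 Z le_rfl).trans z6) (by omega) (by omega) (by omega) le_rfl ?_ ?_ ?_ ?_) ?_
    (by simp)
  · intro j hj
    have hj' := hN1.node j hj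
    rw [r7, r6' _ (hlow _ j hj), r6' _ (hlow _ j hj), r6' _ (hlow _ j hj), r6' _ (hlow _ j hj)]
    exact ⟨hj'.x₀, hj'.x₁, hj'.y₀, hj'.y₁⟩
  · intro k hk
    obtain ⟨hl, he⟩ := List.getElem?_eq_some_iff.1 (hfr k hk)
    rw [n7.eq 33, m7 _ (by omega), (l6 k hk).1, hv 33 _ (by omega), n5.eq 33, n4.eq 33, d3 _ hl, he]
  · intro k hk
    obtain ⟨hl, he⟩ := List.getElem?_eq_some_iff.1 (htg k hk)
    rw [n7.eq 34, m7 _ (by omega), (l6 k hk).2.1, hv 34 _ (by omega), n5.eq 34, d4 _ hl, he]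
  · intro k hk
    rw [r7, (l6 k hk).2.2, List.getD_eq_getElem _ _ hk]
  · rintro s₈ ⟨n8, r8, q8⟩
    -- `Z` is a multiple of 64, so it belongs to the array 0, which the moves leave alone.
    have z8 : s₈.nat Z = L.length := by
      obtain ⟨c, i, hci⟩ := exists_eq_addr Z
      have hi : 0 < i := by unfold addr at hci; omega
      have : s₈.nat Z = s₇.nat Z := by
        have n8' : ∀ c, c ∉ [5, 6, 7] → s₈.nat (addr c i) = s₇.nat (addr c i) := fun c hc => n8 c i hc
        have : c = 0 := by unfold addr at hci; ext; simp; omega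
        subst this
        rw [hci]
        exact n8' 0 (by decide)
      rw [this, m7 Z le_rfl, z6]
    have y22 : s₈.nat (addr 22 0) = Z := by rw [n8.eq 22, n7.eq 22, u22]
    have y38 : s₈.nat (addr 38 0) = Z + 11 * all.length + L.length := by rw [n8.eq 38, e7]; simp
    have y35 : s₈.nat (addr 35 0) = all.length := by rw [n8.eq 35, n7.eq 35, u35]
    have y36 : s₈.nat (addr 36 0) = Z + 6 * all.length := by rw [n8.eq 36, n7.eq 36, u36]
    refine Tot.seqs_flat (by simp) (Tot.seqs_flat (by simp) (Tot.seqs_flat (by simp)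
      (Tot.seqs_flat (by simp) (Tot.seqs_nil ?_))))
    have a0 : addr 0 0 = 0 := rfl
    have a1 : addr 1 0 = 1 := rfl
    have a2 : addr 2 0 = 2 := rfl
    have a3 : addr 3 0 = 3 := rfl
    rw [← a0, ← a1, ← a2, ← a3]
    simp only [Program.run_setVar, NatExpr.eval_load, NatExpr.eval_var, update_addr, Fin.reduceEq,
      false_and, if_false, and_self, if_true, y22, y38, y35, y36, z8]
    refine ⟨trivial, trivial, q8, q5.congr (fun a h1 h2 => ?_) fun _ _ => rfl⟩
    rw [r8 a (by omega), r7, r6 a (by omega)]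


/-! ### The input -/

/-- The triangles of two families, one after the other. -/
noncomputable def joined {n m : ℕ} (P : Fin n → Fin 3 → Plane) (S : Fin m → Fin 3 → Plane) (t : ℕ) :
    Fin 3 → Plane := (List.ofFn P ++ List.ofFn S).getD t 0

theorem joined_left {n m : ℕ} (P : Fin n → Fin 3 → Plane) (S : Fin m → Fin 3 → Plane) (i : Fin n) :
    joined P S i = P i := by
  simp [joined, List.getElem?_append_left]

theorem joined_right {n m : ℕ} (P : Fin n → Fin 3 → Plane) (S : Fin m → Fin 3 → Plane) (j : Fin m) :
    joined P S (n + j) = S j := by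
  simp [joined, List.getElem?_append_right]

theorem getElem?_flatMap_of_length {α β : Type*} {F : α → List β} {w : ℕ} (hF : ∀ a, (F a).length = w)
    {l : List α} {k c : ℕ} (hk : k < l.length) (hc : c < w) :
    (l.flatMap F)[w * k + c]? = (F l[k])[c]? := by
  induction l generalizing k with
  | nil => simp at hk
  | cons a l ih =>
    cases k with
    | zero => simp [List.getElem?_append_left, hF, hc]
    | succ k =>
      rw [List.flatMap_cons, List.getElem?_append_right (by rw [hF]; nlinarith), hF,
        show w * (k + 1) + c - w = w * k + c by rw [mul_add, mul_one]; omega,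
        ih (by simpa using hk), List.getElem_cons_succ]

theorem isInput_inputState (δ : ℝ) {n m : ℕ} (P : Fin n → Fin 3 → Plane) (S : Fin m → Fin 3 → Plane) :
    IsInput n m δ (joined P S) (inputState δ P S) := by
  have key : ∀ t < n + m, ∀ c < 6, (inputState δ P S).real (6 * t + (c + 1)) =
      [joined P S t 0 0, joined P S t 0 1, joined P S t 1 0, joined P S t 1 1, joined P S t 2 0,
        joined P S t 2 1].getD c 0 := by
    intro t ht c hc
    have hl : t < (List.ofFn P ++ List.ofFn S).length := by simpa using ht
    have h := getElem?_flatMap_of_length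
      (F := fun T : Fin 3 → Plane => [T 0 0, T 0 1, T 1 0, T 1 1, T 2 0, T 2 1]) (fun _ => rfl) hl hc
    rw [List.flatMap_append] at h
    have hj : joined P S t = (List.ofFn P ++ List.ofFn S)[t] := List.getD_eq_getElem _ _ hl
    simp only [inputState, writeBlock, coordList, Nat.zero_le, if_true, Nat.sub_zero, ← add_assoc,
      List.getD_cons_succ]
    rw [List.getD_eq_getElem?_getD, List.getD_eq_getElem?_getD, h, hj]
  refine ⟨rfl, rfl, ?_, rfl, fun t ht => key t ht 0 (by decide), fun t ht => key t ht 1 (by decide),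
    fun t ht => key t ht 2 (by decide), fun t ht => key t ht 3 (by decide),
    fun t ht => key t ht 4 (by decide), fun t ht => key t ht 5 (by decide)⟩
  intro a ha
  obtain ⟨k, rfl⟩ := Nat.exists_eq_add_of_le ha
  simp [inputState, writeBlock, Nat.add_comm 2 k]

theorem dist_joined_le {n m : ℕ} {P : Fin n → Fin 3 → Plane} {S : Fin m → Fin 3 → Plane} {Δ : ℝ}
    (hP : ∀ i a b, dist (P i a) (P i b) ≤ Δ) (hS : ∀ j a b, dist (S j a) (S j b) ≤ Δ) :
    ∀ t < n + m, ∀ a b, dist (joined P S t a) (joined P S t b) ≤ Δ := by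
  intro t ht a b
  by_cases h : t < n
  · rw [joined_left P S ⟨t, h⟩]; exact hP _ _ _
  · obtain ⟨k, rfl⟩ := Nat.exists_eq_add_of_le (not_lt.1 h)
    rw [joined_right P S ⟨k, by omega⟩]; exact hS _ _ _

theorem triangleMass_apply {n : ℕ} (P : Fin n → Fin 3 → Plane) {X : Set Plane} (hX : MeasurableSet X) :
    triangleMass P X = ∑ i, volume (solidTriangle (P i) ∩ X) := by
  simp only [triangleMass, Measure.finsetSum_apply, Measure.restrict_apply hX, Set.inter_comm]

theorem isProbabilityMeasure_triangleMass {n : ℕ} {P : Fin n → Fin 3 → Plane}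
    (h : ∑ i, volume (solidTriangle (P i)) = 1) : IsProbabilityMeasure (triangleMass P) :=
  ⟨by simpa [triangleMass_apply P MeasurableSet.univ] using h⟩

theorem hasMass_left {n m : ℕ} (P : Fin n → Fin 3 → Plane) (S : Fin m → Fin 3 → Plane) (W κ sz : ℝ) :
    QParams.HasMass ⟨n, n + m, joined P S, W, κ, sz⟩ (triangleMass P) (· < n) := by
  intro X hX
  rw [triangleMass_apply P hX, Finset.sum_filter, Finset.sum_range, Fin.sum_univ_add]
  simp [joined_left]

theorem hasMass_right {n m : ℕ} (P : Fin n → Fin 3 → Plane) (S : Fin m → Fin 3 → Plane) (W κ sz : ℝ) :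
    QParams.HasMass ⟨n, n + m, joined P S, W, κ, sz⟩ (triangleMass S) (¬ · < n) := by
  intro X hX
  rw [triangleMass_apply S hX, Finset.sum_filter, Finset.sum_range, Fin.sum_univ_add]
  simp [joined_right]

/-- Triangles of total area one with short edges are many. -/
theorem one_le_of_sum_volume {n : ℕ} {P : Fin n → Fin 3 → Plane} {W : ℝ}
    (h : ∑ i, volume (solidTriangle (P i)) = 1) (hP : ∀ i a b, dist (P i a) (P i b) ≤ W) :
    1 ≤ 4 * (n * W ^ 2) := by
  have h1 : ∀ i, volume (solidTriangle (P i)) ≤ ENNReal.ofReal (4 * W ^ 2) := by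
    intro i
    have hW : 0 ≤ W := dist_nonneg.trans (hP i 0 0)
    refine (measure_mono (t := Metric.closedBall (P i 0) W) fun z hz =>
      dist_le_of_mem_solidTriangle (hP i) hz (vertex_mem _ 0)).trans ?_
    rw [EuclideanSpace.volume_closedBall_fin_two, ← ENNReal.ofReal_pow hW,
      ← ENNReal.ofReal_mul (by positivity)]
    refine ENNReal.ofReal_le_ofReal ?_
    rw [mul_comm]
    exact mul_le_mul_of_nonneg_right Real.pi_le_four (by positivity)
  have h2 : (1 : ENNReal) ≤ ENNReal.ofReal (4 * (n * W ^ 2)) := by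
    rw [← h]
    refine (Finset.sum_le_sum fun i _ => h1 i).trans ?_
    rw [Finset.sum_const, Finset.card_univ, Fintype.card_fin, nsmul_eq_mul, ← ENNReal.ofReal_natCast,
      ← ENNReal.ofReal_mul (by positivity)]
    exact le_of_eq (by ring_nf)
  exact ENNReal.one_le_ofReal.1 h2

/-! ### The time of the given algorithm -/

/-- Writing down a plan from one point to `k` points takes `k` steps. -/
theorem PointSolver.Approximates.le_apply {A : PointSolver} {δ : ℝ} {f : ℕ → ℝ}
    (hA : A.Approximates δ f) {k : ℕ} (hk : 0 < k) : (k : ℝ) ≤ f (k + 1) := by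
  -- One source of weight `k` and `k` targets of weight one: each target needs a move of its own, so
  -- the list has at least `k` entries, and the time is at least its length.
  obtain ⟨h1, h2, -, h4, h5⟩ := hA [((0 : Plane), (k : ℝ))] (List.replicate k (0, 1)) (by simp)
    (by simpa using hk.ne') (by simpa using hk) (by simp) (by simp)
  set L := A.plan [((0 : Plane), (k : ℝ))] (List.replicate k (0, 1))
  have hsub : Finset.range k ⊆ (L.map fun e => e.2.1).toFinset := by
    intro j hj
    have hj : j < k := Finset.mem_range.1 hj
    have h := h2.2.2 ⟨j, by simpa using hj⟩
    by_contra hn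
    have hz : ∀ i, L.matrix i j = 0 := by
      intro i
      refine List.sum_eq_zero fun x hx => ?_
      obtain ⟨e, he, rfl⟩ := List.mem_map.1 hx
      rw [if_neg]
      rintro ⟨-, h'⟩
      exact hn (by simpa using ⟨e.1, e.2.2, by rw [← h']; exact he⟩)
    simp [hz] at h
  have h6 : k ≤ L.length := by
    simpa using (Finset.card_le_card hsub).trans (List.toFinset_card_le _)
  have h7 : (k : ℝ) ≤ A.time [((0 : Plane), (k : ℝ))] (List.replicate k (0, 1)) := by
    exact_mod_cast h6.trans h4
  simpa [add_comm] using h7.trans h5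


theorem getD_map_eq {α β : Type*} (l : List α) (g : α → β) (d : β) (i : Fin l.length) :
    (l.map g).getD i d = g (l.get i) := by
  simp

/-- The moves of the solver for the weights of a cell system. -/
theorem CellSystem.exists_solverMoves {μ ν : Measure Plane} [IsProbabilityMeasure μ]
    [IsProbabilityMeasure ν] {η r₀ : ℝ} {M : ℕ} (hM : 0 < M) (S : CellSystem (Fin M) μ ν η r₀)
    {A : PointSolver} {δ : ℝ} (hδ : 0 < δ) {f : ℕ → ℝ} (hf : Monotone f) (hA : A.Approximates δ f)
    {P : ℕ → Plane} {wu wv : ℕ → ℝ} (hP : ∀ i : Fin M, P i = S.ctr i)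
    (hwu : ∀ i : Fin M, wu i = S.src i) (hwv : ∀ i : Fin M, wv i = S.tgt i) {L : SparsePlan}
    (hL : L = solverMoves A P wu wv M) :
    ∃ (τ : ℕ) (fr tg : ℕ → Fin M),
      (positives wu M ≠ [] → A.time ((positives wu M).map fun j => (P j, wu j))
        ((positives wv M).map fun j => (P j, wv j)) ≤ τ) ∧ L.length ≤ τ ∧
      (τ = 0 ∨ (τ : ℝ) ≤ f (2 * M)) ∧
      (∀ k (hk : k < L.length), (positives wu M)[L[k].1]? = some (fr k : ℕ)) ∧
      (∀ k (hk : k < L.length), (positives wv M)[L[k].2.1]? = some (tg k : ℕ)) ∧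
      (∀ k : Fin L.length, 0 ≤ (L.get k).2.2) ∧
      (∀ i, ∑ k : Fin L.length with fr (Fin.val k) = i, (L.get k).2.2 = S.src i) ∧
      (∀ i, ∑ k : Fin L.length with tg (Fin.val k) = i, (L.get k).2.2 = S.tgt i) ∧
      ∀ σ : Fin M → Fin M → ℝ, (∀ i j, 0 ≤ σ i j) → (∀ i, ∑ j, σ i j = S.src i) →
        (∀ j, ∑ i, σ i j = S.tgt j) →
        ∑ k : Fin L.length, (L.get k).2.2 * dist (S.ctr (fr k)) (S.ctr (tg k)) ≤
          (1 + δ) * ∑ i, ∑ j, σ i j * dist (S.ctr i) (S.ctr j) := by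
  classical
  -- If nothing is sent then nothing is received, by the balance of the totals, and the empty list
  -- of moves is optimal.
  by_cases hn : positives wu M = []
  · have hL0 : L = [] := by simp [hL, solverMoves, hn]
    subst hL0
    have hsrc : ∀ i, S.src i = 0 := fun i =>
      le_antisymm (not_lt.1 fun h => by
        have : (i : ℕ) ∈ positives wu M := mem_positives.2 ⟨i.2, by rwa [hwu]⟩
        simp [hn] at this) (S.src_nonneg i)
    have htgt : ∀ i, S.tgt i = 0 := by
      have h := S.sum_src_eq_sum_tgt
      simp only [hsrc, Finset.sum_const_zero] at h
      exact fun i => (Finset.sum_eq_zero_iff_of_nonneg fun i _ => S.swap.src_nonneg i).1 h.symm i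
        (Finset.mem_univ i)
    refine ⟨0, fun _ => ⟨0, hM⟩, fun _ => ⟨0, hM⟩, fun h => (h hn).elim, by simp, Or.inl rfl,
      fun k hk => by simp at hk, fun k hk => by simp at hk, fun k => k.elim0, fun i => ?_,
      fun i => ?_, fun σ h _ _ => ?_⟩
    · rw [hsrc]; exact Finset.sum_eq_zero fun k _ => k.elim0
    · rw [htgt]; exact Finset.sum_eq_zero fun k _ => k.elim0
    · rw [Finset.sum_eq_zero fun (k : Fin ([] : SparsePlan).length) _ => k.elim0]
      exact mul_nonneg (by linarith) (Finset.sum_nonneg fun i _ => Finset.sum_nonneg fun j _ =>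
        mul_nonneg (h i j) dist_nonneg)
  have key : ∀ (w : ℕ → ℝ) (g : Fin M → ℝ), (∀ i : Fin M, w i = g i) →
      positives w M = ((List.finRange M).filter (0 < g ·)).map Fin.val := by
    intro w g h
    rw [positives, ← List.map_coe_finRange_eq_range, List.filter_map]
    congr 1
    exact List.filter_congr fun i _ => by simp [h]
  have key2 : ∀ (w : ℕ → ℝ) (g : Fin M → ℝ), (∀ i : Fin M, w i = g i) →
      ((positives w M).map fun j => (P j, w j)) =
        ((List.finRange M).filter (0 < g ·)).map fun i => (S.ctr i, g i) := by
    intro w g h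
    rw [key w g h, List.map_map]
    exact List.map_congr_left fun i _ => by simp [hP, h]
  have hLd : L = A.plan ((positives wu M).map fun j => (P j, wu j))
      ((positives wv M).map fun j => (P j, wv j)) := by simp [hL, solverMoves, hn]
  obtain ⟨h1, h2, fr, tg, h3, h4, h5, h6, h7, h8⟩ := S.exists_moves hA
    (iu := (List.finRange M).filter (0 < S.src ·)) (iv := (List.finRange M).filter (0 < S.tgt ·))
    ((List.nodup_finRange M).filter _) ((List.nodup_finRange M).filter _) (by simp) (by simp)
    (fun h => hn (by rw [key wu _ hwu, h, List.map_nil])) (key2 wu _ hwu) (key2 wv _ hwv) hLd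
  have hx : ∀ (a : Fin L.length → Fin M) (k : ℕ) (hk : k < L.length),
      (if h : k < L.length then a ⟨k, h⟩ else ⟨0, hM⟩) = a ⟨k, hk⟩ := fun a k hk => dif_pos hk
  have hx' : ∀ (a : Fin L.length → Fin M) (k : Fin L.length),
      (if h : (k : ℕ) < L.length then a ⟨k, h⟩ else ⟨0, hM⟩) = a k := fun a k => dif_pos k.2
  refine ⟨_, fun k => if h : k < L.length then fr ⟨k, h⟩ else ⟨0, hM⟩,
    fun k => if h : k < L.length then tg ⟨k, h⟩ else ⟨0, hM⟩, fun _ => le_rfl, h1,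
    Or.inr (h2.trans (hf ?_)), fun k hk => ?_, fun k hk => ?_, h5, ?_, ?_, ?_⟩
  · have e1 : ((List.finRange M).filter (0 < S.src ·)).length ≤ M := by
      simpa using List.length_filter_le (fun i => decide (0 < S.src i)) (List.finRange M)
    have e2 : ((List.finRange M).filter (0 < S.tgt ·)).length ≤ M := by
      simpa using List.length_filter_le (fun i => decide (0 < S.tgt i)) (List.finRange M)
    omega
  · have := h3 ⟨k, hk⟩
    simp only [hx _ k hk]
    rw [key wu _ hwu, List.getElem?_map]
    simp only [List.get_eq_getElem] at this
    rw [this]; rfl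
  · have := h4 ⟨k, hk⟩
    simp only [hx _ k hk]
    rw [key wv _ hwv, List.getElem?_map]
    simp only [List.get_eq_getElem] at this
    rw [this]; rfl
  · simpa only [hx'] using h6
  · simpa only [hx'] using h7
  · simpa only [hx'] using h8

theorem storedBox_eq_box {r : ℕ → ℝ} {a : ℕ} {b : QNode}
    (h : ∀ c < 4, r (a + c) = b.corners.getD c 0) : storedBox r a = b.box := by
  have h0 := h 0 (by decide)
  have h1 := h 1 (by decide)
  have h2 := h 2 (by decide)
  have h3 := h 3 (by decide)
  simp only [QNode.corners, add_zero, List.getD_cons_zero, List.getD_cons_succ] at h0 h1 h2 h3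
  simp only [storedBox, QNode.box, hbox, h0, h1, h2, h3]

/-- The plan that is written in the memory at the end. -/
theorem writtenPlan_eq_movesPlan {Q : QParams} {all : List QNode} {μ ν : Measure Plane} {η r₀ : ℝ}
    (S : CellSystem (Fin all.length) μ ν η r₀) (hbox : ∀ i, S.box i = Q.leafBox (all.get i))
    (hsrc : ∀ i, S.src i = Q.srcW (all.get i)) (htgt : ∀ i, S.tgt i = Q.tgtW (all.get i))
    (hstay : ∀ i, S.stay i = QParams.stayW (all.get i)) {L : SparsePlan} {fr tg : ℕ → Fin all.length}
    (hw : ∀ k : Fin L.length, 0 ≤ (L.get k).2.2)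
    (hfr : ∀ i, ∑ k : Fin L.length with fr (Fin.val k) = i, (L.get k).2.2 = S.src i)
    (htg : ∀ i, ∑ k : Fin L.length with tg (Fin.val k) = i, (L.get k).2.2 = S.tgt i) {s : MemState}
    (h0 : s.nat 0 = L.length) (h2 : s.nat 2 = all.length)
    (h1 : Records s.real (s.nat 1) 9 L.length (fun k => all[fr k].corners ++ (all[tg k].corners ++
      [(L.getD k (0, 0, 0)).2.2])))
    (h3 : Records s.real (s.nat 3) 5 all.length fun j =>
      ((all.map fun b => b.corners ++ [QParams.stayW b]).getD j [])) :
    writtenPlan μ ν s = S.movesPlan (fun k : Fin L.length => fr k) (fun k : Fin L.length => tg k)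
      fun k => (L.get k).2.2 := by
  rw [writtenPlan, CellSystem.movesPlan, h0, h2, Finset.sum_range, Finset.sum_range]
  congr 1
  · refine Finset.sum_congr rfl fun k _ => ?_
    have e8 := h1 k k.2 8 (by decide)
    simp only [QNode.corners, List.cons_append, List.nil_append, List.getD_cons_succ,
      List.getD_cons_zero, List.getD_eq_getElem _ _ k.2] at e8
    rw [e8]
    -- A move of a positive amount connects leaves, whose stored boxes are the cells of the system.
    -- If the amount is zero, the boxes do not matter.
    by_cases hk : (L.get k).2.2 = 0
    · simp only [List.get_eq_getElem] at hk
      simp [hk]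
    have l1 : Q.Leaf (all.get (fr k)) := by
      have := S.src_pos_of_move (fr := fun k : Fin L.length => fr k) hw hfr hk
      rw [hsrc] at this
      by_contra hl
      rw [QParams.srcW, if_neg hl] at this
      exact this.false
    have l2 : Q.Leaf (all.get (tg k)) := by
      have : 0 < S.tgt (tg k) := S.swap.src_pos_of_move (fr := fun k : Fin L.length => tg k) hw htg hk
      rw [htgt] at this
      by_contra hl
      rw [QParams.tgtW, if_neg hl] at this
      exact this.false
    rw [hbox, hbox, QParams.leafBox, QParams.leafBox, if_pos l1, if_pos l2,
      storedBox_eq_box (b := all.get (fr k)), storedBox_eq_box (b := all.get (tg k))]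
    · rfl
    · intro c hc
      have := h1 k k.2 (4 + c) (by omega)
      rw [← add_assoc] at this
      rw [this]
      interval_cases c <;> rfl
    · intro c hc
      rw [h1 k k.2 c (by omega)]
      interval_cases c <;> rfl
  · refine Finset.sum_congr rfl fun i _ => ?_
    have hg := getD_map_eq all (fun b => b.corners ++ [QParams.stayW b]) [] i
    have h3' : ∀ c < 5, s.real (s.nat 3 + 5 * i + c) =
        ((all.get i).corners ++ [QParams.stayW (all.get i)]).getD c 0 := fun c hc => by
      rw [← hg]; exact h3 i i.2 c hc
    have e4 := h3' 4 (by decide)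
    simp only [QNode.corners, List.cons_append, List.nil_append, List.getD_cons_succ,
      List.getD_cons_zero] at e4
    rw [e4, hstay]
    by_cases ha : (all.get i).act = []
    · have hl : Q.Leaf (all.get i) := Or.inl ha
      rw [hbox, QParams.leafBox, if_pos hl, storedBox_eq_box (b := all.get i)]
      intro c hc
      rw [h3' c (by omega)]
      interval_cases c <;> rfl
    · rw [QParams.stayW, if_neg ha, ENNReal.ofReal_zero, zero_smul, zero_smul]


/-! ### Correctness of the whole program -/

/-- The whole program. -/
def emdProg : Program :=
  .seqs [prepProg, strips 6 7 30, strips 9 8 31, rootsProg, treeProg, outputProg]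

/-- The program computes a plan of small cost. -/
theorem tot_emdProg {A : PointSolver} {δ : ℝ} (hδ : 0 < δ) {f : ℕ → ℝ} (hf : Monotone f)
    (hA : A.Approximates δ f) {n m : ℕ} {P : Fin n → Fin 3 → Plane} {S : Fin m → Fin 3 → Plane} {Δ : ℝ}
    (hPv : ∑ i, volume (solidTriangle (P i)) = 1) (hSv : ∑ j, volume (solidTriangle (S j)) = 1)
    (hP : ∀ i a b, dist (P i a) (P i b) ≤ Δ) (hS : ∀ j a b, dist (S j a) (S j b) ≤ Δ) {B k : ℕ}
    (hB : B = Nat.sqrt (n + m) + 1) (hk : ∀ a M τ : ℕ, (τ = 0 ∨ (τ : ℝ) ≤ f (2 * M)) →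
      M ≤ 9 * (n + m) + 4 * a → (a : ℝ) ≤ 9 * (n + m : ℕ) + (n + m : ℕ) *
        (2304 * (2 + 1 / δ + 1) ^ 2 * Δ / (δ / (1 + δ) / Real.sqrt (n * m))) → 5 * a + 5 * M + 2 * τ ≤ k) :
    Tot A emdProg (inputState δ P S)
      (2 * (n + m) + 2 * (B * B + B * (B + 1) + (n + m) * (2 * B + 1)) + (n + m) + k) fun s =>
        IsTransportPlan (triangleMass P) (triangleMass S)
          (writtenPlan (triangleMass P) (triangleMass S) s) ∧
        transportCost (writtenPlan (triangleMass P) (triangleMass S) s) ≤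
          ENNReal.ofReal (1 + 5 * δ) * emd (triangleMass P) (triangleMass S) +
            ENNReal.ofReal (4 * δ / Real.sqrt (n * m)) := by
  have := isProbabilityMeasure_triangleMass hPv
  have := isProbabilityMeasure_triangleMass hSv
  have hn : 0 < n := Nat.pos_of_ne_zero fun h => by subst h; simp at hPv
  have hm : 0 < m := Nat.pos_of_ne_zero fun h => by subst h; simp at hSv
  have hΔ0 : 0 ≤ Δ := dist_nonneg.trans (hP ⟨0, hn⟩ 0 0)
  have hsq : 0 < Real.sqrt (n * m) := Real.sqrt_pos.2 (by positivity)
  refine Tot.seqs_step (k₂ := 2 * (B * B + B * (B + 1) + (n + m) * (2 * B + 1)) + (n + m) + k)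
    (tot_prepProg (isInput_inputState δ P S) hΔ0 (dist_joined_le hP hS)) ?_ (by omega)
  rintro s₁ ⟨W, big, hW0, hWΔ, Q, hQ, hT, e1, b1, big1, x1, y1, mx, my, z1⟩
  have hQN : Q.N = n + m := by rw [hQ]
  have hQW : Q.W = W := by rw [hQ]
  have hQT : Q.T = joined P S := by rw [hQ]
  have hQκ : Q.κ = 2 + 1 / δ := by rw [hQ]
  have hQsz : Q.sz = δ / (1 + δ) / Real.sqrt (n * m) := by rw [hQ]
  have hμ : Q.HasMass (triangleMass P) (· < Q.n) := by subst hQ; exact hasMass_left P S _ _ _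
  have hν : Q.HasMass (triangleMass S) (¬ · < Q.n) := by subst hQ; exact hasMass_right P S _ _ _
  clear hQ
  have hTW : ∀ t < Q.N, ∀ a c, dist (Q.T t a) (Q.T t c) ≤ Q.W := by rwa [hQW, hQT]
  have hW : 0 < Q.W := by
    -- Total area one excludes that all edges have length zero; the size of the roots has to be
    -- positive.
    have h1 : 1 ≤ 4 * (n * W ^ 2) := one_le_of_sum_volume hPv fun i a b => by
      have := hT i (by rw [hQN]; omega) a b
      rwa [joined_left] at this
    rw [hQW]
    refine lt_of_le_of_ne hW0 fun h => ?_
    rw [← h] at h1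
    norm_num at h1
  have hκ : 1 < Q.κ := by rw [hQκ]; have : 0 < 1 / δ := by positivity
                          linarith
  have hsz : 0 < Q.sz := by rw [hQsz]; positivity
  have hN0 : 0 < Q.N := by omega
  have hBN : Q.N ≤ B * B := by rw [hQN, hB]; exact (Nat.lt_succ_sqrt _).le
  rw [← hB] at b1
  rw [← hQN] at e1 x1 y1 big1 ⊢
  -- the strips
  refine Tot.seqs_step (k₂ := (B * B + B * (B + 1) + Q.N * (2 * B + 1)) + Q.N + k)
    (tot_strips e1.N_eq e1.off_eq b1 e1.W_eq big1 x1 hW (by decide) (by decide) (by decide) (by decide)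
      (by omega) hBN hN0 mx) ?_ (by omega)
  rintro s₂ ⟨n2, r2, Cx, st2⟩
  have e2 := e1.frame n2 r2
  refine Tot.seqs_step (k₂ := Q.N + k)
    (tot_strips e2.N_eq e2.off_eq ((n2.eq 4 0).trans b1) e2.W_eq ((r2.eq 44 _).trans big1)
      (fun t ht => (r2.eq 9 _).trans (y1 t ht)) hW (by decide) (by decide) (by decide) (by decide)
      (by omega) hBN hN0 my) ?_ (by omega)
  rintro s₃ ⟨n3, r3, Cy, st3⟩
  have e3 := e2.frame n3 r3
  -- the roots and the tree
  refine Tot.seqs_step (k₂ := k) (tot_rootsProg e3 (fun k => r3.eq 7 _) (fun k => rfl)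
    (fun t => n3.eq 30 _) (fun t => rfl) (fun t ht => ⟨st2.cell_pos t ht, (st2.cell_le t ht).trans st2.le⟩)
    (fun t ht => ⟨st3.cell_pos t ht, (st3.cell_le t ht).trans st3.le⟩)
    (fun i => (n3.eq 29 i).trans ((n2.eq 29 i).trans (z1 i)))) ?_ le_rfl
  rintro s₄ ⟨e4, -, R, hR, no4, c4⟩
  obtain ⟨all, tree⟩ := (QParams.isRoots hTW hW st2 st3 hR).exists_tree hκ hW hsz hTW
  have hM : 0 < all.length := by
    obtain ⟨b, hb, -⟩ := tree.cover 0 hN0 _ (vertex_mem _ 0)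
    exact List.length_pos_of_mem hb
  set a := (all.map fun b => b.act.length).sum with ha
  -- This relation fixes `κ`: the margin `l * (κ - 1)` around a cell is its radius `l` divided by `η
  -- = δ / (1 + δ)`.
  have hη : δ / (1 + δ) * (Q.κ - 1) = 1 := by rw [hQκ]; field_simp; ring
  set C := tree.cells hκ hsz.le hη hTW hμ hν with hC
  obtain ⟨τ, fr, tg, hτ, hLτ, hτf, hfr, htg, hw, sfr, stg, hopt⟩ := C.exists_solverMoves hM hδ hf hA
    (P := fun j => (all.map QNode.ctr).getD j 0) (wu := fun j => (all.map Q.srcW).getD j 0)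
    (wv := fun j => (all.map Q.tgtW).getD j 0) (getD_map_eq _ _ _) (getD_map_eq _ _ _)
    (getD_map_eq _ _ _) rfl
  have hbudget := hk a all.length τ hτf (by rw [← hQN]; exact tree.length_le) (by
    rw [← hQN, ← hQκ, ← hQsz]
    refine tree.sum_act.trans ?_
    have : Q.W ≤ Δ := hQW.trans_le hWΔ
    gcongr)
  refine Tot.seqs_step (k₂ := a + 4 * all.length + τ + τ) (tot_treeProg e4 (by simpa using c4) no4 tree) ?_ (by omega)
  rintro s₅ ⟨e5, c5, no5⟩
  refine Tot.seqs_one ((tot_outputProg e5 c5 no5 (fun b hb => (tree.good b hb).act_lt)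
    (fun j hj => getD_map_eq all _ _ ⟨j, hj⟩) (fun j hj => getD_map_eq all _ _ ⟨j, hj⟩)
    (fun j hj => getD_map_eq all _ _ ⟨j, hj⟩) rfl hτ hfr htg).mono (by omega) ?_)
  rintro s ⟨o0, o2, o1, o3⟩
  rw [writtenPlan_eq_movesPlan C (fun _ => rfl) (fun _ => rfl) (fun _ => rfl) (fun _ => rfl) hw sfr stg
    o0 o2 o1 o3]
  refine ⟨C.isTransportPlan_movesPlan hw sfr stg,
    (C.transportCost_movesPlan_le_emd hδ rfl hsz.le hw sfr stg hopt).trans (le_of_eq ?_)⟩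
  congr 2
  rw [hQsz]
  field_simp


/-! ### Numerical estimates and the choice of the constants -/

/-- The estimates for the size of the subdivision. -/
theorem size_estimates {n m : ℕ} {Δ δ δ₀ : ℝ} (hδ : 0 < δ) (hδ₀ : δ ≤ δ₀) (hn : 0 < n) (hm : 0 < m)
    (hΔ : 0 ≤ Δ) (h1 : 1 ≤ 4 * (n * Δ ^ 2)) (h2 : 1 ≤ 4 * (m * Δ ^ 2)) {X : ℝ}
    (hX : X = Real.sqrt (n * m) * Δ * (n + m) / δ ^ 4) {B : ℕ} (hB : B = Nat.sqrt (n + m) + 1) :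
    ((n + m : ℕ) : ℝ) ≤ 3 * δ₀ ^ 4 * X ∧
    ((2 * (n + m) + 2 * (B * B + B * (B + 1) + (n + m) * (2 * B + 1)) + (n + m) : ℕ) : ℝ) ≤
      33 * (3 * δ₀ ^ 4 * X) ∧
    ((n + m : ℕ) : ℝ) * (2304 * (2 + 1 / δ + 1) ^ 2 * Δ / (δ / (1 + δ) / Real.sqrt (n * m))) ≤
      2304 * (3 * δ₀ + 1) ^ 2 * (1 + δ₀) * δ₀ * X := by
  have hx : Real.sqrt (n * m) ^ 2 = n * m := Real.sq_sqrt (by positivity)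
  have hx0 : 0 < Real.sqrt (n * m) := Real.sqrt_pos.2 (by positivity)
  have hn1 : (1 : ℝ) ≤ n := by exact_mod_cast hn
  have hm1 : (1 : ℝ) ≤ m := by exact_mod_cast hm
  set x := Real.sqrt (n * m)
  set N : ℝ := ((n + m : ℕ) : ℝ) with hN
  have hNe : N = n + m := by push_cast [hN]; rfl
  have hN1 : 1 ≤ N := by linarith
  have hX0 : 0 ≤ X := by rw [hX]; positivity
  -- Multiplying the two area bounds by `m` and by `n` and adding them gives `N ≤ 8 * n * m * Δ ^
  -- 2`. This is what makes the time `N √N` for the strips affordable.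
  have hr : Real.sqrt N ≤ 3 * x * Δ := by
    refine Real.sqrt_le_iff.2 ⟨by positivity, ?_⟩
    have e1 := mul_le_mul_of_nonneg_left h1 (by positivity : (0 : ℝ) ≤ m)
    have e2 := mul_le_mul_of_nonneg_left h2 (by positivity : (0 : ℝ) ≤ n)
    have e3 : (3 * x * Δ) ^ 2 = 9 * (n * m * Δ ^ 2) := by rw [← hx]; ring
    rw [e3, hNe]
    nlinarith
  have hr1 : 1 ≤ Real.sqrt N := Real.one_le_sqrt.2 hN1
  have hrr : Real.sqrt N * Real.sqrt N = N := Real.mul_self_sqrt (by linarith)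
  have hXe : X * δ ^ 4 = x * Δ * N := by rw [hX, hNe]; field_simp
  have hNr : N * Real.sqrt N ≤ 3 * δ₀ ^ 4 * X := by
    calc N * Real.sqrt N ≤ N * (3 * x * Δ) := by gcongr
      _ = 3 * (X * δ ^ 4) := by rw [hXe]; ring
      _ ≤ 3 * (X * δ₀ ^ 4) := by gcongr
      _ = 3 * δ₀ ^ 4 * X := by ring
  have hNle : N ≤ N * Real.sqrt N := le_mul_of_one_le_right (by linarith) hr1
  refine ⟨hNle.trans hNr, ?_, ?_⟩
  · have hB2 : (B : ℝ) ≤ 2 * Real.sqrt N := by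
      have : ((Nat.sqrt (n + m) : ℕ) : ℝ) ≤ Real.sqrt N := Real.nat_sqrt_le_real_sqrt
      rw [hB]; push_cast; linarith
    have hB0 : (0 : ℝ) ≤ B := by positivity
    have e : ((2 * (n + m) + 2 * (B * B + B * (B + 1) + (n + m) * (2 * B + 1)) + (n + m) : ℕ) : ℝ) =
        3 * N + 2 * (B * B + B * (B + 1) + N * (2 * B + 1)) := by
      rw [hNe]; push_cast; ring
    rw [e]
    have e1 : (B * B : ℝ) ≤ 4 * N := by nlinarith
    have e2 : (B * (B + 1) : ℝ) ≤ 6 * N := by nlinarith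
    have e3 : (N * (2 * B + 1) : ℝ) ≤ 5 * (N * Real.sqrt N) := by nlinarith
    linarith
  · have e : N * (2304 * (2 + 1 / δ + 1) ^ 2 * Δ / (δ / (1 + δ) / x)) =
        2304 * (3 * δ + 1) ^ 2 * (1 + δ) * δ * X := by
      rw [hX, ← hNe]; field_simp; ring
    rw [e]
    have := hδ.trans_le hδ₀
    gcongr

theorem mainTheorem7 :
    ∃ (prog : Program) (c' A : ℝ), 0 < c' ∧ 0 < A ∧
      ∀ δ₀ : ℝ, 0 < δ₀ → ∃ C : ℕ,
        ∀ (δ : ℝ), 0 < δ → δ ≤ δ₀ →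
        ∀ (f : ℕ → ℝ), Monotone f →
        ∀ (solver : PointSolver), solver.Approximates δ f →
        ∀ (n m : ℕ) (P : Fin n → Fin 3 → Plane) (S : Fin m → Fin 3 → Plane) (Δ : ℝ),
          ∑ i, volume (solidTriangle (P i)) = 1 →
          ∑ j, volume (solidTriangle (S j)) = 1 →
          (∀ i a b, dist (P i a) (P i b) ≤ Δ) →
          (∀ j a b, dist (S j a) (S j b) ≤ Δ) →
          ∀ K : ℕ, K = ⌈Real.sqrt (n * m) * Δ * (n + m) / δ ^ 4⌉₊ →
          ∃ (s : MemState) (t : ℕ),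
            Exec solver prog (inputState δ P S) s t ∧
            IsTransportPlan (triangleMass P) (triangleMass S)
              (writtenPlan (triangleMass P) (triangleMass S) s) ∧
            transportCost (writtenPlan (triangleMass P) (triangleMass S) s) ≤
              ENNReal.ofReal (1 + c' * δ) * emd (triangleMass P) (triangleMass S) +
                ENNReal.ofReal (A * δ / Real.sqrt (n * m)) ∧
            (t : ℝ) ≤ C * f (C * K) ∧
            ∀ D : ℝ, (∀ k, f (2 * k) ≤ D * f k) → (t : ℝ) ≤ C * D ^ C * f K := by
  refine ⟨emdProg, 5, 4, by norm_num, by norm_num, fun δ₀ hδ₀ => ?_⟩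
  set c₀ : ℝ := 3 * δ₀ ^ 4 with hc₀
  set c₁ : ℝ := 2304 * (3 * δ₀ + 1) ^ 2 * (1 + δ₀) * δ₀ with hc₁
  have hc₀0 : 0 ≤ c₀ := by positivity
  have hc₁0 : 0 ≤ c₁ := by positivity
  -- With `N ≤ c₀ * X` and `a ≤ 9 * N + c₁ * X` undecided pairs, `5 * a + 5 * M ≤ 25 * a + 45 * N`
  -- is at most `(270 * c₀ + 25 * c₁) * X`; the preparations add `33 * c₀ * X`.
  set c := ⌈303 * c₀ + 25 * c₁⌉₊ with hc
  have hcle : 303 * c₀ + 25 * c₁ ≤ c := Nat.le_ceil _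
  obtain ⟨z, hz⟩ : ∃ z, z = emdProg.size := ⟨_, rfl⟩
  -- The summand 2 provides for `c * K + 1 ≤ f (C * K)`, and `4 * z` is the factor between `f (C *
  -- K)` and the time.
  set C := c + 2 + 4 * z with hC
  refine ⟨C, fun δ hδ hδδ f hf solver hA n m P S Δ hPv hSv hP hS K hK => ?_⟩
  have hn : 0 < n := Nat.pos_of_ne_zero fun h => by subst h; simp at hPv
  have hm : 0 < m := Nat.pos_of_ne_zero fun h => by subst h; simp at hSv
  have hΔ : 0 ≤ Δ := dist_nonneg.trans (hP ⟨0, hn⟩ 0 0)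
  set X := Real.sqrt (n * m) * Δ * (n + m) / δ ^ 4 with hX
  obtain ⟨s1, s2, s3⟩ := size_estimates hδ hδδ hn hm hΔ (one_le_of_sum_volume hPv hP)
    (one_le_of_sum_volume hSv hS) hX rfl
  rw [← hc₀] at s1 s2
  rw [← hc₁] at s3
  have hXK : X ≤ K := hK ▸ Nat.le_ceil X
  have hX0 : 0 < X := by
    have : (0 : ℝ) < (n + m : ℕ) := by positivity
    exact pos_of_mul_pos_right (this.trans_le s1) hc₀0
  have hK1 : 1 ≤ K := by rw [hK]; exact Nat.ceil_pos.2 hX0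
  have hcX : (303 * c₀ + 25 * c₁) * X ≤ c * K := by gcongr
  have hCK : c * K + 2 ≤ C * K := by
    rw [hC, add_mul, add_mul]; nlinarith [Nat.zero_le (4 * z * K)]
  obtain ⟨j, hj⟩ : ∃ j, C * K = j + 1 := ⟨C * K - 1, by omega⟩
  set F := f (C * K) with hF
  have hjF : (j : ℝ) ≤ F := by rw [hF, hj]; exact hA.le_apply (by omega)
  have hcF : (c : ℝ) * K + 1 ≤ F := by
    refine le_trans ?_ hjF
    exact_mod_cast (by omega : c * K + 1 ≤ j)
  have hcK0 : (0 : ℝ) ≤ c * K := by positivity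
  obtain ⟨s, t, hex, ht, hplan, hcost⟩ := tot_emdProg hδ hf hA hPv hSv hP hS
    (k := ⌊(270 * c₀ + 25 * c₁) * X + 2 * F⌋₊) rfl (by
      intro a M τ hτ hM ha
      have hM' : (M : ℝ) ≤ 9 * ((n + m : ℕ) : ℝ) + 4 * a := by exact_mod_cast hM
      have h0 : 0 ≤ c₀ * X := by positivity
      have h1 : 0 ≤ c₁ * X := by positivity
      have h2 : 2 * M ≤ C * K := by
        have : (2 * M : ℝ) ≤ c * K := by linarith
        have : 2 * M ≤ c * K := by exact_mod_cast this
        omega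
      have h3 : (τ : ℝ) ≤ F := by
        rcases hτ with h | h
        · rw [h, Nat.cast_zero]; linarith
        · exact h.trans (hf h2)
      refine Nat.le_floor ?_
      push_cast
      linarith)
  rw [← hz] at ht
  have htF : (t : ℝ) ≤ C * F := by
    have h1 : (t : ℝ) ≤ z * ((2 * (n + m) + 2 * ((Nat.sqrt (n + m) + 1) *
        (Nat.sqrt (n + m) + 1) + (Nat.sqrt (n + m) + 1) * (Nat.sqrt (n + m) + 1 + 1) +
        (n + m) * (2 * (Nat.sqrt (n + m) + 1) + 1)) + (n + m) : ℕ) +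
        (⌊(270 * c₀ + 25 * c₁) * X + 2 * F⌋₊ : ℝ) + 1) := by exact_mod_cast ht
    have h2 : (⌊(270 * c₀ + 25 * c₁) * X + 2 * F⌋₊ : ℝ) ≤ (270 * c₀ + 25 * c₁) * X + 2 * F :=
      Nat.floor_le (by nlinarith [mul_nonneg hc₀0 hX0.le, mul_nonneg hc₁0 hX0.le])
    -- The work outside of the solver and the added unit are at most `c * K + 1 ≤ F`; the solver's
    -- time and the length of its answer contribute `2 * F`.
    have h3 : (t : ℝ) ≤ z * (4 * F) := h1.trans (by gcongr; linarith)
    have h4 : (4 * z : ℝ) ≤ C := by exact_mod_cast (by omega : 4 * z ≤ C)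
    have h5 : (4 * z : ℝ) * F ≤ C * F := mul_le_mul_of_nonneg_right h4 (by linarith)
    linarith
  refine ⟨s, t, hex, hplan, hcost, htF, fun D hD => htF.trans ?_⟩
  -- The lower bound on solvers gives `f 2 ≥ 1` and `f 4 ≥ 3`, so a negative `D` would contradict `f
  -- 4 ≤ D * f 2`.
  have hD0 : 0 ≤ D := by
    by_contra! h
    have h1 := hA.le_apply (k := 1) one_pos
    have h2 := hA.le_apply (k := 3) (by norm_num)
    have h3 := hD 2
    norm_num at h1 h2 h3
    nlinarith
  -- Doubling `C` times is enough, because `C ≤ 2 ^ C`.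
  have hpow : ∀ j, f (2 ^ j * K) ≤ D ^ j * f K := by
    intro j
    induction j with
    | zero => simp
    | succ j ih =>
      have h1 := hD (2 ^ j * K)
      rw [← mul_assoc, ← pow_succ'] at h1
      refine h1.trans ((mul_le_mul_of_nonneg_left ih hD0).trans (le_of_eq ?_))
      ring
  rw [mul_assoc]
  refine mul_le_mul_of_nonneg_left ((hf ?_).trans (hpow C)) (by positivity)
  exact Nat.mul_le_mul_right K Nat.lt_two_pow_self.le
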